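/- **Setting.** Let $\Sigma=\{0,1,\#\}$ and let $\mathcal B=(\Sigma^*)^{\Sigma^*}$ be Baire space. An *oracle machine* $M^?$ is a multi-tape Turing machine with input, output, oracle query, oracle answer and work tapes. Run with an oracle $\varphi\in\mathcal B$, in an oracle state it replaces, in one time step and without moving heads, the content of the answer tape by $\varphi(\mathbf b)$, where $\mathbf b$ is the content of the query tape. $M^?$ computes the partial operator $\varphi\mapsto M^\varphi$ on $\mathcal B$, defined for those $\varphi$ for which $M^\varphi$ terminates on all inputs; $\mathrm{Time}_M(\varphi,\mathbf a)$ is the number of steps on input $\mathbf a$. The *second-order polynomials* are the smallest class of maps $\mathbb N^{\mathbb N}\times\mathbb N\to\mathbb N$ that contains $(l,n)\mapsto p(n)$ for $p\in\mathbb N[X]$ and is closed under $P\mapsto\big((l,n)\mapsto l(P(l,n))\big)$, pointwise sums and pointwise products. A *parametrised representation* of a set $X$ is a pair $(\xi,\mu)$ of a partial surjection $\xi\colon\subseteq\mathcal B\to X$ (if $\xi(\varphi)=x$ then $\varphi$ is a *name* of $x$) and an arbitrary map $\mu\colon\mathrm{dom}(\xi)\to\mathbb N^{\mathbb N}$ all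 of whose values are non-decreasing. A function $f\colon X\to Y$ between sets with parametrised representations $(\xi_X,\mu_X)$, $(\xi_Y,\mu_Y)$ is *polytime computable* if there are an oracle machine $M^?$ and second-order polynomials $P,Q$ such that for all $\varphi\in\mathrm{dom}(\xi_X)$: $M^\varphi$ is defined and $\xi_Y(M^\varphi)=f(\xi_X(\varphi))$; $\mathrm{Time}_M(\varphi,\mathbf a)\le P(\mu_X(\varphi),|\mathbf a|)$ for all $\mathbf a\in\Sigma^*$; and $\mu_Y(M^\varphi)(n)\le Q(\mu_X(\varphi),n)$ for all $n$. A parametrised representation $(\xi_0,\mu_0)$ of $X$ is *polytime translatable* to another one $(\xi_1,\mu_1)$ of $X$ if the identity $(X,\xi_0,\mu_0)\to(X,\xi_1,\mu_1)$ is polytime computable. Names of a pair $(x,y)\in X\times Y$ are the functions $\langle\varphi,\psi\rangle$ with $\varphi$ a name of $x$ and $\psi$ a name of $y$, where $\langle\varphi,\psi\rangle(0\mathbf b)=\varphi(\mathbf b)$, $\langle\varphi,\psi\rangle(1\mathbf b)=\psi(\mathbf b)$ and $\langle\varphi,\psi\rangle$ is the empty string on all other strings; the parameter of $\langle\varphi,\psi\rangle$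 is the pointwise maximum of $\mu_X(\varphi)$ and $\mu_Y(\psi)$. Let $\mathrm I\mathbb D$ be the set of intervals $[r\pm\varepsilon]=[r-\varepsilon,r+\varepsilon]$ with $r,\varepsilon$ dyadic and $\varepsilon>0$, together with $[-\infty,\infty]$; $\mathrm{diam}[r\pm\varepsilon]=2\varepsilon$ and $\mathrm{diam}[-\infty,\infty]=\infty$. Natural numbers $n$ are encoded by the binary code of the integer $2^n$ (so in unary). Dyadic numbers are encoded by a sign digit, the binary digits of the integer part without leading zeros, the separator $\#$ and the binary digits of the fractional part. $[r\pm\varepsilon]$ is encoded by the pair of a code of $r$ and a code of $\varepsilon$, under the pairing of strings that interleaves both strings symbol by symbol with a control string marking their ends, and $[-\infty,\infty]$ is encoded by the empty string. A string function represents $\varphi\colon\mathbb N\to\mathrm I\mathbb D$ (or $\psi\colon\mathrm I\mathbb D\to\mathrm I\mathbb D$) if it sends every code of an argument to a code of the value. - $\mathbb R_i$: $\varphi\colon\mathbb N\to\mathrm I\mathbb D$ is a name of $x\in\mathbb R$ if $(\varphi(n))_n$ is nested and $\bigcap_n\varphi(n)=\{x\}$; its parameter is $n\mapsto\min\{N\mid\mathrm{diam}(\varphi(N))\le2^{-n}\}+\lceil\log_2(|x|+1)\rceil$.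 $I_i$ is the subspace $I=[0,1]$ of $\mathbb R_i$, with restricted representation and parameter. - $C(I)_i=(C([0,1]),\xi_{if},\mu_{if})$: $\psi\colon\mathrm I\mathbb D\to\mathrm I\mathbb D$ is a name of $f\in C([0,1])$ if for every $x\in[0,1]$ and every name $\varphi$ of $x$ in $\mathbb R_i$ the sequence $\psi\circ\varphi$ is a name of $f(x)$ in $\mathbb R_i$; its parameter is $$\mu_{if}(\psi)(n)=\lceil\log_2(\|f\|_\infty+1)\rceil+\min\{N\mid\forall J\in\mathrm I\mathbb D:\ J\cap[0,1]\ne\emptyset\text{ and }\mathrm{diam}(J)\le2^{-N}\Rightarrow\mathrm{diam}(\psi(J))\le2^{-n}\}.$$ **Theorem (Minimality).** For every parametrised representation $(\xi,\mu)$ of $C([0,1])$ the following are equivalent: 1. Evaluation $(C([0,1]),\xi,\mu)\times I_i\to\mathbb R_i$, $(f,x)\mapsto f(x)$, is polytime computable. 2. $(\xi,\mu)$ is polytime translatable to $(\xi_{if},\mu_{if})$. Moreover, evaluation $C(I)_i\times I_i\to\mathbb R_i$ is polytime computable. So $C(I)_i$ carries the least information among the parametrised representations of $C([0,1])$ that make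 evaluation polytime computable. -/

import Mathlib

/-! Oracle machines, second-order polynomials, parametrised representations, interval reals and
interval functions. -/

namespace ParamSpace

/-! ### Strings and Baire space -/

/-- The alphabet: the two binary digits and a separator symbol. -/
inductive Sym where
  | zero
  | one
  | sep
  deriving DecidableEq

/-- Finite strings. -/
abbrev Str := List Sym

/-- Baire space: string functions, which serve as oracles and as names. -/
abbrev Baire := Str → Str

/-- The pairing `⟨φ, ψ⟩` of string functions. -/
def pair (φ ψ : Baire) : Baire
  | [] => []
  | Sym.zero :: b => φ b
  | Sym.one :: b => ψ b
  | Sym.sep :: _ => []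

/-- The first component of a string function. -/
def fst (φ : Baire) : Baire := fun b => φ (Sym.zero :: b)

/-- The second component of a string function. -/
def snd (φ : Baire) : Baire := fun b => φ (Sym.one :: b)

@[simp] theorem fst_pair (φ ψ : Baire) : fst (pair φ ψ) = φ := rfl

@[simp] theorem snd_pair (φ ψ : Baire) : snd (pair φ ψ) = ψ := rfl

/-! ### Oracle Turing machines -/

/-- A two-way infinite tape with the absolute position of its head; `none` is the blank. -/
structure Tape where
  cell : ℤ → Option Sym
  head : ℤ

/-- Head movements. -/
inductive Dir where
  | left
  | stay
  | right

/-- The displacement of a head movement. -/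
def Dir.offset : Dir → ℤ
  | left => -1
  | stay => 0
  | right => 1

namespace Tape

/-- Replace the content of the tape by the string `s`, written from cell `0` on, with all other
cells blank. The head does not move. -/
def load (T : Tape) (s : Str) : Tape where
  cell i := if 0 ≤ i then s[i.toNat]? else none
  head := T.head

/-- The blank tape, with its head on cell `0`. -/
def blank : Tape := ⟨fun _ => none, 0⟩

/-- Write a symbol into the scanned cell and move the head. -/
def act (T : Tape) (s : Option Sym) (d : Dir) : Tape where
  cell := Function.update T.cell T.head s
  head := T.head + d.offset

/-- The content of a tape: the string that starts in cell `0` and ends before the first blank.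
(In every reachable configuration only finitely many cells are not blank.) -/
noncomputable def content (T : Tape) : Str :=
  (List.range (sInf {n : ℕ | T.cell n = none})).filterMap fun i : ℕ => T.cell (i : ℤ)

end Tape

/-- The tapes of an oracle machine: input, output, oracle query, oracle answer, work tapes. -/
inductive TapeIx (W : Type) where
  | input
  | output
  | query
  | answer
  | work (w : W)

/-- A multi-tape oracle Turing machine with finitely many states and work tapes.
A state `q` with `oracle q = some q'` is an oracle state: being in it, the machine asks the oracle
and then continues in state `q'`. In all other states `trans` is applied to the current state and
the scanned symbols; it returns the new state together with the symbol to be written and the head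
movement on each tape, or `none` if the machine terminates. -/
structure OracleMachine where
  State : Type
  Work : Type
  finite_state : Finite State
  finite_work : Finite Work
  start : State
  oracle : State → Option State
  trans : State → (TapeIx Work → Option Sym) →
    Option (State × (TapeIx Work → Option Sym × Dir))

namespace OracleMachine

variable (M : OracleMachine)

/-- Configurations. -/
structure Config where
  state : M.State
  tape : TapeIx M.Work → Tape

/-- The initial configuration on input `a`. -/
def init (a : Str) : M.Config where
  state := M.start
  tape
    | .input => Tape.blank.load a
    | _ => Tape.blank

/-- The effect of an oracle call on the tapes: the content of the answer tape is replaced by the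
oracle's answer to the content of the query tape; no head moves. -/
noncomputable def callOracle (φ : Baire) (t : TapeIx M.Work → Tape) : TapeIx M.Work → Tape
  | .answer => (t .answer).load (φ (t .query).content)
  | i => t i

/-- One step of the machine with oracle `φ`; `none` if the configuration is terminal.
An oracle call takes one step. -/
noncomputable def step (φ : Baire) (c : M.Config) : Option M.Config :=
  match M.oracle c.state with
  | some q => some ⟨q, M.callOracle φ c.tape⟩
  | none =>
    (M.trans c.state fun i => (c.tape i).cell (c.tape i).head).map fun r =>
      ⟨r.1, fun i => (c.tape i).act (r.2 i).1 (r.2 i).2⟩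

/-- The configuration after `t` steps with oracle `φ` on input `a`
(a terminal configuration is kept for ever). -/
noncomputable def conf (φ : Baire) (a : Str) (t : ℕ) : M.Config :=
  (fun c => (M.step φ c).getD c)^[t] (M.init a)

/-- The machine with oracle `φ` on input `a` has terminated after at most `t` steps. -/
def HaltedBy (φ : Baire) (a : Str) (t : ℕ) : Prop := M.step φ (M.conf φ a t) = none

/-- The number of steps that the machine takes, `⊤` if it does not terminate. -/
noncomputable def time (φ : Baire) (a : Str) : ℕ∞ :=
  ⨅ (t : ℕ) (_ : M.HaltedBy φ a t), (t : ℕ∞)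

open Classical in
/-- The partial operator on Baire space computed by the machine: it is defined on the oracles with
which the machine terminates on all inputs, and then returns the function that sends each input to
the content of the output tape after termination. -/
noncomputable def operator : Baire →. Baire := fun φ =>
  ⟨∀ a, ∃ t, M.HaltedBy φ a t,
    fun h a => ((M.conf φ a (Nat.find (h a))).tape .output).content⟩

end OracleMachine

/-! ### Second-order polynomials -/

/-- The class of second-order polynomials. -/
inductive IsSOP : ((ℕ → ℕ) → ℕ → ℕ) → Prop
  | poly (p : Polynomial ℕ) : IsSOP fun _ n => p.eval n
  | app {P : (ℕ → ℕ) → ℕ → ℕ} : IsSOP P → IsSOP fun l n => l (P l n)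
  | sum {P Q : (ℕ → ℕ) → ℕ → ℕ} : IsSOP P → IsSOP Q → IsSOP fun l n => P l n + Q l n
  | prod {P Q : (ℕ → ℕ) → ℕ → ℕ} : IsSOP P → IsSOP Q → IsSOP fun l n => P l n * Q l n

/-! ### Parametrised representations -/

/-- A parametrised representation of `X`: a partial surjection from Baire space onto `X` together
with a parameter that assigns a non-decreasing function to each name. -/
structure ParamRep (X : Type*) where
  rep : Baire →. X
  surj : ∀ x, ∃ φ, x ∈ rep φ
  param : rep.Dom → ℕ → ℕ
  mono : ∀ φ, Monotone (param φ)

/-- `F` is a realiser of `f`: it sends names of `x` to names of `f x`. -/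
def IsRealiser {X Y : Type*} (A : ParamRep X) (B : ParamRep Y) (F : Baire →. Baire)
    (f : X → Y) : Prop :=
  ∀ φ x, x ∈ A.rep φ → ∃ χ, χ ∈ F φ ∧ f x ∈ B.rep χ

/-- Polytime computability of a function between preparametrised spaces: some machine computes a
realiser of it, with running time and parameter blowup bounded by second-order polynomials in the
parameter of the name. -/
def PolytimeComputable {X Y : Type*} (A : ParamRep X) (B : ParamRep Y) (f : X → Y) : Prop :=
  ∃ (M : OracleMachine) (P Q : (ℕ → ℕ) → ℕ → ℕ),
    IsRealiser A B M.operator f ∧ IsSOP P ∧ IsSOP Q ∧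
    (∀ (φ : A.rep.Dom) (a : Str), M.time φ a ≤ (P (A.param φ) a.length : ℕ∞)) ∧
    (∀ (φ : A.rep.Dom) (χ : B.rep.Dom), (χ : Baire) ∈ M.operator φ →
      ∀ n, B.param χ n ≤ Q (A.param φ) n)

namespace ParamRep

variable {X Y : Type*}

/-- Polytime translatability: the identity is polytime computable. -/
def TranslatableTo (A B : ParamRep X) : Prop := PolytimeComputable A B (id : X → X)

/-- The product: names of pairs are pairs of names, the parameter is the pointwise maximum. -/
def prod (A : ParamRep X) (B : ParamRep Y) : ParamRep (X × Y) where
  rep φ := ⟨φ = pair (fst φ) (snd φ) ∧ (A.rep (fst φ)).Dom ∧ (B.rep (snd φ)).Dom,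
    fun h => ((A.rep (fst φ)).get h.2.1, (B.rep (snd φ)).get h.2.2)⟩
  surj := by
    rintro ⟨x, y⟩
    obtain ⟨φ, h, hx⟩ := A.surj x
    obtain ⟨ψ, k, hy⟩ := B.surj y
    exact ⟨pair φ ψ, ⟨rfl, h, k⟩, Prod.ext hx hy⟩
  param φ n := max (A.param ⟨fst φ, φ.2.2.1⟩ n) (B.param ⟨snd φ, φ.2.2.2⟩ n)
  mono φ _ _ h := max_le_max (A.mono _ h) (B.mono _ h)

/-- The subspace on `S`: range restriction of the representation, restriction of the parameter. -/
def restrict (A : ParamRep X) (S : Set X) : ParamRep S where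
  rep φ := ⟨∃ h : (A.rep φ).Dom, (A.rep φ).get h ∈ S, fun h => ⟨(A.rep φ).get h.1, h.2⟩⟩
  surj := by
    rintro ⟨x, hx⟩
    obtain ⟨φ, h, rfl⟩ := A.surj x
    exact ⟨φ, ⟨h, hx⟩, rfl⟩
  param φ := A.param ⟨φ, φ.2.1⟩
  mono φ := A.mono _

end ParamRep

/-! ### Dyadic intervals -/

/-- Dyadic numbers. -/
def IsDyadic (x : ℝ) : Prop := ∃ (r : ℤ) (n : ℕ), x = r / 2 ^ n

/-- A finite dyadic interval `[mid ± rad]` of positive length. -/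
@[ext] structure DyadicInterval where
  mid : ℝ
  rad : ℝ
  mid_dyadic : IsDyadic mid
  rad_dyadic : IsDyadic rad
  rad_pos : 0 < rad

/-- The finite dyadic intervals together with the infinite interval `none = [-∞, ∞]`. -/
abbrev ID := Option DyadicInterval

namespace ID

/-- The set of real numbers in an interval. -/
def toSet : ID → Set ℝ
  | none => Set.univ
  | some J => Set.Icc (J.mid - J.rad) (J.mid + J.rad)

/-- The length of an interval. -/
noncomputable def diam : ID → ENNReal
  | none => ⊤
  | some J => ENNReal.ofReal (2 * J.rad)

end ID

/-! ### Encodings by strings -/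

/-- Binary digits as symbols. -/
def digit : Bool → Sym
  | false => Sym.zero
  | true => Sym.one

/-- The natural number with the given binary digits, the most significant digit first. -/
def binVal (u : List Bool) : ℕ := u.foldl (fun v b => 2 * v + b.toNat) 0

/-- `c` encodes the dyadic number `x`: it consists of the code of an integer (a sign digit followed
by the binary digits `u` without leading zeros), the separator, and the binary digits `v` of the
fractional part. -/
def IsDyadicCode (c : Str) (x : ℝ) : Prop :=
  ∃ (s : Bool) (u v : List Bool), u.head? ≠ some false ∧
    c = digit s :: u.map digit ++ Sym.sep :: v.map digit ∧
    x = (-1) ^ s.toNat * ((binVal u : ℝ) + (binVal v : ℝ) / 2 ^ v.length)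

/-- The control string of the pairing of `a` and `b`: the digit `1` as often as the length of the
shorter of the two, a `0`, and a bit that is `1` if and only if `b` is the longer one. -/
def control (a b : Str) : Str :=
  List.replicate (min a.length b.length) Sym.one ++
    [Sym.zero, digit (decide (a.length < b.length))]

/-- The pairing of strings: the symbols of the control string, of `a` and of `b` alternate, each of
the three padded by zeros to the length of the longest. -/
def strPair (a b : Str) : Str :=
  (List.range (max (max a.length b.length) (control a b).length)).flatMap fun i =>
    [(control a b).getD i Sym.zero, a.getD i Sym.zero, b.getD i Sym.zero]

/-- `c` encodes the given interval. The infinite interval is encoded by the empty string, a finite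
interval `[r ± ε]` by the pair of a code of `r` and a code of `ε`. -/
def IsIntervalCode (c : Str) : ID → Prop
  | none => c = []
  | some J => ∃ a b, IsDyadicCode a J.mid ∧ IsDyadicCode b J.rad ∧ c = strPair a b

/-- The unary code of `n`: the binary code of the (positive) integer `2 ^ n`. -/
def natCode (n : ℕ) : Str := Sym.zero :: Sym.one :: List.replicate n Sym.zero

/-- The string function `χ` encodes the sequence `φ` of intervals. -/
def EncodesSeq (χ : Baire) (φ : ℕ → ID) : Prop :=
  ∀ n, IsIntervalCode (χ (natCode n)) (φ n)

/-- The string function `χ` encodes the interval function `ψ`. -/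
def EncodesFun (χ : Baire) (ψ : ID → ID) : Prop :=
  ∀ J a, IsIntervalCode a J → IsIntervalCode (χ a) (ψ J)

/-- `φ` is a nested sequence of intervals with intersection `{x}`. -/
def IsRealName (φ : ℕ → ID) (x : ℝ) : Prop :=
  (∀ n, (φ (n + 1)).toSet ⊆ (φ n).toSet) ∧ ⋂ n, (φ n).toSet = {x}

/-- The interval function `ψ` sends every name of every `x ∈ [0, 1]` to a name of `f x`. -/
def IsFunName (ψ : ID → ID) (f : C(unitInterval, ℝ)) : Prop :=
  ∀ (φ : ℕ → ID) (x : unitInterval), IsRealName φ x → IsRealName (ψ ∘ φ) (f x)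

/-- The rate of convergence of a sequence of intervals. -/
noncomputable def rate (φ : ℕ → ID) (n : ℕ) : ℕ :=
  sInf {N : ℕ | (φ N).diam ≤ 2⁻¹ ^ n}

/-- The modulus of an interval function on the intervals that meet `[0, 1]`. -/
noncomputable def modulus (ψ : ID → ID) (n : ℕ) : ℕ :=
  sInf {N : ℕ | ∀ J : ID, (J.toSet ∩ Set.Icc 0 1).Nonempty →
    J.diam ≤ 2⁻¹ ^ N → (ψ J).diam ≤ 2⁻¹ ^ n}

/-! ### The encodings are well defined -/

theorem digit_injective : Function.Injective digit := by
  intro a b h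
  cases a <;> cases b <;> simp_all [digit]

theorem digit_ne_sep (b : Bool) : digit b ≠ Sym.sep := by
  cases b <;> simp [digit]

theorem binVal_append (u v : List Bool) :
    binVal (u ++ v) = binVal u * 2 ^ v.length + binVal v := by
  induction v using List.reverseRecOn with
  | nil => simp [binVal]
  | append_singleton v b ih =>
    have h : ∀ w : List Bool, binVal (w ++ [b]) = 2 * binVal w + b.toNat := by
      intro w
      simp [binVal, List.foldl_append]
    rw [← List.append_assoc, h, ih, h, List.length_append, List.length_singleton]
    ring

theorem binVal_replicate (k : ℕ) : binVal (List.replicate k false) = 0 := by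
  induction k with
  | zero => rfl
  | succ k ih =>
    rw [List.replicate_succ', binVal_append, ih]
    simp [binVal]

theorem split_sep {u u' : List Bool} {x y : Str}
    (h : u.map digit ++ Sym.sep :: x = u'.map digit ++ Sym.sep :: y) : u = u' ∧ x = y := by
  induction u generalizing u' with
  | nil =>
    cases u' with
    | nil => simpa using h
    | cons b u' =>
      simp only [List.map_nil, List.nil_append, List.map_cons, List.cons_append,
        List.cons.injEq] at h
      exact absurd h.1.symm (digit_ne_sep b)
  | cons a u ih =>
    cases u' with
    | nil =>
      simp only [List.map_nil, List.nil_append, List.map_cons, List.cons_append,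
        List.cons.injEq] at h
      exact absurd h.1 (digit_ne_sep a)
    | cons b u' =>
      simp only [List.map_cons, List.cons_append, List.cons.injEq] at h
      obtain ⟨h1, h2⟩ := ih h.2
      exact ⟨by rw [digit_injective h.1, h1], h2⟩

theorem dyadicCode_pad {c c' : Str} {x x' : ℝ} (hc : IsDyadicCode c x) (hc' : IsDyadicCode c' x')
    (k : ℕ) (h : c' = c ++ List.replicate k Sym.zero) : x = x' := by
  obtain ⟨s, u, v, -, rfl, rfl⟩ := hc
  obtain ⟨s', u', v', -, rfl, rfl⟩ := hc'
  have hk : List.replicate k Sym.zero = (List.replicate k false).map digit := by simp [digit]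
  simp only [List.cons_append, List.append_assoc, List.cons.injEq] at h
  obtain ⟨hs, h⟩ := h
  obtain ⟨hu, hv⟩ := split_sep h
  rw [hk, ← List.map_append] at hv
  have hv := List.map_injective_iff.2 digit_injective hv
  have hs := digit_injective hs
  subst hs hu hv
  rw [binVal_append, binVal_replicate, List.length_append]
  simp only [List.length_replicate, pow_add, add_zero]
  push_cast
  rw [mul_div_mul_right _ _ (by positivity)]

theorem eq_append_replicate {c c' : Str} (hl : c.length ≤ c'.length)
    (h : ∀ i, c.getD i Sym.zero = c'.getD i Sym.zero) :
    c' = c ++ List.replicate (c'.length - c.length) Sym.zero := by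
  apply List.ext_getElem
  · simp [hl]
  · intro i h1 h2
    have hi := h i
    rw [List.getElem_append]
    split_ifs with h3
    · simpa [List.getD_eq_getElem?_getD, h1, h3] using hi.symm
    · simpa [List.getD_eq_getElem?_getD, h1, h3] using hi.symm

theorem dyadicCode_unique {c c' : Str} {x x' : ℝ} (hc : IsDyadicCode c x)
    (hc' : IsDyadicCode c' x') (h : ∀ i, c.getD i Sym.zero = c'.getD i Sym.zero) : x = x' := by
  rcases le_total c.length c'.length with hl | hl
  · exact dyadicCode_pad hc hc' _ (eq_append_replicate hl h)
  · exact (dyadicCode_pad hc' hc _ (eq_append_replicate hl fun i => (h i).symm)).symm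

theorem flatMap_range_injective {F F' : ℕ → Str} (hF : ∀ i, (F i).length = 3)
    (hF' : ∀ i, (F' i).length = 3) {L L' : ℕ}
    (h : (List.range L).flatMap F = (List.range L').flatMap F') :
    L = L' ∧ ∀ i < L, F i = F' i := by
  have hl : ∀ (G : ℕ → Str), (∀ i, (G i).length = 3) → ∀ n,
      ((List.range n).flatMap G).length = 3 * n := by
    intro G hG n
    induction n with
    | zero => simp
    | succ n ih => rw [List.range_succ, List.flatMap_append, List.length_append, ih]; simp [hG]; ring
  have hL : L = L' := by
    have := congrArg List.length h
    rw [hl F hF, hl F' hF'] at this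
    omega
  subst hL
  refine ⟨rfl, ?_⟩
  induction L with
  | zero => simp
  | succ L ih =>
    simp only [List.range_succ, List.flatMap_append, List.flatMap_cons, List.flatMap_nil,
      List.append_nil] at h
    obtain ⟨h1, h2⟩ := List.append_inj h (by rw [hl F hF, hl F' hF'])
    intro i hi
    rcases Nat.lt_succ_iff_lt_or_eq.1 hi with hi | rfl
    · exact ih h1 i hi
    · exact h2

theorem strPair_getD {a b a' b' : Str} (h : strPair a b = strPair a' b') (i : ℕ) :
    a.getD i Sym.zero = a'.getD i Sym.zero ∧ b.getD i Sym.zero = b'.getD i Sym.zero := by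
  obtain ⟨hL, h⟩ := flatMap_range_injective (fun _ => rfl) (fun _ => rfl) h
  by_cases hi : i < max (max a.length b.length) (control a b).length
  · have := h i hi
    simp only [List.cons.injEq, and_true] at this
    exact this.2
  · have hi' := hi
    rw [hL] at hi'
    simp only [lt_max_iff, not_or, not_lt] at hi hi'
    rw [List.getD_eq_default _ _ hi.1.1, List.getD_eq_default _ _ hi.1.2,
      List.getD_eq_default _ _ hi'.1.1, List.getD_eq_default _ _ hi'.1.2]
    exact ⟨rfl, rfl⟩

theorem strPair_ne_nil (a b : Str) : strPair a b ≠ [] := by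
  intro h
  have h2 : (control a b).length = min a.length b.length + 2 := by simp [control]
  have h0 : 0 < max (max a.length b.length) (control a b).length := by
    rw [lt_max_iff]; right; omega
  obtain ⟨n, hn⟩ := Nat.exists_eq_succ_of_ne_zero h0.ne'
  rw [strPair, hn, Nat.succ_eq_add_one, List.range_succ] at h
  simp at h

/-- A string encodes at most one interval. -/
theorem intervalCode_unique {c : Str} {J K : ID} (hJ : IsIntervalCode c J)
    (hK : IsIntervalCode c K) : J = K := by
  cases J with
  | none =>
    cases K with
    | none => rfl
    | some K =>
      obtain ⟨a, b, -, -, h⟩ := hK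
      exact absurd (h.symm.trans hJ) (strPair_ne_nil a b)
  | some J =>
    obtain ⟨a, b, ha, hb, h⟩ := hJ
    cases K with
    | none => exact absurd (h.symm.trans hK) (strPair_ne_nil a b)
    | some K =>
      obtain ⟨a', b', ha', hb', h'⟩ := hK
      have := strPair_getD (h.symm.trans h')
      congr 1
      ext
      · exact dyadicCode_unique ha ha' fun i => (this i).1
      · exact dyadicCode_unique hb hb' fun i => (this i).2

theorem exists_digits (n m : ℕ) : ∃ u v : List Bool, u.head? ≠ some false ∧ v.length = n ∧
    m = binVal u * 2 ^ n + binVal v := by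
  have step : ∀ (w : List Bool) (k : ℕ), binVal (w ++ [decide (k % 2 = 1)]) =
      2 * binVal w + k % 2 := by
    intro w k
    rw [binVal_append]
    rcases Nat.mod_two_eq_zero_or_one k with h | h <;> simp [h, binVal, mul_comm]
  induction n generalizing m with
  | zero =>
    induction m using Nat.strong_induction_on with
    | _ m ih =>
      rcases Nat.eq_zero_or_pos m with rfl | hm
      · exact ⟨[], [], by simp, rfl, by simp [binVal]⟩
      · obtain ⟨u, v, hu, hv, h⟩ := ih (m / 2) (by omega)
        rw [List.length_eq_zero_iff] at hv
        subst hv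
        refine ⟨u ++ [decide (m % 2 = 1)], [], ?_, rfl, ?_⟩
        · cases u with
          | nil =>
            have : m / 2 = 0 := by simpa [binVal] using h
            have : m = 1 := by omega
            simp [this]
          | cons b u => simpa using hu
        · rw [step]
          simp [binVal] at h ⊢
          omega
  | succ n ih =>
    obtain ⟨u, v, hu, hv, h⟩ := ih (m / 2)
    refine ⟨u, v ++ [decide (m % 2 = 1)], hu, by simp [hv], ?_⟩
    rw [step, pow_succ]
    have := Nat.div_add_mod m 2
    rw [h] at this
    conv_lhs => rw [← this]
    ring

theorem exists_dyadicCode {x : ℝ} (hx : IsDyadic x) : ∃ c, IsDyadicCode c x := by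
  obtain ⟨r, n, rfl⟩ := hx
  obtain ⟨u, v, hu, hv, h⟩ := exists_digits n r.natAbs
  have hval : (binVal u : ℝ) + (binVal v : ℝ) / 2 ^ v.length = (r.natAbs : ℝ) / 2 ^ n := by
    rw [h, hv]
    push_cast
    field_simp
  refine ⟨_, decide (r < 0), u, v, hu, rfl, ?_⟩
  rw [hval, Nat.cast_natAbs]
  by_cases hr : r < 0
  · simp [hr, abs_of_neg hr]
    ring
  · simp [hr, abs_of_nonneg (not_lt.1 hr)]

/-- Every interval has a code. -/
theorem exists_intervalCode (J : ID) : ∃ c, IsIntervalCode c J := by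
  cases J with
  | none => exact ⟨[], rfl⟩
  | some J =>
    obtain ⟨a, ha⟩ := exists_dyadicCode J.mid_dyadic
    obtain ⟨b, hb⟩ := exists_dyadicCode J.rad_dyadic
    exact ⟨_, a, b, ha, hb, rfl⟩

theorem natCode_injective : Function.Injective natCode := by
  intro m n h
  simpa [natCode] using congrArg List.length h

theorem exists_encodesSeq (φ : ℕ → ID) : ∃ χ, EncodesSeq χ φ := by
  classical
  choose c hc using fun n => exists_intervalCode (φ n)
  refine ⟨fun a => if h : ∃ n, natCode n = a then c h.choose else [], fun n => ?_⟩
  have h : ∃ m, natCode m = natCode n := ⟨n, rfl⟩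
  simp only [h, dite_true]
  rw [natCode_injective h.choose_spec]
  exact hc n

theorem exists_encodesFun (ψ : ID → ID) : ∃ χ, EncodesFun χ ψ := by
  classical
  choose c hc using exists_intervalCode
  refine ⟨fun a => if h : ∃ J, IsIntervalCode a J then c (ψ h.choose) else [], fun J a ha => ?_⟩
  have h : ∃ K, IsIntervalCode a K := ⟨J, ha⟩
  simp only [h, dite_true]
  rw [intervalCode_unique ha h.choose_spec]
  exact hc _

/-! ### Names of real numbers -/

theorem diam_le_iff {J : DyadicInterval} {n : ℕ} :
    ID.diam (some J) ≤ 2⁻¹ ^ n ↔ 2 * J.rad ≤ 2⁻¹ ^ n := by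
  have h : (2⁻¹ : ENNReal) ^ n = ENNReal.ofReal (2⁻¹ ^ n) := by
    rw [ENNReal.ofReal_pow (by norm_num), ENNReal.ofReal_inv_of_pos (by norm_num)]
    norm_num
  rw [ID.diam, h, ENNReal.ofReal_le_ofReal_iff (by positivity)]

theorem IsRealName.mem {φ : ℕ → ID} {x : ℝ} (h : IsRealName φ x) (n : ℕ) : x ∈ (φ n).toSet := by
  have : x ∈ ⋂ n, (φ n).toSet := by rw [h.2]; rfl
  exact Set.mem_iInter.1 this n

theorem IsRealName.unique {φ : ℕ → ID} {x y : ℝ} (h : IsRealName φ x) (h' : IsRealName φ y) :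
    x = y := Set.singleton_injective (h.2.symm.trans h'.2)

theorem isRealName_of_small {φ : ℕ → ID} {x : ℝ} (h1 : ∀ n, (φ (n + 1)).toSet ⊆ (φ n).toSet)
    (h2 : ∀ n, x ∈ (φ n).toSet) (h3 : ∀ δ > 0, ∃ n J, φ n = some J ∧ J.rad < δ) :
    IsRealName φ x := by
  refine ⟨h1, Set.Subset.antisymm (fun y hy => ?_) (fun y hy => ?_)⟩
  · by_contra hne
    obtain ⟨n, J, hn, hJ⟩ := h3 (|y - x| / 2) (by
      have : 0 < |y - x| := abs_pos.2 (sub_ne_zero.2 hne)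
      positivity)
    have hx := h2 n
    have hy := Set.mem_iInter.1 hy n
    rw [hn] at hx hy
    simp only [ID.toSet, Set.mem_Icc] at hx hy
    have : |y - x| ≤ 2 * J.rad := abs_le.2 ⟨by linarith, by linarith⟩
    linarith
  · rw [Set.mem_singleton_iff.1 hy]
    exact Set.mem_iInter.2 h2

theorem IsRealName.small {φ : ℕ → ID} {x : ℝ} (h : IsRealName φ x) {δ : ℝ} (hδ : 0 < δ) :
    ∃ n J, φ n = some J ∧ J.rad < δ := by
  by_contra! hc
  have key : ∀ n, x + δ ∈ (φ n).toSet ∨ x - δ ∈ (φ n).toSet := by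
    intro n
    have hx := h.mem n
    cases hn : φ n with
    | none => simp [ID.toSet]
    | some J =>
      have := hc n J hn
      rw [hn] at hx
      simp only [ID.toSet, Set.mem_Icc] at hx ⊢
      by_cases hm : x ≤ J.mid
      · left; constructor <;> linarith
      · right; constructor <;> linarith
  have anti : Antitone fun n => (φ n).toSet := antitone_nat_of_succ_le h.1
  by_cases hp : ∀ n, x + δ ∈ (φ n).toSet
  · have : x + δ ∈ ⋂ n, (φ n).toSet := Set.mem_iInter.2 hp
    rw [h.2, Set.mem_singleton_iff] at this
    linarith
  · push Not at hp
    obtain ⟨m, hm⟩ := hp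
    have : x - δ ∈ ⋂ n, (φ n).toSet := by
      refine Set.mem_iInter.2 fun n => ?_
      rcases key (max n m) with hk | hk
      · exact absurd (anti (le_max_right n m) hk) hm
      · exact anti (le_max_left n m) hk
    rw [h.2, Set.mem_singleton_iff] at this
    linarith

theorem IsRealName.cons {φ : ℕ → ID} {x : ℝ} (h : IsRealName φ x) {K : ID}
    (hK : (φ 0).toSet ⊆ K.toSet) :
    IsRealName (fun n => Nat.casesOn n K φ) x := by
  refine isRealName_of_small ?_ ?_ ?_
  · rintro (_ | n)
    · exact hK
    · exact h.1 n
  · rintro (_ | n)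
    · exact hK (h.mem 0)
    · exact h.mem n
  · intro δ hδ
    obtain ⟨n, J, hn, hJ⟩ := h.small hδ
    exact ⟨n + 1, J, hn, hJ⟩

theorem IsDyadic.half {x : ℝ} (h : IsDyadic x) : IsDyadic (x / 2) := by
  obtain ⟨r, n, rfl⟩ := h
  exact ⟨r, n + 1, by rw [pow_succ, div_div]⟩

theorem IsDyadic.add {x y : ℝ} (hx : IsDyadic x) (hy : IsDyadic y) : IsDyadic (x + y) := by
  obtain ⟨r, n, rfl⟩ := hx
  obtain ⟨s, m, rfl⟩ := hy
  refine ⟨r * 2 ^ m + s * 2 ^ n, n + m, ?_⟩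
  push_cast
  rw [pow_add]
  field_simp

theorem IsDyadic.neg {x : ℝ} (hx : IsDyadic x) : IsDyadic (-x) := by
  obtain ⟨r, n, rfl⟩ := hx
  exact ⟨-r, n, by push_cast; ring⟩

theorem IsDyadic.sub {x y : ℝ} (hx : IsDyadic x) (hy : IsDyadic y) : IsDyadic (x - y) := by
  rw [sub_eq_add_neg]
  exact hx.add hy.neg

open Classical in
/-- The half of an interval that contains `x`. -/
noncomputable def bisect (x : ℝ) (J : DyadicInterval) : DyadicInterval where
  mid := if x ≤ J.mid then J.mid - J.rad / 2 else J.mid + J.rad / 2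
  rad := J.rad / 2
  mid_dyadic := by
    split_ifs
    · exact J.mid_dyadic.sub J.rad_dyadic.half
    · exact J.mid_dyadic.add J.rad_dyadic.half
  rad_dyadic := J.rad_dyadic.half
  rad_pos := half_pos J.rad_pos

/-- Every interval that contains `x` is the first element of a name of `x`. -/
theorem exists_realName_of_mem {x : ℝ} {J : DyadicInterval} (hx : x ∈ ID.toSet (some J)) :
    ∃ φ, IsRealName φ x ∧ φ 0 = some J := by
  have hr : ∀ n, ((bisect x)^[n] J).rad = J.rad / 2 ^ n := by
    intro n
    induction n with
    | zero => simp
    | succ n ih =>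
      rw [Function.iterate_succ_apply', pow_succ, ← div_div, ← ih]
      rfl
  have hsub : ∀ K, ID.toSet (some (bisect x K)) ⊆ ID.toSet (some K) := by
    intro K y hy
    have := K.rad_pos
    simp only [ID.toSet, bisect, Set.mem_Icc] at hy ⊢
    split_ifs at hy <;> constructor <;> linarith
  have hmem : ∀ K, x ∈ ID.toSet (some K) → x ∈ ID.toSet (some (bisect x K)) := by
    intro K hK
    simp only [ID.toSet, bisect, Set.mem_Icc] at hK ⊢
    split_ifs with h
    · constructor <;> linarith
    · constructor <;> linarith
  refine ⟨fun n => some ((bisect x)^[n] J), isRealName_of_small ?_ ?_ ?_, rfl⟩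
  · intro n
    rw [Function.iterate_succ_apply']
    exact hsub _
  · intro n
    induction n with
    | zero => exact hx
    | succ n ih =>
      rw [Function.iterate_succ_apply']
      exact hmem _ ih
  · intro δ hδ
    obtain ⟨n, hn⟩ := exists_pow_lt_of_lt_one (div_pos hδ J.rad_pos)
      (by norm_num : (2⁻¹ : ℝ) < 1)
    refine ⟨n, _, rfl, ?_⟩
    rw [hr]
    rw [lt_div_iff₀ J.rad_pos, inv_pow] at hn
    rw [div_eq_mul_inv, mul_comm]
    exact hn

/-- The interval of radius `2 ^ (1 - n)` around the largest multiple of `2 ^ (-n)` below `x`. -/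
noncomputable def around (x : ℝ) (n : ℕ) : DyadicInterval where
  mid := ⌊x * 2 ^ n⌋ / 2 ^ n
  rad := 2 / 2 ^ n
  mid_dyadic := ⟨_, _, rfl⟩
  rad_dyadic := ⟨2, n, by norm_num⟩
  rad_pos := by positivity

theorem around_mid (x : ℝ) (n : ℕ) : (around x n).mid ≤ x ∧ x < (around x n).mid + 1 / 2 ^ n := by
  have h : (0 : ℝ) < 2 ^ n := by positivity
  constructor
  · exact (div_le_iff₀ h).2 (Int.floor_le _)
  · change x < ⌊x * 2 ^ n⌋ / 2 ^ n + 1 / 2 ^ n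
    rw [← add_div, lt_div_iff₀ h]
    exact Int.lt_floor_add_one _

theorem floor_double (y : ℝ) : 2 * (⌊y⌋ : ℝ) ≤ ⌊2 * y⌋ ∧ (⌊2 * y⌋ : ℝ) ≤ 2 * ⌊y⌋ + 1 := by
  have h1 : 2 * ⌊y⌋ ≤ ⌊2 * y⌋ := by
    rw [Int.le_floor]
    push_cast
    linarith [Int.floor_le y]
  have h2 : ⌊2 * y⌋ < 2 * ⌊y⌋ + 2 := by
    rw [Int.floor_lt]
    push_cast
    linarith [Int.lt_floor_add_one y]
  constructor
  · exact_mod_cast h1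
  · exact_mod_cast Int.lt_add_one_iff.1 (by linarith : ⌊2 * y⌋ < 2 * ⌊y⌋ + 1 + 1)

theorem isRealName_around (x : ℝ) : IsRealName (fun n => some (around x n)) x := by
  refine isRealName_of_small ?_ ?_ ?_
  · intro n y hy
    have h : (0 : ℝ) < 1 / 2 ^ n := by positivity
    obtain ⟨h1, h2⟩ := floor_double (x * 2 ^ n)
    have e1 : (around x (n + 1)).mid = ⌊2 * (x * 2 ^ n)⌋ * (1 / 2 ^ n) / 2 := by
      simp only [around]
      rw [pow_succ, show x * (2 ^ n * 2) = 2 * (x * 2 ^ n) by ring]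
      field_simp
    have e2 : (around x n).mid = ⌊x * 2 ^ n⌋ * (1 / 2 ^ n) := by
      simp only [around]; field_simp
    have e3 : (around x (n + 1)).rad = 1 / 2 ^ n := by
      simp only [around]; rw [pow_succ]; field_simp
    have e4 : (around x n).rad = 2 * (1 / 2 ^ n) := by
      simp only [around]; field_simp
    have g1 := mul_le_mul_of_nonneg_right h1 h.le
    have g2 := mul_le_mul_of_nonneg_right h2 h.le
    simp only [ID.toSet, Set.mem_Icc, e1, e2, e3, e4] at hy ⊢
    constructor <;> nlinarith
  · intro n
    have h : (0 : ℝ) < 1 / 2 ^ n := by positivity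
    have e4 : (around x n).rad = 2 * (1 / 2 ^ n) := by
      simp only [around]; field_simp
    obtain ⟨h1, h2⟩ := around_mid x n
    simp only [ID.toSet, Set.mem_Icc, e4]
    constructor <;> linarith
  · intro δ hδ
    obtain ⟨n, hn⟩ := exists_pow_lt_of_lt_one (half_pos hδ) (by norm_num : (2⁻¹ : ℝ) < 1)
    refine ⟨n, _, rfl, ?_⟩
    rw [inv_pow] at hn
    simp only [around, div_eq_mul_inv]
    linarith

theorem rate_nonempty {φ : ℕ → ID} {x : ℝ} (h : IsRealName φ x) (n : ℕ) :
    {N : ℕ | (φ N).diam ≤ 2⁻¹ ^ n}.Nonempty := by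
  obtain ⟨N, J, hN, hJ⟩ := h.small (δ := 2⁻¹ ^ n / 2) (by positivity)
  refine ⟨N, ?_⟩
  change (φ N).diam ≤ 2⁻¹ ^ n
  rw [hN, diam_le_iff]
  linarith

theorem inv_two_pow_anti {m n : ℕ} (h : m ≤ n) : (2⁻¹ : ENNReal) ^ n ≤ 2⁻¹ ^ m :=
  pow_le_pow_right_of_le_one' (by simp) h

theorem rate_mono {φ : ℕ → ID} {x : ℝ} (h : IsRealName φ x) : Monotone (rate φ) := by
  intro m n hmn
  have := Nat.sInf_mem (rate_nonempty h n)
  exact Nat.sInf_le (le_trans (b := (2⁻¹ : ENNReal) ^ n) this (inv_two_pow_anti hmn))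

/-! ### Names of continuous functions -/

theorem IsFunName.subset {ψ : ID → ID} {f : C(unitInterval, ℝ)} (h : IsFunName ψ f) {J K : ID}
    (hJK : J.toSet ⊆ K.toSet) (hJ : (J.toSet ∩ Set.Icc 0 1).Nonempty) :
    (ψ J).toSet ⊆ (ψ K).toSet := by
  obtain ⟨x, hx, hx'⟩ := hJ
  obtain ⟨φ, hφ, h0⟩ : ∃ φ, IsRealName φ x ∧ φ 0 = J := by
    cases J with
    | none => exact ⟨_, (isRealName_around x).cons (K := none) (Set.subset_univ _), rfl⟩
    | some J => exact exists_realName_of_mem hx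
  have := (h _ ⟨x, hx'⟩ (hφ.cons (K := K) (by rw [h0]; exact hJK))).1 0
  simpa [h0] using this

theorem IsFunName.unique {ψ : ID → ID} {f g : C(unitInterval, ℝ)} (h : IsFunName ψ f)
    (h' : IsFunName ψ g) : f = g := by
  ext x
  exact (h _ x (isRealName_around x)).unique (h' _ x (isRealName_around x))

theorem modulus_nonempty {ψ : ID → ID} {f : C(unitInterval, ℝ)} (h : IsFunName ψ f) (n : ℕ) :
    {N : ℕ | ∀ J : ID, (J.toSet ∩ Set.Icc 0 1).Nonempty →
      J.diam ≤ 2⁻¹ ^ N → (ψ J).diam ≤ 2⁻¹ ^ n}.Nonempty := by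
  by_contra hne
  rw [Set.not_nonempty_iff_eq_empty] at hne
  have hall : ∀ N : ℕ, ∃ J : ID, (J.toSet ∩ Set.Icc 0 1).Nonempty ∧
      J.diam ≤ 2⁻¹ ^ N ∧ ¬ (ψ J).diam ≤ 2⁻¹ ^ n := by
    intro N
    have : N ∉ {N : ℕ | ∀ J : ID, (J.toSet ∩ Set.Icc 0 1).Nonempty →
      J.diam ≤ 2⁻¹ ^ N → (ψ J).diam ≤ 2⁻¹ ^ n} := by rw [hne]; exact Set.notMem_empty N
    simpa using this
  choose J hmeet hsmall hbig using hall
  choose t ht ht' using hmeet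
  obtain ⟨x, hx, s, hs, hlim⟩ := isCompact_Icc.tendsto_subseq ht'
  obtain ⟨m, hm⟩ := rate_nonempty (h _ ⟨x, hx⟩ (isRealName_around x)) n
  have hm : (ψ (some (around x m))).diam ≤ 2⁻¹ ^ n := hm
  have hε : (0 : ℝ) < 1 / 2 ^ m := by positivity
  have hε' : (0 : ℝ) < 1 / 2 ^ m / 4 := by positivity
  obtain ⟨k₁, hk₁⟩ := Metric.tendsto_atTop.1 hlim _ hε'
  obtain ⟨k₂, hk₂⟩ := exists_pow_lt_of_lt_one hε' (by norm_num : (2⁻¹ : ℝ) < 1)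
  let k := max k₁ k₂
  have h1 := hk₁ k (le_max_left _ _)
  have h2 : (2⁻¹ : ℝ) ^ s k < 1 / 2 ^ m / 4 :=
    lt_of_le_of_lt (pow_le_pow_of_le_one (by norm_num) (by norm_num)
      ((le_max_right k₁ k₂).trans (hs.id_le k))) hk₂
  have hsub : (J (s k)).toSet ⊆ ID.toSet (some (around x m)) := by
    have hd := hsmall (s k)
    have htk := ht (s k)
    cases hJ : J (s k) with
    | none =>
      rw [hJ] at hd
      simp [ID.diam] at hd
    | some K =>
      rw [hJ] at hd htk
      rw [diam_le_iff] at hd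
      intro y hy
      obtain ⟨h3, h4⟩ := around_mid x m
      have e4 : (around x m).rad = 2 * (1 / 2 ^ m) := by
        simp only [around]; field_simp
      simp only [Function.comp, Real.dist_eq, abs_lt] at h1
      simp only [ID.toSet, Set.mem_Icc, e4] at hy htk ⊢
      constructor <;> linarith [h1.1, h1.2]
  have hmono := h.subset hsub ⟨_, ht (s k), ht' (s k)⟩
  apply hbig (s k)
  cases hA : ψ (some (around x m)) with
  | none =>
    rw [hA] at hm
    simp [ID.diam] at hm
  | some A =>
    rw [hA] at hm hmono
    rw [diam_le_iff] at hm
    cases hB : ψ (J (s k)) with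
    | none =>
      rw [hB] at hmono
      have := hmono (Set.mem_univ (A.mid + A.rad + 1))
      simp only [ID.toSet, Set.mem_Icc] at this
      linarith [this.2]
    | some B =>
      rw [hB] at hmono
      have hp := B.rad_pos
      have m1 := hmono (show B.mid - B.rad ∈ ID.toSet (some B) from ⟨le_rfl, by linarith⟩)
      have m2 := hmono (show B.mid + B.rad ∈ ID.toSet (some B) from ⟨by linarith, le_rfl⟩)
      simp only [ID.toSet, Set.mem_Icc] at m1 m2
      rw [diam_le_iff]
      linarith [m1.1, m2.2]

theorem modulus_mono {ψ : ID → ID} {f : C(unitInterval, ℝ)} (h : IsFunName ψ f) :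
    Monotone (modulus ψ) := fun _ n hmn =>
  Nat.sInf_le fun J h1 h2 =>
    le_trans (Nat.sInf_mem (modulus_nonempty h n) J h1 h2) (inv_two_pow_anti hmn)

/-- The multiple of `2 ^ (-k)` that is at least `2 ^ (-k)`, but not `2 * 2 ^ (-k)`, below `y`. -/
noncomputable def below (y : ℝ) (k : ℕ) : ℝ := ⌊y * 2 ^ k⌋ / 2 ^ k - 1 / 2 ^ k

theorem below_dyadic (y : ℝ) (k : ℕ) : IsDyadic (below y k) :=
  IsDyadic.sub ⟨_, _, rfl⟩ ⟨1, k, by norm_num⟩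

theorem below_bounds (y : ℝ) (k : ℕ) : below y k < y ∧ y ≤ below y k + 2 / 2 ^ k := by
  have h : (0 : ℝ) < 2 ^ k := by positivity
  have h' : (0 : ℝ) < 1 / 2 ^ k := by positivity
  have h1 : (⌊y * 2 ^ k⌋ : ℝ) / 2 ^ k ≤ y := (div_le_iff₀ h).2 (Int.floor_le _)
  have h2 : y < ⌊y * 2 ^ k⌋ / 2 ^ k + 1 / 2 ^ k := by
    rw [← add_div, lt_div_iff₀ h]
    exact Int.lt_floor_add_one _
  have h3 : (2 : ℝ) / 2 ^ k = 1 / 2 ^ k + 1 / 2 ^ k := by ring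
  rw [below, h3]
  constructor <;> linarith

theorem below_mono {y z : ℝ} {k l : ℕ} (hyz : y ≤ z) (hkl : k ≤ l) : below y k ≤ below z l := by
  obtain ⟨j, rfl⟩ := Nat.exists_eq_add_of_le hkl
  have h : (0 : ℝ) < 2 ^ k := by positivity
  have h1 : ⌊y * 2 ^ k⌋ * 2 ^ j ≤ ⌊z * 2 ^ (k + j)⌋ := by
    rw [Int.le_floor]
    push_cast
    rw [pow_add, ← mul_assoc]
    exact mul_le_mul_of_nonneg_right ((Int.floor_le _).trans
      (mul_le_mul_of_nonneg_right hyz h.le)) (by positivity)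
  have h2 : ((⌊y * 2 ^ k⌋ : ℝ)) / 2 ^ k ≤ ⌊z * 2 ^ (k + j)⌋ / 2 ^ (k + j) := by
    rw [div_le_div_iff₀ h (by positivity), pow_add]
    have : ((⌊y * 2 ^ k⌋ : ℝ)) * 2 ^ j ≤ ⌊z * 2 ^ (k + j)⌋ := by exact_mod_cast h1
    rw [pow_add] at this
    nlinarith
  have h3 : (1 : ℝ) / 2 ^ (k + j) ≤ 1 / 2 ^ k :=
    one_div_le_one_div_of_le h (pow_le_pow_right₀ (by norm_num) hkl)
  unfold below
  linarith

/-- Every continuous function is represented by an interval function. -/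
theorem exists_isFunName (f : C(unitInterval, ℝ)) : ∃ ψ, IsFunName ψ f := by
  let S : DyadicInterval → Set ℝ := fun J => f '' {t | (t : ℝ) ∈ ID.toSet (some J)}
  let k : DyadicInterval → ℕ := fun J => ⌊1 / J.rad⌋₊
  have hb : ∀ J, BddBelow (S J) := fun J =>
    ⟨-‖f‖, by rintro _ ⟨t, -, rfl⟩; exact (abs_le.1 (f.norm_coe_le_norm t)).1⟩
  have ha : ∀ J, BddAbove (S J) := fun J =>
    ⟨‖f‖, by rintro _ ⟨t, -, rfl⟩; exact (abs_le.1 (f.norm_coe_le_norm t)).2⟩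
  have key : ∀ J : DyadicInterval, ∃ K : ID, (S J).Nonempty → ∃ K', K = some K' ∧
      K'.mid - K'.rad = below (sInf (S J)) (k J) ∧
      K'.mid + K'.rad = -below (-sSup (S J)) (k J) := by
    intro J
    by_cases hne : (S J).Nonempty
    · have h1 := (below_bounds (sInf (S J)) (k J)).1
      have h2 := (below_bounds (-sSup (S J)) (k J)).1
      have h3 := (csInf_le (hb J) hne.some_mem).trans (le_csSup (ha J) hne.some_mem)
      have d1 := below_dyadic (sInf (S J)) (k J)
      have d2 := (below_dyadic (-sSup (S J)) (k J)).neg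
      refine ⟨some ⟨(below (sInf (S J)) (k J) + -below (-sSup (S J)) (k J)) / 2,
        (-below (-sSup (S J)) (k J) - below (sInf (S J)) (k J)) / 2,
        (d1.add d2).half, (d2.sub d1).half, by linarith⟩, fun _ => ⟨_, rfl, ?_, ?_⟩⟩
      · ring
      · ring
    · exact ⟨none, fun h => absurd h hne⟩
  choose K hK using key
  let ψ : ID → ID := fun J => J.elim none K
  refine ⟨ψ, fun φ x hφ => ?_⟩
  have hmem : ∀ J : DyadicInterval, (x : ℝ) ∈ ID.toSet (some J) → f x ∈ S J :=
    fun J h => ⟨x, h, rfl⟩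
  refine isRealName_of_small ?_ ?_ ?_
  · intro n
    have hx := hφ.mem (n + 1)
    have hs := hφ.1 n
    cases hJ : φ n with
    | none => simp [ψ, hJ, ID.toSet]
    | some J =>
      rw [hJ] at hs
      cases hJ' : φ (n + 1) with
      | none =>
        rw [hJ'] at hs
        have := hs (Set.mem_univ (J.mid + J.rad + 1))
        simp only [ID.toSet, Set.mem_Icc] at this
        linarith [this.2]
      | some J' =>
        rw [hJ'] at hs hx
        have hx' := hs hx
        obtain ⟨A, hA, hA1, hA2⟩ := hK J ⟨_, hmem J hx'⟩
        obtain ⟨B, hB, hB1, hB2⟩ := hK J' ⟨_, hmem J' hx⟩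
        have hsub : S J' ⊆ S J := Set.image_mono fun t ht => hs ht
        have hr : J'.rad ≤ J.rad := by
          have hp := J'.rad_pos
          have m1 := hs (show J'.mid - J'.rad ∈ ID.toSet (some J') from ⟨le_rfl, by linarith⟩)
          have m2 := hs (show J'.mid + J'.rad ∈ ID.toSet (some J') from ⟨by linarith, le_rfl⟩)
          simp only [ID.toSet, Set.mem_Icc] at m1 m2
          linarith [m1.1, m2.2]
        have hk : k J ≤ k J' := Nat.floor_mono (one_div_le_one_div_of_le J'.rad_pos hr)
        have g1 := below_mono (csInf_le_csInf (hb J) ⟨_, hmem J' hx⟩ hsub) hk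
        have g2 := below_mono (neg_le_neg (csSup_le_csSup (ha J) ⟨_, hmem J' hx⟩ hsub)) hk
        simp only [Function.comp, hJ, hJ', ψ, Option.elim, hA, hB, ID.toSet]
        exact Set.Icc_subset_Icc (by linarith) (by linarith)
  · intro n
    have hx := hφ.mem n
    cases hJ : φ n with
    | none => simp [ψ, hJ, ID.toSet]
    | some J =>
      rw [hJ] at hx
      obtain ⟨A, hA, hA1, hA2⟩ := hK J ⟨_, hmem J hx⟩
      have h1 := (below_bounds (sInf (S J)) (k J)).1
      have h2 := (below_bounds (-sSup (S J)) (k J)).1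
      have h3 := csInf_le (hb J) (hmem J hx)
      have h4 := le_csSup (ha J) (hmem J hx)
      simp only [Function.comp, hJ, ψ, Option.elim, hA, ID.toSet, Set.mem_Icc]
      constructor <;> linarith
  · intro δ hδ
    obtain ⟨η, hη, hf⟩ := Metric.continuousAt_iff.1 (f.continuous.continuousAt (x := x)) (δ / 4)
      (by positivity)
    obtain ⟨m, hm⟩ := exists_pow_lt_of_lt_one (show 0 < δ / 8 by positivity)
      (by norm_num : (2⁻¹ : ℝ) < 1)
    obtain ⟨n, J, hJ, hr⟩ := hφ.small (δ := min (η / 2) (1 / (m + 1))) (by positivity)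
    have hx := hφ.mem n
    rw [hJ] at hx
    obtain ⟨A, hA, hA1, hA2⟩ := hK J ⟨_, hmem J hx⟩
    refine ⟨n, A, by simp [Function.comp, hJ, ψ, hA], ?_⟩
    have hk : m ≤ k J := by
      apply Nat.le_floor
      rw [le_div_iff₀ J.rad_pos]
      have := (hr.trans_le (min_le_right _ _)).le
      rw [le_div_iff₀ (by positivity)] at this
      nlinarith [J.rad_pos]
    have hk' : (2 : ℝ) / 2 ^ k J < δ / 4 := by
      have : (2⁻¹ : ℝ) ^ k J ≤ 2⁻¹ ^ m := pow_le_pow_of_le_one (by norm_num) (by norm_num) hk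
      rw [inv_pow, inv_pow] at this
      rw [inv_pow] at hm
      rw [div_eq_mul_inv]
      linarith
    have hnear : ∀ y ∈ S J, |y - f x| ≤ δ / 4 := by
      rintro _ ⟨t, ht, rfl⟩
      have htx : dist t x < η := by
        have := hr.trans_le (min_le_left _ _)
        have ht' : (t : ℝ) ∈ ID.toSet (some J) := ht
        simp only [ID.toSet, Set.mem_Icc] at ht' hx
        rw [Subtype.dist_eq, Real.dist_eq, abs_lt]
        constructor <;> linarith
      exact (hf htx).le
    have h1 := (below_bounds (sInf (S J)) (k J)).2
    have h2 := (below_bounds (-sSup (S J)) (k J)).2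
    have h3 : f x - δ / 4 ≤ sInf (S J) :=
      le_csInf ⟨_, hmem J hx⟩ fun y hy => by linarith [(abs_le.1 (hnear y hy)).1]
    have h4 : sSup (S J) ≤ f x + δ / 4 :=
      csSup_le ⟨_, hmem J hx⟩ fun y hy => by linarith [(abs_le.1 (hnear y hy)).2]
    linarith

/-! ### The spaces of interval reals and of interval functions -/

/-- The parametrised space of interval reals. -/
noncomputable def intervalReals : ParamRep ℝ where
  rep χ := ⟨∃ p : (ℕ → ID) × ℝ, EncodesSeq χ p.1 ∧ IsRealName p.1 p.2, fun h => h.choose.2⟩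
  surj x := by
    obtain ⟨χ, hχ⟩ := exists_encodesSeq fun n => some (around x n)
    have h : ∃ p : (ℕ → ID) × ℝ, EncodesSeq χ p.1 ∧ IsRealName p.1 p.2 :=
      ⟨(_, x), hχ, isRealName_around x⟩
    refine ⟨χ, h, ?_⟩
    have he : h.choose.1 = fun n => some (around x n) :=
      funext fun n => intervalCode_unique (h.choose_spec.1 n) (hχ n)
    have hn := h.choose_spec.2
    rw [he] at hn
    exact hn.unique (isRealName_around x)
  param χ n := rate χ.2.choose.1 n + ⌈Real.logb 2 (|χ.2.choose.2| + 1)⌉₊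
  mono χ _ _ h := Nat.add_le_add_right (rate_mono χ.2.choose_spec.2 h) _

/-- The unit interval as a subspace of the interval reals. -/
noncomputable def intervalUnit : ParamRep unitInterval := intervalReals.restrict unitInterval

/-- The parametrised space of interval functions. -/
noncomputable def intervalFunctions : ParamRep C(unitInterval, ℝ) where
  rep χ := ⟨∃ p : (ID → ID) × C(unitInterval, ℝ), EncodesFun χ p.1 ∧ IsFunName p.1 p.2,
    fun h => h.choose.2⟩
  surj f := by
    obtain ⟨ψ, hψ⟩ := exists_isFunName f
    obtain ⟨χ, hχ⟩ := exists_encodesFun ψ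
    have h : ∃ p : (ID → ID) × C(unitInterval, ℝ), EncodesFun χ p.1 ∧ IsFunName p.1 p.2 :=
      ⟨(ψ, f), hχ, hψ⟩
    refine ⟨χ, h, ?_⟩
    have he : h.choose.1 = ψ := funext fun J => by
      obtain ⟨a, ha⟩ := exists_intervalCode J
      exact intervalCode_unique (h.choose_spec.1 J a ha) (hχ J a ha)
    have hn := h.choose_spec.2
    rw [he] at hn
    exact hn.unique hψ
  param χ n := modulus χ.2.choose.1 n + ⌈Real.logb 2 (‖χ.2.choose.2‖ + 1)⌉₊
  mono χ _ _ h := Nat.add_le_add_right (modulus_mono χ.2.choose_spec.2 h) _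

/-- Evaluation `C([0, 1]) × [0, 1] → ℝ` is polytime computable with respect to the given
parametrised representation of `C([0, 1])`. -/
def EvalPolytime (R : ParamRep C(unitInterval, ℝ)) : Prop :=
  PolytimeComputable (R.prod intervalUnit) intervalReals fun p => p.1 p.2

end ParamSpace

/-!
Every machine below is obtained from a structured program on stacks, which is compiled to an oracle
machine with linear overhead (`Prog.mach`, `mach_run`). One of these programs simulates a given
oracle machine step by step while another program answers its queries (`sim`, `run_sim`).

*From interval functions to evaluation.* A sequence of intervals that shrinks to a real number is
turned into a sequence of *records*, a dyadic approximation together with a grade, where a record is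
updated only by an interval that is short enough to raise the grade by one (`stepRec`, `recs`). The
interval emitted for a record depends on the record alone and shrinks with the grade
(`approx_subset`), and the length of its code is controlled by the grade. Given names of `f` and `x`,
the machine turns the name of `x` into records, asks an interval function that represents `f` for its
value on the interval of each record, and emits the records of these values (`evalPolytime_of`). The
number of rounds is the length of the input, so time and rate do not require knowledge of the
parameter. The interval function is either given (`evalPolytime_intervalFunctions`), or computed by
simulating a translation (`evalPolytime_of_translatable`).

*From evaluation to interval functions.* Let `M` evaluate, in time `P` and with the bound `Q` for the
parameter of the result. The value of the interval function on `J` has to be independent of the code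
of `J`, monotone in `J`, and computable in polynomial time although neither the parameter of the name
of `f` nor a modulus of `f` is known. The interval `J` lies in cells of dyadic grids. Two grids are
used, one of them shifted by a third, so that a short interval lies in a small cell of one of them
(`exists_inCell`). The address of the smallest cell around `J` is the common prefix of the binary
digits of the shifted endpoints (`cellOf`), it depends only on `J`, and it gets longer as `J` shrinks
(`IsCell.prefix`).

Each prefix of the address is a *level*. On a level, `M` is run on the given name of `f` and on a
canonical name `nu X` of a binary fraction `0.X` near the cell, where `X` has as many digits as the
prefix. These are genuine names, and the parameter of `nu X` is bounded independently of `X`, so every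
such run ends in polynomial time, and no clock is needed (`Witness.halted`). If the run asks only for
approximations to `0.X` that are coarser than the cell, then the same run occurs for suitable names of
all other points of the cell (`exists_splice`, `OracleMachine.conf_congr`). The result then contains
all values of `f` on the cell, and the level is good; other levels are ignored. Going along the
prefixes, the record is updated by the results of the good levels, where the index with which `M` is
run is the number of good levels so far (`chain`). The record for `J` is thus an initial part of the
process for any smaller interval, which yields monotonicity (`Levels.funID_subset`). Since `M`
cannot ask for more digits than it has time to write, all long prefixes are good, and the modulus of
the interval function is polynomial in the parameter (`Levels.modulus_le`). For each of the two
grids there is a record, and the one of larger grade is emitted (`sel`). The radii emitted for the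
two grids differ, so that this choice preserves monotonicity.
-/

set_option linter.unusedSimpArgs false

namespace ParamSpace

/-! ### Stack programs -/

/-- Stack symbols: the possible contents of a tape cell, blanks included. -/
abbrev Cell := Option Sym

/-- The stacks of a program: the query stack, the output stack, the answer stack, and finitely many
registers. The bottom of the query and of the output stack is cell `0` of the corresponding tape.
The answer stack is virtual: after an oracle call it holds the whole answer, whose first symbol is
on top. -/
inductive Stk (K : Type) where
  | qry
  | out
  | ans
  | reg (k : K)

noncomputable instance (K : Type) : DecidableEq (Stk K) := Classical.decEq _

/-- Push a symbol, if there is one. -/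
def pushO : Option Cell → List Cell → List Cell
  | none, s => s
  | some g, s => g :: s

/-- What an instruction does to one stack: it may pop the top symbol, and then pushes up to three
symbols, `p1` first. -/
structure Op where
  pop : Bool
  p1 : Option Cell
  p2 : Option Cell
  p3 : Option Cell

namespace Op

/-- The effect on the stack. -/
def ap (o : Op) (s : List Cell) : List Cell :=
  pushO o.p3 (pushO o.p2 (pushO o.p1 (if o.pop then s.tail else s)))

/-- The symbol that is pushed in round `j`. -/
def sel (o : Op) : Fin 3 → Option Cell
  | 0 => o.p1
  | 1 => o.p2
  | 2 => o.p3

end Op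

/-- What an instruction sees: the finite datum, the tops of all stacks, the next input symbol. -/
structure View (D K : Type) where
  d : D
  top : Stk K → Option Cell
  inp : Option Sym

/-- What an instruction does: the new datum, the stack operations, and whether the next input symbol
is consumed. -/
structure Res (D K : Type) where
  d : D
  op : Stk K → Op
  rd : Bool

/-- States of a stack program: a datum of a finite type, the stacks (top first), and the part of the
input that has not been read. -/
@[ext] structure St (D K : Type) where
  d : D
  stk : Stk K → List Cell
  inp : Str

/-- A tape that holds the stack `s` with its bottom in cell `0` and the head on its top. -/
def stkT (s : List Cell) : Tape where
  cell i := if 0 ≤ i then (s.reverse[i.toNat]?).join else none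
  head := s.length - 1

namespace St

variable {D K : Type}

/-- The part of a state that an instruction sees. -/
def view (σ : St D K) : View D K := ⟨σ.d, fun i => (σ.stk i).head?, σ.inp.head?⟩

/-- The state after the effects `r` of an instruction. -/
def app (σ : St D K) (r : Res D K) : St D K :=
  ⟨r.d, fun i => (r.op i).ap (σ.stk i), if r.rd then σ.inp.tail else σ.inp⟩

/-- The state after the stacks in `S` have been emptied. -/
def clr (σ : St D K) (S : Stk K → Bool) : St D K :=
  ⟨σ.d, fun i => if S i then [] else σ.stk i, σ.inp⟩

/-- The state after an oracle call: the answer replaces the answer stack. The question is the content of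
the tape that holds the query stack, that is, it ends at the first blank above the bottom. -/
noncomputable def ask (φ : Baire) (σ : St D K) : St D K :=
  ⟨σ.d, Function.update σ.stk .ans ((φ (stkT (σ.stk .qry)).content).map some), σ.inp⟩

end St

/-- Structured stack programs over oracle calls. -/
inductive Prog (D K : Type) : Type where
  | act (f : View D K → Res D K)
  | clear (S : Stk K → Bool)
  | call
  | seq (a b : Prog D K)
  | ite (p : View D K → Bool) (a b : Prog D K)
  | loop (p : View D K → Bool) (a : Prog D K)

/-- Big-step semantics: with oracle `φ` the program takes `σ` to `σ'` in `t` steps. Emptying any set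
of stacks counts as one step, which is justified by amortisation. -/
inductive Exec {D K : Type} (φ : Baire) : Prog D K → St D K → ℕ → St D K → Prop
  | act (f σ) : Exec φ (.act f) σ 1 (σ.app (f σ.view))
  | clear (S σ) : Exec φ (.clear S) σ 1 (σ.clr S)
  | call (σ) : Exec φ .call σ 1 (σ.ask φ)
  | seq {a b σ σ₁ σ₂ t t'} : Exec φ a σ t σ₁ → Exec φ b σ₁ t' σ₂ → Exec φ (.seq a b) σ (t + t') σ₂
  | ite_true {p a b σ t σ'} : p σ.view = true → Exec φ a σ t σ' → Exec φ (.ite p a b) σ (t + 1) σ'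
  | ite_false {p a b σ t σ'} : p σ.view = false → Exec φ b σ t σ' →
      Exec φ (.ite p a b) σ (t + 1) σ'
  | loop_false {p a σ} : p σ.view = false → Exec φ (.loop p a) σ 1 σ
  | loop_true {p a σ t σ₁ t' σ₂} : p σ.view = true → Exec φ a σ t σ₁ →
      Exec φ (.loop p a) σ₁ t' σ₂ → Exec φ (.loop p a) σ (t + t' + 1) σ₂

/-! ### Flow charts -/

/-- The instruction at a label `L` of a flow chart, with the label of the next instruction (`none` at
the end of the program). -/
inductive Node (D K L : Type) where
  | act (f : View D K → Res D K × Option L)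
  | clear (S : Stk K → Bool) (n : Option L)
  | call (n : Option L)

namespace Node

variable {D K L L' : Type}

/-- Rename the labels of the successors. -/
def map (g : Option L → Option L') : Node D K L → Node D K L'
  | act f => act fun v => ((f v).1, g (f v).2)
  | clear S n => clear S (g n)
  | call n => call (g n)

/-- One step of a flow chart: the next label and the new state. -/
noncomputable def step (φ : Baire) (σ : St D K) : Node D K L → Option L × St D K
  | act f => ((f σ.view).2, σ.app (f σ.view).1)
  | clear S n => (n, σ.clr S)
  | call n => (n, σ.ask φ)

theorem step_map (φ : Baire) (σ : St D K) (g : Option L → Option L') (n : Node D K L) :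
    (n.map g).step φ σ = (g (n.step φ σ).1, (n.step φ σ).2) := by
  cases n <;> rfl

end Node

/-- Runs of a flow chart. -/
inductive Steps {D K L : Type} (nd : L → Node D K L) (φ : Baire) :
    ℕ → Option L × St D K → Option L × St D K → Prop
  | refl (x) : Steps nd φ 0 x x
  | step {n l σ y} : Steps nd φ n ((nd l).step φ σ) y → Steps nd φ (n + 1) (some l, σ) y

theorem Steps.trans {D K L : Type} {nd : L → Node D K L} {φ : Baire} {n m : ℕ}
    {x y z : Option L × St D K} (h : Steps nd φ n x y) (h' : Steps nd φ m y z) :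
    Steps nd φ (n + m) x z := by
  induction h with
  | refl => simpa using h'
  | step _ ih => rw [Nat.add_right_comm]; exact (ih h').step

theorem Steps.lift {D K L L' : Type} {nd : L → Node D K L} {nd' : L' → Node D K L'} {φ : Baire}
    (g : Option L → Option L') (e : L → L') (hg : ∀ l, g (some l) = some (e l))
    (hn : ∀ l, nd' (e l) = (nd l).map g) {n : ℕ} {x y : Option L × St D K}
    (h : Steps nd φ n x y) : Steps nd' φ n (g x.1, x.2) (g y.1, y.2) := by
  induction h with
  | refl => exact .refl _
  | @step n l σ y _ ih =>
    rw [hg]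
    refine .step ?_
    rw [hn, Node.step_map]
    exact ih

namespace Prog

variable {D K : Type}

/-- The instruction without effect. -/
def idRes (v : View D K) : Res D K := ⟨v.d, fun _ => ⟨false, none, none, none⟩, false⟩

/-- The labels of the flow chart of a program. -/
def Lab : Prog D K → Type
  | act _ => Unit
  | clear _ => Unit
  | call => Unit
  | seq a b => a.Lab ⊕ b.Lab
  | ite _ a b => Option (a.Lab ⊕ b.Lab)
  | loop _ a => Option a.Lab

theorem finite_lab (c : Prog D K) : Finite c.Lab := by
  induction c with
  | act | clear | call => exact inferInstanceAs (Finite Unit)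
  | seq a b iha ihb => exact inferInstanceAs (Finite (a.Lab ⊕ b.Lab))
  | ite p a b iha ihb => exact inferInstanceAs (Finite (Option (a.Lab ⊕ b.Lab)))
  | loop p a ih => exact inferInstanceAs (Finite (Option a.Lab))

/-- The label at which a program starts. -/
def entry : (c : Prog D K) → c.Lab
  | act _ => ()
  | clear _ => ()
  | call => ()
  | seq a _ => Sum.inl a.entry
  | ite _ _ _ => none
  | loop _ _ => none

/-- The flow chart of a program. -/
def node : (c : Prog D K) → c.Lab → Node D K c.Lab
  | act f, _ => .act fun v => (f v, none)
  | clear S, _ => .clear S none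
  | call, _ => .call none
  | seq a b, Sum.inl l =>
    (a.node l).map fun o => some (o.elim (Sum.inr b.entry) Sum.inl)
  | seq _ b, Sum.inr l => (b.node l).map (Option.map Sum.inr)
  | ite p a b, none => .act fun v =>
    (idRes v, some (some (if p v then Sum.inl a.entry else Sum.inr b.entry)))
  | ite _ a _, some (Sum.inl l) => (a.node l).map (Option.map fun l => some (Sum.inl l))
  | ite _ _ b, some (Sum.inr l) => (b.node l).map (Option.map fun l => some (Sum.inr l))
  | loop p a, none => .act fun v => (idRes v, if p v then some (some a.entry) else none)
  | loop _ a, some l => (a.node l).map some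

theorem steps_of_exec {φ : Baire} {c : Prog D K} {σ σ' : St D K} {t : ℕ} (h : Exec φ c σ t σ') :
    Steps c.node φ t (some c.entry, σ) (none, σ') := by
  induction h with
  | act f σ => exact .step (.refl _)
  | clear S σ => exact .step (.refl _)
  | call σ => exact .step (.refl _)
  | @seq a b σ σ₁ σ₂ t t' _ _ iha ihb =>
    have h1 := iha.lift (nd' := (seq a b).node)
      (fun o => some (o.elim (Sum.inr b.entry) Sum.inl)) Sum.inl (fun _ => rfl) (fun _ => rfl)
    have h2 := ihb.lift (nd' := (seq a b).node) (Option.map Sum.inr) Sum.inr (fun _ => rfl)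
      (fun _ => rfl)
    exact h1.trans h2
  | @ite_true p a b σ t σ' hp _ ih =>
    have h1 := ih.lift (nd' := (ite p a b).node) (Option.map fun l => some (Sum.inl l))
      (fun l => some (Sum.inl l)) (fun _ => rfl) (fun _ => rfl)
    refine .step ?_
    have e : ((ite p a b).node (ite p a b).entry).step φ σ =
        (some (some (if p σ.view then Sum.inl a.entry else Sum.inr b.entry)), σ) := rfl
    rw [e, hp]
    exact h1
  | @ite_false p a b σ t σ' hp _ ih =>
    have h1 := ih.lift (nd' := (ite p a b).node) (Option.map fun l => some (Sum.inr l))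
      (fun l => some (Sum.inr l)) (fun _ => rfl) (fun _ => rfl)
    refine .step ?_
    have e : ((ite p a b).node (ite p a b).entry).step φ σ =
        (some (some (if p σ.view then Sum.inl a.entry else Sum.inr b.entry)), σ) := rfl
    rw [e, hp]
    exact h1
  | @loop_false p a σ hp =>
    refine .step ?_
    have e : ((loop p a).node (loop p a).entry).step φ σ =
        (if p σ.view then some (some a.entry) else none, σ) := rfl
    rw [e, hp]
    exact .refl _
  | @loop_true p a σ t σ₁ t' σ₂ hp _ _ iha ihb =>
    have h1 := iha.lift (nd' := (loop p a).node) some some (fun _ => rfl) (fun _ => rfl)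
    refine .step ?_
    have h2 := h1.trans ihb
    have e : ((loop p a).node (loop p a).entry).step φ σ =
        (if p σ.view then some (some a.entry) else none, σ) := rfl
    rw [e, hp]
    exact h2

end Prog

/-! ### Tapes that hold stacks -/

namespace Tape

/-- The scanned symbol. -/
def read (T : Tape) : Cell := T.cell T.head

theorem act_same (T : Tape) (d : Dir) : T.act T.read d = ⟨T.cell, T.head + d.offset⟩ := by
  simp [act, read]

theorem act_stay (T : Tape) : T.act T.read .stay = T := by
  simp [act_same, Dir.offset]

theorem act_left (T : Tape) : T.act T.read .left = ⟨T.cell, T.head - 1⟩ := act_same T _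

theorem act_right (T : Tape) : T.act T.read .right = ⟨T.cell, T.head + 1⟩ := act_same T _

/-- A sufficient condition for the content of a tape. -/
theorem content_eq {T : Tape} {q : Str} (h : ∀ i : ℕ, i < q.length → T.cell i = q[i]?)
    (h' : T.cell q.length = none) : T.content = q := by
  have hs : sInf {n : ℕ | T.cell n = none} = q.length := by
    apply le_antisymm
    · exact Nat.sInf_le h'
    · refine le_csInf ⟨_, h'⟩ fun n hn => ?_
      by_contra hlt
      push Not at hlt
      have h1 := h n hlt
      have hn : T.cell n = none := hn
      rw [hn, List.getElem?_eq_getElem hlt] at h1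
      exact absurd h1 (by simp)
  rw [content, hs]
  clear hs h'
  induction q using List.reverseRecOn with
  | nil => simp
  | append_singleton q a ih =>
    rw [List.length_append, List.length_singleton, List.range_succ, List.filterMap_append, ih]
    · have := h q.length (by simp)
      simp [this]
    · intro i hi
      rw [h i (by simp; omega), List.getElem?_append_left hi]

end Tape

theorem stkT_read (s : List Cell) : (stkT s).read = s.head?.join := by
  cases s with
  | nil => simp [Tape.read, stkT]
  | cons x s => simp [Tape.read, stkT]

theorem stkT_pop (x : Cell) (s : List Cell) : (stkT (x :: s)).act none .left = stkT s := by
  simp only [Tape.act, stkT, Dir.offset, List.length_cons, Tape.mk.injEq]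
  refine ⟨?_, by push_cast; ring⟩
  funext i
  simp only [Function.update_apply]
  split_ifs with h1 h2 h2
  · subst h1; simp
  · rfl
  · have : i.toNat ≠ s.length := by push_cast at h1; omega
    rcases lt_or_gt_of_ne this with hl | hl
    · rw [List.reverse_cons, List.getElem?_append_left (by simpa using hl)]
    · rw [List.getElem?_eq_none (by simp; omega), List.getElem?_eq_none (by simp; omega)]
  · rfl

theorem stkT_push (g : Cell) (s : List Cell) :
    ((stkT s).act (stkT s).read .right).act g .stay = stkT (g :: s) := by
  rw [Tape.act_same]
  simp only [Tape.act, stkT, Dir.offset, List.length_cons, Tape.mk.injEq]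
  refine ⟨?_, by push_cast; ring⟩
  funext i
  simp only [Function.update_apply]
  split_ifs with h1 h2 h2
  · subst h1; simp
  · omega
  · have : i.toNat ≠ s.length := by omega
    rcases lt_or_gt_of_ne this with hl | hl
    · rw [List.reverse_cons, List.getElem?_append_left (by simpa using hl)]
    · rw [List.getElem?_eq_none (by simp; omega), List.getElem?_eq_none (by simp; omega)]
  · rfl

theorem stkT_content (q : Str) : (stkT (q.map some).reverse).content = q := by
  apply Tape.content_eq
  · intro i hi
    simp [stkT, hi]
  · simp [stkT]

theorem stkT_nil : stkT [] = ⟨fun _ => none, -1⟩ := by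
  simp [stkT]

/-! ### The oracle machine of a stack program -/

/-- The phases of the machine at a label: moving the heads to the top of the empty stacks, reading,
pushing in three rounds of moving and writing, rewinding the answer tape, emptying stacks, and asking
the oracle. -/
inductive PC (K : Type) where
  | init
  | at
  | mov (j : Fin 3) (o : Stk K → Op)
  | wrt (j : Fin 3) (o : Stk K → Op)
  | rew0
  | rew1
  | del
  | ask

/-- Elementary actions on a stack. -/
inductive SA where
  | keep
  | pop
  | mov
  | bak
  | wrt (g : Cell)

namespace SA

/-- The action on the tape that holds the symbols. -/
def val : SA → Cell → Cell × Dir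
  | keep, s => (s, .stay)
  | pop, _ => (none, .left)
  | mov, s => (s, .right)
  | bak, s => (s, .left)
  | wrt g, _ => (g, .stay)

/-- The action on the tape that marks the used cells. -/
def mark : SA → Cell → Cell × Dir
  | keep, s => (s, .stay)
  | pop, _ => (none, .left)
  | mov, s => (s, .right)
  | bak, s => (s, .left)
  | wrt _, _ => (some .one, .stay)

end SA

/-- The work tapes of the machine: for each stack `i`, the tape `(i, false)` holds its symbols and the
tape `(i, true)` marks the cells in use, since a stack may hold blanks. The query and the output stack
are mirrored on the query and the output tape. -/
abbrev Wk (K : Type) := Stk K × Bool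

section Tapes

variable {K : Type}

/-- All tapes of the machine. -/
def tapesOf (V P : Stk K → Tape) (I A : Tape) : TapeIx (Wk K) → Tape
  | .input => I
  | .answer => A
  | .query => V .qry
  | .output => V .out
  | .work (i, false) => V i
  | .work (i, true) => P i

/-- The action on all tapes. -/
def tapeAct (sc : TapeIx (Wk K) → Option Sym) (a : Stk K → SA) (di da : Dir) :
    TapeIx (Wk K) → Option Sym × Dir
  | .input => (sc .input, di)
  | .answer => (sc .answer, da)
  | .query => (a .qry).val (sc .query)
  | .output => (a .out).val (sc .output)
  | .work (i, false) => (a i).val (sc (.work (i, false)))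
  | .work (i, true) => (a i).mark (sc (.work (i, true)))

/-- The tape of symbols after an action. -/
def SA.doVal (a : SA) (T : Tape) : Tape := T.act (a.val T.read).1 (a.val T.read).2

/-- The tape of marks after an action. -/
def SA.doMark (a : SA) (T : Tape) : Tape := T.act (a.mark T.read).1 (a.mark T.read).2

/-- The scanned symbols. -/
def scan {W : Type} (T : TapeIx W → Tape) : TapeIx W → Option Sym := fun i => (T i).read

theorem act_tapesOf (V P : Stk K → Tape) (I A : Tape) (a : Stk K → SA) (di da : Dir) :
    (fun i => (tapesOf V P I A i).act (tapeAct (scan (tapesOf V P I A)) a di da i).1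
      (tapeAct (scan (tapesOf V P I A)) a di da i).2) =
    tapesOf (fun i => (a i).doVal (V i)) (fun i => (a i).doMark (P i)) (I.act I.read di)
      (A.act A.read da) := by
  funext i
  rcases i with _ | _ | _ | _ | ⟨i, _ | _⟩ <;> rfl

end Tapes

section Machine

variable {D K : Type}

/-- The view of the scanned symbols; the top of the answer stack is read from the answer tape if the
oracle has been called (`lv`) and nothing lies above the answer. -/
def vw (d : D) (lv : Bool) (sc : TapeIx (Wk K) → Option Sym) : View D K where
  d := d
  top i := if (sc (.work (i, true))).isSome then some (sc (.work (i, false))) else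
    match i, lv with
    | .ans, true => (sc .answer).map some
    | _, _ => none
  inp := sc .input

/-- The states of the machine of a stack program: the label (`none` after the program has ended), the
finite datum, whether the rest of the answer tape belongs to the answer stack, below the symbols on
its work tape, and the phase. -/
abbrev MState (D K L : Type) := Option L × D × Bool × PC K

/-- The action on stack `i` in the first step of an instruction. -/
def popAct (r : Res D K) (sc : TapeIx (Wk K) → Option Sym) (i : Stk K) : SA :=
  if (r.op i).pop = true ∧ (sc (.work (i, true))).isSome = true then .pop else .keep

/-- The move of the head on the answer tape: a symbol is popped from there if the answer stack has
no symbols of its own. -/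
def ansDir (r : Res D K) (lv : Bool) (sc : TapeIx (Wk K) → Option Sym) : Dir :=
  if (r.op .ans).pop = true ∧ (sc (.work (.ans, true))).isSome = false ∧ lv = true ∧
    (sc .answer).isSome = true then .right else .stay

/-- In round `j` of pushing, move the head if a symbol is to be pushed. -/
def movAct (j : Fin 3) (o : Stk K → Op) (i : Stk K) : SA :=
  if ((o i).sel j).isSome then .mov else .keep

/-- In round `j` of pushing, write the symbol if there is one. -/
def wrtAct (j : Fin 3) (o : Stk K → Op) (i : Stk K) : SA :=
  match (o i).sel j with
  | some g => .wrt g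
  | none => .keep

/-- The phase after round `j` of pushing. -/
def wrtNext (o : Stk K → Op) : Fin 3 → PC K
  | 0 => .mov 1 o
  | 1 => .mov 2 o
  | 2 => .at

/-- The stacks that are to be emptied at a label. -/
noncomputable def delSet {L : Type} : Node D K L → Stk K → Bool
  | .act _ => fun _ => false
  | .clear S _ => S
  | .call _ => fun i => decide (i = .ans)

/-- The state after the stacks have been emptied. -/
def delNext {L : Type} (l : L) (d : D) (lv : Bool) : Node D K L → MState D K L
  | .act _ => (none, d, lv, .at)
  | .clear S n => (n, d, if S .ans then false else lv, .at)
  | .call _ => (some l, d, lv, .ask)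

open Classical in
/-- The transition function of the machine. -/
noncomputable def mtrans {L : Type} (node : L → Node D K L) (q : MState D K L)
    (sc : TapeIx (Wk K) → Option Sym) :
    Option (MState D K L × (TapeIx (Wk K) → Option Sym × Dir)) :=
  match q with
  | (l, d, lv, .init) => some ((l, d, lv, .at), tapeAct sc (fun _ => .bak) .stay .stay)
  | (l, d, lv, .mov j o) => some ((l, d, lv, .wrt j o), tapeAct sc (movAct j o) .stay .stay)
  | (l, d, lv, .wrt j o) => some ((l, d, lv, wrtNext o j), tapeAct sc (wrtAct j o) .stay .stay)
  | (none, _, _, _) => none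
  | (some l, d, lv, .at) =>
    match node l with
    | .act f => some (((f (vw d lv sc)).2, (f (vw d lv sc)).1.d, lv, .mov 0 (f (vw d lv sc)).1.op),
        tapeAct sc (popAct (f (vw d lv sc)).1 sc) (if (f (vw d lv sc)).1.rd then .right else .stay)
          (ansDir (f (vw d lv sc)).1 lv sc))
    | .clear S _ => some ((some l, d, lv, if S .ans then .rew0 else .del),
        tapeAct sc (fun _ => .keep) .stay .stay)
    | .call _ => some ((some l, d, lv, .rew0), tapeAct sc (fun _ => .keep) .stay .stay)
  | (some l, d, lv, .rew0) => some ((some l, d, lv, .rew1),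
      tapeAct sc (fun _ => .keep) .stay .left)
  | (some l, d, lv, .rew1) =>
    if (sc .answer).isSome then
      some ((some l, d, lv, .rew1), tapeAct sc (fun _ => .keep) .stay .left)
    else some ((some l, d, lv, .del), tapeAct sc (fun _ => .keep) .stay .right)
  | (some l, d, lv, .del) =>
    if ∃ i, delSet (node l) i = true ∧ (sc (.work (i, true))).isSome = true then
      some ((some l, d, lv, .del), tapeAct sc (fun i =>
        if delSet (node l) i = true ∧ (sc (.work (i, true))).isSome = true then .pop else .keep)
        .stay .stay)
    else some (delNext l d lv (node l), tapeAct sc (fun _ => .keep) .stay .stay)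
  | (some _, _, _, .ask) => none

/-- The oracle states of the machine and their successors. -/
def moracle {L : Type} (node : L → Node D K L) : MState D K L → Option (MState D K L)
  | (some l, d, _, .ask) =>
    match node l with
    | .call n => some (n, d, true, .at)
    | _ => none
  | _ => none

instance : Finite Sym := by
  refine Finite.of_surjective (α := Fin 3) (fun i => match i with
    | 0 => Sym.zero | 1 => Sym.one | 2 => Sym.sep) fun s => ?_
  cases s
  · exact ⟨0, rfl⟩
  · exact ⟨1, rfl⟩
  · exact ⟨2, rfl⟩

instance : Finite Op :=
  Finite.of_injective (fun o : Op => (o.pop, o.p1, o.p2, o.p3)) fun a b h => by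
    cases a; cases b; simpa using h

instance [Finite K] : Finite (Stk K) :=
  Finite.of_surjective (α := Fin 3 ⊕ K) (fun x => match x with
    | .inl 0 => Stk.qry | .inl 1 => Stk.out | .inl 2 => Stk.ans | .inr k => Stk.reg k) fun s => by
    rcases s with _ | _ | _ | k
    · exact ⟨.inl 0, rfl⟩
    · exact ⟨.inl 1, rfl⟩
    · exact ⟨.inl 2, rfl⟩
    · exact ⟨.inr k, rfl⟩

instance [Finite K] : Finite (PC K) :=
  Finite.of_surjective (α := Fin 6 ⊕ (Bool × Fin 3 × (Stk K → Op))) (fun x => match x with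
    | .inl 0 => PC.init | .inl 1 => PC.at | .inl 2 => .rew0 | .inl 3 => .rew1 | .inl 4 => .del
    | .inl 5 => .ask | .inr (false, j, o) => .mov j o | .inr (true, j, o) => .wrt j o) fun s => by
    rcases s with _ | _ | ⟨j, o⟩ | ⟨j, o⟩ | _ | _ | _ | _
    · exact ⟨.inl 0, rfl⟩
    · exact ⟨.inl 1, rfl⟩
    · exact ⟨.inr (false, j, o), rfl⟩
    · exact ⟨.inr (true, j, o), rfl⟩
    · exact ⟨.inl 2, rfl⟩
    · exact ⟨.inl 3, rfl⟩
    · exact ⟨.inl 4, rfl⟩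
    · exact ⟨.inl 5, rfl⟩

/-- The oracle machine that runs a program. -/
@[reducible] noncomputable def Prog.mach [Finite D] [Finite K] (c : Prog D K) (d₀ : D) : OracleMachine where
  State := MState D K c.Lab
  Work := Wk K
  finite_state := by
    have := c.finite_lab
    infer_instance
  finite_work := inferInstance
  start := (some c.entry, d₀, false, .init)
  oracle := moracle c.node
  trans := mtrans c.node

/-- Iterated steps. -/
noncomputable def OracleMachine.iter (M : OracleMachine) (φ : Baire) (n : ℕ) (x : M.Config) :
    M.Config := (fun c => (M.step φ c).getD c)^[n] x

theorem OracleMachine.iter_succ {M : OracleMachine} {φ : Baire} {n : ℕ} {x y : M.Config}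
    (h : M.step φ x = some y) : M.iter φ (n + 1) x = M.iter φ n y := by
  simp [iter, h]

theorem OracleMachine.iter_add {M : OracleMachine} {φ : Baire} (m n : ℕ) (x : M.Config) :
    M.iter φ (m + n) x = M.iter φ m (M.iter φ n x) := Function.iterate_add_apply _ _ _ _

variable [Finite D] [Finite K] {c : Prog D K} {d₀ : D} {φ : Baire}

/-- The configuration of the machine with stacks `S`, input tape `I`, and the head of the answer tape
with answer `s` in cell `p`. -/
def mconf (c : Prog D K) (d₀ : D) (q : MState D K c.Lab) (S : Stk K → List Cell) (I : Tape) (s : Str)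
    (p : ℤ) : (c.mach d₀).Config :=
  ⟨q, tapesOf (fun i => stkT (S i)) (fun i => stkT ((S i).map fun _ => some Sym.one)) I
    ⟨(Tape.blank.load s).cell, p⟩⟩

theorem OracleMachine.step_of_trans {M : OracleMachine} {C : M.Config}
    {r : M.State × (TapeIx M.Work → Option Sym × Dir)} (ho : M.oracle C.state = none)
    (ht : M.trans C.state (scan C.tape) = some r) :
    M.step φ C = some ⟨r.1, fun i => (C.tape i).act (r.2 i).1 (r.2 i).2⟩ := by
  unfold scan Tape.read at ht
  simp [step, ho, ht]

theorem OracleMachine.step_of_oracle {M : OracleMachine} {C : M.Config} {q : M.State}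
    (ho : M.oracle C.state = some q) : M.step φ C = some ⟨q, M.callOracle φ C.tape⟩ := by
  simp [step, ho]

theorem mach_step {q q' : MState D K c.Lab} {V P : Stk K → Tape} {I A : Tape} {a : Stk K → SA}
    {di da : Dir} (ho : moracle c.node q = none)
    (ht : mtrans c.node q (scan (tapesOf V P I A)) =
      some (q', tapeAct (scan (tapesOf V P I A)) a di da)) :
    (c.mach d₀).step φ ⟨q, tapesOf V P I A⟩ = some ⟨q', tapesOf (fun i => (a i).doVal (V i))
      (fun i => (a i).doMark (P i)) (I.act I.read di) (A.act A.read da)⟩ := by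
  rw [← act_tapesOf]
  exact OracleMachine.step_of_trans (M := c.mach d₀) (C := ⟨q, tapesOf V P I A⟩) ho ht

theorem mark_isSome (s : List Cell) :
    (stkT (s.map fun _ => some Sym.one)).read.isSome = !s.isEmpty := by
  rw [stkT_read]
  cases s <;> rfl

theorem doVal_keep (T : Tape) : SA.keep.doVal T = T := T.act_stay

theorem doMark_keep (T : Tape) : SA.keep.doMark T = T := T.act_stay

/-- One round of pushing. -/
theorem push_round (l : Option c.Lab) (d : D) (lv : Bool) (j : Fin 3) (o : Stk K → Op)
    (S : Stk K → List Cell) (I : Tape) (s : Str) (p : ℤ) (n : ℕ) :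
    (c.mach d₀).iter φ (n + 2) (mconf c d₀ (l, d, lv, .mov j o) S I s p) =
    (c.mach d₀).iter φ n (mconf c d₀ (l, d, lv, wrtNext o j) (fun i => pushO ((o i).sel j) (S i))
      I s p) := by
  have h1 : moracle c.node (l, d, lv, .mov j o) = none := by cases l <;> rfl
  have h2 : moracle c.node (l, d, lv, .wrt j o) = none := by cases l <;> rfl
  have h3 : ∀ sc, mtrans c.node (l, d, lv, .mov j o) sc =
      some ((l, d, lv, .wrt j o), tapeAct sc (movAct j o) .stay .stay) := by cases l <;> exact fun _ => rfl
  have h4 : ∀ sc, mtrans c.node (l, d, lv, .wrt j o) sc =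
      some ((l, d, lv, wrtNext o j), tapeAct sc (wrtAct j o) .stay .stay) := by cases l <;> exact fun _ => rfl
  rw [mconf, OracleMachine.iter_succ (mach_step h1 (h3 _)),
    OracleMachine.iter_succ (mach_step h2 (h4 _))]
  simp only [Tape.act_stay]
  congr 1
  simp only [mconf]
  congr 2
  · funext i
    simp only [movAct, wrtAct]
    cases h : (o i).sel j with
    | none => simp [doVal_keep, pushO]
    | some g =>
      simp only [Option.isSome_some, if_true, pushO]
      exact stkT_push g (S i)
  · funext i
    simp only [movAct, wrtAct]
    cases h : (o i).sel j with
    | none => simp [doMark_keep, pushO]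
    | some g =>
      simp only [Option.isSome_some, if_true, pushO, List.map_cons]
      exact stkT_push _ _

theorem push_rounds (l : Option c.Lab) (d : D) (lv : Bool) (o : Stk K → Op)
    (S : Stk K → List Cell) (I : Tape) (s : Str) (p : ℤ) (n : ℕ) :
    (c.mach d₀).iter φ (n + 6) (mconf c d₀ (l, d, lv, .mov 0 o) S I s p) =
    (c.mach d₀).iter φ n (mconf c d₀ (l, d, lv, .at)
      (fun i => pushO (o i).p3 (pushO (o i).p2 (pushO (o i).p1 (S i)))) I s p) := by
  rw [show n + 6 = n + 4 + 2 by ring, push_round, wrtNext, show n + 4 = n + 2 + 2 by ring,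
    push_round, wrtNext, push_round]
  rfl

/-- The unread part of the answer tape. -/
def rest (lv : Bool) (s : Str) (p : ℕ) : List Cell := if lv then (s.drop p).map some else []

/-- The abstract stacks: the answer stack continues on the answer tape. -/
noncomputable def absStk (S : Stk K → List Cell) (lv : Bool) (s : Str) (p : ℕ) : Stk K → List Cell :=
  Function.update S .ans (S .ans ++ rest lv s p)

/-- The input tape `I` has `a` still to be read. -/
def InpRep (I : Tape) (a : Str) : Prop :=
  ∃ (b : Str) (h : ℕ), I = ⟨(Tape.blank.load b).cell, h⟩ ∧ a = b.drop h

theorem InpRep.read {I : Tape} {a : Str} (h : InpRep I a) : I.read = a.head? := by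
  obtain ⟨b, h, rfl, rfl⟩ := h
  simp [Tape.read, Tape.load, List.head?_drop]

theorem InpRep.right {I : Tape} {a : Str} (h : InpRep I a) : InpRep (I.act I.read .right) a.tail := by
  obtain ⟨b, h, rfl, rfl⟩ := h
  refine ⟨b, h + 1, ?_, by simp⟩
  rw [Tape.act_same]
  simp [Dir.offset]

theorem ans_read (s : Str) (p : ℕ) : (⟨(Tape.blank.load s).cell, p⟩ : Tape).read = s[p]? := by
  simp [Tape.read, Tape.load]

/-- The machine configurations that represent a state of the program, with the work stacks `S`, the
flag `lv` and the head position `p` on the answer tape. -/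
def MRep (x : Option c.Lab × St D K) (S : Stk K → List Cell) (lv : Bool) (p : ℕ)
    (C : (c.mach d₀).Config) : Prop :=
  ∃ I s, C = mconf c d₀ (x.1, x.2.d, lv, .at) S I s p ∧ InpRep I x.2.inp ∧ p ≤ s.length ∧
    x.2.stk = absStk S lv s p

/-- The potential that pays for emptying stacks and rewinding the answer tape. -/
noncomputable def pot (S : Stk K → List Cell) (p : ℕ) : ℕ := by
  classical exact letI := Fintype.ofFinite (Stk K); ∑ i, (S i).length + p

theorem pot_eq [Fintype (Stk K)] (S : Stk K → List Cell) (p : ℕ) :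
    pot S p = ∑ i, (S i).length + p := by
  rw [pot]
  congr!

omit [Finite D] [Finite K] in
theorem view_eq {σ : St D K} {S : Stk K → List Cell} {lv : Bool} {p : ℕ} {I : Tape} {s : Str}
    (hI : InpRep I σ.inp) (hS : σ.stk = absStk S lv s p) :
    vw σ.d lv (scan (tapesOf (fun i => stkT (S i))
      (fun i => stkT ((S i).map fun _ => some Sym.one)) I ⟨(Tape.blank.load s).cell, p⟩)) =
    σ.view := by
  simp only [vw, St.view, View.mk.injEq, true_and]
  refine ⟨?_, hI.read⟩
  funext i
  simp only [scan, tapesOf, stkT_read, hS, absStk, ans_read]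
  by_cases hi : i = .ans
  · subst hi
    cases h : S .ans with
    | cons x l => simp
    | nil =>
      cases lv
      · simp [rest]
      · simp [rest, List.head?_drop]
  · rw [Function.update_of_ne hi]
    cases h : S i with
    | cons x l => simp
    | nil =>
      rcases i with _ | _ | _ | k
      · simp
      · simp
      · exact absurd rfl hi
      · simp

theorem pushO_append (o : Option Cell) (s t : List Cell) : pushO o (s ++ t) = pushO o s ++ t := by
  cases o <;> rfl

theorem pushO_length (o : Option Cell) (s : List Cell) : (pushO o s).length ≤ s.length + 1 := by
  cases o <;> simp [pushO]

theorem act_sim {σ : St D K} {f : View D K → Res D K × Option c.Lab} {l : c.Lab}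
    {S : Stk K → List Cell} {lv : Bool} {p : ℕ} {C : (c.mach d₀).Config}
    (h : MRep (some l, σ) S lv p C) (hn : c.node l = .act f) :
    ∃ S' lv' p', MRep ((c.node l).step φ σ) S' lv' p' ((c.mach d₀).iter φ 7 C) ∧
      pot S' p' ≤ pot S p + (3 * Nat.card (Stk K) + 1) := by
  have := Fintype.ofFinite (Stk K)
  obtain ⟨I, s, rfl, hI, hp, hS⟩ := h
  have hv := view_eq hI hS
  dsimp only at hI hS hv
  have hA : σ.stk .ans = S .ans ++ rest lv s p := by rw [hS]; simp [absStk]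
  set r := (f σ.view).1 with hr
  let S₁ : Stk K → List Cell := fun i => if (r.op i).pop then (S i).tail else S i
  let S' : Stk K → List Cell := fun i =>
    pushO (r.op i).p3 (pushO (r.op i).p2 (pushO (r.op i).p1 (S₁ i)))
  let adv : Bool := (r.op .ans).pop && (S .ans).isEmpty && lv && (s[p]?).isSome
  let p' := if adv then p + 1 else p
  refine ⟨S', lv, p', ⟨if r.rd then I.act I.read .right else I, s, ?_, ?_, ?_, ?_⟩, ?_⟩
  · have h1 : moracle c.node (some l, σ.d, lv, .at) = none := rfl
    rw [mconf, OracleMachine.iter_succ (n := 6) (mach_step (a := popAct r (scan _))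
      (di := if r.rd then .right else .stay) (da := ansDir r lv (scan _))
      (q' := ((f σ.view).2, r.d, lv, .mov 0 r.op)) h1
      (by simp only [mtrans, hn]; simp only [hv]; rfl))]
    have e : (⟨((f σ.view).2, r.d, lv, .mov 0 r.op), tapesOf
        (fun i => (popAct r (scan (tapesOf (fun i => stkT (S i))
          (fun i => stkT ((S i).map fun _ => some Sym.one)) I
            ⟨(Tape.blank.load s).cell, p⟩)) i).doVal (stkT (S i)))
        (fun i => (popAct r (scan (tapesOf (fun i => stkT (S i))
          (fun i => stkT ((S i).map fun _ => some Sym.one)) I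
            ⟨(Tape.blank.load s).cell, p⟩)) i).doMark (stkT ((S i).map fun _ => some Sym.one)))
        (I.act I.read (if r.rd then .right else .stay))
        ((⟨(Tape.blank.load s).cell, p⟩ : Tape).act (⟨(Tape.blank.load s).cell, p⟩ : Tape).read
          (ansDir r lv (scan (tapesOf (fun i => stkT (S i))
          (fun i => stkT ((S i).map fun _ => some Sym.one)) I
            ⟨(Tape.blank.load s).cell, p⟩))))⟩ : (c.mach d₀).Config) =
        mconf c d₀ ((f σ.view).2, r.d, lv, .mov 0 r.op) S₁
          (if r.rd then I.act I.read .right else I) s p' := by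
      simp only [mconf]
      congr 2
      · funext i
        simp only [popAct, scan, tapesOf, mark_isSome, S₁]
        by_cases hpop : (r.op i).pop = true
        · cases hs : S i with
          | nil => simp [doVal_keep]
          | cons x t =>
            simp only [hpop, List.isEmpty_cons, Bool.not_false, and_self, if_true, List.tail_cons]
            exact stkT_pop x t
        · simp [hpop, doVal_keep]
      · funext i
        simp only [popAct, scan, tapesOf, mark_isSome, S₁]
        by_cases hpop : (r.op i).pop = true
        · cases hs : S i with
          | nil => simp [doMark_keep]
          | cons x t =>
            simp only [hpop, List.isEmpty_cons, Bool.not_false, and_self, if_true, List.tail_cons]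
            exact stkT_pop _ _
        · simp [hpop, doMark_keep]
      · by_cases hrd : r.rd
        · simp [hrd]
        · simp [hrd, Tape.act_stay]
      · simp only [ansDir, scan, tapesOf, mark_isSome, ans_read]
        rw [← ans_read, Tape.act_same, ans_read]
        have e1 : ((r.op .ans).pop = true ∧ (!(S .ans).isEmpty) = false ∧ lv = true ∧
            (s[p]?).isSome = true) ↔ adv = true := by
          simp only [adv, Bool.and_eq_true, and_assoc, Bool.not_eq_false']
        simp only [e1, p']
        split_ifs <;> simp [Dir.offset]
    rw [e]
    refine (push_rounds _ _ _ _ _ _ _ _ 0).trans ?_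
    simp only [OracleMachine.iter, Function.iterate_zero, id, hn, Node.step]
    simp [St.app, hr, S']
  · simp only [hn, Node.step, St.app]
    by_cases hrd : r.rd
    · simp only [hrd, if_true, ← hr]; exact hI.right
    · simp only [hrd, ← hr]; exact hI
  · simp only [p', adv]
    split_ifs with h
    · simp only [Bool.and_eq_true] at h
      have := h.2
      by_contra hc
      rw [List.getElem?_eq_none (by omega)] at this
      simp at this
    · exact hp
  · simp only [hn, Node.step, St.app, ← hr]
    funext i
    by_cases hi : i = .ans
    · subst hi
      simp only [absStk, Function.update_self, Op.ap, S', S₁, hA]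
      rw [← pushO_append, ← pushO_append, ← pushO_append]
      congr 3
      by_cases hpop : (r.op .ans).pop = true
      · simp only [hpop, if_true, p', adv, Bool.true_and]
        cases hs : S .ans with
        | cons x t => simp
        | nil =>
          cases lv
          · simp [rest]
          · simp only [rest, List.isEmpty_nil, Bool.true_and, if_true, List.nil_append,
              List.tail_nil, ← List.map_tail, List.tail_drop]
            split_ifs with h
            · rfl
            · have hle : s.length ≤ p := by
                by_contra hc
                rw [List.getElem?_eq_getElem (by omega)] at h
                simp at h
              rw [List.drop_eq_nil_of_le hle, List.drop_eq_nil_of_le (by omega)]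
      · simp [hpop, p', adv]
    · rw [hS]; simp only [absStk, Function.update_of_ne hi, Op.ap, S', S₁]
  · rw [pot_eq, pot_eq, Nat.card_eq_fintype_card]
    have h1 : ∑ i, (S' i).length ≤ ∑ i, ((S i).length + 3) := by
      apply Finset.sum_le_sum
      intro i _
      have a1 := pushO_length (r.op i).p1 (S₁ i)
      have a2 := pushO_length (r.op i).p2 (pushO (r.op i).p1 (S₁ i))
      have a3 := pushO_length (r.op i).p3 (pushO (r.op i).p2 (pushO (r.op i).p1 (S₁ i)))
      have a4 : (S₁ i).length ≤ (S i).length := by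
        simp only [S₁]; split_ifs <;> simp
      simp only [S']
      omega
    rw [Finset.sum_add_distrib] at h1
    simp only [Finset.sum_const, Finset.card_univ, smul_eq_mul] at h1
    have h2 : p' ≤ p + 1 := by simp only [p']; split_ifs <;> omega
    rw [mul_comm] at h1
    omega

theorem rewind (l : c.Lab) (d : D) (lv : Bool) (S : Stk K → List Cell) (I : Tape) (s : Str) (p : ℕ)
    (hp : p ≤ s.length) (n : ℕ) :
    (c.mach d₀).iter φ (n + (p + 1)) (mconf c d₀ (some l, d, lv, .rew1) S I s (p - 1)) =
    (c.mach d₀).iter φ n (mconf c d₀ (some l, d, lv, .del) S I s 0) := by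
  induction p with
  | zero =>
    rw [mconf, OracleMachine.iter_succ (mach_step (a := fun _ => .keep) (di := .stay) (da := .right)
      (q' := (some l, d, lv, .del)) rfl ?_)]
    · simp only [doVal_keep, doMark_keep, Tape.act_stay, Tape.act_right, mconf]
      simp
    · simp [mtrans, scan, tapesOf, Tape.read, Tape.load, Tape.blank]
  | succ p ih =>
    rw [mconf, ← add_assoc, OracleMachine.iter_succ (mach_step (a := fun _ => .keep) (di := .stay)
      (da := .left) (q' := (some l, d, lv, .rew1)) rfl ?_)]
    · rw [← ih (by omega)]
      simp only [doVal_keep, doMark_keep, Tape.act_stay, Tape.act_left, mconf]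
      congr 4
      push_cast
      ring
    · have : ((p + 1 : ℕ) : ℤ) - 1 = p := by push_cast; ring
      rw [this]
      simp only [mtrans, scan, tapesOf, ans_read]
      rw [List.getElem?_eq_getElem (by omega)]
      simp

theorem empty_stacks (l : c.Lab) (d : D) (lv : Bool) (I : Tape) (s : Str) (p : ℕ) (m : ℕ)
    (S : Stk K → List Cell) (hm : pot S p = m) :
    ∃ n, (c.mach d₀).iter φ n (mconf c d₀ (some l, d, lv, .del) S I s p) =
      mconf c d₀ (delNext l d lv (c.node l)) (fun i => if delSet (c.node l) i then [] else S i) I s p ∧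
      n + pot (fun i => if delSet (c.node l) i then [] else S i) p ≤ m + 1 := by
  have := Fintype.ofFinite (Stk K)
  induction m using Nat.strong_induction_on generalizing S with
  | _ m ih =>
    by_cases h : ∃ i, delSet (c.node l) i = true ∧ (!(S i).isEmpty) = true
    · let S₁ : Stk K → List Cell := fun i => if delSet (c.node l) i then (S i).tail else S i
      have hlt : pot S₁ p < m := by
        rw [← hm, pot_eq, pot_eq]
        apply Nat.add_lt_add_right
        apply Finset.sum_lt_sum
        · intro i _
          simp only [S₁]
          split_ifs <;> simp
        · obtain ⟨i, h1, h2⟩ := h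
          refine ⟨i, Finset.mem_univ _, ?_⟩
          simp only [S₁, h1, if_true, List.length_tail]
          cases hs : S i with
          | nil => simp [hs] at h2
          | cons x t => simp
      obtain ⟨n, h1, h2⟩ := ih _ hlt S₁ rfl
      have e : (fun i => if delSet (c.node l) i then [] else S₁ i) =
          fun i => if delSet (c.node l) i then [] else S i := by
        funext i
        simp only [S₁]
        split_ifs <;> rfl
      rw [e] at h1 h2
      refine ⟨n + 1, ?_, by omega⟩
      rw [← h1, mconf, OracleMachine.iter_succ (mach_step (a := fun i =>
        if delSet (c.node l) i = true ∧ (!(S i).isEmpty) = true then .pop else .keep)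
        (di := .stay) (da := .stay) (q' := (some l, d, lv, .del)) rfl ?_)]
      · simp only [Tape.act_stay, mconf]
        congr 3
        · funext i
          simp only [S₁]
          cases hs : S i with
          | nil => simp [doVal_keep]
          | cons x t =>
            by_cases hd : delSet (c.node l) i = true
            · simp only [hd, List.isEmpty_cons, Bool.not_false, and_self, if_true, List.tail_cons]
              exact stkT_pop x t
            · simp [hd, doVal_keep]
        · funext i
          simp only [S₁]
          cases hs : S i with
          | nil => simp [doMark_keep]
          | cons x t =>
            by_cases hd : delSet (c.node l) i = true
            · simp only [hd, List.isEmpty_cons, Bool.not_false, and_self, if_true, List.tail_cons]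
              exact stkT_pop _ _
            · simp [hd, doMark_keep]
      · simp only [mtrans, scan, tapesOf, mark_isSome]
        rw [if_pos h]
    · refine ⟨1, ?_, ?_⟩
      · have e : (fun i => if delSet (c.node l) i then [] else S i) = S := by
          funext i
          split_ifs with hi
          · by_contra hne
            refine h ⟨i, hi, ?_⟩
            simpa [List.isEmpty_iff] using Ne.symm hne
          · rfl
        rw [e, mconf, OracleMachine.iter_succ (n := 0) (mach_step (a := fun i => .keep)
          (di := .stay) (da := .stay) (q' := delNext l d lv (c.node l)) rfl ?_)]
        · simp only [doVal_keep, doMark_keep, Tape.act_stay, mconf]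
          rfl
        · simp only [mtrans, scan, tapesOf, mark_isSome]
          rw [if_neg h]
      · rw [← hm, pot_eq, pot_eq]
        have : ∑ i, (if delSet (c.node l) i then [] else S i).length ≤ ∑ i, (S i).length := by
          apply Finset.sum_le_sum
          intro i _
          split_ifs <;> simp
        omega

/-- Rewinding the answer tape and emptying stacks. -/
theorem rewind_empty (l : c.Lab) (d : D) (lv : Bool) (I : Tape) (s : Str) (p : ℕ)
    (hp : p ≤ s.length) (S : Stk K → List Cell) :
    ∃ n, (c.mach d₀).iter φ n (mconf c d₀ (some l, d, lv, .rew0) S I s p) =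
      mconf c d₀ (delNext l d lv (c.node l)) (fun i => if delSet (c.node l) i then [] else S i) I s 0 ∧
      n + pot (fun i => if delSet (c.node l) i then [] else S i) 0 ≤ pot S p + 3 := by
  have := Fintype.ofFinite (Stk K)
  obtain ⟨n, h1, h2⟩ := empty_stacks (φ := φ) (d₀ := d₀) l d lv I s 0 _ S rfl
  refine ⟨n + (p + 1) + 1, ?_, ?_⟩
  · rw [mconf, OracleMachine.iter_succ (mach_step (a := fun _ => .keep) (di := .stay) (da := .left)
      (q' := (some l, d, lv, .rew1)) rfl rfl)]
    simp only [doVal_keep, doMark_keep, Tape.act_stay, Tape.act_left]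
    have := rewind (φ := φ) (d₀ := d₀) l d lv S I s p hp n
    rw [mconf] at this
    refine Eq.trans ?_ (this.trans h1)
    rfl
  · have : pot S p = pot S 0 + p := by rw [pot_eq, pot_eq]; ring
    omega

theorem start_empty (l : c.Lab) {q' : PC K} (d : D) (lv : Bool) (I : Tape) (s : Str) (p : ℕ)
    (S : Stk K → List Cell)
    (h : ∀ sc, mtrans c.node (some l, d, lv, .at) sc =
      some ((some l, d, lv, q'), tapeAct sc (fun _ => .keep) .stay .stay)) (n : ℕ) :
    (c.mach d₀).iter φ (n + 1) (mconf c d₀ (some l, d, lv, .at) S I s p) =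
      (c.mach d₀).iter φ n (mconf c d₀ (some l, d, lv, q') S I s p) := by
  rw [mconf, OracleMachine.iter_succ (mach_step rfl (h _))]
  simp only [doVal_keep, doMark_keep, Tape.act_stay]
  rfl

theorem clear_sim {σ : St D K} {Δ : Stk K → Bool} {k : Option c.Lab} {l : c.Lab}
    {S : Stk K → List Cell} {lv : Bool} {p : ℕ} {C : (c.mach d₀).Config}
    (h : MRep (some l, σ) S lv p C) (hn : c.node l = .clear Δ k) :
    ∃ n S' lv' p', MRep ((c.node l).step φ σ) S' lv' p' ((c.mach d₀).iter φ n C) ∧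
      n + pot S' p' ≤ pot S p + 5 := by
  obtain ⟨I, s, rfl, hI, hp, hS⟩ := h
  dsimp only at hI hS
  by_cases hΔ : Δ .ans = true
  · obtain ⟨n, h1, h2⟩ := rewind_empty (φ := φ) (d₀ := d₀) l σ.d lv I s p hp S
    refine ⟨n + 1, (fun i => if delSet (c.node l) i then [] else S i), false, 0,
      ⟨I, s, ?_, ?_, Nat.zero_le _, ?_⟩, by omega⟩
    · rw [start_empty (q' := .rew0) l σ.d lv I s p S (fun _ => by simp [mtrans, hn, hΔ]), h1]
      simp [hn, delNext, hΔ, Node.step, St.clr, delSet]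
    · simpa [hn, Node.step, St.clr] using hI
    · simp only [hn, Node.step, St.clr, delSet, hS]
      funext i
      by_cases hi : i = .ans
      · subst hi; simp [absStk, hΔ, rest]
      · simp [absStk, hi]
  · obtain ⟨n, h1, h2⟩ := empty_stacks (φ := φ) (d₀ := d₀) l σ.d lv I s p _ S rfl
    refine ⟨n + 1, (fun i => if delSet (c.node l) i then [] else S i), lv, p,
      ⟨I, s, ?_, ?_, hp, ?_⟩, by omega⟩
    · rw [start_empty (q' := .del) l σ.d lv I s p S (fun _ => by simp [mtrans, hn, hΔ]), h1]
      simp [hn, delNext, hΔ, Node.step, St.clr, delSet]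
    · simpa [hn, Node.step, St.clr] using hI
    · simp only [hn, Node.step, St.clr, delSet, hS]
      funext i
      by_cases hi : i = .ans
      · subst hi; simp [absStk, hΔ]
      · simp [absStk, hi]

theorem call_sim {σ : St D K} {k : Option c.Lab} {l : c.Lab}
    {S : Stk K → List Cell} {lv : Bool} {p : ℕ} {C : (c.mach d₀).Config}
    (h : MRep (some l, σ) S lv p C) (hn : c.node l = .call k) :
    ∃ n S' lv' p', MRep ((c.node l).step φ σ) S' lv' p' ((c.mach d₀).iter φ n C) ∧
      n + pot S' p' ≤ pot S p + 5 := by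
  obtain ⟨I, s, rfl, hI, hp, hS⟩ := h
  dsimp only at hI hS
  obtain ⟨n, h1, h2⟩ := rewind_empty (φ := φ) (d₀ := d₀) l σ.d lv I s p hp S
  refine ⟨1 + n + 1, (fun i => if delSet (c.node l) i then [] else S i), true, 0,
    ⟨I, φ (stkT (S .qry)).content, ?_, ?_, Nat.zero_le _, ?_⟩, by omega⟩
  · rw [start_empty (q' := .rew0) l σ.d lv I s p S (fun _ => by simp [mtrans, hn]),
      OracleMachine.iter_add, h1, mconf, ← zero_add 1, OracleMachine.iter_succ
      (OracleMachine.step_of_oracle (q := (k, σ.d, true, .at)) (by simp [hn, delNext, moracle]))]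
    simp only [OracleMachine.iter, Function.iterate_zero, id, hn, Node.step, mconf, St.ask]
    congr 1
    funext i
    rcases i with _ | _ | _ | _ | ⟨i, _ | _⟩
    · rfl
    · rfl
    · rfl
    · simp [OracleMachine.callOracle, tapesOf, Tape.load, delSet]
    · rfl
    · rfl
  · simpa [hn, Node.step, St.ask] using hI
  · simp only [hn, Node.step, St.ask, delSet, hS]
    have hq : absStk S lv s p .qry = S .qry := Function.update_of_ne (by simp) _ _
    rw [hq]
    funext i
    by_cases hi : i = .ans
    · subst hi; simp [absStk, rest]
    · simp [absStk, hi]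

theorem node_sim {x : St D K} {l : c.Lab} {S : Stk K → List Cell} {lv : Bool} {p : ℕ}
    {C : (c.mach d₀).Config} (h : MRep (some l, x) S lv p C) :
    ∃ n S' lv' p', MRep ((c.node l).step φ x) S' lv' p' ((c.mach d₀).iter φ n C) ∧
      n + pot S' p' ≤ pot S p + (3 * Nat.card (Stk K) + 8) := by
  cases hn : c.node l with
  | act f =>
    obtain ⟨S', lv', p', h1, h2⟩ := act_sim (φ := φ) h hn
    exact ⟨7, S', lv', p', hn ▸ h1, by omega⟩
  | clear Δ k =>
    obtain ⟨n, S', lv', p', h1, h2⟩ := clear_sim (φ := φ) h hn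
    exact ⟨n, S', lv', p', hn ▸ h1, by omega⟩
  | call k =>
    obtain ⟨n, S', lv', p', h1, h2⟩ := call_sim (φ := φ) h hn
    exact ⟨n, S', lv', p', hn ▸ h1, by omega⟩

theorem steps_sim {n : ℕ} {x y : Option c.Lab × St D K} (hs : Steps c.node φ n x y)
    {S : Stk K → List Cell} {lv : Bool} {p : ℕ} {C : (c.mach d₀).Config} (h : MRep x S lv p C) :
    ∃ m S' lv' p', MRep y S' lv' p' ((c.mach d₀).iter φ m C) ∧
      m + pot S' p' ≤ pot S p + n * (3 * Nat.card (Stk K) + 8) := by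
  induction hs generalizing S lv p C with
  | refl x => exact ⟨0, S, lv, p, h, by omega⟩
  | step _ ih =>
    obtain ⟨m₁, S₁, lv₁, p₁, h1, h2⟩ := node_sim (φ := φ) h
    obtain ⟨m₂, S₂, lv₂, p₂, h3, h4⟩ := ih h1
    refine ⟨m₂ + m₁, S₂, lv₂, p₂, ?_, ?_⟩
    · rw [OracleMachine.iter_add]; exact h3
    · rw [Nat.add_mul]; omega

/-- The machine of a program computes what the program computes, with linear overhead. -/
theorem mach_run {a : Str} {t : ℕ} {σ : St D K} (h : Exec φ c ⟨d₀, fun _ => [], a⟩ t σ) :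
    ∃ n ≤ t * (3 * Nat.card (Stk K) + 8) + 1, (c.mach d₀).HaltedBy φ a n ∧
      (((c.mach d₀).conf φ a n).tape .output).content = (stkT (σ.stk .out)).content := by
  have := Fintype.ofFinite (Stk K)
  have h0 : (c.mach d₀).iter φ 1 ((c.mach d₀).init a) =
      mconf c d₀ (some c.entry, d₀, false, .at) (fun _ => []) (Tape.blank.load a) [] 0 := by
    have e : (c.mach d₀).init a = ⟨(some c.entry, d₀, false, .init),
        tapesOf (fun _ => Tape.blank) (fun _ => Tape.blank) (Tape.blank.load a) Tape.blank⟩ := by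
      simp only [OracleMachine.init]
      congr 1
      funext i
      rcases i with _ | _ | _ | _ | ⟨i, _ | _⟩ <;> rfl
    rw [e, ← zero_add 1, OracleMachine.iter_succ (mach_step (a := fun _ => .bak) (di := .stay)
      (da := .stay) (q' := (some c.entry, d₀, false, .at)) rfl rfl)]
    simp only [Tape.act_stay, mconf, SA.doVal, SA.doMark, SA.val, SA.mark, Tape.act_left,
      List.map_nil, stkT_nil, OracleMachine.iter, Function.iterate_zero, id]
    congr 2
    simp [Tape.blank, Tape.load]
  have hrep : MRep (some c.entry, ⟨d₀, fun _ => [], a⟩) (fun _ => []) false 0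
      ((c.mach d₀).iter φ 1 ((c.mach d₀).init a)) := by
    refine ⟨_, [], h0, ⟨a, 0, rfl, rfl⟩, le_rfl, ?_⟩
    funext i
    by_cases hi : i = .ans
    · subst hi; simp [absStk, rest]
    · simp [absStk, hi]
  obtain ⟨m, S, lv, p, ⟨I, s, h1, -, -, h2⟩, h3⟩ := steps_sim (Prog.steps_of_exec h) hrep
  rw [← OracleMachine.iter_add] at h1
  have hc : (c.mach d₀).conf φ a (m + 1) = _ := h1
  refine ⟨m + 1, ?_, ?_, ?_⟩
  · have : pot (fun _ : Stk K => []) 0 = 0 := by rw [pot_eq]; simp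
    omega
  · rw [OracleMachine.HaltedBy, hc]
    rfl
  · rw [hc, h2]
    simp [mconf, tapesOf, absStk]

end Machine

open Function (update)

/-! ### Program logic -/

/-- The program terminates from `σ` within `T` steps, in a state with property `Q`. -/
def Run {D K : Type} (φ : Baire) (c : Prog D K) (σ : St D K) (T : ℕ) (Q : St D K → Prop) : Prop :=
  ∃ t σ', t ≤ T ∧ Exec φ c σ t σ' ∧ Q σ'

namespace Run

variable {D K : Type} {φ : Baire} {σ : St D K} {T T' : ℕ} {Q Q' : St D K → Prop} {a b : Prog D K}
  {p : View D K → Bool}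

theorem mono (h : Run φ a σ T Q) (hT : T ≤ T') (hQ : ∀ σ, Q σ → Q' σ) : Run φ a σ T' Q' := by
  obtain ⟨t, σ', h1, h2, h3⟩ := h
  exact ⟨t, σ', h1.trans hT, h2, hQ _ h3⟩

theorem weaken (h : Run φ a σ T Q) (hT : T ≤ T') : Run φ a σ T' Q := h.mono hT fun _ => id

theorem act {f : View D K → Res D K} (h : Q (σ.app (f σ.view))) : Run φ (.act f) σ 1 Q :=
  ⟨1, _, le_rfl, .act f σ, h⟩

theorem clear {S : Stk K → Bool} (h : Q (σ.clr S)) : Run φ (.clear S) σ 1 Q :=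
  ⟨1, _, le_rfl, .clear S σ, h⟩

theorem call (h : Q (σ.ask φ)) : Run φ .call σ 1 Q := ⟨1, _, le_rfl, .call σ, h⟩

theorem seq (h : Run φ a σ T Q) (h' : ∀ σ, Q σ → Run φ b σ T' Q') :
    Run φ (.seq a b) σ (T + T') Q' := by
  obtain ⟨t, σ₁, h1, h2, h3⟩ := h
  obtain ⟨t', σ₂, h4, h5, h6⟩ := h' _ h3
  exact ⟨_, _, by omega, .seq h2 h5, h6⟩

theorem ite_true (hp : p σ.view = true) (h : Run φ a σ T Q) : Run φ (.ite p a b) σ (T + 1) Q := by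
  obtain ⟨t, σ₁, h1, h2, h3⟩ := h
  exact ⟨_, _, by omega, .ite_true hp h2, h3⟩

theorem ite_false (hp : p σ.view = false) (h : Run φ b σ T Q) : Run φ (.ite p a b) σ (T + 1) Q := by
  obtain ⟨t, σ₁, h1, h2, h3⟩ := h
  exact ⟨_, _, by omega, .ite_false hp h2, h3⟩

theorem ite (h : p σ.view = true → Run φ a σ T Q) (h' : p σ.view = false → Run φ b σ T Q) :
    Run φ (.ite p a b) σ (T + 1) Q := by
  cases hp : p σ.view with
  | true => exact ite_true hp (h hp)
  | false => exact ite_false hp (h' hp)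

theorem loop_false (hp : p σ.view = false) (h : Q σ) : Run φ (.loop p a) σ 1 Q :=
  ⟨1, _, le_rfl, .loop_false hp, h⟩

theorem loop_true (hp : p σ.view = true) (h : Run φ a σ T Q)
    (h' : ∀ σ, Q σ → Run φ (.loop p a) σ T' Q') : Run φ (.loop p a) σ (T + T' + 1) Q' := by
  obtain ⟨t, σ₁, h1, h2, h3⟩ := h
  obtain ⟨t', σ₂, h4, h5, h6⟩ := h' _ h3
  exact ⟨_, _, by omega, .loop_true hp h2 h5, h6⟩

/-- A loop with `n` rounds and an invariant that counts the rounds. -/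
theorem loop {I : ℕ → St D K → Prop} {n : ℕ}
    (h : ∀ i < n, ∀ σ, I i σ → p σ.view = true ∧ Run φ a σ T (I (i + 1)))
    (h' : ∀ σ, I n σ → p σ.view = false) (h0 : I 0 σ) :
    Run φ (.loop p a) σ (n * (T + 1) + 1) (I n) := by
  have key : ∀ m ≤ n, ∀ σ, I (n - m) σ → Run φ (.loop p a) σ (m * (T + 1) + 1) (I n) := by
    intro m
    induction m with
    | zero => exact fun _ σ hσ => (loop_false (h' σ hσ) hσ).weaken (by omega)
    | succ m ih =>
      intro hm σ hσ
      obtain ⟨h1, h2⟩ := h _ (by omega) σ hσ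
      refine (loop_true h1 h2 fun σ' hσ' => ih (by omega) σ' ?_).weaken ?_
      · rwa [show n - (m + 1) + 1 = n - m by omega] at hσ'
      · rw [Nat.add_mul m 1]; omega
  exact key n le_rfl σ (by simpa using h0)

end Run

/-! ### Basic instructions -/

namespace Op

/-- Leave the stack as it is. -/
abbrev keep : Op := ⟨false, none, none, none⟩

/-- Pop a symbol. -/
abbrev drop : Op := ⟨true, none, none, none⟩

/-- Push a symbol. -/
abbrev put (g : Cell) : Op := ⟨false, some g, none, none⟩

/-- Push three symbols, `c` last. -/
abbrev put3 (a b c : Cell) : Op := ⟨false, some a, some b, some c⟩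

theorem keep_ap (s : List Cell) : keep.ap s = s := rfl

end Op

section Basic

variable {D K : Type} {φ : Baire}

/-- A table of stack operations. -/
noncomputable def opl : List (Stk K × Op) → Stk K → Op
  | [], _ => Op.keep
  | (k, o) :: l, i => if i = k then o else opl l i

/-- The effect of a table of stack operations. -/
noncomputable def sem : List (Stk K × Op) → (Stk K → List Cell) → Stk K → List Cell
  | [], S => S
  | (k, o) :: l, S => update (sem l S) k (o.ap (S k))

theorem opl_ap (l : List (Stk K × Op)) (S : Stk K → List Cell) :
    (fun i => (opl l i).ap (S i)) = sem l S := by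
  induction l with
  | nil => rfl
  | cons x l ih =>
    funext i
    rw [sem, ← ih]
    by_cases hi : i = x.1
    · subst hi; simp [opl]
    · simp [opl, hi]

/-- An instruction that is given by a table. -/
noncomputable def doOps (f : View D K → D) (g : View D K → List (Stk K × Op)) : Prog D K :=
  .act fun v => ⟨f v, opl (g v), false⟩

theorem run_doOps {f : View D K → D} {g : View D K → List (Stk K × Op)} {σ : St D K}
    {Q : St D K → Prop} (h : Q ⟨f σ.view, sem (g σ.view) σ.stk, σ.inp⟩) :
    Run φ (doOps f g) σ 1 Q := by
  refine Run.act ?_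
  simpa [St.app, opl_ap] using h

/-- Move the stack `k` to the stack `k'`, which reverses it. -/
noncomputable def move (k k' : Stk K) : Prog D K :=
  .loop (fun v => (v.top k).isSome)
    (doOps (fun v => v.d) fun v => [(k, .drop), (k', .put (v.top k).join)])

theorem run_move {k k' : Stk K} (hk : k ≠ k') (d : D) (S : Stk K → List Cell) (x : Str) :
    Run φ (move k k') ⟨d, S, x⟩ (2 * (S k).length + 1)
      fun σ => σ = ⟨d, update (update S k' ((S k).reverse ++ S k')) k [], x⟩ := by
  induction h : S k generalizing S with
  | nil =>
    refine Run.loop_false (by simp [St.view, h]) ?_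
    congr 1
    funext i
    simp only [Function.update_apply]
    split_ifs <;> simp_all
  | cons g s ih =>
    refine (Run.loop_true (T := 1) (by simp [St.view, h]) (run_doOps rfl) ?_).weaken
      (T := 1 + (2 * s.length + 1) + 1) (by simp; omega)
    rintro _ rfl
    simp only [St.view, sem, h, Op.ap, pushO]
    refine (ih _ (by simp)).mono le_rfl ?_
    rintro _ rfl
    congr 1
    funext i
    simp only [Function.update_apply]
    split_ifs <;> simp_all

/-- Move the stack `k` to the stacks `k'` and `k''`. -/
noncomputable def move2 (k k' k'' : Stk K) : Prog D K :=
  .loop (fun v => (v.top k).isSome)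
    (doOps (fun v => v.d) fun v =>
      [(k, .drop), (k', .put (v.top k).join), (k'', .put (v.top k).join)])

theorem run_move2 {k k' k'' : Stk K} (hk : k ≠ k') (hk' : k ≠ k'') (hk'' : k' ≠ k'') (d : D)
    (S : Stk K → List Cell) (x : Str) :
    Run φ (move2 k k' k'') ⟨d, S, x⟩ (2 * (S k).length + 1) fun σ => σ = ⟨d, update (update
      (update S k'' ((S k).reverse ++ S k'')) k' ((S k).reverse ++ S k')) k [], x⟩ := by
  induction h : S k generalizing S with
  | nil =>
    refine Run.loop_false (by simp [St.view, h]) ?_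
    congr 1
    funext i
    simp only [Function.update_apply]
    split_ifs <;> simp_all
  | cons g s ih =>
    refine (Run.loop_true (T := 1) (by simp [St.view, h]) (run_doOps rfl) ?_).weaken
      (T := 1 + (2 * s.length + 1) + 1) (by simp; omega)
    rintro _ rfl
    simp only [St.view, sem, h, Op.ap, pushO]
    refine (ih _ (by simp)).mono le_rfl ?_
    rintro _ rfl
    congr 1
    funext i
    simp only [Function.update_apply]
    split_ifs <;> simp_all

/-- Empty one stack. -/
noncomputable def empty (k : Stk K) : Prog D K := .clear fun i => decide (i = k)

theorem run_empty (k : Stk K) (d : D) (S : Stk K → List Cell) (x : Str) :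
    Run φ (empty k) ⟨d, S, x⟩ 1 fun σ => σ = ⟨d, update S k [], x⟩ := by
  refine Run.clear ?_
  simp only [St.clr]
  congr 1
  funext i
  by_cases hi : i = k
  · subst hi; simp
  · simp [hi]

end Basic

/-! ### Zippers -/

/-- The cells of a tape with the cells `L` to the left of position `h` (nearest first) and the cells
`R` from position `h` on. -/
def zc (L R : List Cell) (h j : ℤ) : Option Sym :=
  if h ≤ j then (R[(j - h).toNat]?).join else (L[(h - 1 - j).toNat]?).join

/-- The tape with these cells and the head in position `h`. -/
def zt (L R : List Cell) (h : ℤ) : Tape := ⟨zc L R h, h⟩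

theorem zt_read (L R : List Cell) (h : ℤ) : (zt L R h).read = R.head?.join := by
  cases R <;> simp [Tape.read, zt, zc]

theorem zc_right (L R : List Cell) (h : ℤ) : zc (R.head?.join :: L) R.tail (h + 1) = zc L R h := by
  funext j
  simp only [zc]
  rcases lt_trichotomy j h with hj | rfl | hj
  · rw [if_neg (by omega), if_neg (by omega)]
    rw [show (h + 1 - 1 - j).toNat = (h - 1 - j).toNat + 1 by omega]
    simp
  · rw [if_neg (by omega), if_pos le_rfl]
    cases R <;> simp
  · rw [if_pos (by omega), if_pos (by omega)]
    rw [show (j - h).toNat = (j - (h + 1)).toNat + 1 by omega]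
    cases R <;> simp

theorem zc_left (L R : List Cell) (h : ℤ) : zc L.tail (L.head?.join :: R) (h - 1) = zc L R h := by
  have := zc_right L.tail (L.head?.join :: R) (h - 1)
  rw [← this]
  simp only [List.head?_cons, List.tail_cons, sub_add_cancel]
  funext j
  simp only [zc]
  split_ifs with hj
  · rfl
  · cases L with
    | nil => cases (h - 1 - j).toNat <;> simp
    | cons x L => simp

theorem zc_write (L R : List Cell) (h : ℤ) (s : Cell) :
    zc L (s :: R.tail) h = update (zc L R h) h s := by
  funext j
  simp only [zc, Function.update_apply]
  rcases lt_trichotomy j h with hj | rfl | hj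
  · rw [if_neg (by omega), if_neg (by omega), if_neg (by omega)]
  · simp
  · rw [if_pos (by omega), if_neg (by omega), if_pos (by omega)]
    obtain ⟨m, hm⟩ : ∃ m : ℕ, (j - h).toNat = m + 1 := ⟨(j - h).toNat - 1, by omega⟩
    rw [hm]
    cases R <;> simp

theorem zt_stay (L R : List Cell) (h : ℤ) (s : Cell) :
    (zt L R h).act s .stay = zt L (s :: R.tail) h := by
  simp [zt, Tape.act, zc_write, Dir.offset]

theorem zt_right (L R : List Cell) (h : ℤ) (s : Cell) :
    (zt L R h).act s .right = zt (s :: L) R.tail (h + 1) := by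
  have := zc_right L (s :: R.tail) h
  simp only [List.head?_cons, Option.join_some, List.tail_cons] at this
  simp [zt, Tape.act, zc_write, Dir.offset, this]

theorem zt_left (L R : List Cell) (h : ℤ) (s : Cell) :
    (zt L R h).act s .left = zt L.tail (L.head?.join :: s :: R.tail) (h - 1) := by
  have := zc_left L (s :: R.tail) h
  simp only [zt, Tape.act, Dir.offset, this, zc_write]
  rfl

theorem zt_content (L R : List Cell) :
    R.takeWhile Option.isSome = (zt L R 0).content.map some := by
  have key : ∀ R : List Cell, ∃ q : Str, R.takeWhile Option.isSome = q.map some ∧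
      (∀ i : ℕ, i < q.length → (R[i]?).join = q[i]?) ∧ (R[q.length]?).join = none := by
    intro R
    induction R with
    | nil => exact ⟨[], by simp⟩
    | cons g R ih =>
      cases g with
      | none => exact ⟨[], by simp⟩
      | some x =>
        obtain ⟨q, h1, h2, h3⟩ := ih
        refine ⟨x :: q, by simp [h1], ?_, by simpa using h3⟩
        intro i hi
        cases i with
        | zero => simp
        | succ i => simpa using h2 i (by simpa using hi)
  obtain ⟨q, h1, h2, h3⟩ := key R
  rw [h1, Tape.content_eq (T := zt L R 0) (q := q)]
  · intro i hi
    simp [zt, zc, h2 i hi]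
  · simp [zt, zc, h3]

theorem content_congr {T T' : Tape} (h : T.cell = T'.cell) : T.content = T'.content := by
  simp [Tape.content, h]

/-! ### Runs of oracle machines -/

namespace OracleMachine

variable {M : OracleMachine} {θ θ' : Baire} {a : Str}

theorem conf_succ (s : ℕ) :
    M.conf θ a (s + 1) = (M.step θ (M.conf θ a s)).getD (M.conf θ a s) := by
  rw [conf, Function.iterate_succ_apply']; rfl

theorem conf_of_halted {n s : ℕ} (h : M.HaltedBy θ a n) (hs : n ≤ s) :
    M.conf θ a s = M.conf θ a n := by
  induction s, hs using Nat.le_induction with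
  | base => rfl
  | succ s _ ih =>
    rw [conf_succ, ih, show M.step θ (M.conf θ a n) = none from h]
    rfl

theorem HaltedBy.mono {n s : ℕ} (h : M.HaltedBy θ a n) (hs : n ≤ s) : M.HaltedBy θ a s := by
  rw [HaltedBy, conf_of_halted h hs]; exact h

theorem content_find (h : ∃ t, M.HaltedBy θ a t) [DecidablePred fun t => M.HaltedBy θ a t] {n : ℕ}
    (hn : M.HaltedBy θ a n) : M.conf θ a (Nat.find h) = M.conf θ a n :=
  (conf_of_halted (Nat.find_spec h) (Nat.find_min' h hn)).symm

theorem haltedBy_of_time_le {n : ℕ} (h : M.time θ a ≤ n) : M.HaltedBy θ a n := by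
  by_contra hn
  have : ((n + 1 : ℕ) : ℕ∞) ≤ M.time θ a := by
    refine le_iInf₂ fun t ht => ?_
    rw [Nat.cast_le]
    by_contra hlt
    exact hn (ht.mono (by omega))
  have := this.trans h
  rw [Nat.cast_le] at this
  omega

theorem time_le_of_haltedBy {n : ℕ} (h : M.HaltedBy θ a n) : M.time θ a ≤ n :=
  iInf₂_le n h

/-- A head moves by at most one cell in each step. -/
theorem head_le (s : ℕ) (i : TapeIx M.Work) : |((M.conf θ a s).tape i).head| ≤ s := by
  induction s with
  | zero => cases i <;> simp [conf, init, Tape.blank, Tape.load]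
  | succ s ih =>
    rw [conf_succ]
    have hd : ∀ d : Dir, |d.offset| ≤ 1 := by intro d; cases d <;> simp [Dir.offset]
    cases h : M.step θ (M.conf θ a s) with
    | none => simp only [Option.getD_none]; push_cast; omega
    | some c =>
      rw [step] at h
      split at h
      · cases h
        simp only [Option.getD_some]
        cases i <;> exact ih.trans (by push_cast; omega)
      · simp only [Option.map_eq_some_iff] at h
        obtain ⟨r, -, rfl⟩ := h
        simp only [Option.getD_some, Tape.act]
        push_cast
        exact (abs_add_le _ _).trans (add_le_add ih (hd _))

/-- The tapes on which neither an argument nor an answer is placed are blank ahead of time. -/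
theorem cell_blank (s : ℕ) (i : TapeIx M.Work) (hi : i ≠ .input) (ha : i ≠ .answer) (j : ℤ)
    (hj : (s : ℤ) ≤ j) : ((M.conf θ a s).tape i).cell j = none := by
  induction s with
  | zero => cases i <;> simp_all [conf, init, Tape.blank]
  | succ s ih =>
    have ih := ih (by omega)
    rw [conf_succ]
    cases h : M.step θ (M.conf θ a s) with
    | none => simpa using ih
    | some c =>
      rw [step] at h
      split at h
      · cases h
        simp only [Option.getD_some]
        cases i <;> simp_all [callOracle]
      · simp only [Option.map_eq_some_iff] at h
        obtain ⟨r, -, rfl⟩ := h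
        have := abs_le.1 (head_le (M := M) (θ := θ) (a := a) s i)
        simp only [Option.getD_some, Tape.act]
        rw [Function.update_of_ne (by omega), ih]

theorem _root_.ParamSpace.Tape.content_length_le {T : Tape} {s : ℕ} (h : T.cell s = none) :
    T.content.length ≤ s := by
  refine (List.length_filterMap_le _ _).trans ?_
  rw [List.length_range]
  exact Nat.sInf_le h

theorem content_length_le (s : ℕ) (i : TapeIx M.Work) (hi : i ≠ .input) (ha : i ≠ .answer) :
    ((M.conf θ a s).tape i).content.length ≤ s :=
  Tape.content_length_le (cell_blank s i hi ha s le_rfl)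

/-- The strings about which the machine asks the oracle in its first `n` steps. -/
def queries (M : OracleMachine) (θ : Baire) (a : Str) (n : ℕ) : Set Str :=
  {q | ∃ s < n, (M.oracle (M.conf θ a s).state).isSome ∧
    ((M.conf θ a s).tape .query).content = q}

theorem query_length_le {n : ℕ} {q : Str} (h : q ∈ M.queries θ a n) : q.length < n := by
  obtain ⟨s, hs, -, rfl⟩ := h
  exact (content_length_le s .query (by simp) (by simp)).trans_lt hs

/-- A run depends only on the answers to its queries. -/
theorem conf_congr {n : ℕ} (h : ∀ q ∈ M.queries θ a n, θ q = θ' q) {s : ℕ} (hs : s ≤ n) :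
    M.conf θ a s = M.conf θ' a s := by
  induction s with
  | zero => rfl
  | succ s ih =>
    rw [conf_succ, conf_succ, ← ih (by omega)]
    congr 1
    simp only [step]
    cases hq : M.oracle (M.conf θ a s).state with
    | none => rfl
    | some q =>
      simp only [Option.some.injEq]
      congr 1
      funext i
      cases i <;> simp [callOracle]
      rw [h]
      exact ⟨s, by omega, by simp [hq], rfl⟩

end OracleMachine

/-! ### Registers and data -/

/-- The registers. A simulated tape `i` is kept in the stacks `L i` and `R i`, to the left and to
the right of its head, with the head position in unary in `P i` (if positive) or `N i`. The string
asked by a simulated machine is passed in `harg`; `tmp`, `cd` and `tp` are scratch space, as are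
`An`, `Ab`, `w2` and `X2`. A record is kept in `A c` (the approximation) and `Z c` (the grade), and
`cnt` is the index of the next query to a sequence. The other registers hold the input, which
counts rounds (`fuel`), the digits of the midpoint and the radius of an interval (`ma`, `rb`), the digits of the
shifts of the grids (`th c`, `tb c`), the digits of the shifted endpoints (`lo c`, `hi c`), an address
and as many digits of the shift (`w`, `tw`), and the digits of the argument of a level (`X`). -/
inductive Rg (W : Type) where
  | L (i : TapeIx W)
  | R (i : TapeIx W)
  | P (i : TapeIx W)
  | N (i : TapeIx W)
  | harg
  | tmp
  | cd
  | tp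
  | An
  | A (c : Bool)
  | Z (c : Bool)
  | Ab
  | fuel
  | cnt
  | ma
  | rb
  | th (c : Bool)
  | lo (c : Bool)
  | hi (c : Bool)
  | tb (c : Bool)
  | w
  | tw
  | w2
  | X
  | X2

instance {W : Type} [Finite W] : Finite (TapeIx W) :=
  Finite.of_surjective (α := Fin 4 ⊕ W) (fun x => match x with
    | .inl 0 => .input | .inl 1 => .output | .inl 2 => .query | .inl 3 => .answer
    | .inr w => .work w) fun i => match i with
    | .input => ⟨.inl 0, rfl⟩ | .output => ⟨.inl 1, rfl⟩ | .query => ⟨.inl 2, rfl⟩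
    | .answer => ⟨.inl 3, rfl⟩ | .work w => ⟨.inr w, rfl⟩

instance {W : Type} [Finite W] : Finite (Rg W) :=
  Finite.of_surjective (α := (Fin 4 × TapeIx W) ⊕ (Fin 6 × Bool) ⊕ Fin 15) (fun x => match x with
    | .inl (0, i) => .L i | .inl (1, i) => .R i | .inl (2, i) => .P i | .inl (3, i) => .N i
    | .inr (.inl (0, c)) => .A c | .inr (.inl (1, c)) => .Z c | .inr (.inl (2, c)) => .th c
    | .inr (.inl (3, c)) => .lo c | .inr (.inl (4, c)) => .hi c | .inr (.inl (5, c)) => .tb c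
    | .inr (.inr 0) => .harg | .inr (.inr 1) => .tmp | .inr (.inr 2) => .cd
    | .inr (.inr 3) => .tp | .inr (.inr 4) => .An | .inr (.inr 5) => .Ab
    | .inr (.inr 6) => .fuel | .inr (.inr 7) => .cnt | .inr (.inr 8) => .ma
    | .inr (.inr 9) => .rb | .inr (.inr 10) => .w | .inr (.inr 11) => .tw
    | .inr (.inr 12) => .w2 | .inr (.inr 13) => .X | .inr (.inr 14) => .X2) fun i => match i with
    | .L i => ⟨.inl (0, i), rfl⟩ | .R i => ⟨.inl (1, i), rfl⟩ | .P i => ⟨.inl (2, i), rfl⟩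
    | .N i => ⟨.inl (3, i), rfl⟩
    | .A c => ⟨.inr (.inl (0, c)), rfl⟩ | .Z c => ⟨.inr (.inl (1, c)), rfl⟩
    | .th c => ⟨.inr (.inl (2, c)), rfl⟩ | .lo c => ⟨.inr (.inl (3, c)), rfl⟩
    | .hi c => ⟨.inr (.inl (4, c)), rfl⟩ | .tb c => ⟨.inr (.inl (5, c)), rfl⟩
    | .harg => ⟨.inr (.inr 0), rfl⟩ | .tmp => ⟨.inr (.inr 1), rfl⟩
    | .cd => ⟨.inr (.inr 2), rfl⟩ | .tp => ⟨.inr (.inr 3), rfl⟩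
    | .An => ⟨.inr (.inr 4), rfl⟩ | .Ab => ⟨.inr (.inr 5), rfl⟩
    | .fuel => ⟨.inr (.inr 6), rfl⟩ | .cnt => ⟨.inr (.inr 7), rfl⟩
    | .ma => ⟨.inr (.inr 8), rfl⟩ | .rb => ⟨.inr (.inr 9), rfl⟩ | .w => ⟨.inr (.inr 10), rfl⟩
    | .tw => ⟨.inr (.inr 11), rfl⟩ | .w2 => ⟨.inr (.inr 12), rfl⟩
    | .X => ⟨.inr (.inr 13), rfl⟩ | .X2 => ⟨.inr (.inr 14), rfl⟩

/-- The finite data: the state of the simulated machine, whether it has terminated, flags, the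
symbols that were read last, and small counters. -/
structure Dat (Q : Type) where
  q : Q
  halt : Bool
  bad : Bool
  ok : Bool
  s1 : Sym
  s2 : Sym
  s3 : Sym
  sgn : Bool
  lc : Bool → Fin 6
  hc : Bool → Fin 6

instance {Q : Type} [Finite Q] : Finite (Dat Q) :=
  Finite.of_injective (fun d : Dat Q =>
    (d.q, d.halt, d.bad, d.ok, d.s1, d.s2, d.s3, d.sgn, d.lc, d.hc)) fun a b h => by
    cases a; cases b; simp_all

/-! ### Simulation of an oracle machine by a stack program -/

section Sim

variable {M : OracleMachine}

/-- The stack of the cells from the head position on. For the answer tape this is the answer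
stack. -/
def Rs {W : Type} : TapeIx W → Stk (Rg W)
  | .answer => .ans
  | i => .reg (.R i)

theorem Rs_inj {W : Type} {i j : TapeIx W} : Rs i = Rs j ↔ i = j := by
  cases i <;> cases j <;> simp [Rs]

@[simp] theorem Rs_ne_L {W : Type} (i j : TapeIx W) : Rs i ≠ .reg (.L j) := by
  cases i <;> simp [Rs]

@[simp] theorem Rs_ne_P {W : Type} (i j : TapeIx W) : Rs i ≠ .reg (.P j) := by
  cases i <;> simp [Rs]

@[simp] theorem Rs_ne_N {W : Type} (i j : TapeIx W) : Rs i ≠ .reg (.N j) := by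
  cases i <;> simp [Rs]

@[simp] theorem Rs_ne_tp {W : Type} (i : TapeIx W) : Rs i ≠ .reg .tp := by
  cases i <;> simp [Rs]

@[simp] theorem Rs_ne_cd {W : Type} (i : TapeIx W) : Rs i ≠ .reg .cd := by
  cases i <;> simp [Rs]

@[simp] theorem Rs_ne_tmp {W : Type} (i : TapeIx W) : Rs i ≠ .reg .tmp := by
  cases i <;> simp [Rs]

@[simp] theorem Rs_ne_harg {W : Type} (i : TapeIx W) : Rs i ≠ .reg .harg := by
  cases i <;> simp [Rs]

/-- The stacks that the simulation uses. -/
def Scratch {W : Type} : Stk (Rg W) → Prop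
  | .ans => True
  | .reg (.L _) => True
  | .reg (.R _) => True
  | .reg (.P _) => True
  | .reg (.N _) => True
  | .reg .harg => True
  | .reg .tmp => True
  | .reg .cd => True
  | .reg .tp => True
  | _ => False

/-- The simulated tape. -/
def simT {W : Type} (S : Stk (Rg W) → List Cell) (i : TapeIx W) : Tape :=
  zt (S (.reg (.L i))) (S (Rs i)) ((S (.reg (.P i))).length - (S (.reg (.N i))).length)

/-- The stacks hold the tapes `t`, and agree with `S₀` where the simulation does not touch them. -/
structure SimOk {W : Type} (S₀ : Stk (Rg W) → List Cell) (t : TapeIx W → Tape)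
    (S : Stk (Rg W) → List Cell) : Prop where
  tape : ∀ i, simT S i = t i
  excl : ∀ i, S (.reg (.P i)) = [] ∨ S (.reg (.N i)) = []
  harg : S (.reg .harg) = []
  tmp : S (.reg .tmp) = []
  cd : S (.reg .cd) = []
  tp : S (.reg .tp) = []
  base : ∀ k, ¬ Scratch k → S k = S₀ k

/-- What one step of the machine does to the stacks of one tape. -/
def tapeOp (w : Option Sym) : Dir → (l r p n : Option Cell) → (Op × Op × Op × Op)
  | .stay, _, _, _, _ => (.keep, ⟨true, some w, none, none⟩, .keep, .keep)
  | .right, _, _, _, n =>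
    (.put w, .drop, if n.isSome then .keep else .put none, if n.isSome then .drop else .keep)
  | .left, l, _, p, _ =>
    (.drop, ⟨true, some w, some l.join, none⟩, if p.isSome then .drop else .keep,
      if p.isSome then .keep else .put none)

theorem tapeOp_spec (w : Option Sym) (d : Dir) (l r p n : List Cell) (h : p = [] ∨ n = []) :
    let o := tapeOp w d l.head? r.head? p.head? n.head?
    zt (o.1.ap l) (o.2.1.ap r) ((o.2.2.1.ap p).length - (o.2.2.2.ap n).length) =
      (zt l r (p.length - n.length)).act w d ∧ (o.2.2.1.ap p = [] ∨ o.2.2.2.ap n = []) := by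
  cases d with
  | stay => exact ⟨by simp [tapeOp, zt_stay, Op.ap, pushO], h⟩
  | right =>
    rw [zt_right]
    cases n with
    | nil => exact ⟨by simp [tapeOp, Op.ap, pushO], by simp [tapeOp, Op.ap, pushO]⟩
    | cons x n =>
      have hp : p = [] := by simpa using h
      subst hp
      refine ⟨?_, by simp [tapeOp, Op.ap, pushO]⟩
      simp only [tapeOp, Op.ap, pushO, List.head?_cons, Option.isSome_some, if_true,
        List.tail_cons, List.length_cons]
      congr 1
      push_cast
      ring
  | left =>
    rw [zt_left]
    cases p with
    | nil =>
      refine ⟨?_, by simp [tapeOp, Op.ap, pushO]⟩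
      simp only [tapeOp, Op.ap, pushO, List.head?_nil, Option.isSome_none]
      simp
      congr 1
      ring
    | cons x p =>
      have hn : n = [] := by simpa using h
      subst hn
      refine ⟨?_, by simp [tapeOp, Op.ap, pushO]⟩
      simp [tapeOp, Op.ap, pushO]

/-- One step without an oracle call. -/
noncomputable def stepP (M : OracleMachine) : Prog (Dat M.State) (Rg M.Work) :=
  .act fun v =>
    match M.trans v.d.q fun i => (v.top (Rs i)).join with
    | none => ⟨{ v.d with halt := true }, fun _ => .keep, false⟩
    | some r =>
      let o := fun i => tapeOp (r.2 i).1 (r.2 i).2 (v.top (.reg (.L i))) (v.top (Rs i))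
        (v.top (.reg (.P i))) (v.top (.reg (.N i)))
      ⟨{ v.d with q := r.1 }, fun k => match k with
        | .reg (.L i) => (o i).1
        | .reg (.R .answer) => .keep
        | .reg (.R i) => (o i).2.1
        | .ans => (o .answer).2.1
        | .reg (.P i) => (o i).2.2.1
        | .reg (.N i) => (o i).2.2.2
        | _ => .keep, false⟩

variable {φ θ : Baire} {S₀ : Stk (Rg M.Work) → List Cell}

theorem run_stepP {t : TapeIx M.Work → Tape} {d : Dat M.State} {S : Stk (Rg M.Work) → List Cell}
    {x : Str} (h : SimOk S₀ t S) (ho : M.oracle d.q = none) :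
    Run φ (stepP M) ⟨d, S, x⟩ 1 fun σ => ∃ S', SimOk S₀
      (match M.step θ ⟨d.q, t⟩ with | none => t | some c => c.tape) S' ∧
      σ = ⟨match M.step θ ⟨d.q, t⟩ with
        | none => { d with halt := true }
        | some c => { d with q := c.state }, S', x⟩ := by
  refine Run.act ?_
  have hr : (fun i => ((S (Rs i)).head?).join) = fun i => (t i).cell (t i).head := by
    funext i
    rw [← zt_read (S (.reg (.L i))) (S (Rs i))
      ((S (.reg (.P i))).length - (S (.reg (.N i))).length), ← h.tape i]
    rfl
  simp only [St.view, St.app, OracleMachine.step, ho, hr]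
  cases M.trans d.q fun i => (t i).cell (t i).head with
  | none => exact ⟨S, h, by simp [Op.keep_ap]⟩
  | some r =>
    refine ⟨_, ?_, rfl⟩
    have key := fun i => tapeOp_spec (r.2 i).1 (r.2 i).2 (S (.reg (.L i))) (S (Rs i))
      (S (.reg (.P i))) (S (.reg (.N i))) (h.excl i)
    constructor
    · intro i
      have h1 := (key i).1
      have h2 := h.tape i
      simp only [simT] at h2
      rw [h2] at h1
      simp only [Option.map_some]
      rw [← h1]
      cases i <;> rfl
    · exact fun i => (key i).2
    · exact h.harg
    · exact h.tmp
    · exact h.cd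
    · exact h.tp
    · intro k hk
      rw [← h.base k hk]
      rcases k with _ | _ | _ | k
      · rfl
      · rfl
      · exact absurd trivial hk
      · cases k <;> first | rfl | exact absurd trivial hk

/-- While there are symbols on `k`, move them to `k'` and move the head of tape `i`, to the right if
`b` and else to the left. -/
noncomputable def walk (b : Bool) (i : TapeIx M.Work) (k k' : Rg M.Work) :
    Prog (Dat M.State) (Rg M.Work) :=
  .loop (fun v => (v.top (.reg k)).isSome) (doOps (fun v => v.d) fun v =>
    [(.reg k, .drop), (.reg k', .put none),
      (if b then Rs i else .reg (.L i), .drop),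
      (if b then .reg (.L i) else Rs i,
        .put (if b then v.top (Rs i) else v.top (.reg (.L i))).join)])

theorem run_walk (b : Bool) (i : TapeIx M.Work) {k k' : Rg M.Work} (hk : k ≠ k')
    (h1 : .reg k ≠ Rs i) (h2 : k ≠ .L i) (h3 : .reg k' ≠ Rs i) (h4 : k' ≠ .L i)
    (d : Dat M.State) (S : Stk (Rg M.Work) → List Cell) (x : Str) :
    Run φ (walk b i k k') ⟨d, S, x⟩ (2 * (S (.reg k)).length + 1) fun σ => ∃ S', σ = ⟨d, S', x⟩ ∧
      (∀ h : ℤ, zc (S' (.reg (.L i))) (S' (Rs i))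
        (if b then h + (S (.reg k)).length else h - (S (.reg k)).length) =
        zc (S (.reg (.L i))) (S (Rs i)) h) ∧
      S' (.reg k) = [] ∧ (S' (.reg k')).length = (S (.reg k)).length + (S (.reg k')).length ∧
      ∀ j, j ≠ .reg k → j ≠ .reg k' → j ≠ .reg (.L i) → j ≠ Rs i → S' j = S j := by
  have hR := Rs_ne_L i i
  induction h : S (.reg k) generalizing S with
  | nil =>
    refine Run.loop_false (by simp [St.view, h]) ⟨S, rfl, ?_, h, by simp, by simp⟩
    cases b <;> simp
  | cons g s ih =>
    refine (Run.loop_true (T := 1) (by simp [St.view, h]) (run_doOps rfl) ?_).weaken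
      (T := 1 + (2 * s.length + 1) + 1) (by simp; omega)
    rintro _ rfl
    cases b with
    | true =>
      simp only [if_true] at ih ⊢
      refine (ih _ ?_).mono le_rfl ?_
      · simp [sem, h, Op.ap, pushO]
      rintro _ ⟨S', rfl, e1, e2, e3, e4⟩
      refine ⟨S', rfl, ?_, e2, ?_, ?_⟩
      · intro z
        have := e1 (z + 1)
        simp only [sem, Op.ap, pushO, St.view, Function.update_apply] at this
        simp only [hR, hR.symm, h1.symm, h3.symm, Stk.reg.injEq, h2.symm, h4.symm,
          if_true, if_false, Bool.false_eq_true] at this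
        rw [← zc_right (S (.reg (.L i)))]
        refine Eq.trans ?_ this
        congr 1
        push_cast [List.length_cons]
        ring
      · rw [e3]
        simp [sem, Op.ap, pushO, hk.symm]
        omega
      · intro j j1 j2 j3 j4
        rw [e4 j j1 j2 j3 j4]
        simp [sem, j1, j2, j3, j4]
    | false =>
      simp only [Bool.false_eq_true, if_false] at ih ⊢
      refine (ih _ ?_).mono le_rfl ?_
      · simp [sem, h, Op.ap, pushO]
      rintro _ ⟨S', rfl, e1, e2, e3, e4⟩
      refine ⟨S', rfl, ?_, e2, ?_, ?_⟩
      · intro z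
        have := e1 (z - 1)
        simp only [sem, Op.ap, pushO, St.view, Function.update_apply] at this
        simp only [hR, hR.symm, h1.symm, h3.symm, Stk.reg.injEq, h2.symm, h4.symm,
          if_true, if_false, Bool.false_eq_true] at this
        rw [← zc_left (S (.reg (.L i)))]
        refine Eq.trans ?_ this
        congr 1
        push_cast [List.length_cons]
        ring
      · rw [e3]
        simp [sem, Op.ap, pushO, hk.symm]
        omega
      · intro j j1 j2 j3 j4
        rw [e4 j j1 j2 j3 j4]
        simp [sem, j1, j2, j3, j4]

/-- Move the head of tape `i` to cell `0`; its position is remembered in `tp` and `cd`. -/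
noncomputable def home (i : TapeIx M.Work) : Prog (Dat M.State) (Rg M.Work) :=
  .seq (walk false i (.P i) .tp) (walk true i (.N i) .cd)

/-- Move the head of tape `i` from cell `0` to the position given by `tp` and `cd`. -/
noncomputable def away (i : TapeIx M.Work) : Prog (Dat M.State) (Rg M.Work) :=
  .seq (walk true i .tp (.P i)) (walk false i .cd (.N i))

theorem run_home (i : TapeIx M.Work) (d : Dat M.State) (S : Stk (Rg M.Work) → List Cell) (x : Str)
    (hp : S (.reg .tp) = []) (hc : S (.reg .cd) = []) :
    Run φ (home i) ⟨d, S, x⟩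
      (2 * (S (.reg (.P i))).length + 1 + (2 * (S (.reg (.N i))).length + 1))
      fun σ => ∃ S', σ = ⟨d, S', x⟩ ∧
        zc (S' (.reg (.L i))) (S' (Rs i)) 0 = (simT S i).cell ∧
        S' (.reg (.P i)) = [] ∧ S' (.reg (.N i)) = [] ∧
        (S' (.reg .tp)).length = (S (.reg (.P i))).length ∧
        (S' (.reg .cd)).length = (S (.reg (.N i))).length ∧
        ∀ j, j ≠ .reg (.P i) → j ≠ .reg (.N i) → j ≠ .reg (.L i) → j ≠ Rs i → j ≠ .reg .tp →
          j ≠ .reg .cd → S' j = S j := by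
  refine (run_walk (φ := φ) false i (k := .P i) (k' := .tp) (by simp) (Rs_ne_P i i).symm (by simp)
    (Rs_ne_tp i).symm (by simp) d S x).seq
    (T' := 2 * (S (.reg (.N i))).length + 1) ?_
  rintro _ ⟨S', rfl, e1, e2, e3, e4⟩
  have hN := e4 (.reg (.N i)) (by simp) (by simp) (by simp) (Rs_ne_N i i).symm
  have hC := e4 (.reg .cd) (by simp) (by simp) (by simp) (Rs_ne_cd i).symm
  rw [← hN]
  refine (run_walk (φ := φ) true i (k := .N i) (k' := .cd) (by simp) (Rs_ne_N i i).symm (by simp)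
    (Rs_ne_cd i).symm (by simp) d S' x).mono le_rfl ?_
  rintro _ ⟨S'', rfl, f1, f2, f3, f4⟩
  have g1 := f4 (.reg (.P i)) (by simp) (by simp) (by simp) (Rs_ne_P i i).symm
  have g2 := f4 (.reg .tp) (by simp) (by simp) (by simp) (Rs_ne_tp i).symm
  refine ⟨S'', rfl, ?_, by rw [g1, e2], f2, by rw [g2, e3, hp]; simp,
    by rw [f3, hC, hc]; simp, ?_⟩
  · simp only [simT, zt]
    rw [← e1, ← f1]
    congr 1
    simp [hN]
  · intro j j1 j2 j3 j4 j5 j6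
    rw [f4 j j2 j6 j3 j4, e4 j j1 j5 j3 j4]

theorem run_away (i : TapeIx M.Work) (d : Dat M.State) (S : Stk (Rg M.Work) → List Cell) (x : Str)
    (hp : S (.reg (.P i)) = []) (hn : S (.reg (.N i)) = []) :
    Run φ (away i) ⟨d, S, x⟩
      (2 * (S (.reg .tp)).length + 1 + (2 * (S (.reg .cd)).length + 1))
      fun σ => ∃ S', σ = ⟨d, S', x⟩ ∧
        simT S' i = ⟨zc (S (.reg (.L i))) (S (Rs i)) 0,
          (S (.reg .tp)).length - (S (.reg .cd)).length⟩ ∧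
        S' (.reg .tp) = [] ∧ S' (.reg .cd) = [] ∧
        (S' (.reg (.P i))).length = (S (.reg .tp)).length ∧
        (S' (.reg (.N i))).length = (S (.reg .cd)).length ∧
        ∀ j, j ≠ .reg (.P i) → j ≠ .reg (.N i) → j ≠ .reg (.L i) → j ≠ Rs i → j ≠ .reg .tp →
          j ≠ .reg .cd → S' j = S j := by
  refine (run_walk (φ := φ) true i (k := .tp) (k' := .P i) (by simp) (Rs_ne_tp i).symm (by simp)
    (Rs_ne_P i i).symm (by simp) d S x).seq
    (T' := 2 * (S (.reg .cd)).length + 1) ?_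
  rintro _ ⟨S', rfl, e1, e2, e3, e4⟩
  have hN := e4 (.reg (.N i)) (by simp) (by simp) (by simp) (Rs_ne_N i i).symm
  have hC := e4 (.reg .cd) (by simp) (by simp) (by simp) (Rs_ne_cd i).symm
  rw [← hC]
  refine (run_walk (φ := φ) false i (k := .cd) (k' := .N i) (by simp) (Rs_ne_cd i).symm (by simp)
    (Rs_ne_N i i).symm (by simp) d S' x).mono le_rfl ?_
  rintro _ ⟨S'', rfl, f1, f2, f3, f4⟩
  have g1 := f4 (.reg (.P i)) (by simp) (by simp) (by simp) (Rs_ne_P i i).symm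
  have g2 := f4 (.reg .tp) (by simp) (by simp) (by simp) (Rs_ne_tp i).symm
  have l1 : (S'' (.reg (.P i))).length = (S (.reg .tp)).length := by rw [g1, e3, hp]; simp
  have l2 : (S'' (.reg (.N i))).length = (S' (.reg .cd)).length := by rw [f3, hN, hn]; simp
  refine ⟨S'', rfl, ?_, by rw [g2, e2], f2, l1, l2, ?_⟩
  · simp only [simT, zt, l1, l2]
    rw [← e1, ← f1]
    simp
  · intro j j1 j2 j3 j4 j5 j6
    rw [f4 j j6 j2 j3 j4, e4 j j5 j1 j3 j4]

end Sim

namespace OracleMachine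

variable {M : OracleMachine} {θ θ' : Baire} {a : Str}

theorem mem_queries_succ {n : ℕ} {q : Str} : q ∈ M.queries θ a (n + 1) ↔ q ∈ M.queries θ a n ∨
    (M.oracle (M.conf θ a n).state).isSome ∧ ((M.conf θ a n).tape .query).content = q := by
  constructor
  · rintro ⟨s, hs, h⟩
    rcases Nat.lt_succ_iff_lt_or_eq.1 hs with hs | rfl
    · exact .inl ⟨s, hs, h⟩
    · exact .inr h
  · rintro (⟨s, hs, h⟩ | h)
    · exact ⟨s, by omega, h⟩
    · exact ⟨n, by omega, h⟩

theorem HaltedBy.oracle_eq_none {n : ℕ} (h : M.HaltedBy θ a n) :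
    M.oracle (M.conf θ a n).state = none := by
  simp only [HaltedBy, step] at h
  split at h
  · simp at h
  · assumption

theorem queries_of_halted {n s : ℕ} (h : M.HaltedBy θ a n) (hs : n ≤ s) :
    M.queries θ a s = M.queries θ a n := by
  induction s, hs using Nat.le_induction with
  | base => rfl
  | succ s hs ih =>
    ext q
    rw [mem_queries_succ, ih, (h.mono hs).oracle_eq_none]
    simp

end OracleMachine

section Sim

variable {M : OracleMachine} {φ θ : Baire} {S₀ : Stk (Rg M.Work) → List Cell} {ok : Set Str}
  {H : Prog (Dat M.State) (Rg M.Work)} {hb n : ℕ} {x : Str}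

/-- The program `H` answers queries: it replaces a string `q` in `harg` by `θ q` on the answer
stack, and reports in the flag `bad` whether `q` is outside `ok`. This is required for `q` of length
at most `n`, and where the stacks that are not used in the simulation are as in `S₀`. -/
def Handles (φ : Baire) (H : Prog (Dat M.State) (Rg M.Work)) (θ : Baire) (ok : Set Str) (hb n : ℕ)
    (S₀ : Stk (Rg M.Work) → List Cell) (x : Str) : Prop :=
  ∀ d S q, (∀ k, ¬ Scratch k → S k = S₀ k) → q.length ≤ n → S (.reg .harg) = q.map some →
    S (.reg .tmp) = [] → S (.reg .cd) = [] → S (.reg .tp) = [] → S .ans = [] →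
    Run φ H ⟨d, S, x⟩ hb fun σ => ∃ d', σ = ⟨d', update (update S (.reg .harg) []) .ans
      ((θ q).map some), x⟩ ∧ d'.q = d.q ∧ d'.halt = d.halt ∧
      (d'.bad = false ↔ d.bad = false ∧ q ∈ ok)

/-- Move the content of tape `i`, with its head on cell `0`, to the stack `tmp`. -/
noncomputable def grab (i : TapeIx M.Work) : Prog (Dat M.State) (Rg M.Work) :=
  .loop (fun v => (v.top (Rs i)).join.isSome) (doOps (fun v => v.d) fun v =>
    [(Rs i, .drop), (.reg .tmp, .put (v.top (Rs i)).join)])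

theorem run_grab (i : TapeIx M.Work) (d : Dat M.State) (S : Stk (Rg M.Work) → List Cell) (x : Str) :
    Run φ (grab i) ⟨d, S, x⟩ (2 * ((S (Rs i)).takeWhile Option.isSome).length + 1) fun σ =>
      σ = ⟨d, update (update S (.reg .tmp)
        (((S (Rs i)).takeWhile Option.isSome).reverse ++ S (.reg .tmp))) (Rs i)
        ((S (Rs i)).dropWhile Option.isSome), x⟩ := by
  have hR := Rs_ne_tmp i
  induction h : S (Rs i) generalizing S with
  | nil =>
    refine Run.loop_false (by simp [St.view, h]) ?_
    congr 1
    funext j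
    simp only [Function.update_apply]
    split_ifs <;> simp_all
  | cons g s ih =>
    cases g with
    | none =>
      refine Run.loop_false (by simp [St.view, h]) ?_
      congr 1
      funext j
      simp only [Function.update_apply]
      split_ifs <;> simp_all
    | some g =>
      refine (Run.loop_true (T := 1) (by simp [St.view, h]) (run_doOps rfl) ?_).weaken
        (T := 1 + (2 * (s.takeWhile Option.isSome).length + 1) + 1) (by simp; omega)
      rintro _ rfl
      simp only [St.view, sem, h, Op.ap, pushO]
      refine (ih _ (by simp)).mono le_rfl ?_
      rintro _ rfl
      congr 1
      funext j
      simp only [Function.update_apply]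
      split_ifs <;> simp_all

theorem SimOk.length_le {t : TapeIx M.Work → Tape} {S : Stk (Rg M.Work) → List Cell}
    (h : SimOk S₀ t S) {i : TapeIx M.Work} (hi : |(t i).head| ≤ n) :
    (S (.reg (.P i))).length ≤ n ∧ (S (.reg (.N i))).length ≤ n := by
  have h1 := h.excl i
  have h2 : (t i).head = (S (.reg (.P i))).length - (S (.reg (.N i))).length := by
    rw [← h.tape i]; rfl
  rw [h2, abs_le] at hi
  rcases h1 with h1 | h1 <;> simp only [h1, List.length_nil] at hi ⊢ <;> omega

theorem takeWhile_of_cell {L R : List Cell} {T : Tape} (h : zc L R 0 = T.cell) :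
    R.takeWhile Option.isSome = T.content.map some := by
  rw [zt_content L R, content_congr (T := zt L R 0) (T' := T) h]

/-- The simulation of an oracle call. -/
noncomputable def callP (M : OracleMachine) (H : Prog (Dat M.State) (Rg M.Work)) :
    Prog (Dat M.State) (Rg M.Work) :=
  .seq (home .query) <| .seq (grab .query) <| .seq (move2 (.reg .tmp) (Rs .query) (.reg .harg)) <|
  .seq (away .query) <| .seq (empty .ans) <| .seq H <| .seq (empty (.reg (.L .answer))) <|
  .seq (move (.reg (.P .answer)) (.reg .tp)) <| .seq (move (.reg (.N .answer)) (.reg .cd)) <|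
  .seq (away .answer) (doOps (fun v => { v.d with q := (M.oracle v.d.q).getD v.d.q }) fun _ => [])

theorem zc_load (T : Tape) (s : Str) : zc [] (s.map some) 0 = (T.load s).cell := by
  funext j
  simp only [zc, Tape.load]
  split_ifs with h
  · rw [List.getElem?_map]
    cases h' : s[(j - 0).toNat]? <;> simp_all
  · simp

theorem run_callP {t : TapeIx M.Work → Tape} {d : Dat M.State} {S : Stk (Rg M.Work) → List Cell}
    {q' : M.State} (hH : Handles φ H θ ok hb n S₀ x) (h : SimOk S₀ t S)
    (ho : M.oracle d.q = some q') (hh : ∀ i, |(t i).head| ≤ n) (hc : (t .query).content.length ≤ n) :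
    Run φ (callP M H) ⟨d, S, x⟩ (20 * n + hb + 20) fun σ => ∃ d' S', σ = ⟨d', S', x⟩ ∧
      SimOk S₀ (M.callOracle θ t) S' ∧ d'.q = q' ∧ d'.halt = d.halt ∧
      (d'.bad = false ↔ d.bad = false ∧ (t .query).content ∈ ok) := by
  have hq := h.length_le (hh .query)
  have ha := h.length_le (hh .answer)
  refine Run.weaken (T := (4 * n + 2) + ((2 * n + 1) + ((2 * n + 1) + ((4 * n + 2) + (1 + (hb +
    (1 + ((2 * n + 1) + ((2 * n + 1) + ((4 * n + 2) + 1)))))))))) ?_ (by omega)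
  refine ((run_home .query d S x h.tp h.cd).weaken (by omega)).seq ?_
  rintro _ ⟨S1, rfl, a1, a2, a3, a4, a5, a6⟩
  rw [h.tape] at a1
  have hw := takeWhile_of_cell a1
  refine ((run_grab .query d S1 x).weaken (by rw [hw, List.length_map]; omega)).seq ?_
  rintro _ rfl
  have b1 : S1 (.reg .tmp) = [] := by
    rw [a6 _ (by simp) (by simp) (by simp) (by simp [Rs]) (by simp) (by simp), h.tmp]
  have b2 : S1 (.reg .harg) = [] := by
    rw [a6 _ (by simp) (by simp) (by simp) (by simp [Rs]) (by simp) (by simp), h.harg]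
  have hRt : Rs (.query : TapeIx M.Work) ≠ .reg .tmp := Rs_ne_tmp _
  have hRh : Rs (.query : TapeIx M.Work) ≠ .reg .harg := Rs_ne_harg _
  have hsplit := List.takeWhile_append_dropWhile (p := Option.isSome) (l := S1 (Rs .query))
  rw [hw] at hsplit
  obtain ⟨S2, hS2⟩ : ∃ S2, S2 = update S1 (.reg .harg) ((t .query).content.map some) := ⟨_, rfl⟩
  refine ((run_move2 hRt.symm (by simp) hRh _ _ _).mono (Q' := fun σ => σ = ⟨d, S2, x⟩) ?_ ?_).seq ?_
  · simp [hRt.symm, b1, hw, hc]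
  · rintro _ rfl
    rw [hS2]
    congr 1
    funext j
    simp only [Function.update_apply]
    split_ifs <;> simp_all
  rintro _ rfl
  have c1 : S2 (.reg .tp) = S1 (.reg .tp) := by simp [hS2]
  have c2 : S2 (.reg .cd) = S1 (.reg .cd) := by simp [hS2]
  refine ((run_away .query d S2 x (by simp [hS2, a2]) (by simp [hS2, a3])).weaken
    (by rw [c1, c2, a4, a5]; omega)).seq ?_
  rintro _ ⟨S3, rfl, f1, f2, f3, f4, f5, f6⟩
  refine (run_empty _ _ _ _).seq ?_
  rintro _ rfl
  have g1 : ∀ j, j ≠ .reg (.P .query) → j ≠ .reg (.N .query) → j ≠ .reg (.L .query) →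
      j ≠ .reg (.R .query) → j ≠ .reg .tp → j ≠ .reg .cd → j ≠ .reg .harg → S3 j = S j := by
    intro j j1 j2 j3 j4 j5 j6 j7
    rw [f6 j j1 j2 j3 j4 j5 j6, hS2, Function.update_of_ne j7, a6 j j1 j2 j3 j4 j5 j6]
  have g2 : S3 (.reg .harg) = (t .query).content.map some := by
    rw [f6 _ (by simp) (by simp) (by simp) (by simp [Rs]) (by simp) (by simp), hS2]
    simp
  have g3 : simT S3 .query = t .query := by
    rw [f1, c1, c2, a4, a5, ← h.tape .query]
    simp only [hS2, simT, zt, Rs]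
    rw [Function.update_of_ne (by simp), Function.update_of_ne (by simp)]
    congr 1
    exact a1.trans (by rw [← h.tape .query]; rfl)
  refine (hH d (update S3 .ans []) _ ?_ hc (by simp [g2]) ?_ ?_ ?_ ?_).seq ?_
  · intro k hk
    rw [← h.base k hk, Function.update_of_ne (by rintro rfl; exact hk trivial)]
    exact g1 k (by rintro rfl; exact hk trivial) (by rintro rfl; exact hk trivial)
      (by rintro rfl; exact hk trivial) (by rintro rfl; exact hk trivial)
      (by rintro rfl; exact hk trivial) (by rintro rfl; exact hk trivial)
      (by rintro rfl; exact hk trivial)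
  · rw [Function.update_of_ne (by simp), g1 _ (by simp) (by simp) (by simp) (by simp) (by simp)
      (by simp) (by simp), h.tmp]
  · simp [f3]
  · simp [f2]
  · simp
  rintro _ ⟨d', rfl, hdq, hdh, hdb⟩
  refine (run_empty _ _ _ _).seq ?_
  rintro _ rfl
  have gP := g1 (.reg (.P .answer)) (by simp) (by simp) (by simp) (by simp) (by simp) (by simp)
    (by simp)
  have gN := g1 (.reg (.N .answer)) (by simp) (by simp) (by simp) (by simp) (by simp) (by simp)
    (by simp)
  refine ((run_move (by simp) _ _ _).weaken (by simp [gP, ha.1])).seq ?_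
  rintro _ rfl
  refine ((run_move (by simp) _ _ _).weaken (by simp [gN, ha.2])).seq ?_
  rintro _ rfl
  refine ((run_away .answer _ _ x ?_ ?_).weaken ?_).seq ?_
  · simp
  · simp
  · simp [f2, f3, gP, gN]; omega
  rintro _ ⟨S4, rfl, k1, k2, k3, k4, k5, k6⟩
  refine run_doOps ?_
  have k6' : ∀ j, j ≠ .reg (.P .answer) → j ≠ .reg (.N .answer) → j ≠ .reg (.L .answer) →
      j ≠ .ans → j ≠ .reg .tp → j ≠ .reg .cd → j ≠ .reg .harg → S4 j = S3 j := by
    intro j j1 j2 j3 j4 j5 j6 j7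
    rw [k6 j j1 j2 j3 j4 j5 j6]
    simp [j1, j2, j3, j4, j5, j6, j7]
  refine ⟨_, S4, rfl, ⟨?_, ?_, ?_, ?_, k3, k2, ?_⟩, ?_, hdh, hdb⟩
  · have hoth : ∀ i : TapeIx M.Work, i ≠ .query → i ≠ .answer → simT S4 i = t i := by
      intro i i1 i2
      rw [← h.tape i]
      have hRq : Rs i ≠ .reg (.R .query) := fun e => i1 (Rs_inj.1 (e.trans rfl))
      have hRa : Rs i ≠ .ans := fun e => i2 (Rs_inj.1 (e.trans rfl))
      simp only [simT]
      rw [k6' (.reg (.L i)) (by simp) (by simp) (by simpa using i2) (by simp) (by simp) (by simp)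
        (by simp), k6' (Rs i) (by simp) (by simp) (by simp) hRa (by simp) (by simp) (by simp),
        k6' (.reg (.P i)) (by simpa using i2) (by simp) (by simp) (by simp) (by simp) (by simp)
        (by simp), k6' (.reg (.N i)) (by simp) (by simpa using i2) (by simp) (by simp) (by simp)
        (by simp) (by simp),
        g1 (.reg (.L i)) (by simp) (by simp) (by simpa using i1) (by simp) (by simp) (by simp)
        (by simp), g1 (Rs i) (by simp) (by simp) (by simp) hRq (by simp) (by simp) (by simp),
        g1 (.reg (.P i)) (by simpa using i1) (by simp) (by simp) (by simp) (by simp) (by simp)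
        (by simp), g1 (.reg (.N i)) (by simp) (by simpa using i1) (by simp) (by simp) (by simp)
        (by simp) (by simp)]
    intro i
    cases i with
    | input => exact hoth _ (by simp) (by simp)
    | output => exact hoth _ (by simp) (by simp)
    | work w => exact hoth _ (by simp) (by simp)
    | query =>
      rw [OracleMachine.callOracle, ← g3]
      · simp only [simT, Rs]
        rw [k6' _ (by simp) (by simp) (by simp) (by simp) (by simp) (by simp) (by simp),
          k6' _ (by simp) (by simp) (by simp) (by simp) (by simp) (by simp) (by simp),
          k6' _ (by simp) (by simp) (by simp) (by simp) (by simp) (by simp) (by simp),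
          k6' _ (by simp) (by simp) (by simp) (by simp) (by simp) (by simp) (by simp)]
      · simp
    | answer =>
      have hl : (t .answer).load (θ (t .query).content) =
          ⟨zc [] ((θ (t .query).content).map some) 0, (t .answer).head⟩ := by
        rw [zc_load (t .answer)]; rfl
      rw [k1, OracleMachine.callOracle, hl, ← h.tape .answer]
      simp [Rs, simT, zt, f2, f3, gP, gN]
  · intro i
    rcases eq_or_ne i .answer with rfl | hi
    · rw [← List.length_eq_zero_iff, ← List.length_eq_zero_iff, k4, k5]
      simpa [f2, f3, gP, gN] using h.excl .answer
    · rw [k6' (.reg (.P i)) (by simpa using hi) (by simp) (by simp) (by simp) (by simp) (by simp)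
        (by simp), k6' (.reg (.N i)) (by simp) (by simpa using hi) (by simp) (by simp) (by simp)
        (by simp) (by simp)]
      rcases eq_or_ne i .query with rfl | hi
      · rw [← List.length_eq_zero_iff, ← List.length_eq_zero_iff, f4, f5, c1, c2, a4, a5]
        simpa using h.excl .query
      · rw [g1 (.reg (.P i)) (by simpa using hi) (by simp) (by simp) (by simp) (by simp) (by simp)
          (by simp), g1 (.reg (.N i)) (by simp) (by simpa using hi) (by simp) (by simp) (by simp)
          (by simp) (by simp)]
        exact h.excl i
  · rw [k6 _ (by simp) (by simp) (by simp) (by simp [Rs]) (by simp) (by simp)]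
    simp
  · rw [k6' _ (by simp) (by simp) (by simp) (by simp) (by simp) (by simp) (by simp),
      g1 _ (by simp) (by simp) (by simp) (by simp) (by simp) (by simp) (by simp), h.tmp]
  · intro k hk
    rw [← h.base k hk, k6' k (by rintro rfl; exact hk trivial) (by rintro rfl; exact hk trivial)
      (by rintro rfl; exact hk trivial) (by rintro rfl; exact hk trivial)
      (by rintro rfl; exact hk trivial) (by rintro rfl; exact hk trivial)
      (by rintro rfl; exact hk trivial)]
    exact g1 k (by rintro rfl; exact hk trivial) (by rintro rfl; exact hk trivial)
      (by rintro rfl; exact hk trivial) (by rintro rfl; exact hk trivial)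
      (by rintro rfl; exact hk trivial) (by rintro rfl; exact hk trivial)
      (by rintro rfl; exact hk trivial)
  · simp [St.view, hdq, ho]

/-- The simulation of `M`: its argument is taken from `tmp` (last symbol on top), its result is left
on the answer stack. -/
noncomputable def sim (M : OracleMachine) (H : Prog (Dat M.State) (Rg M.Work)) :
    Prog (Dat M.State) (Rg M.Work) :=
  .seq (doOps (fun v => { v.d with q := M.start, halt := false }) fun _ => []) <|
  .seq (move (.reg .tmp) (Rs .input)) <|
  .seq (.loop (fun v => !v.d.halt)
    (.ite (fun v => (M.oracle v.d.q).isSome) (callP M H) (stepP M))) <|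
  .seq (home .output) <| .seq (grab .output) <|
  .seq (.clear fun k => open Classical in decide (Scratch k ∧ k ≠ .reg .tmp))
    (move (.reg .tmp) .ans)

/-- The simulation of a run of at most `n` steps. It also detects, by the flag `bad`, whether any query
of the machine was outside `ok`. -/
theorem run_sim {a : Str} {d : Dat M.State} {S : Stk (Rg M.Work) → List Cell}
    (hH : Handles φ H θ ok hb n S x) (hn : M.HaltedBy θ a n)
    (hS : ∀ k, Scratch k → k ≠ .reg .tmp → S k = []) (ht : S (.reg .tmp) = (a.map some).reverse) :
    Run φ (sim M H) ⟨d, S, x⟩ ((n + 1) * (20 * n + hb + 22) + 2 * a.length + 8 * n + 10) fun σ =>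
      ∃ d', σ = ⟨d', update (update S (.reg .tmp) []) .ans
        (((M.conf θ a n).tape .output).content.map some), x⟩ ∧
        (d'.bad = false ↔ d.bad = false ∧ ∀ q ∈ M.queries θ a n, q ∈ ok) := by
  obtain ⟨n₀, hn₀, hle, hmin⟩ : ∃ n₀, M.HaltedBy θ a n₀ ∧ n₀ ≤ n ∧ ∀ s < n₀, ¬ M.HaltedBy θ a s := by
    classical
    exact ⟨Nat.find ⟨n, hn⟩, Nat.find_spec _, Nat.find_min' _ hn, fun s hs => Nat.find_min _ hs⟩
  rw [OracleMachine.conf_of_halted hn₀ hle, OracleMachine.queries_of_halted hn₀ hle]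
  refine Run.weaken (T := 1 + ((2 * a.length + 1) + (((n₀ + 1) * (20 * n + hb + 21 + 1) + 1) +
    ((4 * n + 2) + ((2 * n + 1) + (1 + (2 * n + 1))))))) ?_ ?_
  swap
  · have : (n₀ + 1) * (20 * n + hb + 21 + 1) ≤ (n + 1) * (20 * n + hb + 22) :=
      Nat.mul_le_mul (by omega) (by omega)
    omega
  refine (run_doOps rfl).seq ?_
  rintro _ rfl
  simp only [St.view, sem]
  refine ((run_move (Rs_ne_tmp _).symm _ _ _).weaken (by simp [ht])).seq ?_
  rintro _ rfl
  have hinit : SimOk S (M.init a).tape (update (update S (Rs .input)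
      ((S (.reg .tmp)).reverse ++ S (Rs .input))) (.reg .tmp) []) := by
    have hs : ∀ k, Scratch k → k ≠ Rs .input → update (update S (Rs .input)
      ((S (.reg .tmp)).reverse ++ S (Rs .input))) (.reg .tmp) [] k = [] := by
      intro k hk hk'
      rcases eq_or_ne k (.reg .tmp) with rfl | h
      · simp
      · rw [Function.update_of_ne h, Function.update_of_ne hk', hS k hk h]
    have hb : ∀ L R : List Cell, L = [] → R = [] → zt L R 0 = Tape.blank := by
      rintro _ _ rfl rfl
      simp only [zt, Tape.blank, Tape.mk.injEq, and_true]
      funext j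
      simp [zc]
    refine ⟨?_, ?_, ?_, ?_, ?_, ?_, ?_⟩
    · intro i
      simp only [simT, hs (.reg (.L i)) trivial (by simp [Rs]),
        hs (.reg (.P i)) trivial (by simp [Rs]), hs (.reg (.N i)) trivial (by simp [Rs])]
      cases i with
      | input =>
        have h1 : S (Rs .input) = [] := hS _ trivial (by simp [Rs])
        rw [Function.update_of_ne (by simp), Function.update_self, ht, h1]
        have := zc_load Tape.blank a
        simp only [List.reverse_reverse, List.append_nil, zt, List.length_nil, Nat.cast_zero,
          sub_zero, this]
        rfl
      | output => exact hb _ _ rfl (hs _ trivial (by simp [Rs]))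
      | query => exact hb _ _ rfl (hs _ trivial (by simp [Rs]))
      | answer => exact hb _ _ rfl (hs _ trivial (by simp [Rs]))
      | work w => exact hb _ _ rfl (hs _ trivial (by simp [Rs]))
    · exact fun i => .inl (hs _ trivial (by simp [Rs]))
    · exact hs _ trivial (by simp [Rs])
    · exact hs _ trivial (by simp [Rs])
    · exact hs _ trivial (by simp [Rs])
    · exact hs _ trivial (by simp [Rs])
    · intro k hk
      rw [Function.update_of_ne (by rintro rfl; exact hk trivial),
        Function.update_of_ne (by rintro rfl; exact hk trivial)]
  refine (Run.loop (T := 20 * n + hb + 21) (n := n₀ + 1) (I := fun i σ => ∃ d' S', σ = ⟨d', S', x⟩ ∧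
    SimOk S (M.conf θ a i).tape S' ∧ d'.q = (M.conf θ a i).state ∧ d'.halt = decide (n₀ < i) ∧
    (d'.bad = false ↔ d.bad = false ∧ ∀ q ∈ M.queries θ a i, q ∈ ok)) ?_ ?_ ?_).seq ?_
  · rintro i hi _ ⟨d', S', rfl, h1, h2, h3, h4⟩
    refine ⟨by simp [St.view, h3]; omega, ?_⟩
    refine Run.ite ?_ ?_
    · intro ho
      simp only [St.view, h2, Option.isSome_iff_exists] at ho
      obtain ⟨q', ho⟩ := ho
      refine (run_callP hH h1 (by rw [h2]; exact ho) (fun i => (OracleMachine.head_le _ i).trans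
        (by push_cast; omega)) ((OracleMachine.content_length_le i .query (by simp)
        (by simp)).trans (by omega))).mono le_rfl ?_
      rintro _ ⟨d'', S'', rfl, k1, k2, k3, k4⟩
      have hne : i ≠ n₀ := by
        rintro rfl
        rw [hn₀.oracle_eq_none] at ho
        simp at ho
      have hc : M.conf θ a (i + 1) = ⟨q', M.callOracle θ (M.conf θ a i).tape⟩ := by
        rw [OracleMachine.conf_succ, OracleMachine.step, ho]; rfl
      refine ⟨d'', S'', rfl, by rw [hc]; exact k1, by rw [hc]; exact k2, ?_, ?_⟩
      · rw [k3, h3, decide_eq_decide]; omega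
      · rw [k4, h4]
        simp only [OracleMachine.mem_queries_succ, ho, Option.isSome_some, true_and]
        constructor
        · rintro ⟨⟨h5, h6⟩, h7⟩
          exact ⟨h5, fun q hq => hq.elim (h6 q) fun e => e ▸ h7⟩
        · rintro ⟨h5, h6⟩
          exact ⟨⟨h5, fun q hq => h6 q (.inl hq)⟩, h6 _ (.inr rfl)⟩
    · intro ho
      simp only [St.view, h2, Option.isSome_eq_false_iff, Option.isNone_iff_eq_none] at ho
      refine (run_stepP (θ := θ) h1 (by rw [h2]; exact ho)).mono (by omega) ?_
      rintro _ ⟨S'', k1, rfl⟩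
      have hquer : ∀ q, q ∈ M.queries θ a (i + 1) ↔ q ∈ M.queries θ a i := by
        intro q
        rw [OracleMachine.mem_queries_succ, ho]
        simp
      have he : (⟨d'.q, (M.conf θ a i).tape⟩ : M.Config) = M.conf θ a i := by rw [h2]
      rw [he] at k1 ⊢
      cases hst : M.step θ (M.conf θ a i) with
      | none =>
        have : i = n₀ := by
          by_contra hne
          exact hmin i (by omega) hst
        have hc : M.conf θ a (i + 1) = M.conf θ a i := by
          rw [OracleMachine.conf_succ, hst]; rfl
        rw [hst] at k1
        exact ⟨_, S'', rfl, by rw [hc]; exact k1, by rw [hc]; exact h2, by simp [this],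
          by simpa only [hquer] using h4⟩
      | some c =>
        have : i ≠ n₀ := by
          rintro rfl
          rw [OracleMachine.HaltedBy, hst] at hn₀
          simp at hn₀
        have hc : M.conf θ a (i + 1) = c := by
          rw [OracleMachine.conf_succ, hst]; rfl
        rw [hst] at k1
        refine ⟨_, S'', rfl, by rw [hc]; exact k1, by rw [hc], ?_, by simpa only [hquer] using h4⟩
        simp only [h3, decide_eq_decide]
        omega
  · rintro _ ⟨d', S', rfl, h1, h2, h3, h4⟩
    simp [St.view, h3]
  · exact ⟨_, _, rfl, hinit, rfl, by simp, by simp [OracleMachine.queries]⟩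
  rintro _ ⟨d', S', rfl, h1, h2, h3, h4⟩
  rw [OracleMachine.conf_of_halted hn₀ (by omega)] at h1
  rw [OracleMachine.queries_of_halted hn₀ (by omega)] at h4
  have hl := h1.length_le (i := .output) (n := n)
    ((OracleMachine.head_le _ _).trans (by push_cast; omega))
  refine ((run_home .output d' S' x h1.tp h1.cd).weaken (by omega)).seq ?_
  rintro _ ⟨S1, rfl, a1, a2, a3, a4, a5, a6⟩
  rw [h1.tape] at a1
  have hw := takeWhile_of_cell a1
  have hlen := OracleMachine.content_length_le (M := M) (θ := θ) (a := a) n₀ .output (by simp)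
    (by simp)
  refine ((run_grab .output d' S1 x).weaken (by rw [hw, List.length_map]; omega)).seq ?_
  rintro _ rfl
  refine (Run.clear (Q := fun σ => σ = ⟨d', update S (.reg .tmp)
    (((M.conf θ a n₀).tape .output).content.map some).reverse, x⟩) ?_).seq ?_
  · have b1 : S1 (.reg .tmp) = [] := by
      rw [a6 _ (by simp) (by simp) (by simp) (by simp [Rs]) (by simp) (by simp), h1.tmp]
    simp only [St.clr, hw, b1]
    congr 1
    funext k
    by_cases hk : Scratch k
    · by_cases hk' : k = .reg .tmp
      · subst hk'; simp [Rs]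
      · simp [hk, hk', hS k hk hk']
    · have hk' : ∀ {j}, Scratch j → k ≠ j := by rintro j hj rfl; exact hk hj
      have hk1 : k ≠ .reg .tmp := hk' trivial
      have hk2 : k ≠ Rs .output := hk' trivial
      simp only [hk, hk1, hk2, false_and, decide_false, ne_eq, not_false_eq_true,
        Function.update_of_ne, Bool.false_eq_true, if_false]
      rw [a6 k (hk' trivial) (hk' trivial) (hk' trivial) hk2 (hk' trivial) (hk' trivial),
        h1.base k hk]
  rintro _ rfl
  refine ((run_move (by simp) _ _ _).mono (by simp; omega) ?_)
  rintro _ rfl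
  refine ⟨d', ?_, h4⟩
  congr 1
  funext k
  have h0 : S .ans = [] := hS _ trivial (by simp)
  simp only [Function.update_apply]
  split_ifs <;> simp_all

end Sim


/-! ### Binary fractions -/

/-- The value of the binary fraction with the digits `v`. -/
noncomputable def frac (v : List Bool) : ℝ := binVal v / 2 ^ v.length

@[simp] theorem frac_nil : frac [] = 0 := by simp [frac, binVal]

theorem binVal_cons (b : Bool) (v : List Bool) :
    binVal (b :: v) = b.toNat * 2 ^ v.length + binVal v := by
  have := binVal_append [b] v
  simpa [binVal] using this

theorem frac_cons (b : Bool) (v : List Bool) : frac (b :: v) = (b.toNat + frac v) / 2 := by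
  simp only [frac, binVal_cons, List.length_cons, pow_succ]
  push_cast
  field_simp

theorem frac_append (u v : List Bool) : frac (u ++ v) = frac u + frac v / 2 ^ u.length := by
  induction u with
  | nil => simp
  | cons b u ih =>
    rw [List.cons_append, frac_cons, frac_cons, ih, List.length_cons, pow_succ]
    field_simp
    ring

theorem frac_replicate (n : ℕ) : frac (List.replicate n false) = 0 := by
  simp [frac, binVal_replicate]

theorem frac_nonneg (v : List Bool) : 0 ≤ frac v := by unfold frac; positivity

theorem toNat_le_one (b : Bool) : (b.toNat : ℝ) ≤ 1 := by exact_mod_cast Bool.toNat_le b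

theorem frac_le (v : List Bool) : frac v ≤ 1 - 1 / 2 ^ v.length := by
  induction v with
  | nil => simp
  | cons b v ih =>
    rw [frac_cons, List.length_cons, pow_succ]
    have := toNat_le_one b
    have e : (1 : ℝ) / (2 ^ v.length * 2) = 1 / 2 ^ v.length / 2 := by field_simp
    rw [e]
    linarith

theorem frac_lt_one (v : List Bool) : frac v < 1 := by
  have : (0 : ℝ) < 1 / 2 ^ v.length := by positivity
  linarith [frac_le v]

theorem frac_dyadic (v : List Bool) : IsDyadic (frac v) := ⟨binVal v, v.length, by simp [frac]⟩

/-- The first `n` entries of a list, padded if it is too short. -/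
def padTake {α : Type} (z : α) (n : ℕ) (l : List α) : List α := (List.range n).map fun i => l.getD i z

theorem padTake_length {α : Type} (z : α) (n : ℕ) (l : List α) : (padTake z n l).length = n := by
  simp [padTake]

theorem padTake_append {α : Type} (z : α) (m : ℕ) (p q : List α) :
    padTake z (p.length + m) (p ++ q) = p ++ padTake z m q := by
  apply List.ext_getElem
  · simp [padTake]
  · intro i h1 h2
    simp only [padTake, List.getElem_map, List.getElem_range, List.getElem_append]
    simp only [padTake, List.length_map, List.length_range] at h1
    split_ifs with h
    · simp [List.getElem?_append_left, h]
    · simp [List.getElem?_append_right (not_lt.1 h)]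

theorem padTake_succ {α : Type} (z : α) (n : ℕ) (l : List α) :
    padTake z (n + 1) l = padTake z n l ++ [l.getD n z] := by
  simp [padTake, List.range_succ]

theorem padTake_succ' {α : Type} (z : α) (n : ℕ) (l : List α) :
    padTake z (n + 1) l = l.headD z :: padTake z n l.tail := by
  rw [padTake, List.range_succ_eq_map]
  simp only [List.map_cons, List.map_map, padTake, Function.comp_def]
  cases l <;> simp

theorem padTake_map {α β : Type} (f : α → β) (z : α) (n : ℕ) (l : List α) :
    padTake (f z) n (l.map f) = (padTake z n l).map f := by
  simp only [padTake, List.map_map]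
  congr 1
  funext i
  simp [List.getD_eq_getElem?_getD, List.getElem?_map]

theorem frac_eq (v : List Bool) : frac v = ((v.headD false).toNat + frac v.tail) / 2 := by
  cases v with
  | nil => simp
  | cons b v => rw [frac_cons]; rfl

theorem frac_padTake (n : ℕ) (v : List Bool) :
    frac (padTake false n v) ≤ frac v ∧ frac v < frac (padTake false n v) + 1 / 2 ^ n := by
  induction n generalizing v with
  | zero => simpa [padTake] using ⟨frac_nonneg v, frac_lt_one v⟩
  | succ n ih =>
    obtain ⟨h1, h2⟩ := ih v.tail
    rw [padTake_succ', frac_cons, frac_eq v, pow_succ]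
    have e : (1 : ℝ) / (2 ^ n * 2) = 1 / 2 ^ n / 2 := by field_simp
    rw [e]
    constructor <;> linarith

theorem frac_lt_iff (n : ℕ) (v : List Bool) :
    frac v < 1 / 2 ^ n ↔ ∀ j < n, v.getD j false = false := by
  induction n generalizing v with
  | zero => simpa using frac_lt_one v
  | succ n ih =>
    have e : (1 : ℝ) / (2 ^ (n + 1)) = 1 / 2 ^ n / 2 := by rw [pow_succ]; field_simp
    have e1 : (1 : ℝ) / 2 ^ n ≤ 1 := by
      rw [div_le_one (by positivity)]; exact one_le_pow₀ (by norm_num)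
    rw [frac_eq, e]
    have hsplit : (∀ j < n + 1, v.getD j false = false) ↔
        v.headD false = false ∧ ∀ j < n, v.tail.getD j false = false := by
      constructor
      · intro h
        refine ⟨?_, fun j hj => ?_⟩
        · have := h 0 (by omega); cases v <;> simp_all
        · have := h (j + 1) (by omega); cases v <;> simp_all
      · rintro ⟨h1, h2⟩ j hj
        cases j with
        | zero => cases v <;> simp_all
        | succ j => have := h2 j (by omega); cases v <;> simp_all
    rw [hsplit, ← ih]
    cases v.headD false with
    | false => simp; constructor <;> intro h <;> linarith
    | true =>
      simp only [Bool.toNat_true, Nat.cast_one, Bool.true_eq_false, false_and, iff_false, not_lt]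
      linarith [frac_nonneg v.tail]

theorem le_binVal {u : List Bool} (hu : u.head? ≠ some false) {B : ℕ} (h : binVal u < 2 ^ B) :
    u.length ≤ B := by
  cases u with
  | nil => simp
  | cons b u =>
    have hb : b = true := by simpa using hu
    subst hb
    rw [binVal_cons] at h
    have : 2 ^ u.length < 2 ^ B := by simp at h; omega
    exact (Nat.pow_lt_pow_iff_right (by norm_num)).1 this

/-! ### Codes as sequences of columns -/

theorem strPair_columns (a b : Str) (i : ℕ) :
    ((strPair a b).getD (3 * i) .zero, (strPair a b).getD (3 * i + 1) .zero,
      (strPair a b).getD (3 * i + 2) .zero) =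
    ((control a b).getD i .zero, a.getD i .zero, b.getD i .zero) := by
  have key : ∀ (g : ℕ → Sym × Sym × Sym) (n i : ℕ), ∀ r < 3,
      ((List.range n).flatMap fun i => [(g i).1, (g i).2.1, (g i).2.2])[3 * i + r]? =
        if i < n then [(g i).1, (g i).2.1, (g i).2.2][r]? else none := by
    intro g n
    induction n with
    | zero => simp
    | succ n ih =>
      intro i r hr
      have hl : ((List.range n).flatMap fun i => [(g i).1, (g i).2.1, (g i).2.2]).length = 3 * n := by
        simp [List.length_flatMap, mul_comm]
      rw [List.range_succ, List.flatMap_append]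
      rcases lt_or_ge i n with h | h
      · rw [List.getElem?_append_left (by rw [hl]; omega), ih i r hr, if_pos h, if_pos (by omega)]
      · rw [List.getElem?_append_right (by rw [hl]; omega), hl]
        rcases eq_or_lt_of_le h with rfl | h
        · simp
        · rw [if_neg (by omega), List.getElem?_eq_none]
          simp
          omega
  have key' := key (fun i => ((control a b).getD i .zero, a.getD i .zero, b.getD i .zero))
    (max (max a.length b.length) (control a b).length) i
  have hlen : ∀ l : Str, l.length ≤ max (max a.length b.length) (control a b).length →
      ¬ i < max (max a.length b.length) (control a b).length → l.getD i .zero = .zero := by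
    intro l h1 h2
    rw [List.getD_eq_default]
    omega
  have k0 := key' 0 (by omega)
  have k1 := key' 1 (by omega)
  have k2 := key' 2 (by omega)
  simp only [List.getD_eq_getElem?_getD, strPair] at *
  simp only [add_zero] at k0
  rw [k0, k1, k2]
  split_ifs with h
  · simp
  · have h1 := hlen a (by omega) h
    have h2 := hlen b (by omega) h
    have h3 := hlen (control a b) (by omega) h
    simp [h1, h2, h3]

/-- The columns that are paired to a code. -/
def cols (p : List (Sym × Sym)) : Str := p.flatMap fun x => [.one, x.1, x.2]

theorem cols_append (p q : List (Sym × Sym)) : cols (p ++ q) = cols p ++ cols q := by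
  simp [cols]

/-- The pairing of two strings of the same length. -/
theorem strPair_eq {a b : Str} (h : a.length = b.length) :
    strPair a b = cols (a.zip b) ++ List.replicate 6 Sym.zero := by
  have hc : (control a b).length = a.length + 2 := by simp [control, ← h]
  have h1 : control a b = List.replicate a.length .one ++ [.zero, .zero] := by
    simp [control, ← h, digit]
  rw [strPair, hc, show max (max a.length b.length) (a.length + 2) = a.length + 2 by omega,
    List.range_add, List.flatMap_append]
  congr 1
  · have key : ∀ (n : ℕ) (a b c : Str), a.length = n → b.length = n →
        ((List.range n).flatMap fun i => [(List.replicate n Sym.one ++ c).getD i .zero,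
          a.getD i .zero, b.getD i .zero]) = cols (a.zip b) := by
      intro n a b c ha hb
      apply Eq.trans (b := ((List.range n).map fun i => (a.getD i .zero, b.getD i .zero)).flatMap
        fun x => [Sym.one, x.1, x.2])
      · rw [List.flatMap_map]
        refine List.flatMap_congr fun i hi => ?_
        rw [List.mem_range] at hi
        simp [hi, List.getElem?_append_left]
      · rw [cols]
        congr 1
        apply List.ext_getElem
        · simp [ha, hb]
        · intro i i1 i2
          simp at i1 i2
          simp [i2]
    rw [h1]
    exact key _ _ _ _ rfl h.symm
  · rw [h1]
    simp [List.range_succ, h]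

/-! ### Reading an interval into a record -/

section Rec

variable {M : OracleMachine} {φ : Baire}

/-- Read one symbol from the answer stack, zero at its end. -/
noncomputable def fetch : Prog (Dat M.State) (Rg M.Work) :=
  doOps (fun v => { v.d with s1 := v.d.s2, s2 := v.d.s3, s3 := (v.top .ans).join.getD .zero })
    fun _ => [(.ans, .drop)]

/-- Read a column: its symbols are then in `s1`, `s2`, `s3`. -/
noncomputable def col : Prog (Dat M.State) (Rg M.Work) := .seq fetch (.seq fetch fetch)

theorem run_col {a b : Str} {i : ℕ} (d : Dat M.State) {S : Stk (Rg M.Work) → List Cell} (x : Str)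
    (h : S .ans = ((strPair a b).drop (3 * i)).map some) :
    Run φ col ⟨d, S, x⟩ 3 fun σ => σ = ⟨{ d with
        s1 := (control a b).getD i .zero
        s2 := a.getD i .zero
        s3 := b.getD i .zero },
      update S .ans (((strPair a b).drop (3 * (i + 1))).map some), x⟩ := by
  refine (run_doOps rfl).seq (T' := 1 + 1) ?_
  rintro _ rfl
  refine (run_doOps rfl).seq ?_
  rintro _ rfl
  refine (run_doOps rfl).mono le_rfl ?_
  rintro _ rfl
  have hg := strPair_columns a b i
  simp only [Prod.mk.injEq] at hg
  have hd : ∀ (l : Str) (j : ℕ), ((l.drop j).map some : List Cell).head?.join.getD .zero =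
      l.getD j .zero := by
    intro l j
    rw [List.head?_map, List.head?_drop, List.getD_eq_getElem?_getD]
    cases l[j]? <;> simp
  simp only [sem, St.view, h, Op.ap, pushO, Function.update_self, ← List.map_tail, List.tail_drop,
    if_true, hd]
  rw [hg.1, hg.2.1, hg.2.2]
  congr 1
  funext j
  simp only [Function.update_apply, Stk.reg.injEq, reduceCtorEq, ↓reduceIte]
  split_ifs
  · congr 2
  · rfl

/-- Repeat a program. -/
noncomputable def rep (c : Prog (Dat M.State) (Rg M.Work)) : ℕ → Prog (Dat M.State) (Rg M.Work)
  | 0 => doOps (fun v => v.d) fun _ => []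
  | n + 1 => .seq c (rep c n)

theorem run_rep {c : Prog (Dat M.State) (Rg M.Work)} {T n : ℕ}
    {I : ℕ → St (Dat M.State) (Rg M.Work) → Prop}
    (h : ∀ i < n, ∀ σ, I i σ → Run φ c σ T (I (i + 1))) {σ : St (Dat M.State) (Rg M.Work)}
    (h0 : I 0 σ) : Run φ (rep c n) σ (n * T + 1) (I n) := by
  induction n generalizing I σ with
  | zero => exact (run_doOps h0).weaken (by omega)
  | succ n ih =>
    refine ((h 0 (by omega) σ h0).seq fun σ' hσ' => ih (I := fun i => I (i + 1))
      (fun i hi => h (i + 1) (by omega)) hσ').weaken ?_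
    rw [Nat.add_mul n 1]; omega

/-- Read a column and append its first digit to `An`; the flag `ok` records whether all second
digits have been zero. -/
noncomputable def colpush : Prog (Dat M.State) (Rg M.Work) :=
  .seq col (doOps (fun v => { v.d with ok := v.d.ok && decide (v.d.s3 = .zero) })
    fun v => [(.reg .An, .put (some v.d.s2))])

/-- The stacks after `i` columns have been read and appended. -/
noncomputable def readS (a b : Str) (i : ℕ) (S : Stk (Rg M.Work) → List Cell) :
    Stk (Rg M.Work) → List Cell :=
  update (update S .ans (((strPair a b).drop (3 * i)).map some)) (.reg .An)
    ((padTake .zero i a).map some).reverse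

theorem run_colpush (a b : Str) (i : ℕ) (d : Dat M.State) (S : Stk (Rg M.Work) → List Cell)
    (x : Str) : Run φ colpush ⟨d, readS a b i S, x⟩ 4 fun σ => ∃ d' : Dat M.State,
      σ = ⟨d', readS a b (i + 1) S, x⟩ ∧ d'.s2 = a.getD i .zero ∧ d'.s3 = b.getD i .zero ∧
      d'.ok = (d.ok && decide (b.getD i .zero = .zero)) := by
  refine (run_col (a := a) (b := b) (i := i) d x (by simp [readS])).seq (T' := 1) ?_
  rintro _ rfl
  refine run_doOps ⟨{ d with
    s1 := (control a b).getD i .zero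
    s2 := a.getD i .zero
    s3 := b.getD i .zero
    ok := d.ok && decide (b.getD i .zero = .zero) }, ?_, rfl, rfl, rfl⟩
  simp only [sem, St.view, Op.ap, pushO]
  congr 1
  funext j
  simp only [readS, Function.update_apply, Stk.reg.injEq, reduceCtorEq, ↓reduceIte, padTake_succ]
  split_ifs <;> simp_all

/-- The update of record `c` by a finite interval, up to a remainder of the code. -/
noncomputable def updateBody (M : OracleMachine) (c : Bool) : Prog (Dat M.State) (Rg M.Work) :=
  .seq colpush <| .seq colpush <| .seq (doOps (fun v => { v.d with ok := true }) fun _ => []) <|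
    .ite (fun v => decide (v.d.s3 = .sep))
      (.seq (.loop (fun v => !decide (v.d.s2 = .sep)) colpush) <|
        .seq (.loop (fun v => (v.top (.reg (.Z c))).isSome) (.seq (doOps (fun v => v.d)
          fun _ => [(.reg (.Z c), .drop), (.reg .cd, .put none)]) colpush)) <|
        .seq (rep colpush 6) <| .seq (move (.reg .cd) (.reg (.Z c))) <|
        .ite (fun v => v.d.ok)
          (.seq (empty (.reg (.A c))) <| .seq (move (.reg .An) (.reg (.A c)))
            (doOps (fun v => v.d) fun _ => [(.reg (.Z c), .put none)]))
          (empty (.reg .An)))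
      (empty (.reg .An))

/-- Update the record `c` by the interval whose code is on the answer stack: if its radius is small
enough, replace the approximation by the truncated midpoint and raise the grade. -/
noncomputable def updateRec (M : OracleMachine) (c : Bool) : Prog (Dat M.State) (Rg M.Work) :=
  .seq (.ite (fun v => (v.top .ans).isSome) (updateBody M c) (doOps (fun v => v.d) fun _ => []))
    (empty .ans)

/-- How an interval `J` changes a record `(A, t)` to `(A', t')`. The grade is raised exactly if the
radius of `J` is small compared with the grade and the size of the midpoint. -/
def Upd (J : ID) (A : Str) (t : ℕ) (A' : Str) (t' : ℕ) : Prop :=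
  (A' = A ∧ t' = t ∧ ∀ K, J = some K → ∀ B : ℕ, |K.mid| < 2 ^ B → 1 / 2 ^ (B + t + 6) ≤ K.rad) ∨
  (t' = t + 1 ∧ ∃ K y, J = some K ∧ K.rad < 1 / 2 ^ (t + 6) ∧ IsDyadicCode A' y ∧
    |y - K.mid| ≤ 1 / 2 ^ (t + 6) ∧ t + 8 ≤ A'.length ∧
    ∀ B : ℕ, |K.mid| < 2 ^ B → A'.length ≤ B + t + 8)

theorem abs_sign (s : Bool) (y : ℝ) : |(-1) ^ s.toNat * y| = |y| := by
  rw [abs_mul, abs_pow]; simp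

/-- The result `(A', t')` of an update depends only on the code and on the record. -/
theorem exists_updateRec {J : ID} {code : Str} (hc : IsIntervalCode code J) (A : Str) (t : ℕ) :
    ∃ A' t', Upd J A t A' t' ∧ ∀ (M : OracleMachine) (φ : Baire) (c : Bool) (B : ℕ)
      (d : Dat M.State) (S : Stk (Rg M.Work) → List Cell) (x : Str),
      (∀ K, J = some K → K.rad < 1 → |K.mid| < 2 ^ B) → S .ans = code.map some →
      S (.reg .An) = [] → S (.reg .cd) = [] → S (.reg (.A c)) = A.map some →
      S (.reg (.Z c)) = List.replicate t none →
      Run φ (updateRec M c) ⟨d, S, x⟩ (12 * (B + t) + 80) fun σ => ∃ d',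
        σ = ⟨d', update (update (update S .ans []) (.reg (.A c)) (A'.map some)) (.reg (.Z c))
          (List.replicate t' none), x⟩ := by
  suffices hsuff : ∃ A' t', Upd J A t A' t' ∧ ∀ (M : OracleMachine) (φ : Baire) (c : Bool) (B : ℕ)
      (d : Dat M.State) (S : Stk (Rg M.Work) → List Cell) (x : Str),
      (∀ K, J = some K → K.rad < 1 → |K.mid| < 2 ^ B) → S .ans = code.map some →
      S (.reg .An) = [] → S (.reg .cd) = [] → S (.reg (.A c)) = A.map some →
      S (.reg (.Z c)) = List.replicate t none →
      Run φ (.ite (fun v => (v.top .ans).isSome) (updateBody M c) (doOps (fun v => v.d) fun _ => []))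
        ⟨d, S, x⟩ (12 * (B + t) + 79) fun σ => ∃ d' r, σ = ⟨d', update (update (update S .ans r)
          (.reg (.A c)) (A'.map some)) (.reg (.Z c)) (List.replicate t' none), x⟩ by
    obtain ⟨A', t', h1, h2⟩ := hsuff
    refine ⟨A', t', h1, fun M φ c B d S x hB hans hAn hcd hA hZ => ?_⟩
    refine (Run.seq (h2 M φ c B d S x hB hans hAn hcd hA hZ) ?_).weaken
      (T := 12 * (B + t) + 79 + 1) (by omega)
    rintro _ ⟨d', r, rfl⟩
    refine (run_empty _ _ _ _).mono le_rfl ?_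
    rintro _ rfl
    refine ⟨d', ?_⟩
    congr 1
    funext j
    simp only [Function.update_apply, Stk.reg.injEq, reduceCtorEq, ↓reduceIte]
    split_ifs <;> simp_all
  cases J with
  | none =>
    have hc : code = [] := hc
    subst hc
    refine ⟨A, t, .inl ⟨rfl, rfl, by simp⟩, fun M φ c B d S x hB hans hAn hcd hA hZ => ?_⟩
    refine Run.ite_false (by simp [St.view, hans]) ((run_doOps ?_).weaken (by omega))
    refine ⟨d, [], ?_⟩
    simp only [St.view, sem]
    congr 1
    funext j
    simp only [Function.update_apply, Stk.reg.injEq, reduceCtorEq, ↓reduceIte]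
    split_ifs <;> simp_all
  | some K =>
    obtain ⟨a, b, ⟨s, u, v, hu, rfl, hmid⟩, ⟨s', u', v', hu', rfl, hrad⟩, rfl⟩ := hc
    -- the conditions under which the update succeeds, in terms of digits and of values
    have hu0 := frac_nonneg v
    have hmid' : |K.mid| = binVal u + frac v := by
      rw [hmid, abs_sign, abs_of_nonneg (by positivity)]; rfl
    have hs' : s' = false := by
      have := K.rad_pos
      rw [hrad] at this
      cases s' with
      | false => rfl
      | true =>
        have h0 : (0 : ℝ) ≤ (binVal u' : ℝ) + (binVal v' : ℝ) / 2 ^ v'.length := by positivity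
        simp at this
        linarith
    subst hs'
    have hrad' : K.rad = binVal u' + frac v' := by rw [hrad]; simp [frac]
    have hlen : ∀ B : ℕ, |K.mid| < 2 ^ B → u.length ≤ B := by
      intro B h
      refine le_binVal hu ?_
      have : (binVal u : ℝ) < 2 ^ B := by linarith
      exact_mod_cast this
    have hlen' : u'.length = 0 ↔ K.rad < 1 := by
      constructor
      · intro h
        rw [List.length_eq_zero_iff] at h
        subst h
        rw [hrad']
        simpa [binVal] using frac_lt_one v'
      · intro h
        have h0 := frac_nonneg v'
        have : (binVal u' : ℝ) < 1 := by linarith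
        have := le_binVal hu' (B := 0) (by exact_mod_cast this)
        omega
    set a : Str := digit s :: u.map digit ++ Sym.sep :: v.map digit with ha
    set b : Str := digit false :: u'.map digit ++ Sym.sep :: v'.map digit with hb
    have asep : a.getD (1 + u.length) .zero = .sep := by
      simp [ha, Nat.add_comm 1]
    have anesep : ∀ j < u.length, a.getD (1 + j) .zero ≠ .sep := by
      intro j hj
      simp [ha, Nat.add_comm 1, List.getElem?_append_left, hj, digit_ne_sep]
    have atake : padTake .zero (2 + u.length + (t + 6)) a =
        digit s :: u.map digit ++ Sym.sep :: (padTake false (t + 6) v).map digit := by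
      have h1 := padTake_append Sym.zero (t + 6) (digit s :: u.map digit ++ [Sym.sep]) (v.map digit)
      rw [← padTake_map digit false]
      simp only [List.length_append, List.length_cons, List.length_map, List.length_nil,
        List.append_assoc, List.cons_append, List.nil_append] at h1 ⊢
      rw [ha, show 2 + u.length + (t + 6) = u.length + 1 + (0 + 1) + (t + 6) by omega]
      exact h1
    have hupd : ∃ A' t', Upd (some K) A t A' t' ∧
        ((u' = [] ∧ ∀ j < u.length + t + 6, v'.getD j false = false) →
          A' = digit s :: u.map digit ++ Sym.sep :: (padTake false (t + 6) v).map digit ∧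
          t' = t + 1) ∧
        (¬ (u' = [] ∧ ∀ j < u.length + t + 6, v'.getD j false = false) → A' = A ∧ t' = t) := by
      by_cases hcond : u' = [] ∧ ∀ j < u.length + t + 6, v'.getD j false = false
      · refine ⟨digit s :: u.map digit ++ Sym.sep :: (padTake false (t + 6) v).map digit, t + 1,
          .inr ⟨rfl, K, (-1) ^ s.toNat * (binVal u + frac (padTake false (t + 6) v)), rfl, ?_,
          ⟨s, u, _, hu, rfl, rfl⟩, ?_, ?_, ?_⟩, fun _ => ⟨rfl, rfl⟩, fun h => absurd hcond h⟩
        · have hrf : K.rad = frac v' := by rw [hrad', hcond.1]; simp [binVal]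
          have hrad6 : K.rad < 1 / 2 ^ (u.length + t + 6) := by
            rw [hrf, frac_lt_iff]
            exact hcond.2
          exact hrad6.trans_le (one_div_le_one_div_of_le (by positivity)
            (pow_le_pow_right₀ (by norm_num) (by omega)))
        · have h1 := frac_padTake (t + 6) v
          have h2 : (-1 : ℝ) ^ s.toNat * (binVal u + frac (padTake false (t + 6) v)) - K.mid =
              (-1) ^ s.toNat * (frac (padTake false (t + 6) v) - frac v) := by
            rw [hmid, frac]; simp only [frac]; ring
          rw [h2, abs_sign, abs_le]
          constructor <;> linarith [h1.1, h1.2]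
        · simp [padTake_length]
        · intro B' hB'
          have := hlen B' hB'
          simp [padTake_length]
          omega
      · refine ⟨A, t, .inl ⟨rfl, rfl, ?_⟩, fun h => absurd h hcond, fun _ => ⟨rfl, rfl⟩⟩
        rintro _ ⟨⟩ B' hB'
        have h1 : ¬ K.rad < 1 / 2 ^ (u.length + t + 6) := by
          intro h
          have hr1 : K.rad < 1 := h.trans_le (by
            rw [div_le_one (by positivity)]; exact one_le_pow₀ (by norm_num))
          have hu0 := List.length_eq_zero_iff.1 (hlen'.2 hr1)
          have hrf : K.rad = frac v' := by rw [hrad', hu0]; simp [binVal]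
          rw [hrf, frac_lt_iff] at h
          exact hcond ⟨hu0, h⟩
        refine le_trans ?_ (not_lt.1 h1)
        have := hlen B' hB'
        exact one_div_le_one_div_of_le (by positivity) (pow_le_pow_right₀ (by norm_num) (by omega))
    obtain ⟨A', t', hupd, htrue, hfalse⟩ := hupd
    refine ⟨A', t', hupd, fun M φ c B d S x hB hans hAn hcd hA hZ => ?_⟩
    clear hupd
    have h0 : S = readS a b 0 S := by
      clear * - hans hAn
      funext j
      simp only [readS, Function.update_apply, Stk.reg.injEq, reduceCtorEq, ↓reduceIte, padTake]
      split_ifs <;> simp_all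
    have hne := strPair_ne_nil a b
    refine Run.ite_true (by simpa [St.view, hans] using hne) ?_
    refine Run.weaken (T := 4 + (4 + (1 + (12 * (B + t) + 65)))) ?_ (by omega)
    rw [show (⟨d, S, x⟩ : St (Dat M.State) (Rg M.Work)) = ⟨d, readS a b 0 S, x⟩ by rw [← h0]]
    clear h0
    refine (run_colpush a b 0 d S x).seq ?_
    rintro _ ⟨d1, rfl, -, -, -⟩
    refine (run_colpush a b 1 d1 S x).seq ?_
    rintro _ ⟨d2, rfl, e1, e2, -⟩
    refine (run_doOps rfl).seq ?_
    rintro _ rfl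
    by_cases hu0 : u' = []
    swap
    · refine Run.ite_false ?_ ((run_empty _ _ _ _).mono (by omega) ?_)
      · have : b.getD 1 .zero ≠ .sep := by
          cases u' with
          | nil => exact absurd rfl hu0
          | cons x u' => simp [hb, digit_ne_sep]
        simp only [St.view, e2]
        simpa using this
      rintro _ rfl
      obtain ⟨rfl, rfl⟩ := hfalse fun h => hu0 h.1
      refine ⟨{ d2 with ok := true }, ((strPair a b).drop (3 * 2)).map some, ?_⟩
      · congr 1
        rw [← hA, ← hZ]
        clear * - hAn
        funext j
        simp only [sem, readS, Function.update_apply, Stk.reg.injEq, reduceCtorEq, ↓reduceIte]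
        split_ifs <;> simp_all
    subst hu0
    have hr1 : K.rad < 1 := hlen'.1 rfl
    have hrf : K.rad = frac v' := by rw [hrad']; simp [binVal]
    have huB := hlen B (hB K rfl hr1)
    have bget : ∀ j, (b.getD (2 + j) .zero = .zero ↔ v'.getD j false = false) := by
      intro j
      have : b.getD (2 + j) .zero = digit (v'.getD j false) := by
        rw [Nat.add_comm 2, hb]
        change (v'.map digit).getD j .zero = _
        rw [List.getD_eq_getElem?_getD, List.getD_eq_getElem?_getD, List.getElem?_map]
        cases v'[j]? <;> rfl
      rw [this]
      cases v'.getD j false <;> simp [digit]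
    have okstep : ∀ (k : ℕ) (β : Bool), (β = true ↔ ∀ j < k, v'.getD j false = false) →
        ((β && decide (b.getD (2 + k) .zero = .zero)) = true ↔
          ∀ j < k + 1, v'.getD j false = false) := by
      intro k β hβ
      rw [Bool.and_eq_true, hβ, decide_eq_true_iff, bget]
      constructor
      · rintro ⟨h1, h2⟩ j hj
        rcases Nat.lt_succ_iff_lt_or_eq.1 hj with hj | rfl
        · exact h1 j hj
        · exact h2
      · exact fun h => ⟨fun j hj => h j (by omega), h k (by omega)⟩
    refine Run.ite_true (by simp [St.view, e2, hb]) ?_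
    refine Run.weaken (T := (u.length * (4 + 1) + 1) + ((t * (1 + 4 + 1) + 1) + ((6 * 4 + 1) +
      ((2 * t + 1) + (1 + ((2 * (2 + u.length + (t + 6)) + 1) + 1) + 1))))) ?_ (by omega)
    refine (Run.loop (n := u.length) (T := 4) (I := fun k σ => ∃ d' : Dat M.State,
      σ = ⟨d', readS a b (2 + k) S, x⟩ ∧ d'.s2 = a.getD (1 + k) .zero ∧
      (d'.ok = true ↔ ∀ j < k, v'.getD j false = false)) ?_ ?_ ?_).seq ?_
    · rintro k hk _ ⟨d', rfl, f1, f2⟩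
      refine ⟨by simpa [St.view, f1] using anesep k hk, (run_colpush a b _ d' S x).mono le_rfl ?_⟩
      rintro _ ⟨d'', rfl, g1, g2, g3⟩
      exact ⟨d'', rfl, by rw [g1]; congr 1; omega, by rw [g3]; exact okstep k _ f2⟩
    · rintro _ ⟨d', rfl, f1, f2⟩
      simp only [St.view, f1, asep]
      rfl
    · exact ⟨_, rfl, e1, by simp⟩
    rintro _ ⟨d3, rfl, -, f2⟩
    refine (Run.loop (n := t) (T := 1 + 4) (I := fun k σ => ∃ d' : Dat M.State,
      σ = ⟨d', readS a b (2 + (u.length + k)) (update (update S (.reg (.Z c))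
        (List.replicate (t - k) none)) (.reg .cd) (List.replicate k none)), x⟩ ∧
      (d'.ok = true ↔ ∀ j < u.length + k, v'.getD j false = false)) ?_ ?_ ?_).seq ?_
    · rintro k hk _ ⟨d', rfl, f2⟩
      obtain ⟨m, hm⟩ : ∃ m, t - k = m + 1 := ⟨t - k - 1, by omega⟩
      have hm' : t - (k + 1) = m := by omega
      refine ⟨by simp [St.view, readS, hm, List.replicate_succ], ?_⟩
      refine (Run.seq (run_doOps rfl) ?_)
      rintro _ rfl
      have e : sem [(.reg (.Z c), .drop), (.reg .cd, .put none)] (readS a b (2 + (u.length + k))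
          (update (update S (.reg (.Z c)) (List.replicate (t - k) none)) (.reg .cd)
            (List.replicate k none))) = readS a b (2 + (u.length + k)) (update (update S
          (.reg (.Z c)) (List.replicate (t - (k + 1)) none)) (.reg .cd)
            (List.replicate (k + 1) none)) := by
        clear * - hm hm'
        funext j
        simp only [sem, readS, Function.update_apply, Stk.reg.injEq, reduceCtorEq, ↓reduceIte, hm, hm', Op.ap, pushO]
        split_ifs <;> simp_all [List.replicate_succ]
      simp only [e]
      refine (run_colpush a b _ d' _ x).mono le_rfl ?_
      rintro _ ⟨d'', rfl, g1, g2, g3⟩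
      exact ⟨d'', rfl, by rw [g3]; exact okstep _ _ f2⟩
    · rintro _ ⟨d', rfl, f2⟩
      simp [St.view, readS]
    · refine ⟨d3, ?_, f2⟩
      congr 1
      clear * - hZ hcd
      funext j
      simp only [readS, Function.update_apply, Stk.reg.injEq, reduceCtorEq, ↓reduceIte]
      split_ifs <;> simp_all
    rintro _ ⟨d4, rfl, f3⟩
    refine (run_rep (n := 6) (I := fun k σ => ∃ d' : Dat M.State,
      σ = ⟨d', readS a b (2 + (u.length + t + k)) (update (update S (.reg (.Z c)) []) (.reg .cd)
        (List.replicate t none)), x⟩ ∧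
      (d'.ok = true ↔ ∀ j < u.length + t + k, v'.getD j false = false)) ?_ ?_).seq ?_
    · rintro k hk _ ⟨d', rfl, f2⟩
      refine (run_colpush a b _ d' _ x).mono le_rfl ?_
      rintro _ ⟨d'', rfl, g1, g2, g3⟩
      exact ⟨d'', rfl, by rw [g3]; exact okstep _ _ f2⟩
    · refine ⟨d4, ?_, f3⟩
      simp
    rintro _ ⟨d5, rfl, f4⟩
    have hcdS : readS a b (2 + (u.length + t + 6)) (update (update S (.reg (.Z c)) []) (.reg .cd)
        (List.replicate t none)) (.reg .cd) = List.replicate t none := by simp [readS]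
    refine (Run.mono (run_move (by simp) _ _ _) (T' := 2 * t + 1) (Q' := fun σ => σ = ⟨d5,
      readS a b (2 + (u.length + t + 6)) S, x⟩) (by rw [hcdS]; simp) ?_).seq ?_
    · rintro _ rfl
      congr 1
      clear * - hZ hcd
      funext j
      simp only [readS, Function.update_apply, Stk.reg.injEq, reduceCtorEq, ↓reduceIte]
      split_ifs <;> simp_all
    rintro _ rfl
    have hpow : u.length + t + 6 = u.length + (t + 6) := by omega
    refine Run.ite ?_ ?_
    · intro hok
      obtain ⟨rfl, rfl⟩ := htrue ⟨rfl, f4.1 hok⟩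
      refine (run_empty _ _ _ _).seq ?_
      rintro _ rfl
      refine ((run_move (by simp) _ _ _).weaken ?_).seq ?_
      · simp [readS, padTake_length]
        omega
      rintro _ rfl
      refine run_doOps ⟨d5, ((strPair a b).drop (3 * (2 + (u.length + t + 6)))).map some, ?_⟩
      · have e : 2 + (u.length + t + 6) = 2 + u.length + (t + 6) := by omega
        simp only [St.view, sem]
        congr 1
        clear * - atake e hZ hAn
        clear_value a b
        funext j
        simp only [readS, Function.update_apply, Stk.reg.injEq, reduceCtorEq, ↓reduceIte, Op.ap, pushO, ← atake, e]
        split_ifs <;> simp_all [List.replicate_succ]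
    · intro hok
      refine (run_empty _ _ _ _).mono (by omega) ?_
      rintro _ rfl
      have hcond : ¬ ((([] : List Bool) = []) ∧ ∀ j < u.length + t + 6, v'.getD j false = false) := by
        rintro ⟨-, h⟩
        have hok : d5.ok = false := hok
        rw [f4.2 h] at hok
        exact absurd hok (by simp)
      obtain ⟨rfl, rfl⟩ := hfalse hcond
      refine ⟨d5, ((strPair a b).drop (3 * (2 + (u.length + t' + 6)))).map some, ?_⟩
      · congr 1
        rw [← hA, ← hZ]
        clear * - hAn
        funext j
        simp only [readS, Function.update_apply, Stk.reg.injEq, reduceCtorEq, ↓reduceIte]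
        split_ifs <;> simp_all

open Classical in
/-- The record after an update of the record `r` by the interval with the given code. -/
noncomputable def stepRec (code : Str) (r : Str × ℕ) : Str × ℕ :=
  if h : ∃ J, IsIntervalCode code J then
    ((exists_updateRec h.choose_spec r.1 r.2).choose,
      (exists_updateRec h.choose_spec r.1 r.2).choose_spec.choose)
  else r

theorem upd_stepRec {J : ID} {code : Str} (hc : IsIntervalCode code J) (r : Str × ℕ) :
    Upd J r.1 r.2 (stepRec code r).1 (stepRec code r).2 := by
  have h : ∃ J, IsIntervalCode code J := ⟨J, hc⟩
  rw [intervalCode_unique hc h.choose_spec, stepRec, dif_pos h]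
  exact (exists_updateRec h.choose_spec r.1 r.2).choose_spec.choose_spec.1

theorem run_updateRec {c : Bool} {J : ID} {code : Str} {r : Str × ℕ} {B : ℕ}
    (hc : IsIntervalCode code J) (hB : ∀ K, J = some K → K.rad < 1 → |K.mid| < 2 ^ B)
    (d : Dat M.State) {S : Stk (Rg M.Work) → List Cell} (x : Str) (hans : S .ans = code.map some)
    (hAn : S (.reg .An) = []) (hcd : S (.reg .cd) = [])
    (hA : S (.reg (.A c)) = r.1.map some) (hZ : S (.reg (.Z c)) = List.replicate r.2 none) :
    Run φ (updateRec M c) ⟨d, S, x⟩ (12 * (B + r.2) + 80) fun σ => ∃ d',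
      σ = ⟨d', update (update (update S .ans []) (.reg (.A c)) ((stepRec code r).1.map some))
        (.reg (.Z c)) (List.replicate (stepRec code r).2 none), x⟩ := by
  have h : ∃ J, IsIntervalCode code J := ⟨J, hc⟩
  rw [intervalCode_unique hc h.choose_spec] at hB
  rw [stepRec, dif_pos h]
  exact (exists_updateRec h.choose_spec r.1 r.2).choose_spec.choose_spec.2 M φ c B d S x hB hans
    hAn hcd hA hZ

end Rec

section Rec

variable {M : OracleMachine} {φ : Baire}

/-- The second symbols of an emitted code, with `t` zeros before the first digit one. The class
decides between the radii `2 ^ (-(t + 1))` and `3 / 4 * 2 ^ (-(t + 1))`. -/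
def radCode (c : Bool) (t n : ℕ) : Str :=
  [.zero, .sep] ++ List.replicate t .zero ++ (if c then [.zero, .one, .one] else [.one]) ++
    List.replicate n .zero

/-- The radius that belongs to a class and a grade. -/
noncomputable def radius (c : Bool) (t : ℕ) : ℝ := (if c then 3 / 4 else 1) / 2 ^ (t + 1)

theorem radius_pos (c : Bool) (t : ℕ) : 0 < radius c t := by
  unfold radius; cases c <;> simp

theorem radius_dyadic (c : Bool) (t : ℕ) : IsDyadic (radius c t) := by
  cases c with
  | false => exact ⟨1, t + 1, by simp [radius]⟩
  | true => exact ⟨3, t + 3, by simp [radius]; field_simp; ring⟩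

theorem radCode_spec (c : Bool) (t n : ℕ) : IsDyadicCode (radCode c t n) (radius c t) := by
  refine ⟨false, [], List.replicate t false ++ (if c then [false, true, true] else [true]) ++
    List.replicate n false, by simp, ?_, ?_⟩
  · cases c <;> simp [radCode, digit]
  · have : frac (List.replicate t false ++ (if c then [false, true, true] else [true]) ++
        List.replicate n false) = radius c t := by
      rw [frac_append, frac_append, frac_replicate, frac_replicate, radius]
      cases c <;> simp [frac_cons, pow_succ] <;> field_simp <;> norm_num
    rw [← this]
    simp [frac, binVal]

/-- The interval that is emitted for an approximation `y` of grade `t`. -/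
noncomputable def approx (c : Bool) (t : ℕ) (y : ℝ) (hy : IsDyadic y) : DyadicInterval :=
  ⟨y, radius c t, hy, radius_dyadic c t, radius_pos c t⟩

theorem IsDyadicCode.dyadic {a : Str} {y : ℝ} (h : IsDyadicCode a y) : IsDyadic y := by
  obtain ⟨s, u, v, -, -, rfl⟩ := h
  have h1 : IsDyadic ((binVal u : ℝ) + (binVal v : ℝ) / 2 ^ v.length) :=
    IsDyadic.add ⟨binVal u, 0, by simp⟩ ⟨binVal v, v.length, by simp⟩
  cases s with
  | false => simpa using h1
  | true => simpa [add_comm] using h1.neg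

/-- Intervals of larger grade, or of the same approximation and larger class, are smaller. -/
theorem approx_subset {c c' : Bool} {t t' : ℕ} {y y' v : ℝ} (hy : IsDyadic y) (hy' : IsDyadic y')
    (h : |y - v| ≤ 1 / 2 ^ (t + 4)) (h' : |y' - v| ≤ 1 / 2 ^ (t' + 4))
    (hlt : t < t' ∨ t = t' ∧ c = false ∧ c' = true) :
    ID.toSet (some (approx c' t' y' hy')) ⊆ ID.toSet (some (approx c t y hy)) := by
  have hp : (0 : ℝ) < 1 / 2 ^ (t + 4) := by positivity
  have e1 : (1 : ℝ) / 2 ^ (t + 1) = 8 * (1 / 2 ^ (t + 4)) := by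
    rw [pow_add _ t 4, pow_add _ t 1]; field_simp; norm_num
  have key : |y - v| + |y' - v| + radius c' t' ≤ radius c t := by
    rcases hlt with hlt | ⟨rfl, rfl, rfl⟩
    · obtain ⟨k, rfl⟩ := Nat.exists_eq_add_of_le hlt
      have e2 : (1 : ℝ) / 2 ^ (t.succ + k + 4) ≤ 1 / 2 ^ (t + 4) / 2 := by
        rw [div_div, ← pow_succ]
        exact one_div_le_one_div_of_le (by positivity) (pow_le_pow_right₀ (by norm_num) (by omega))
      have e3 : (1 : ℝ) / 2 ^ (t.succ + k + 1) ≤ 4 * (1 / 2 ^ (t + 4)) := by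
        have : (1 : ℝ) / 2 ^ (t.succ + k + 1) ≤ 1 / 2 ^ (t + 2) :=
          one_div_le_one_div_of_le (by positivity) (pow_le_pow_right₀ (by norm_num) (by omega))
        refine this.trans (le_of_eq ?_)
        rw [pow_add _ t 4, pow_add _ t 2]; field_simp; norm_num
      have e4 : radius c' (t.succ + k) ≤ 4 * (1 / 2 ^ (t + 4)) := by
        refine le_trans ?_ e3
        unfold radius
        have : (0 : ℝ) < 2 ^ (t.succ + k + 1) := by positivity
        rw [div_le_div_iff_of_pos_right this]
        split_ifs <;> norm_num
      have e5 : 6 * (1 / 2 ^ (t + 4)) ≤ radius c t := by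
        have : radius c t = (if c then 3 / 4 else 1) * (1 / 2 ^ (t + 1)) := by
          rw [radius]; field_simp
        rw [this, e1]
        split_ifs <;> linarith
      linarith
    · have : radius true t = 3 / 4 * (1 / 2 ^ (t + 1)) := by simp [radius]; field_simp
      have h2 : radius false t = 1 / 2 ^ (t + 1) := by simp [radius]
      rw [this, h2, e1]
      linarith
  have h1 := abs_le.1 (le_refl |y - v|)
  have h2 := abs_le.1 (le_refl |y' - v|)
  simp only [ID.toSet, approx]
  exact Set.Icc_subset_Icc (by linarith [h1.2, h2.1]) (by linarith [h1.1, h2.2])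

theorem mem_approx {c : Bool} {t : ℕ} {y v : ℝ} (hy : IsDyadic y) (h : |y - v| ≤ 1 / 2 ^ (t + 4)) :
    v ∈ ID.toSet (some (approx c t y hy)) := by
  have e1 : (1 : ℝ) / 2 ^ (t + 1) = 8 * (1 / 2 ^ (t + 4)) := by
    rw [pow_add _ t 4, pow_add _ t 1]; field_simp; norm_num
  have hp : (0 : ℝ) < 1 / 2 ^ (t + 4) := by positivity
  have : radius c t = (if c then 3 / 4 else 1) * (1 / 2 ^ (t + 1)) := by rw [radius]; field_simp
  have h3 : 1 / 2 ^ (t + 4) ≤ radius c t := by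
    rw [this, e1]
    split_ifs <;> linarith
  have h1 := abs_le.1 h
  simp only [ID.toSet, approx, Set.mem_Icc]
  constructor <;> linarith [h1.1, h1.2]

/-- The code of the emitted interval. -/
def emitCode (c : Bool) (A : Str) (t : ℕ) : Str :=
  strPair A (radCode c t (A.length - (radCode c t 0).length))

theorem emitCode_spec {A : Str} {y : ℝ} (c : Bool) (t : ℕ) (h : IsDyadicCode A y) :
    IsIntervalCode (emitCode c A t) (some (approx c t y h.dyadic)) :=
  ⟨A, _, h, radCode_spec c t _, rfl⟩

/-- Move one symbol of the approximation to `tmp`, as part of a column with second symbol `s`. -/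
noncomputable def emitCol (M : OracleMachine) (c : Bool) (s : Sym) : Prog (Dat M.State) (Rg M.Work) :=
  doOps (fun v => v.d) fun v => [(.reg (.A c), .drop), (.reg .Ab, .put (v.top (.reg (.A c))).join),
    (.reg .tmp, .put3 (some .one) (v.top (.reg (.A c))).join (some s))]

/-- The stacks after the columns of `p` and `b` have been emitted, where `r` is the rest of the
approximation. -/
noncomputable def emitS (c : Bool) (p b r : Str) (S : Stk (Rg M.Work) → List Cell) :
    Stk (Rg M.Work) → List Cell :=
  update (update (update S (.reg (.A c)) (r.map some)) (.reg .Ab) (p.map some).reverse)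
    (.reg .tmp) (((cols (p.zip b)).map some).reverse ++ S (.reg .tmp))

theorem run_emitCol (c : Bool) (s y : Sym) {p b r : Str} (h : p.length = b.length)
    (d : Dat M.State) (S : Stk (Rg M.Work) → List Cell) (x : Str) :
    Run φ (emitCol M c s) ⟨d, emitS c p b (y :: r) S, x⟩ 1
      fun σ => σ = ⟨d, emitS c (p ++ [y]) (b ++ [s]) r S, x⟩ := by
  refine run_doOps ?_
  simp only [sem, St.view, Op.ap, pushO]
  congr 1
  clear * - h
  funext j
  simp only [emitS, Function.update_apply, Stk.reg.injEq, reduceCtorEq, ↓reduceIte, List.zip_append h, cols_append]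
  split_ifs <;> simp_all [cols]

/-- Write the code of the interval of record `c` to the stack `tmp`, last symbol on top. -/
noncomputable def emitRec (M : OracleMachine) (c : Bool) : Prog (Dat M.State) (Rg M.Work) :=
  .seq (emitCol M c .zero) <| .seq (emitCol M c .sep) <|
  .seq (.loop (fun v => (v.top (.reg (.Z c))).isSome) (.seq (doOps (fun v => v.d)
    fun _ => [(.reg (.Z c), .drop), (.reg .cd, .put none)]) (emitCol M c .zero))) <|
  .seq (if c then .seq (emitCol M c .zero) (.seq (emitCol M c .one) (emitCol M c .one))
    else emitCol M c .one) <|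
  .seq (.loop (fun v => (v.top (.reg (.A c))).isSome) (emitCol M c .zero)) <|
  .seq (rep (doOps (fun v => v.d) fun _ =>
    [(.reg .tmp, .put3 (some .zero) (some .zero) (some .zero))]) 2) <|
  .seq (move (.reg .cd) (.reg (.Z c))) (move (.reg .Ab) (.reg (.A c)))

set_option maxHeartbeats 1000000 in
theorem run_emitRec {c : Bool} {A : Str} {t : ℕ} (hl : t + 5 ≤ A.length) (d : Dat M.State)
    {S : Stk (Rg M.Work) → List Cell} (x : Str) (hAb : S (.reg .Ab) = [])
    (hcd : S (.reg .cd) = []) (hA : S (.reg (.A c)) = A.map some)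
    (hZ : S (.reg (.Z c)) = List.replicate t none) :
    Run φ (emitRec M c) ⟨d, S, x⟩ (12 * A.length + 30) fun σ => σ = ⟨d, update S (.reg .tmp)
      (((emitCode c A t).map some).reverse ++ S (.reg .tmp)), x⟩ := by
  obtain ⟨y0, y1, A2, h2⟩ : ∃ y0 y1 A2, A = y0 :: y1 :: A2 := by
    match A, hl with
    | y0 :: y1 :: A2, _ => exact ⟨y0, y1, A2, rfl⟩
  have hl2 : A2.length = A.length - 2 := by simp [h2]
  have h0 : S = emitS c [] [] (y0 :: y1 :: A2) S := by
    clear * - hA hAb h2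
    funext j
    simp only [emitS, Function.update_apply, Stk.reg.injEq, reduceCtorEq, ↓reduceIte, cols]
    split_ifs <;> simp_all
  refine Run.weaken (T := 1 + (1 + ((t * (1 + 1 + 1) + 1) + (3 + (((A.length * (1 + 1)) + 1) +
    ((2 * 1 + 1) + ((2 * t + 1) + (2 * A.length + 1)))))))) ?_ (by omega)
  rw [show (⟨d, S, x⟩ : St (Dat M.State) (Rg M.Work)) =
    ⟨d, emitS c [] [] (y0 :: y1 :: A2) S, x⟩ by rw [← h0]]
  clear h0
  refine (run_emitCol c _ _ (p := []) (b := []) rfl _ _ _).seq ?_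
  rintro _ rfl
  refine (run_emitCol c _ _ (p := [y0]) (b := [.zero]) rfl _ _ _).seq ?_
  rintro _ rfl
  simp only [List.nil_append, List.cons_append]
  have hsplit : ∀ k, A2 = A2.take k ++ A2.drop k := fun k => (List.take_append_drop k A2).symm
  have hdrop : ∀ k < A2.length, ∃ y, A2.drop k = y :: A2.drop (k + 1) ∧
      A2.take (k + 1) = A2.take k ++ [y] := by
    intro k hk
    exact ⟨A2[k], List.drop_eq_getElem_cons hk, by rw [List.take_add_one, List.getElem?_eq_getElem hk]; rfl⟩
  -- the stacks after `k` more columns, for second symbols `b`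
  let E := fun (k : ℕ) (b : Str) (S : Stk (Rg M.Work) → List Cell) =>
    emitS c (y0 :: y1 :: A2.take k) (.zero :: .sep :: b) (A2.drop k) S
  have hE : ∀ (k : ℕ) (b : Str) (s : Sym) (S : Stk (Rg M.Work) → List Cell), k < A2.length →
      b.length = k → Run φ (emitCol M c s) ⟨d, E k b S, x⟩ 1
        fun σ => σ = ⟨d, E (k + 1) (b ++ [s]) S, x⟩ := by
    intro k b s S hk hb
    obtain ⟨y, e1, e2⟩ := hdrop k hk
    simp only [E, e1, e2]
    exact run_emitCol c s y (by simp [hb, hk.le]) d S x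
  refine (Run.loop (n := t) (T := 1 + 1) (I := fun k σ => σ = ⟨d, E k (List.replicate k .zero)
    (update (update S (.reg (.Z c)) (List.replicate (t - k) none)) (.reg .cd)
      (List.replicate k none)), x⟩) ?_ ?_ ?_).seq ?_
  · rintro k hk _ rfl
    obtain ⟨m, hm⟩ : ∃ m, t - k = m + 1 := ⟨t - k - 1, by omega⟩
    have hm' : t - (k + 1) = m := by omega
    refine ⟨by simp [St.view, E, emitS, hm, List.replicate_succ], ?_⟩
    refine (Run.seq (run_doOps rfl) ?_)
    rintro _ rfl
    have e : sem [(.reg (.Z c), .drop), (.reg .cd, .put none)] (E k (List.replicate k .zero)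
        (update (update S (.reg (.Z c)) (List.replicate (t - k) none)) (.reg .cd)
          (List.replicate k none))) = E k (List.replicate k .zero) (update (update S
        (.reg (.Z c)) (List.replicate (t - (k + 1)) none)) (.reg .cd)
          (List.replicate (k + 1) none)) := by
      simp only [E]
      clear * - hm hm'
      funext j
      simp only [sem, emitS, Function.update_apply, Stk.reg.injEq, reduceCtorEq, ↓reduceIte, hm, hm', Op.ap, pushO]
      clear hm hm'
      split_ifs <;> simp_all [List.replicate_succ]
    simp only [e]
    refine (hE k _ .zero _ (by omega) (by simp)).mono le_rfl ?_
    rintro _ rfl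
    rw [List.replicate_succ' (a := Sym.zero)]
  · rintro _ rfl
    simp [St.view, E, emitS]
  · simp only [E]
    congr 1
    clear * - hZ hcd
    funext j
    simp only [emitS, Function.update_apply, Stk.reg.injEq, reduceCtorEq, ↓reduceIte]
    split_ifs <;> simp_all
  rintro _ rfl
  set S1 := update (update S (.reg (.Z c)) (List.replicate (t - t) none)) (.reg .cd)
    (List.replicate t none) with hS1
  refine Run.seq (Q := fun σ => ∃ k b, σ = ⟨d, E k b S1, x⟩ ∧ b.length = k ∧ k ≤ A2.length ∧
    b = List.replicate t .zero ++ (if c then [.zero, .one, .one] else [.one])) ?_ ?_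
  · cases c with
    | true =>
      refine Run.weaken (T := 1 + (1 + 1)) ?_ (by omega)
      refine (hE t _ .zero _ (by omega) (by simp)).seq ?_
      rintro _ rfl
      refine (hE (t + 1) _ .one _ (by omega) (by simp)).seq ?_
      rintro _ rfl
      refine (hE (t + 2) _ .one _ (by omega) (by simp)).mono (by omega) ?_
      rintro _ rfl
      exact ⟨t + 3, _, rfl, by simp, by omega, by simp⟩
    | false =>
      refine (hE t _ .one _ (by omega) (by simp)).mono (by omega) ?_
      rintro _ rfl
      exact ⟨t + 1, _, rfl, by simp, by omega, by simp⟩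
  rintro _ ⟨k, b, rfl, hbk, hk, hb⟩
  refine (Run.weaken (Run.loop (n := A2.length - k) (T := 1) (I := fun i σ => σ = ⟨d, E (k + i)
    (b ++ List.replicate i .zero) S1, x⟩) ?_ ?_ ?_) ?_).seq ?_
  · rintro i hi _ rfl
    refine ⟨by simp [St.view, E, emitS]; omega, ?_⟩
    refine (hE (k + i) _ .zero _ (by omega) (by simp [hbk])).mono le_rfl ?_
    rintro _ rfl
    rw [List.replicate_succ', List.append_assoc, add_assoc]
  · rintro _ rfl
    simp [St.view, E, emitS, Nat.add_sub_cancel' hk]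
  · simp
  · have : (A2.length - k) * (1 + 1) ≤ A.length * (1 + 1) := Nat.mul_le_mul (by omega) le_rfl
    omega
  rintro _ rfl
  rw [Nat.add_sub_cancel' hk]
  -- the second symbols
  obtain ⟨n, hn⟩ : ∃ n, n = A2.length - k := ⟨_, rfl⟩
  have hn' : emitCode c A t = strPair A (radCode c t n) := by
    rw [emitCode, hn, ← hbk, hb, h2]
    cases c <;> simp [radCode]
  rw [← hn, hn']
  have hrad : .zero :: .sep :: (b ++ List.replicate n .zero) = radCode c t n := by
    rw [hb]; simp [radCode]
  have hlen : A.length = (radCode c t n).length := by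
    rw [← hrad]; simp [h2]; omega
  have hpair := strPair_eq hlen
  have hE2 : E A2.length (b ++ List.replicate n .zero) S1 = emitS c A (radCode c t n) [] S1 := by
    simp only [E, List.take_length, List.drop_length, hrad, ← h2]
  rw [hE2]
  clear_value S1
  clear hE2 hE hdrop hsplit
  have hrep : List.replicate 6 Sym.zero = [.zero, .zero, .zero, .zero, .zero, .zero] := rfl
  refine (run_rep (n := 2) (I := fun i σ => σ = ⟨d, update (emitS c A (radCode c t n) [] S1)
    (.reg .tmp) (List.replicate (3 * i) (some .zero) ++
      emitS c A (radCode c t n) [] S1 (.reg .tmp)), x⟩) ?_ ?_).seq ?_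
  · rintro i hi _ rfl
    refine run_doOps ?_
    simp only [St.view, sem, Op.ap, pushO]
    congr 1
    rw [show 3 * (i + 1) = 3 * i + 1 + 1 + 1 by ring]
    simp [List.replicate_succ]
  · simp
  rintro _ rfl
  set S2 := update (emitS c A (radCode c t n) [] S1)
    (.reg .tmp) (List.replicate (3 * 2) (some .zero) ++
      emitS c A (radCode c t n) [] S1 (.reg .tmp)) with hS2
  have hS2' : S2 = update (update (update S1 (.reg (.A c)) []) (.reg .Ab) (A.map some).reverse)
      (.reg .tmp) (((strPair A (radCode c t n)).map some).reverse ++ S (.reg .tmp)) := by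
    rw [hpair, hrep, hS2]
    have ht : S1 (.reg .tmp) = S (.reg .tmp) := by rw [hS1]; simp
    clear * - ht
    funext j
    simp only [emitS, Function.update_apply, Stk.reg.injEq, reduceCtorEq, ↓reduceIte]
    split_ifs <;> simp_all [List.replicate_succ]
  clear_value S2
  clear hS2
  have l1 : S2 (.reg .cd) = List.replicate t none := by rw [hS2', hS1]; simp
  refine ((run_move (by simp) _ _ _).weaken (by rw [l1]; simp)).seq ?_
  rintro _ rfl
  refine (run_move (by simp) _ _ _).mono (by simp [hS2']) ?_
  rintro _ rfl
  rw [hS2', hS1]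
  congr 1
  clear * - hA hAb hZ hcd
  funext j
  simp only [Function.update_apply, Stk.reg.injEq, reduceCtorEq, ↓reduceIte]
  split_ifs <;> simp_all

end Rec

/-! ### Second-order polynomials -/

namespace IsSOP

variable {P Q : (ℕ → ℕ) → ℕ → ℕ}

theorem const (c : ℕ) : IsSOP fun _ _ => c := by
  simpa using poly (Polynomial.C c)

theorem id' : IsSOP fun _ n => n := by
  simpa using poly Polynomial.X

theorem eval (p : Polynomial ℕ) (hP : IsSOP P) : IsSOP fun l n => p.eval (P l n) := by
  induction p using Polynomial.induction_on' with
  | add p q hp hq => simpa using hp.sum hq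
  | monomial k a =>
    simp only [Polynomial.eval_monomial]
    refine (const a).prod ?_
    induction k with
    | zero => simpa using const 1
    | succ k ih => simpa [pow_succ] using ih.prod hP

theorem comp (hP : IsSOP P) (hQ : IsSOP Q) : IsSOP fun l n => P l (Q l n) := by
  induction hP with
  | poly p => exact eval p hQ
  | app _ ih => exact ih.app
  | sum _ _ ih ih' => exact ih.sum ih'
  | prod _ _ ih ih' => exact ih.prod ih'

/-- Substitution in the function argument. -/
theorem subst (hP : IsSOP P) (hQ : IsSOP Q) : IsSOP fun l n => P (Q l) n := by
  induction hP with
  | poly p => exact poly p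
  | app _ ih => exact hQ.comp ih
  | sum _ _ ih ih' => exact ih.sum ih'
  | prod _ _ ih ih' => exact ih.prod ih'

theorem mono (hP : IsSOP P) {l l' : ℕ → ℕ} (hl' : Monotone l') (hll : ∀ n, l n ≤ l' n) {m n : ℕ}
    (hmn : m ≤ n) : P l m ≤ P l' n := by
  have hpoly : ∀ p : Polynomial ℕ, p.eval m ≤ p.eval n := by
    intro p
    induction p using Polynomial.induction_on' with
    | add p q hp hq => simpa using add_le_add hp hq
    | monomial k a =>
      simp only [Polynomial.eval_monomial]
      exact Nat.mul_le_mul le_rfl (Nat.pow_le_pow_left hmn k)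
  induction hP with
  | poly p => exact hpoly p
  | app _ ih => exact (hll _).trans (hl' ih)
  | sum _ _ ih ih' => exact add_le_add ih ih'
  | prod _ _ ih ih' => exact Nat.mul_le_mul ih ih'

end IsSOP

/-! ### Sequences of records -/

/-- The record after the updates by the first `n` codes of a sequence. -/
noncomputable def recs (code : ℕ → Str) : ℕ → Str × ℕ
  | 0 => ([], 0)
  | n + 1 => stepRec (code n) (recs code n)

/-- The approximation in the record is close to `v`, and its code has about as many digits as the
grade demands. -/
def RecOk (v : ℝ) (B : ℕ) (r : Str × ℕ) : Prop :=
  r.2 = 0 ∨ ∃ y, IsDyadicCode r.1 y ∧ |y - v| ≤ 1 / 2 ^ (r.2 + 4) ∧ r.2 + 7 ≤ r.1.length ∧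
    r.1.length ≤ B + r.2 + 7

theorem one_div_pow_le {m n : ℕ} (h : m ≤ n) : (1 : ℝ) / 2 ^ n ≤ 1 / 2 ^ m :=
  one_div_le_one_div_of_le (by positivity) (pow_le_pow_right₀ (by norm_num) h)

section

variable {J : ID} {code : Str} {r : Str × ℕ} {v : ℝ} {B : ℕ}

theorem stepRec_le (hc : IsIntervalCode code J) (r : Str × ℕ) :
    r.2 ≤ (stepRec code r).2 ∧ (stepRec code r).2 ≤ r.2 + 1 := by
  rcases upd_stepRec hc r with ⟨-, h, -⟩ | ⟨h, -⟩ <;> omega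

theorem stepRec_eq (hc : IsIntervalCode code J) (h : (stepRec code r).2 = r.2) :
    stepRec code r = r := by
  rcases upd_stepRec hc r with ⟨h1, h2, -⟩ | ⟨h1, -⟩
  · exact Prod.ext h1 h2
  · omega

theorem abs_mid_lt {K : DyadicInterval} (hv : v ∈ ID.toSet (some K)) (hB : |v| + 1 ≤ 2 ^ B)
    (h : K.rad < 1) : |K.mid| < 2 ^ B := by
  simp only [ID.toSet, Set.mem_Icc] at hv
  have h1 := le_abs_self v
  have h2 := neg_abs_le v
  rw [abs_lt]
  constructor <;> linarith

theorem RecOk.step (hr : RecOk v B r) (hc : IsIntervalCode code J) (hv : v ∈ J.toSet)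
    (hB : |v| + 1 ≤ 2 ^ B) : RecOk v B (stepRec code r) := by
  rcases upd_stepRec hc r with ⟨h1, h2, -⟩ | ⟨h, K, y, rfl, h1, h2, h3, h4, h5⟩
  · rwa [show stepRec code r = r from Prod.ext h1 h2]
  · have h6 : (1 : ℝ) / 2 ^ (r.2 + 6) ≤ 1 := by simpa using one_div_pow_le (Nat.zero_le (r.2 + 6))
    refine .inr ⟨y, h2, ?_, by omega, ?_⟩
    · have e : (1 : ℝ) / 2 ^ (r.2 + 1 + 4) = 1 / 2 ^ (r.2 + 6) + 1 / 2 ^ (r.2 + 6) := by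
        rw [show r.2 + 6 = r.2 + 1 + 4 + 1 by ring, pow_succ _ (r.2 + 1 + 4)]; field_simp; norm_num
      have h7 : |K.mid - v| ≤ K.rad := by
        simp only [ID.toSet, Set.mem_Icc] at hv
        rw [abs_le]
        constructor <;> linarith
      rw [h, e]
      have := abs_sub_le y K.mid v
      linarith
    · have := h5 B (abs_mid_lt hv hB (by linarith))
      omega

theorem stepRec_progress (hc : IsIntervalCode code J) {K : DyadicInterval} (hJ : J = some K)
    (hv : v ∈ J.toSet) (hB : |v| + 1 ≤ 2 ^ B) (h : K.rad < 1 / 2 ^ (B + r.2 + 6)) :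
    (stepRec code r).2 = r.2 + 1 := by
  rcases upd_stepRec hc r with ⟨-, -, h1⟩ | ⟨h1, -⟩
  · subst hJ
    have h6 : (1 : ℝ) / 2 ^ (B + r.2 + 6) ≤ 1 := by
      simpa using one_div_pow_le (Nat.zero_le (B + r.2 + 6))
    have := h1 K rfl B (abs_mid_lt hv hB (by linarith))
    linarith
  · exact h1

open Classical in
/-- The interval of a record; the infinite interval for grade zero. -/
noncomputable def recID (c : Bool) (r : Str × ℕ) : ID :=
  if h : r.2 ≠ 0 ∧ ∃ y, IsDyadicCode r.1 y then
    some (approx c r.2 h.2.choose h.2.choose_spec.dyadic) else none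

/-- The code of the interval of a record. -/
noncomputable def recCode (c : Bool) (r : Str × ℕ) : Str :=
  if r.2 = 0 then [] else emitCode c r.1 r.2

theorem dyadicCode_inj {c : Str} {x x' : ℝ} (h : IsDyadicCode c x) (h' : IsDyadicCode c x') :
    x = x' := dyadicCode_unique h h' fun _ => rfl

theorem recID_eq {c : Bool} {y : ℝ} (h0 : r.2 ≠ 0) (h : IsDyadicCode r.1 y) :
    recID c r = some (approx c r.2 y h.dyadic) := by
  have h' : r.2 ≠ 0 ∧ ∃ y, IsDyadicCode r.1 y := ⟨h0, y, h⟩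
  rw [recID, dif_pos h']
  congr 2
  exact dyadicCode_inj h'.2.choose_spec h

theorem recID_zero {c : Bool} (h0 : r.2 = 0) : recID c r = none := by
  rw [recID, dif_neg (by simp [h0])]

theorem RecOk.isCode (hr : RecOk v B r) (c : Bool) : IsIntervalCode (recCode c r) (recID c r) := by
  by_cases h0 : r.2 = 0
  · rw [recID_zero h0, recCode, if_pos h0]; rfl
  · obtain ⟨y, h1, -⟩ := hr.resolve_left h0
    rw [recID_eq h0 h1, recCode, if_neg h0]
    exact emitCode_spec c r.2 h1

theorem RecOk.mem (hr : RecOk v B r) (c : Bool) : v ∈ (recID c r).toSet := by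
  by_cases h0 : r.2 = 0
  · rw [recID_zero h0]; trivial
  · obtain ⟨y, h1, h2, -⟩ := hr.resolve_left h0
    rw [recID_eq h0 h1]
    exact mem_approx h1.dyadic h2

theorem RecOk.subset {B' : ℕ} {r' : Str × ℕ} (hr : RecOk v B r) (hr' : RecOk v B' r')
    {c c' : Bool} (h : r.2 < r'.2 ∨ r.2 = r'.2 ∧ c = false ∧ c' = true ∨ r = r' ∧ c = c') :
    (recID c' r').toSet ⊆ (recID c r).toSet := by
  rcases h with h | h | ⟨rfl, rfl⟩
  · by_cases h0 : r.2 = 0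
    · rw [recID_zero h0]; exact Set.subset_univ _
    · obtain ⟨y, h1, h2, -⟩ := hr.resolve_left h0
      obtain ⟨y', h1', h2', -⟩ := hr'.resolve_left (by omega)
      rw [recID_eq h0 h1, recID_eq (by omega) h1']
      exact approx_subset _ _ h2 h2' (.inl h)
  · by_cases h0 : r.2 = 0
    · rw [recID_zero h0]; exact Set.subset_univ _
    · obtain ⟨y, h1, h2, -⟩ := hr.resolve_left h0
      obtain ⟨y', h1', h2', -⟩ := hr'.resolve_left (by omega)
      rw [recID_eq h0 h1, recID_eq (by omega) h1']
      exact approx_subset _ _ h2 h2' (.inr h)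
  · exact subset_rfl

theorem radius_le (c : Bool) (t : ℕ) : 2 * radius c t ≤ 1 / 2 ^ t := by
  have : radius c t = (if c then 3 / 4 else 1) * (1 / 2 ^ (t + 1)) := by rw [radius]; field_simp
  have h : (0 : ℝ) < 1 / 2 ^ t := by positivity
  rw [this, pow_succ, show (1 : ℝ) / (2 ^ t * 2) = 1 / 2 ^ t / 2 by field_simp]
  split_ifs <;> linarith

/-- The diameter of the interval of a record of grade at least `n`. -/
theorem RecOk.diam_le (hr : RecOk v B r) (c : Bool) {n : ℕ} (h0 : r.2 ≠ 0) (hn : n ≤ r.2) :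
    (recID c r).diam ≤ 2⁻¹ ^ n := by
  obtain ⟨y, h1, h2, -⟩ := hr.resolve_left h0
  rw [recID_eq h0 h1, diam_le_iff, inv_pow, ← one_div]
  exact (radius_le c r.2).trans (one_div_pow_le hn)

theorem strPair_length {a b : Str} (h : a.length = b.length) :
    (strPair a b).length = 3 * (a.length + 2) := by
  rw [strPair_eq h, cols, List.length_append, List.length_flatMap]
  simp [h]
  omega

theorem RecOk.length_le (hr : RecOk v B r) (c : Bool) :
    (recCode c r).length ≤ 3 * (B + r.2 + 9) := by
  by_cases h0 : r.2 = 0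
  · simp [recCode, h0]
  · obtain ⟨y, h1, h2, h3, h4⟩ := hr.resolve_left h0
    rw [recCode, if_neg h0, emitCode, strPair_length]
    · omega
    · cases c <;> simp [radCode] <;> omega

end

section

variable {J : ℕ → ID} {code : ℕ → Str} {v : ℝ} {B : ℕ}

theorem recs_le_succ (hc : ∀ n, IsIntervalCode (code n) (J n)) (n : ℕ) :
    (recs code n).2 ≤ (recs code (n + 1)).2 := (stepRec_le (hc n) _).1

theorem recs_mono (hc : ∀ n, IsIntervalCode (code n) (J n)) :
    Monotone fun n => (recs code n).2 := monotone_nat_of_le_succ (recs_le_succ hc)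

theorem recs_le (hc : ∀ n, IsIntervalCode (code n) (J n)) (n : ℕ) : (recs code n).2 ≤ n := by
  induction n with
  | zero => rfl
  | succ n ih => exact (stepRec_le (hc n) _).2.trans (by omega)

theorem recs_ok (hc : ∀ n, IsIntervalCode (code n) (J n)) (hv : ∀ n, v ∈ (J n).toSet)
    (hB : |v| + 1 ≤ 2 ^ B) (n : ℕ) : RecOk v B (recs code n) := by
  induction n with
  | zero => exact .inl rfl
  | succ n ih => exact ih.step (hc n) (hv n) hB

theorem recs_subset (hc : ∀ n, IsIntervalCode (code n) (J n)) (hv : ∀ n, v ∈ (J n).toSet)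
    (hB : |v| + 1 ≤ 2 ^ B) (c : Bool) (n : ℕ) :
    (recID c (recs code (n + 1))).toSet ⊆ (recID c (recs code n)).toSet := by
  refine (recs_ok hc hv hB n).subset (recs_ok hc hv hB (n + 1)) ?_
  rcases eq_or_lt_of_le (recs_le_succ hc n) with h | h
  · exact .inr (.inr ⟨(stepRec_eq (hc n) h.symm).symm, rfl⟩)
  · exact .inl h

/-- Once the intervals are small, every step raises the grade. -/
theorem recs_progress (hc : ∀ n, IsIntervalCode (code n) (J n)) (hv : ∀ n, v ∈ (J n).toSet)
    (hB : |v| + 1 ≤ 2 ^ B) {m T : ℕ} (hJ : ∀ n ≥ m, (J n).diam ≤ 2⁻¹ ^ (B + T + 6)) (i : ℕ) :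
    min T i ≤ (recs code (m + i)).2 := by
  induction i with
  | zero => simp
  | succ i ih =>
    by_cases h : T ≤ (recs code (m + i)).2
    · have := recs_le_succ hc (m + i)
      rw [← add_assoc]
      omega
    · have hd := hJ (m + i) (by omega)
      obtain ⟨K, hK⟩ : ∃ K, J (m + i) = some K := by
        cases hK : J (m + i) with
        | none => rw [hK] at hd; simp [ID.diam] at hd
        | some K => exact ⟨K, rfl⟩
      rw [hK, diam_le_iff, inv_pow, ← one_div] at hd
      have hp := K.rad_pos
      have := one_div_pow_le (m := B + (recs code (m + i)).2 + 6) (n := B + T + 6) (by omega)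
      have := stepRec_progress (r := recs code (m + i)) (hc (m + i)) hK (hv _) hB (by linarith)
      rw [← add_assoc, recs]
      omega

/-- If the intervals shrink to `v` then so do the intervals of the records. -/
theorem isRealName_recs {k : ℕ} (c : Bool) (hc : ∀ n, IsIntervalCode (code n) (J n))
    (hv : ∀ n, v ∈ (J n).toSet) (hB : |v| + 1 ≤ 2 ^ B)
    (hJ : ∀ T, ∃ m, ∀ n ≥ m, (J n).diam ≤ 2⁻¹ ^ T) :
    IsRealName (fun n => recID c (recs code (n + k))) v := by
  refine isRealName_of_small ?_ ?_ ?_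
  · intro n
    rw [add_right_comm]
    exact recs_subset hc hv hB c _
  · exact fun n => (recs_ok hc hv hB _).mem c
  · intro δ hδ
    obtain ⟨T, hT⟩ := exists_pow_lt_of_lt_one hδ (by norm_num : (2⁻¹ : ℝ) < 1)
    obtain ⟨m, hm⟩ := hJ (B + (T + 1) + 6)
    have h := recs_progress hc hv hB hm (T + 1)
    rw [min_self] at h
    have h' : T + 1 ≤ (recs code (m + (T + 1) + k)).2 :=
      h.trans (recs_mono hc (Nat.le_add_right _ _))
    obtain ⟨y, h1, -⟩ := (recs_ok hc hv hB (m + (T + 1) + k)).resolve_left (by omega)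
    refine ⟨m + (T + 1), _, recID_eq (by omega) h1, ?_⟩
    have h2 := radius_le c (recs code (m + (T + 1) + k)).2
    have h3 := one_div_pow_le (m := T) (n := (recs code (m + (T + 1) + k)).2) (by omega)
    have h4 := radius_pos c (recs code (m + (T + 1) + k)).2
    rw [inv_pow, ← one_div] at hT
    change radius c _ < δ
    linarith

end

/-! ### Evaluation by a stack program -/

section Eval

variable {M : OracleMachine} {φ : Baire}

/-- The instruction without effect. -/
noncomputable def skip : Prog (Dat M.State) (Rg M.Work) := doOps (fun v => v.d) fun _ => []

/-- Read the input to the stack `k`. -/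
noncomputable def readIn (k : Stk (Rg M.Work)) : Prog (Dat M.State) (Rg M.Work) :=
  .loop (fun v => v.inp.isSome) (.act fun v => ⟨v.d, opl [(k, .put v.inp)], true⟩)

theorem run_readIn (k : Stk (Rg M.Work)) (d : Dat M.State) (S : Stk (Rg M.Work) → List Cell)
    (a : Str) : Run φ (readIn k) ⟨d, S, a⟩ (2 * a.length + 1)
      fun σ => σ = ⟨d, update S k ((a.map some).reverse ++ S k), []⟩ := by
  induction a generalizing S with
  | nil =>
    refine Run.loop_false (by simp [St.view]) ?_
    simp
  | cons s a ih =>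
    refine (Run.loop_true (T := 1) (by simp [St.view])
      (Run.act (Q := fun σ => σ = ⟨d, update S k (some s :: S k), a⟩) ?_) ?_).weaken
      (T := 1 + (2 * a.length + 1) + 1) (by simp; omega)
    · simp only [St.app, opl_ap, St.view]
      simp [sem, Op.ap, pushO]
    rintro _ rfl
    refine (ih _).mono le_rfl ?_
    rintro _ rfl
    simp

/-- Ask the second component of the oracle for its value on the number that is in unary on `cnt`. -/
noncomputable def askNat (M : OracleMachine) : Prog (Dat M.State) (Rg M.Work) :=
  .seq (doOps (fun v => v.d) fun _ => [(.qry, .put3 (some .one) (some .zero) (some .one))]) <|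
  .seq (.loop (fun v => (v.top (.reg .cnt)).isSome) (doOps (fun v => v.d)
    fun _ => [(.reg .cnt, .drop), (.reg .cd, .put none), (.qry, .put (some .zero))])) <|
  .seq (move (.reg .cd) (.reg .cnt)) (.seq .call (empty .qry))

theorem run_askNat {n : ℕ} (d : Dat M.State) {S : Stk (Rg M.Work) → List Cell} (x : Str)
    (hq : S .qry = []) (hcd : S (.reg .cd) = []) (hcnt : S (.reg .cnt) = List.replicate n none) :
    Run φ (askNat M) ⟨d, S, x⟩ (4 * n + 5)
      fun σ => σ = ⟨d, update S .ans ((snd φ (natCode n)).map some), x⟩ := by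
  refine Run.weaken (T := 1 + ((n * (1 + 1) + 1) + ((2 * n + 1) + (1 + 1)))) ?_ (by omega)
  refine (run_doOps rfl).seq ?_
  rintro _ rfl
  refine (Run.loop (n := n) (I := fun i σ => σ = ⟨d, update (update (update S .qry
    (List.replicate i (some .zero) ++ [some .one, some .zero, some .one])) (.reg .cnt)
    (List.replicate (n - i) none)) (.reg .cd) (List.replicate i none), x⟩) ?_ ?_ ?_).seq ?_
  · rintro i hi _ rfl
    obtain ⟨m, hm⟩ : ∃ m, n - i = m + 1 := ⟨n - i - 1, by omega⟩
    have hm' : n - (i + 1) = m := by omega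
    refine ⟨by simp [St.view, hm, List.replicate_succ], run_doOps ?_⟩
    simp only [St.view, sem, Op.ap, pushO, hm, hm']
    congr 1
    funext j
    clear hm hm'
    simp only [Function.update_apply, Stk.reg.injEq, reduceCtorEq, ↓reduceIte]
    split_ifs <;> simp_all [List.replicate_succ]
  · rintro _ rfl
    simp [St.view]
  · simp only [St.view, sem, Op.ap, pushO]
    congr 1
    funext j
    simp only [Function.update_apply, Stk.reg.injEq, reduceCtorEq, ↓reduceIte]
    split_ifs <;> simp_all
  rintro _ rfl
  refine ((run_move (by simp) _ _ _).weaken (by simp)).seq ?_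
  rintro _ rfl
  refine (Run.call rfl).seq ?_
  rintro _ rfl
  refine (run_empty _ _ _ _).mono le_rfl ?_
  rintro _ rfl
  simp only [St.ask]
  congr 1
  funext j
  have hc : (stkT (List.replicate n (some Sym.zero) ++ [some .one, some .zero, some .one])).content =
      .one :: natCode n := by
    simpa [natCode] using stkT_content (.one :: natCode n)
  simp only [Function.update_apply, Stk.reg.injEq, reduceCtorEq, ↓reduceIte, hc, snd]
  split_ifs <;> simp_all

/-- Ask the first component of the oracle about the string in `harg`. -/
noncomputable def askFst (M : OracleMachine) : Prog (Dat M.State) (Rg M.Work) :=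
  .seq (doOps (fun v => v.d) fun _ => [(.qry, .put (some .zero))]) <|
  .seq (move (.reg .harg) .qry) (.seq .call (empty .qry))

theorem run_askFst {q : Str} (d : Dat M.State) {S : Stk (Rg M.Work) → List Cell} (x : Str)
    (hq : S .qry = []) (hh : S (.reg .harg) = q.map some) :
    Run φ (askFst M) ⟨d, S, x⟩ (2 * q.length + 4)
      fun σ => σ = ⟨d, update (update S (.reg .harg) []) .ans ((fst φ q).map some), x⟩ := by
  refine Run.weaken (T := 1 + ((2 * q.length + 1) + (1 + 1))) ?_ (by omega)
  refine (run_doOps rfl).seq ?_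
  rintro _ rfl
  refine ((run_move (by simp) _ _ _).weaken (by simp [sem, hh])).seq ?_
  rintro _ rfl
  refine (Run.call rfl).seq ?_
  rintro _ rfl
  refine (run_empty _ _ _ _).mono le_rfl ?_
  rintro _ rfl
  simp only [St.ask, St.view, sem, Op.ap, pushO]
  congr 1
  funext j
  have hc := stkT_content (Sym.zero :: q)
  simp only [List.map_cons, List.reverse_cons] at hc
  simp only [Function.update_apply, Stk.reg.injEq, reduceCtorEq, ↓reduceIte, hh, hq, hc, fst]
  split_ifs <;> simp_all

theorem handles_askFst {S₀ : Stk (Rg M.Work) → List Cell} (hq : S₀ .qry = []) (n : ℕ) (x : Str) :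
    Handles φ (askFst M) (fst φ) Set.univ (2 * n + 4) n S₀ x := by
  intro d S q hS hn hh _ _ _ _
  refine (run_askFst d x ((hS _ id).trans hq) hh).mono (by omega) ?_
  rintro _ rfl
  exact ⟨d, rfl, rfl, rfl, by simp⟩

/-- The program `ev` replaces a string `s` on `tmp` by `θ s` on the answer stack. -/
def Evaluates (φ : Baire) (ev : Prog (Dat M.State) (Rg M.Work)) (θ : Baire) (eb : ℕ → ℕ) : Prop :=
  ∀ d S x s, (∀ k, Scratch k → k ≠ .reg .tmp → S k = []) → S .qry = [] →
    S (.reg .tmp) = (s.map some).reverse → Run φ ev ⟨d, S, x⟩ (eb s.length) fun σ =>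
      ∃ d', σ = ⟨d', update (update S (.reg .tmp) []) .ans ((θ s).map some), x⟩

theorem evaluates_askFst :
    Evaluates φ (.seq (move (.reg .tmp) (.reg .harg)) (askFst M)) (fst φ) (fun n => 4 * n + 5) := by
  intro d S x s hS hq ht
  refine Run.weaken (T := (2 * s.length + 1) + (2 * s.length + 4)) ?_ (by dsimp only; omega)
  have hh := hS (.reg .harg) trivial (by simp)
  refine ((run_move (by simp) _ _ _).weaken (by simp [ht])).seq ?_
  rintro _ rfl
  refine (run_askFst (q := s) d x (by simp [hq]) (by simp [hh, ht])).mono le_rfl ?_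
  rintro _ rfl
  refine ⟨d, ?_⟩
  congr 1
  funext j
  simp only [Function.update_apply, Stk.reg.injEq, reduceCtorEq, ↓reduceIte]
  split_ifs <;> simp_all

theorem evaluates_sim {N : ℕ → ℕ} {χ : Baire}
    (hN : ∀ a, M.HaltedBy (fst φ) a (N a.length)) (hχ : χ ∈ M.operator (fst φ)) :
    Evaluates φ (sim M (askFst M)) χ (fun n => (N n + 1) * (20 * N n + (2 * N n + 4) + 22) +
      2 * n + 8 * N n + 10) := by
  classical
  intro d S x s hS hq ht
  refine (run_sim (handles_askFst hq (N s.length) x) (hN s) hS ht).mono le_rfl ?_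
  rintro _ ⟨d', rfl, -⟩
  obtain ⟨h, rfl⟩ := hχ
  refine ⟨d', ?_⟩
  simp only [OracleMachine.operator]
  rw [OracleMachine.content_find (h s) (hN s)]

/-- Emit the code of a record, which is empty for grade zero. -/
noncomputable def emit (M : OracleMachine) (c : Bool) : Prog (Dat M.State) (Rg M.Work) :=
  .ite (fun v => (v.top (.reg (.Z c))).isSome) (emitRec M c) skip

theorem run_emit {c : Bool} {r : Str × ℕ} {v : ℝ} {B : ℕ} (hr : RecOk v B r) (d : Dat M.State)
    {S : Stk (Rg M.Work) → List Cell} (x : Str) (hAb : S (.reg .Ab) = [])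
    (hcd : S (.reg .cd) = []) (hA : S (.reg (.A c)) = r.1.map some)
    (hZ : S (.reg (.Z c)) = List.replicate r.2 none) :
    Run φ (emit M c) ⟨d, S, x⟩ (12 * (B + r.2 + 7) + 31) fun σ => σ = ⟨d, update S (.reg .tmp)
      (((recCode c r).map some).reverse ++ S (.reg .tmp)), x⟩ := by
  by_cases h0 : r.2 = 0
  · refine Run.ite_false (by simp [St.view, hZ, h0]) ((run_doOps ?_).weaken (by omega))
    simp [sem, St.view, recCode, h0]
  · obtain ⟨y, -, -, h1, h2⟩ := hr.resolve_left h0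
    refine Run.ite_true ?_ ((run_emitRec (by omega) d x hAb hcd hA hZ).mono (by omega) ?_)
    · obtain ⟨m, hm⟩ := Nat.exists_eq_succ_of_ne_zero h0
      simp [St.view, hZ, hm, List.replicate_succ]
    · rintro _ rfl
      rw [recCode, if_neg h0]

/-- One round of the evaluation: the next interval of the argument updates the first record, whose
interval is evaluated; the result updates the second record. -/
noncomputable def evalRound (ev : Prog (Dat M.State) (Rg M.Work)) : Prog (Dat M.State) (Rg M.Work) :=
  .seq (doOps (fun v => v.d) fun _ => [(.reg .fuel, .drop)]) <| .seq (askNat M) <|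
  .seq (updateRec M false) <| .seq (emit M false) <| .seq ev <|
  .seq (updateRec M true) (doOps (fun v => v.d) fun _ => [(.reg .cnt, .put none)])

/-- The evaluation: as many rounds as there are input symbols. -/
noncomputable def evalProg (ev : Prog (Dat M.State) (Rg M.Work)) : Prog (Dat M.State) (Rg M.Work) :=
  .seq (readIn (.reg .fuel)) <|
  .seq (.loop (fun v => (v.top (.reg .fuel)).isSome) (evalRound ev)) <|
  .seq (emit M true) <| .seq (move (.reg .tmp) (.reg .harg)) (move (.reg .harg) .out)

/-- The stacks between two rounds of the evaluation. -/
def evalS {W : Type} (fu : List Cell) (n : ℕ) (r k : Str × ℕ) : Stk (Rg W) → List Cell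
  | .reg .fuel => fu
  | .reg .cnt => List.replicate n none
  | .reg (.A false) => r.1.map some
  | .reg (.Z false) => List.replicate r.2 none
  | .reg (.A true) => k.1.map some
  | .reg (.Z true) => List.replicate k.2 none
  | _ => []

theorem evalS_scratch {W : Type} (fu : List Cell) (n : ℕ) (r k : Str × ℕ) {j : Stk (Rg W)}
    (h : Scratch j) : evalS fu n r k j = [] := by
  rcases j with _ | _ | _ | j
  · rfl
  · rfl
  · rfl
  · cases j <;> first | rfl | exact absurd h id

variable {ev : Prog (Dat M.State) (Rg M.Work)} {θ : Baire} {eb : ℕ → ℕ} {J K : ℕ → ID} {u v : ℝ}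
  {B : ℕ}

/-- The codes of the intervals that are obtained from the argument by evaluation. -/
noncomputable def evalCode (φ θ : Baire) (i : ℕ) : Str :=
  θ (recCode false (recs (fun j => snd φ (natCode j)) (i + 1)))

theorem run_evalRound (hev : Evaluates φ ev θ eb) (heb : Monotone eb)
    (hJ : ∀ n, IsIntervalCode (snd φ (natCode n)) (J n)) (hu : ∀ n, u ∈ (J n).toSet)
    (hu1 : |u| + 1 ≤ 2 ^ 1) (hK : ∀ n, IsIntervalCode (evalCode φ θ n) (K n))
    (hv : ∀ n, v ∈ (K n).toSet) (hB : |v| + 1 ≤ 2 ^ B) {i n : ℕ} (hi : i < n) (g : Cell)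
    (fu : List Cell) (d : Dat M.State) (x : Str) :
    Run φ (evalRound ev) ⟨d, evalS (g :: fu) i (recs (fun j => snd φ (natCode j)) i)
      (recs (evalCode φ θ) i), x⟩ (40 * n + 12 * B + eb (3 * n + 30) + 400) fun σ => ∃ d',
        σ = ⟨d', evalS fu (i + 1) (recs (fun j => snd φ (natCode j)) (i + 1))
          (recs (evalCode φ θ) (i + 1)), x⟩ := by
  set cJ := fun j => snd φ (natCode j) with hcJ
  have tJ := recs_le (code := cJ) hJ
  have tK := recs_le hK
  have tJi := tJ i
  have tJi' := tJ (i + 1)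
  have tKi := tK i
  have okJ := recs_ok (code := cJ) hJ hu hu1
  have okK := recs_ok hK hv hB
  refine Run.weaken (T := 1 + ((4 * n + 5) + ((12 * (1 + n) + 80) + ((12 * (1 + n + 7) + 31) +
    (eb (3 * n + 30) + ((12 * (B + n) + 80) + 1)))))) ?_ (by omega)
  refine (run_doOps rfl).seq ?_
  rintro _ rfl
  have e1 : sem [(.reg .fuel, .drop)] (evalS (g :: fu) i (recs cJ i) (recs (evalCode φ θ) i)) =
      (evalS fu i (recs cJ i) (recs (evalCode φ θ) i) : Stk (Rg M.Work) → List Cell) := by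
    funext j
    cases j with
    | reg j =>
      cases j with
      | A c => cases c <;> simp [sem, Function.update_apply, evalS, Op.ap, pushO]
      | Z c => cases c <;> simp [sem, Function.update_apply, evalS, Op.ap, pushO]
      | _ => simp [sem, Function.update_apply, evalS, Op.ap, pushO]
    | _ => simp [sem, Function.update_apply, evalS, Op.ap, pushO]
  simp only [e1, St.view]
  refine ((run_askNat (n := i) d x rfl rfl rfl).weaken (by omega)).seq ?_
  rintro _ rfl
  refine ((run_updateRec (c := false) (J := J i) (r := recs cJ i) (B := 1) (hJ i) ?_ d x
    (by simp [hcJ]) (by simp [evalS]) (by simp [evalS]) (by simp [evalS]) (by simp [evalS])).mono (Q' := fun σ => ∃ d', σ = ⟨d', evalS fu i (recs cJ (i + 1))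
      (recs (evalCode φ θ) i), x⟩) (by omega) ?_).seq ?_
  · intro L hL hr
    have := hu i
    rw [hL] at this
    exact abs_mid_lt this hu1 hr
  · rintro _ ⟨d', rfl⟩
    refine ⟨d', ?_⟩
    congr 1
    funext j
    cases j with
    | reg j =>
      cases j with
      | A c => cases c <;> simp [Function.update_apply, evalS, recs, hcJ]
      | Z c => cases c <;> simp [Function.update_apply, evalS, recs, hcJ]
      | _ => simp [Function.update_apply, evalS]
    | _ => simp [Function.update_apply, evalS]
  rintro _ ⟨d1, rfl⟩
  refine ((run_emit (c := false) (okJ (i + 1)) d1 x rfl rfl rfl rfl).weaken (by omega)).seq ?_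
  rintro _ rfl
  refine ((hev d1 _ x (recCode false (recs cJ (i + 1))) ?_ (by simp [evalS]) ?_).weaken ?_).seq ?_
  · intro k hk hk'
    rw [Function.update_of_ne hk']
    exact evalS_scratch _ _ _ _ hk
  · simp [evalS]
  · exact heb (((okJ (i + 1)).length_le false).trans (by omega))
  rintro _ ⟨d2, rfl⟩
  refine ((run_updateRec (c := true) (J := K i) (r := recs (evalCode φ θ) i) (B := B) (hK i) ?_ d2 x
    (by simp [evalCode, hcJ]) (by simp [evalS]) (by simp [evalS]) (by simp [evalS]) (by simp [evalS])).mono (Q' := fun σ => ∃ d', σ = ⟨d',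
      evalS fu i (recs cJ (i + 1)) (recs (evalCode φ θ) (i + 1)), x⟩) (by omega) ?_).seq ?_
  · intro L hL hr
    have := hv i
    rw [hL] at this
    exact abs_mid_lt this hB hr
  · rintro _ ⟨d', rfl⟩
    refine ⟨d', ?_⟩
    congr 1
    funext j
    cases j with
    | reg j =>
      cases j with
      | A c => cases c <;> simp [Function.update_apply, evalS, recs]
      | Z c => cases c <;> simp [Function.update_apply, evalS, recs]
      | _ => simp [Function.update_apply, evalS]
    | _ => simp [Function.update_apply, evalS]
  rintro _ ⟨d3, rfl⟩
  refine run_doOps ⟨d3, ?_⟩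
  simp only [St.view, sem]
  congr 1
  funext j
  cases j with
  | reg j =>
    cases j with
    | A c => cases c <;> simp [Function.update_apply, evalS, Op.ap, pushO]
    | Z c => cases c <;> simp [Function.update_apply, evalS, Op.ap, pushO]
    | _ => simp [Function.update_apply, evalS, Op.ap, pushO, List.replicate_succ]
  | _ => simp [Function.update_apply, evalS, Op.ap, pushO]

theorem run_evalProg (hev : Evaluates φ ev θ eb) (heb : Monotone eb)
    (hJ : ∀ n, IsIntervalCode (snd φ (natCode n)) (J n)) (hu : ∀ n, u ∈ (J n).toSet)
    (hu1 : |u| + 1 ≤ 2 ^ 1) (hK : ∀ n, IsIntervalCode (evalCode φ θ n) (K n))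
    (hv : ∀ n, v ∈ (K n).toSet) (hB : |v| + 1 ≤ 2 ^ B) (d : Dat M.State) (a : Str) :
    Run φ (evalProg ev) ⟨d, fun _ => [], a⟩
      ((a.length + 1) * (70 * a.length + 40 * B + eb (3 * a.length + 30) + 600)) fun σ =>
        σ.stk .out = ((recCode true (recs (evalCode φ θ) a.length)).map some).reverse := by
  have tK := recs_le hK a.length
  have okK := recs_ok hK hv hB a.length
  set n := a.length with hn
  set T := 40 * n + 12 * B + eb (3 * n + 30) + 400 with hT
  have hL := okK.length_le true
  refine Run.weaken (T := (2 * n + 1) + ((n * (T + 1) + 1) + ((12 * (B + n + 7) + 31) +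
    ((2 * (3 * (B + n + 9)) + 1) + (2 * (3 * (B + n + 9)) + 1))))) ?_ ?_
  swap
  · have : n * (T + 1) ≤ n * (70 * n + 40 * B + eb (3 * n + 30) + 600) :=
      Nat.mul_le_mul le_rfl (by omega)
    rw [Nat.add_mul n 1, one_mul]
    omega
  refine (run_readIn _ _ _ _).seq ?_
  rintro _ rfl
  have hlen : ((a.map some).reverse : List Cell).length = n := by simp [hn]
  refine (Run.loop (n := n) (T := T) (I := fun i σ => ∃ d', σ = ⟨d', evalS
    ((a.map some).reverse.drop i) i (recs (fun j => snd φ (natCode j)) i)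
    (recs (evalCode φ θ) i), []⟩) ?_ ?_ ?_).seq ?_
  · rintro i hi _ ⟨d', rfl⟩
    have hd : ((a.map some).reverse : List Cell).drop i =
        ((a.map some).reverse : List Cell)[i] :: ((a.map some).reverse : List Cell).drop (i + 1) :=
      List.drop_eq_getElem_cons (by omega)
    rw [hd]
    exact ⟨rfl, run_evalRound hev heb hJ hu hu1 hK hv hB hi _ _ d' []⟩
  · rintro _ ⟨d', rfl⟩
    simp [St.view, evalS, hn]
  · refine ⟨d, ?_⟩
    congr 1
    funext j
    cases j with
    | reg j =>
      cases j with
      | A c => cases c <;> simp [Function.update_apply, evalS, recs]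
      | Z c => cases c <;> simp [Function.update_apply, evalS, recs]
      | _ => simp [Function.update_apply, evalS]
    | _ => simp [Function.update_apply, evalS]
  rintro _ ⟨d1, rfl⟩
  refine ((run_emit (c := true) okK d1 [] rfl rfl rfl rfl).weaken (by omega)).seq ?_
  rintro _ rfl
  refine ((run_move (by simp) _ _ _).weaken ?_).seq ?_
  · simp [evalS]; omega
  rintro _ rfl
  refine (run_move (by simp) _ _ _).mono ?_ ?_
  · simp [evalS]; omega
  rintro _ rfl
  simp [evalS]

end Eval

/-! ### Membership and parameters in the concrete spaces -/

theorem mem_intervalReals {χ : Baire} {x : ℝ} :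
    x ∈ intervalReals.rep χ ↔ ∃ J, EncodesSeq χ J ∧ IsRealName J x := by
  constructor
  · rintro ⟨h, rfl⟩
    exact ⟨_, h.choose_spec⟩
  · rintro ⟨J, h1, h2⟩
    have h : ∃ p : (ℕ → ID) × ℝ, EncodesSeq χ p.1 ∧ IsRealName p.1 p.2 := ⟨(J, x), h1, h2⟩
    refine ⟨h, ?_⟩
    have he : h.choose.1 = J := funext fun n => intervalCode_unique (h.choose_spec.1 n) (h1 n)
    have hn := h.choose_spec.2
    rw [he] at hn
    exact hn.unique h2

theorem param_intervalReals {χ : intervalReals.rep.Dom} {J : ℕ → ID} {x : ℝ}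
    (h1 : EncodesSeq χ J) (h2 : IsRealName J x) (n : ℕ) :
    intervalReals.param χ n = rate J n + ⌈Real.logb 2 (|x| + 1)⌉₊ := by
  have h : ∃ p : (ℕ → ID) × ℝ, EncodesSeq χ p.1 ∧ IsRealName p.1 p.2 := χ.2
  have he : h.choose.1 = J := funext fun n => intervalCode_unique (h.choose_spec.1 n) (h1 n)
  have hn := h.choose_spec.2
  rw [he] at hn
  change rate h.choose.1 n + ⌈Real.logb 2 (|h.choose.2| + 1)⌉₊ = _
  rw [he, hn.unique h2]

theorem encodesFun_unique {χ : Baire} {ψ ψ' : ID → ID} (h : EncodesFun χ ψ)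
    (h' : EncodesFun χ ψ') : ψ = ψ' := funext fun J => by
  obtain ⟨a, ha⟩ := exists_intervalCode J
  exact intervalCode_unique (h J a ha) (h' J a ha)

theorem mem_intervalFunctions {χ : Baire} {f : C(unitInterval, ℝ)} :
    f ∈ intervalFunctions.rep χ ↔ ∃ ψ, EncodesFun χ ψ ∧ IsFunName ψ f := by
  constructor
  · rintro ⟨h, rfl⟩
    exact ⟨_, h.choose_spec⟩
  · rintro ⟨ψ, h1, h2⟩
    have h : ∃ p : (ID → ID) × C(unitInterval, ℝ), EncodesFun χ p.1 ∧ IsFunName p.1 p.2 :=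
      ⟨(ψ, f), h1, h2⟩
    refine ⟨h, ?_⟩
    have hn := h.choose_spec.2
    rw [encodesFun_unique h.choose_spec.1 h1] at hn
    exact hn.unique h2

theorem param_intervalFunctions {χ : intervalFunctions.rep.Dom} {ψ : ID → ID}
    {f : C(unitInterval, ℝ)} (h1 : EncodesFun χ ψ) (h2 : IsFunName ψ f) (n : ℕ) :
    intervalFunctions.param χ n = modulus ψ n + ⌈Real.logb 2 (‖f‖ + 1)⌉₊ := by
  have h : ∃ p : (ID → ID) × C(unitInterval, ℝ), EncodesFun χ p.1 ∧ IsFunName p.1 p.2 := χ.2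
  have he := encodesFun_unique h.choose_spec.1 h1
  have hn := h.choose_spec.2
  rw [he] at hn
  change modulus h.choose.1 n + ⌈Real.logb 2 (‖h.choose.2‖ + 1)⌉₊ = _
  rw [he, hn.unique h2]

theorem add_one_le_two_pow {y : ℝ} (hy : 0 ≤ y) : y + 1 ≤ 2 ^ ⌈Real.logb 2 (y + 1)⌉₊ := by
  have h := Nat.le_ceil (Real.logb 2 (y + 1))
  rwa [Real.logb_le_iff_le_rpow (by norm_num) (by linarith), Real.rpow_natCast] at h

theorem diam_mono {J K : ID} (h : J.toSet ⊆ K.toSet) : J.diam ≤ K.diam := by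
  cases K with
  | none => exact le_top
  | some K =>
    cases J with
    | none =>
      have := h (Set.mem_univ (K.mid + K.rad + 1))
      simp only [ID.toSet, Set.mem_Icc] at this
      linarith [this.2]
    | some J =>
      have hp := J.rad_pos
      have m1 := h (show J.mid - J.rad ∈ ID.toSet (some J) from ⟨le_rfl, by linarith⟩)
      have m2 := h (show J.mid + J.rad ∈ ID.toSet (some J) from ⟨by linarith, le_rfl⟩)
      simp only [ID.toSet, Set.mem_Icc] at m1 m2
      exact ENNReal.ofReal_le_ofReal (by linarith [m1.1, m2.2])

theorem diam_le_of_rate_le {J : ℕ → ID} {x : ℝ} (h : IsRealName J x) {n m : ℕ}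
    (hm : rate J n ≤ m) : (J m).diam ≤ 2⁻¹ ^ n :=
  (diam_mono ((antitone_nat_of_succ_le h.1 : Antitone fun n => (J n).toSet) hm)).trans
    (Nat.sInf_mem (rate_nonempty h n))

theorem diam_le_of_modulus {ψ : ID → ID} {f : C(unitInterval, ℝ)} (h : IsFunName ψ f) {n m : ℕ}
    (hm : modulus ψ n ≤ m) {J : ID} (hJ : (J.toSet ∩ Set.Icc 0 1).Nonempty)
    (hd : J.diam ≤ 2⁻¹ ^ m) : (ψ J).diam ≤ 2⁻¹ ^ n :=
  Nat.sInf_mem (modulus_nonempty h n) J hJ (hd.trans (inv_two_pow_anti hm))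

/-! ### Evaluation from interval functions -/

section Eval

variable {M : OracleMachine} {φ θ : Baire} {ψ : ID → ID} {f : C(unitInterval, ℝ)}
  {x : unitInterval} {J : ℕ → ID}

/-- The codes that the evaluation collects are codes of intervals that contain the value, and they
shrink at a rate that is determined by the argument and the function. -/
theorem evalCode_spec (hψ : EncodesFun θ ψ) (hf : IsFunName ψ f) (hJ : EncodesSeq (snd φ) J)
    (hx : IsRealName J x) : ∃ K : ℕ → ID, (∀ n, IsIntervalCode (evalCode φ θ n) (K n)) ∧
      (∀ n, f x ∈ (K n).toSet) ∧ ∀ n m, rate J (modulus ψ n + 8) + (modulus ψ n + 1) ≤ m →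
        (K m).diam ≤ 2⁻¹ ^ n := by
  have hu : |(x : ℝ)| + 1 ≤ 2 ^ 1 := by
    have := x.2.1
    have := x.2.2
    rw [abs_of_nonneg x.2.1]; linarith
  have hc : ∀ n, IsIntervalCode (snd φ (natCode n)) (J n) := hJ
  have hok := recs_ok hc hx.mem hu
  have hname := isRealName_recs (k := 1) false hc hx.mem hu
    fun T => ⟨rate J T, fun n hn => diam_le_of_rate_le hx hn⟩
  refine ⟨fun n => ψ (recID false (recs (fun j => snd φ (natCode j)) (n + 1))),
    fun n => hψ _ _ ((hok _).isCode _), (hf _ x hname).mem, fun n m hm => ?_⟩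
  have hp := recs_progress hc hx.mem hu (T := modulus ψ n + 1) (m := rate J (modulus ψ n + 8))
    (fun i hi => by convert diam_le_of_rate_le hx hi using 2; omega) (modulus ψ n + 1)
  rw [min_self] at hp
  have hp' := hp.trans (recs_mono hc (b := m + 1) (by omega))
  refine diam_le_of_modulus hf le_rfl ⟨x, (hok _).mem _, x.2⟩
    ((hok (m + 1)).diam_le false ?_ ?_)
  · dsimp only at hp'; omega
  · dsimp only at hp'; omega

instance : Finite M.State := M.finite_state

instance : Finite M.Work := M.finite_work

variable {ev : Prog (Dat M.State) (Rg M.Work)} {eb : ℕ → ℕ}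

/-- The machine of the evaluation program outputs a name of the value. -/
theorem mach_evalProg (hev : Evaluates φ ev θ eb) (heb : Monotone eb) (hψ : EncodesFun θ ψ)
    (hf : IsFunName ψ f) (hJ : EncodesSeq (snd φ) J) (hx : IsRealName J x) {B : ℕ}
    (hB : ‖f‖ + 1 ≤ 2 ^ B) (d : Dat M.State) :
    (∀ a, ((evalProg ev).mach d).HaltedBy φ a ((a.length + 1) *
      (70 * a.length + 40 * B + eb (3 * a.length + 30) + 600) *
        (3 * Nat.card (Stk (Rg M.Work)) + 8) + 1)) ∧
    ∃ χ ∈ ((evalProg ev).mach d).operator φ, ∃ L, EncodesSeq χ L ∧ IsRealName L (f x) ∧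
      ∀ n, rate L n ≤ rate J (modulus ψ (B + n + 7) + 8) + modulus ψ (B + n + 7) + n + 2 := by
  classical
  obtain ⟨K, hK, hv, hr⟩ := evalCode_spec hψ hf hJ hx
  have hB' : |f x| + 1 ≤ 2 ^ B := by
    have := f.norm_coe_le_norm x
    rw [Real.norm_eq_abs] at this
    linarith
  have hu : |(x : ℝ)| + 1 ≤ 2 ^ 1 := by
    have := x.2.1
    have := x.2.2
    rw [abs_of_nonneg x.2.1]; linarith
  have hok := recs_ok hK hv hB'
  have hrun : ∀ a, ((evalProg ev).mach d).HaltedBy φ a ((a.length + 1) *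
      (70 * a.length + 40 * B + eb (3 * a.length + 30) + 600) *
        (3 * Nat.card (Stk (Rg M.Work)) + 8) + 1) ∧ ∀ h : ∃ t, ((evalProg ev).mach d).HaltedBy φ a t,
        ((((evalProg ev).mach d).conf φ a (Nat.find h)).tape .output).content =
          recCode true (recs (evalCode φ θ) a.length) := by
    intro a
    obtain ⟨t, σ, ht, hσ, hout⟩ := run_evalProg hev heb hJ hx.mem hu hK hv hB' d a
    obtain ⟨n, hn, hh, hc⟩ := mach_run hσ
    refine ⟨hh.mono (hn.trans (Nat.succ_le_succ (Nat.mul_le_mul_right _ ht))), fun h => ?_⟩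
    rw [OracleMachine.content_find h hh, hc, hout, stkT_content]
  refine ⟨fun a => (hrun a).1, fun a => recCode true (recs (evalCode φ θ) a.length),
    ⟨fun a => ⟨_, (hrun a).1⟩, ?_⟩, fun n => recID true (recs (evalCode φ θ) (n + 2)), ?_, ?_, ?_⟩
  · funext a
    refine (Eq.trans ?_ ((hrun a).2 ⟨_, (hrun a).1⟩))
    simp only [OracleMachine.operator]
  · intro n
    have := (hok (n + 2)).isCode true
    simpa [natCode] using this
  · exact isRealName_recs true hK hv hB' fun T => ⟨_, fun n hn => hr T n hn⟩
  · intro n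
    refine Nat.sInf_le ?_
    have hp := recs_progress hK hv hB' (T := n + 1)
      (m := rate J (modulus ψ (B + n + 7) + 8) + (modulus ψ (B + n + 7) + 1))
      (fun i hi => by convert hr _ i hi using 2; omega) (n + 1)
    rw [min_self] at hp
    have hp' := hp.trans (recs_mono hK (b := rate J (modulus ψ (B + n + 7) + 8) +
      modulus ψ (B + n + 7) + n + 2 + 2) (by omega))
    dsimp only at hp'
    exact (hok _).diam_le true (by omega) (by omega)

/-- Evaluation is polytime computable if a program can evaluate, for each name of a function, some
interval function that represents the same function, with polynomial time and modulus. -/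
theorem evalPolytime_of {R : ParamRep C(unitInterval, ℝ)} (M : OracleMachine)
    (ev : Prog (Dat M.State) (Rg M.Work)) (d : Dat M.State) {q e : (ℕ → ℕ) → ℕ → ℕ} (hq : IsSOP q)
    (he : IsSOP e) (h : ∀ (χ : R.rep.Dom) f, f ∈ R.rep χ → ∃ θ ψ, EncodesFun θ ψ ∧ IsFunName ψ f ∧
      ∀ l, Monotone l → (∀ n, R.param χ n ≤ l n) →
        (∀ n, modulus ψ n + ⌈Real.logb 2 (‖f‖ + 1)⌉₊ ≤ q l n) ∧
          ∀ φ, fst φ = χ → Evaluates φ ev θ (e l)) : EvalPolytime R := by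
  let C := 3 * Nat.card (Stk (Rg M.Work)) + 8
  let P : (ℕ → ℕ) → ℕ → ℕ := fun l n =>
    (n + 1) * (70 * n + 40 * q l 0 + e l (3 * n + 30) + 600) * C + 1
  let Q : (ℕ → ℕ) → ℕ → ℕ := fun l n =>
    l (q l (q l 0 + n + 7) + 8) + q l (q l 0 + n + 7) + n + 2 + q l 0
  have c := IsSOP.const
  have i := IsSOP.id'
  have hq0 : IsSOP fun l _ => q l 0 := hq.comp (c 0)
  have hq1 : IsSOP fun l n => q l (q l 0 + n + 7) := hq.comp ((hq0.sum i).sum (c 7))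
  have hP : IsSOP P := (((i.sum (c 1)).prod (((((c 70).prod i).sum ((c 40).prod hq0)).sum
    (he.comp (((c 3).prod i).sum (c 30)))).sum (c 600))).prod (c C)).sum (c 1)
  have hQ : IsSOP Q := ((((hq1.sum (c 8)).app.sum hq1).sum i).sum (c 2)).sum hq0
  have key : ∀ (φ : (R.prod intervalUnit).rep.Dom) p, p ∈ (R.prod intervalUnit).rep φ →
      (∀ a, ((evalProg ev).mach d).HaltedBy φ a (P ((R.prod intervalUnit).param φ) a.length)) ∧
      ∃ χ ∈ ((evalProg ev).mach d).operator φ, ∃ L, EncodesSeq χ L ∧ IsRealName L (p.1 p.2) ∧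
        ∀ n, rate L n + ⌈Real.logb 2 (|p.1 p.2| + 1)⌉₊ ≤ Q ((R.prod intervalUnit).param φ) n := by
    rintro ⟨φ, hφ⟩ p ⟨hd, rfl⟩
    set l := (R.prod intervalUnit).param ⟨φ, hφ⟩ with hl
    have hlm : Monotone l := (R.prod intervalUnit).mono _
    set f := (R.rep (fst φ)).get hd.2.1 with hf
    set x := (intervalUnit.rep (snd φ)).get hd.2.2 with hx
    obtain ⟨J, hJ, hJx⟩ := mem_intervalReals.1
      (show (x : ℝ) ∈ intervalReals.rep (snd φ) from ⟨hd.2.2.1, rfl⟩)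
    obtain ⟨θ, ψ, hψ, hψf, hb⟩ := h ⟨fst φ, hd.2.1⟩ f ⟨hd.2.1, rfl⟩
    obtain ⟨hb, hev⟩ := hb l hlm fun n => le_max_left _ _
    have hrate : ∀ n, rate J n ≤ l n := fun n => by
      have h1 : intervalReals.param ⟨snd φ, hd.2.2.1⟩ n ≤ l n := le_max_right _ _
      rw [param_intervalReals (χ := ⟨snd φ, hd.2.2.1⟩) hJ hJx] at h1
      omega
    have hB : ⌈Real.logb 2 (‖f‖ + 1)⌉₊ ≤ q l 0 := (Nat.le_add_left _ _).trans (hb 0)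
    have hB' : ‖f‖ + 1 ≤ 2 ^ q l 0 := (add_one_le_two_pow (norm_nonneg f)).trans
      (pow_le_pow_right₀ (by norm_num) hB)
    obtain ⟨h1, χ, h2, L, h3, h4, h5⟩ := mach_evalProg (hev φ rfl)
      (fun _ _ h => he.mono hlm (fun _ => le_rfl) h) hψ hψf hJ hJx hB' d
    refine ⟨h1, χ, h2, L, h3, h4, fun n => ?_⟩
    have h6 := h5 n
    have h7 : modulus ψ (q l 0 + n + 7) ≤ q l (q l 0 + n + 7) :=
      (Nat.le_add_right _ _).trans (hb _)
    have h8 := (hrate (modulus ψ (q l 0 + n + 7) + 8)).trans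
      (hlm (show _ ≤ q l (q l 0 + n + 7) + 8 by omega))
    have h9 : ⌈Real.logb 2 (|f x| + 1)⌉₊ ≤ q l 0 := by
      refine (Nat.ceil_mono (Real.logb_le_logb_of_le (by norm_num) (by positivity) ?_)).trans hB
      have := f.norm_coe_le_norm x
      rw [Real.norm_eq_abs] at this
      linarith
    change _ + ⌈Real.logb 2 (|f x| + 1)⌉₊ ≤ l (q l (q l 0 + n + 7) + 8) + q l (q l 0 + n + 7) + n +
      2 + q l 0
    omega
  refine ⟨(evalProg ev).mach d, P, Q, ?_, hP, hQ, ?_, ?_⟩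
  · rintro φ p hp
    obtain ⟨-, χ, h2, L, h3, h4, -⟩ := key ⟨φ, hp.1⟩ p hp
    exact ⟨χ, h2, mem_intervalReals.2 ⟨L, h3, h4⟩⟩
  · intro φ a
    exact OracleMachine.time_le_of_haltedBy ((key φ _ ⟨φ.2, rfl⟩).1 a)
  · intro φ χ hχ n
    obtain ⟨-, χ', h2, L, h3, h4, h5⟩ := key φ _ ⟨φ.2, rfl⟩
    obtain rfl := Part.mem_unique hχ h2
    rw [param_intervalReals h3 h4]
    exact h5 n

end Eval

/-- The machine that terminates at once. -/
def trivialMachine : OracleMachine where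
  State := Unit
  Work := Unit
  finite_state := inferInstance
  finite_work := inferInstance
  start := ()
  oracle _ := none
  trans _ _ := none

/-- Initial data of the simulating programs. -/
def Dat.init (M : OracleMachine) : Dat M.State :=
  ⟨M.start, false, false, false, .zero, .zero, .zero, false, fun _ => 0, fun _ => 0⟩

/-- Evaluation of interval functions: ask the function for its value on an interval. -/
theorem evalPolytime_intervalFunctions : EvalPolytime intervalFunctions := by
  refine evalPolytime_of trivialMachine (.seq (move (.reg .tmp) (.reg .harg)) (askFst _))
    (Dat.init _) (q := fun l n => l n) (e := fun _ n => 4 * n + 5) IsSOP.id'.app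
    (((IsSOP.const 4).prod IsSOP.id').sum (IsSOP.const 5)) ?_
  intro χ f hf
  obtain ⟨ψ, h1, h2⟩ := mem_intervalFunctions.1 hf
  refine ⟨χ, ψ, h1, h2, fun l _ hl => ⟨fun n => ?_, ?_⟩⟩
  · rw [← param_intervalFunctions h1 h2]; exact hl n
  · rintro φ hφ
    rw [← hφ]
    exact evaluates_askFst

/-- A translation to interval functions can be simulated by the evaluation. -/
theorem evalPolytime_of_translatable {R : ParamRep C(unitInterval, ℝ)}
    (h : R.TranslatableTo intervalFunctions) : EvalPolytime R := by
  obtain ⟨M, P, Q, hM, hP, hQ, ht, hp⟩ := h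
  refine evalPolytime_of M (sim M (askFst M)) (Dat.init _) hQ
    (e := fun l n => (P l n + 1) * (20 * P l n + (2 * P l n + 4) + 22) + 2 * n + 8 * P l n + 10)
    ?_ ?_
  · have c := IsSOP.const
    exact ((((hP.sum (c 1)).prod ((((c 20).prod hP).sum (((c 2).prod hP).sum (c 4))).sum
      (c 22))).sum ((c 2).prod .id')).sum ((c 8).prod hP)).sum (c 10)
  intro χ f hf
  obtain ⟨θ, hθ, hθf⟩ := hM χ f hf
  obtain ⟨ψ, h1, h2⟩ := mem_intervalFunctions.1 hθf
  refine ⟨θ, ψ, h1, h2, fun l hlm hl => ⟨fun n => ?_, ?_⟩⟩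
  · have := hp χ ⟨θ, hθf.1⟩ hθ n
    rw [param_intervalFunctions h1 h2] at this
    exact this.trans (hQ.mono hlm hl le_rfl)
  · intro φ hφ
    refine evaluates_sim (N := P l) (fun a => ?_) (hφ ▸ hθ)
    rw [hφ]
    exact (OracleMachine.haltedBy_of_time_le (ht χ a)).mono (hP.mono hlm hl le_rfl)

/-! ### Binary digits of shifted numbers -/

/-- The binary digits of `1 / 2` and of `13 / 24`. -/
def pat (c : Bool) (i : ℕ) : Bool := decide (i = 0) || (c && decide (4 ≤ i) && decide (i % 2 = 0))

/-- The first `n` binary digits of `1 / 2` or of `13 / 24`. -/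
def pats (c : Bool) (n : ℕ) : List Bool := (List.range n).map (pat c)

/-- The amount by which the grid of a class is shifted. -/
noncomputable def shift (c : Bool) : ℝ := if c then 13 / 3 else 4

theorem pats_succ (c : Bool) (n : ℕ) : pats c (n + 1) = pats c n ++ [pat c n] := by
  simp [pats, List.range_succ]

theorem pats_length (c : Bool) (n : ℕ) : (pats c n).length = n := by simp [pats]

theorem binVal_concat (u : List Bool) (b : Bool) : binVal (u ++ [b]) = 2 * binVal u + b.toNat := by
  rw [binVal_append]; simp [binVal, mul_comm]

theorem binVal_lt (u : List Bool) : binVal u < 2 ^ u.length := by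
  have := frac_lt_one u
  rw [frac, div_lt_one (by positivity)] at this
  exact_mod_cast this

theorem pats_spec (c : Bool) (p : ℕ) : (binVal (pats c (p + 3)) : ℝ) ≤ shift c * 2 ^ p ∧
    shift c * 2 ^ p < binVal (pats c (p + 3)) + 1 := by
  cases c with
  | false =>
    have : binVal (pats false (p + 3)) = 4 * 2 ^ p := by
      induction p with
      | zero => decide
      | succ p ih =>
        rw [show p + 1 + 3 = p + 3 + 1 by ring, pats_succ, binVal_concat, ih, pow_succ]
        simp [pat]; ring
    rw [this]
    simp [shift]
  | true =>
    have : 3 * binVal (pats true (p + 3)) + (1 + p % 2) = 13 * 2 ^ p := by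
      induction p with
      | zero => decide
      | succ p ih =>
        rw [show p + 1 + 3 = p + 3 + 1 by ring, pats_succ, binVal_concat, pow_succ]
        rcases Nat.mod_two_eq_zero_or_one p with h | h
        · have : pat true (p + 3) = false := by simp [pat]; omega
          rw [this]; simp; omega
        · have : pat true (p + 3) = true := by simp [pat]; omega
          rw [this]; simp; omega
    have h2 : p % 2 < 2 := Nat.mod_lt _ (by norm_num)
    have h3 : 3 * binVal (pats true (p + 3)) + 1 ≤ 13 * 2 ^ p := by omega
    have h4 : 13 * 2 ^ p < 3 * binVal (pats true (p + 3)) + 3 := by omega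
    have h3' : 3 * (binVal (pats true (p + 3)) : ℝ) + 1 ≤ 13 * 2 ^ p := by exact_mod_cast h3
    have h4' : 13 * 2 ^ p < 3 * (binVal (pats true (p + 3)) : ℝ) + 3 := by exact_mod_cast h4
    simp only [shift, if_true]
    constructor <;> linarith

/-- Addition with carry `c` of the signed digits `l`, the least significant digit first. The binary
digits of the sum are put before `acc`, the most significant digit first. -/
def addBits : ℤ → List ℤ → List Bool → List Bool
  | _, [], acc => acc
  | c, t :: l, acc => addBits ((t + c) / 2) l (decide ((t + c) % 2 = 1) :: acc)

/-- The value of a list of signed digits, the least significant digit first. -/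
def lsum : List ℤ → ℤ
  | [] => 0
  | t :: l => t + 2 * lsum l

theorem addBits_acc (c : ℤ) (l : List ℤ) (acc : List Bool) :
    addBits c l acc = addBits c l [] ++ acc := by
  induction l generalizing c acc with
  | nil => rfl
  | cons t l ih => rw [addBits, addBits, ih, ih _ [_]]; simp

theorem addBits_length (c : ℤ) (l : List ℤ) : (addBits c l []).length = l.length := by
  induction l generalizing c with
  | nil => rfl
  | cons t l ih => rw [addBits, addBits_acc]; simp [ih]

theorem addBits_spec (c : ℤ) (l : List ℤ) :
    ∃ k : ℤ, c + lsum l = binVal (addBits c l []) + k * 2 ^ l.length := by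
  induction l generalizing c with
  | nil => exact ⟨c, by simp [lsum, addBits, binVal]⟩
  | cons t l ih =>
    obtain ⟨k, hk⟩ := ih ((t + c) / 2)
    refine ⟨k, ?_⟩
    rw [addBits, addBits_acc, binVal_concat, lsum, List.length_cons, pow_succ]
    have h1 := Int.mul_ediv_add_emod (t + c) 2
    have h2 : ((decide ((t + c) % 2 = 1)).toNat : ℤ) = (t + c) % 2 := by
      rcases Int.emod_two_eq_zero_or_one (t + c) with h | h <;> simp [h]
    push_cast
    rw [h2]
    linarith

theorem addBits_eq {l : List ℤ} {N : ℕ} (h : lsum l = N) (hN : N < 2 ^ l.length) :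
    binVal (addBits 0 l []) = N := by
  obtain ⟨k, hk⟩ := addBits_spec 0 l
  have h1 := binVal_lt (addBits 0 l [])
  rw [addBits_length] at h1
  rw [h, zero_add] at hk
  have h1' : (binVal (addBits 0 l []) : ℤ) < 2 ^ l.length := by exact_mod_cast h1
  have h2' : (N : ℤ) < 2 ^ l.length := by exact_mod_cast hN
  have hk0 : k = 0 := by
    by_contra hne
    rcases lt_or_gt_of_ne hne with hlt | hgt
    · nlinarith [show k ≤ -1 by omega]
    · nlinarith [show 1 ≤ k by omega]
  rw [hk0] at hk
  omega

section

variable {α : Type}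

theorem lsum_add (l : List α) (f g : α → ℤ) :
    lsum (l.map fun q => f q + g q) = lsum (l.map f) + lsum (l.map g) := by
  induction l with
  | nil => rfl
  | cons q l ih => simp only [List.map_cons, lsum, ih]; ring

theorem lsum_mul (l : List α) (a : ℤ) (f : α → ℤ) :
    lsum (l.map fun q => a * f q) = a * lsum (l.map f) := by
  induction l with
  | nil => simp [lsum]
  | cons q l ih => simp only [List.map_cons, lsum, ih]; ring

theorem lsum_bits (l : List α) (g : α → Bool) :
    lsum (l.map fun q => ((g q).toNat : ℤ)) = binVal (l.map g).reverse := by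
  induction l with
  | nil => rfl
  | cons q l ih =>
    simp only [List.map_cons, lsum, ih, List.reverse_cons, binVal_concat]
    push_cast; ring

end

/-- The longest common prefix of two lists. -/
def cpre : List Bool → List Bool → List Bool
  | a :: l, b :: r => if a = b then a :: cpre l r else []
  | _, _ => []

theorem cpre_prefix (l r : List Bool) : cpre l r <+: l ∧ cpre l r <+: r := by
  induction l generalizing r with
  | nil => simp [cpre]
  | cons a l ih =>
    cases r with
    | nil => simp [cpre]
    | cons b r =>
      rw [cpre]
      split_ifs with h
      · subst h; simpa [List.cons_prefix_cons] using ih r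
      · simp

theorem length_le_cpre {w l r : List Bool} (h : w <+: l) (h' : w <+: r) :
    w.length ≤ (cpre l r).length := by
  induction w generalizing l r with
  | nil => simp
  | cons a w ih =>
    cases l with
    | nil => simp at h
    | cons b l =>
      cases r with
      | nil => simp at h'
      | cons b' r =>
        rw [List.cons_prefix_cons] at h h'
        rw [cpre, if_pos (h.1.symm.trans h'.1)]
        simpa using ih h.2 h'.2

/-! ### Cells of dyadic grids -/

/-- The digits `w` are the first binary digits of `y`. -/
def HasDigits (y : ℝ) (w : List Bool) : Prop := frac w ≤ y ∧ y < frac w + 1 / 2 ^ w.length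

theorem hasDigits_cons {y : ℝ} {b : Bool} {w : List Bool} :
    HasDigits y (b :: w) ↔ HasDigits (2 * y - b.toNat) w := by
  have e : (1 : ℝ) / 2 ^ (w.length + 1) = 1 / 2 ^ w.length / 2 := by rw [pow_succ]; field_simp
  simp only [HasDigits, frac_cons, List.length_cons, e]
  constructor <;> rintro ⟨h1, h2⟩ <;> constructor <;> linarith

theorem HasDigits.bounds {y : ℝ} {w : List Bool} (h : HasDigits y w) : 0 ≤ y ∧ y < 1 := by
  have := frac_nonneg w
  have := frac_le w
  exact ⟨by linarith [h.1], by linarith [h.2]⟩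

theorem HasDigits.prefix_of_le {y : ℝ} {w w' : List Bool} (h : HasDigits y w) (h' : HasDigits y w')
    (hl : w.length ≤ w'.length) : w <+: w' := by
  induction w generalizing w' y with
  | nil => simp
  | cons b w ih =>
    cases w' with
    | nil => simp at hl
    | cons b' w' =>
      rw [hasDigits_cons] at h h'
      have hb : b = b' := by
        obtain ⟨h1, h2⟩ := h.bounds
        obtain ⟨h3, h4⟩ := h'.bounds
        cases b <;> cases b' <;> simp at h1 h2 h3 h4 ⊢ <;> linarith
      subst hb
      rw [List.cons_prefix_cons]
      exact ⟨rfl, ih h h' (by simpa using hl)⟩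

theorem HasDigits.of_prefix {y : ℝ} {w w' : List Bool} (h : HasDigits y w') (hp : w <+: w') : HasDigits y w := by
  induction w generalizing w' y with
  | nil =>
    have := h.bounds
    simpa [HasDigits] using this
  | cons b w ih =>
    cases w' with
    | nil => simp at hp
    | cons b' w' =>
      rw [List.cons_prefix_cons] at hp
      obtain ⟨rfl, hp⟩ := hp
      rw [hasDigits_cons] at h ⊢
      exact ih h hp

theorem HasDigits.exists_length {y : ℝ} (h0 : 0 ≤ y) (h1 : y < 1) (n : ℕ) :
    ∃ w, w.length = n ∧ HasDigits y w := by
  induction n generalizing y with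
  | zero => exact ⟨[], rfl, by simpa [HasDigits] using ⟨h0, h1⟩⟩
  | succ n ih =>
    by_cases h : y < 1 / 2
    · obtain ⟨w, hw, hc⟩ := ih (y := 2 * y) (by linarith) (by linarith)
      exact ⟨false :: w, by simp [hw], hasDigits_cons.2 (by simpa using hc)⟩
    · obtain ⟨w, hw, hc⟩ := ih (y := 2 * y - 1) (by linarith) (by linarith)
      exact ⟨true :: w, by simp [hw], hasDigits_cons.2 (by simpa using hc)⟩

/-- The interval lies in the cell of the shifted grid that has the address `w`. -/
def InCell (c : Bool) (J : ID) (w : List Bool) : Prop := ∀ x ∈ J.toSet, HasDigits ((x + shift c) / 8) w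

/-- The address of the smallest cell that contains the interval. -/
def IsCell (c : Bool) (J : ID) (W : List Bool) : Prop :=
  InCell c J W ∧ ∀ w, InCell c J w → w.length ≤ W.length

theorem toSet_nonempty (J : ID) : J.toSet.Nonempty := by
  cases J with
  | none => exact Set.univ_nonempty
  | some J => exact ⟨J.mid, by have := J.rad_pos; simp only [ID.toSet, Set.mem_Icc]; constructor <;> linarith⟩

theorem IsCell.prefix {c : Bool} {J J' : ID} {W W' : List Bool} (h : IsCell c J W)
    (h' : IsCell c J' W') (hJ : J'.toSet ⊆ J.toSet) : W <+: W' := by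
  have h1 : InCell c J' W := fun x hx => h.1 x (hJ hx)
  obtain ⟨x, hx⟩ := toSet_nonempty J'
  exact (h1 x hx).prefix_of_le (h'.1 x hx) (h'.2 _ h1)

theorem IsCell.unique {c : Bool} {J : ID} {W W' : List Bool} (h : IsCell c J W)
    (h' : IsCell c J W') : W = W' :=
  (h.prefix h' subset_rfl).eq_of_length (le_antisymm (h'.2 _ h.1) (h.2 _ h'.1))

theorem inCell_of_endpoints {c : Bool} {J : DyadicInterval} {w : List Bool}
    (h : HasDigits ((J.mid - J.rad + shift c) / 8) w) (h' : HasDigits ((J.mid + J.rad + shift c) / 8) w) :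
    InCell c (some J) w := by
  intro x hx
  simp only [ID.toSet, Set.mem_Icc] at hx
  exact ⟨h.1.trans (by linarith), lt_of_le_of_lt (by linarith) h'.2⟩

/-- A short interval lies in a small cell of one of the two grids, since the points of the two grids
of spacing `2 ^ (-p)` are at least `2 ^ (-p) / 3` apart. -/
theorem exists_inCell {J : DyadicInterval} (h1 : -4 ≤ J.mid - J.rad) (h2 : J.mid + J.rad < 11 / 3)
    {p : ℕ} (hd : 2 * J.rad ≤ 1 / 2 ^ (p + 2)) : ∃ c w, w.length = p + 3 ∧ InCell c (some J) w := by
  by_contra! hno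
  have hp := J.rad_pos
  have hpow : (0 : ℝ) < 2 ^ p := by positivity
  have key : ∀ c, ∃ i : ℤ, J.mid - J.rad + shift c < i / 2 ^ p ∧ i / 2 ^ p ≤ J.mid + J.rad + shift c := by
    intro c
    have hc : 4 ≤ shift c ∧ shift c ≤ 13 / 3 := by
      cases c <;> simp [shift] <;> norm_num
    obtain ⟨wl, hwl, hl⟩ := HasDigits.exists_length (y := (J.mid - J.rad + shift c) / 8) (by linarith)
      (by linarith) (p + 3)
    obtain ⟨wr, hwr, hr⟩ := HasDigits.exists_length (y := (J.mid + J.rad + shift c) / 8) (by linarith)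
      (by linarith) (p + 3)
    have hne : wl ≠ wr := by
      rintro rfl
      exact hno c wl hwl (inCell_of_endpoints hl hr)
    have hlt : ¬ frac wr ≤ frac wl := by
      intro hle
      have : HasDigits ((J.mid - J.rad + shift c) / 8) wr := by
        refine ⟨hle.trans hl.1, lt_of_le_of_lt ?_ hr.2⟩
        linarith
      exact hne ((hl.prefix_of_le this (by omega)).eq_of_length (by omega))
    have hlt' : binVal wl + 1 ≤ binVal wr := by
      by_contra hge
      refine hlt ?_
      rw [frac, frac, hwl, hwr]
      have : (binVal wr : ℝ) ≤ binVal wl := by exact_mod_cast (by omega : binVal wr ≤ binVal wl)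
      gcongr
    have hlt'' : (binVal wl : ℝ) + 1 ≤ binVal wr := by exact_mod_cast hlt'
    have e8 : (2 : ℝ) ^ (p + 3) = 8 * 2 ^ p := by rw [pow_add]; ring
    refine ⟨binVal wr, ?_, ?_⟩
    · have := hl.2
      rw [frac, hwl, e8, ← add_div, div_lt_div_iff₀ (by norm_num) (by positivity)] at this
      rw [lt_div_iff₀ hpow]
      push_cast
      linarith
    · have := hr.1
      rw [frac, hwr, e8, div_le_div_iff₀ (by positivity) (by norm_num)] at this
      rw [div_le_iff₀ hpow]
      push_cast
      linarith
  obtain ⟨i, hi1, hi2⟩ := key false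
  obtain ⟨j, hj1, hj2⟩ := key true
  simp only [shift, if_true, Bool.false_eq_true, if_false] at hi1 hi2 hj1 hj2
  rw [lt_div_iff₀ hpow] at hi1 hj1
  rw [div_le_iff₀ hpow] at hi2 hj2
  have hd' : 2 * J.rad * 2 ^ p ≤ 1 / 4 := by
    have e : (1 : ℝ) / 2 ^ (p + 2) = 1 / 4 / 2 ^ p := by rw [pow_add]; field_simp; norm_num
    rwa [e, le_div_iff₀ hpow] at hd
  have k1 : (3 * (j - i) - 2 ^ p : ℝ) < 1 := by nlinarith
  have k2 : (-1 : ℝ) < 3 * (j - i) - 2 ^ p := by nlinarith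
  have k1' : 3 * (j - i) - 2 ^ p < 1 := by exact_mod_cast k1
  have k2' : -1 < 3 * (j - i) - 2 ^ p := by exact_mod_cast k2
  have k3 : (3 : ℤ) ∣ 2 ^ p := ⟨j - i, by omega⟩
  have := Int.prime_three.dvd_of_dvd_pow k3
  norm_num at this

/-! ### The argument of a level -/

/-- The binary digits of the difference of an address and the shift, for an address that is given in
reverse order. The first three digits are those of the integer part, modulo `8`. -/
def diffBits (c : Bool) (rw : List Bool) : List Bool :=
  addBits 0 ((rw.zip (pats c rw.length).reverse).map fun q => (q.1.toNat : ℤ) + -1 * q.2.toNat) []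

/-- The digits of the fractional part if the integer part is `0`; otherwise the digits of the
number of the same length that is closest to the negative or large number. -/
def clampBits (D : List Bool) : List Bool :=
  if D.take 3 = [false, false, false] then D.drop 3 else (D.drop 3).map fun _ => !(D.headD false)

/-- The binary digits of an approximation to the numbers in a cell. -/
def argBits (c : Bool) (rw : List Bool) : List Bool := clampBits (diffBits c rw)

theorem diffBits_length (c : Bool) (rw : List Bool) : (diffBits c rw).length = rw.length := by
  simp [diffBits, addBits_length, pats_length]

theorem argBits_length (c : Bool) (rw : List Bool) : (argBits c rw).length = rw.length - 3 := by
  rw [argBits, clampBits]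
  split_ifs <;> simp [diffBits_length]

theorem frac_true (n : ℕ) : frac (List.replicate n true) = 1 - 1 / 2 ^ n := by
  induction n with
  | zero => simp
  | succ n ih => rw [List.replicate_succ, frac_cons, ih, pow_succ]; field_simp; simp; ring

/-- The argument of a level approximates the projection to the unit interval of every number in the
cell. -/
theorem argBits_spec {c : Bool} {x : ℝ} {rw : List Bool}
    (h : HasDigits ((x + shift c) / 8) rw.reverse) (hx : |x| ≤ 3) :
    |max 0 (min 1 x) - frac (argBits c rw)| ≤ 1 / 2 ^ (argBits c rw).length := by
  have hc0 : 0 ≤ max 0 (min 1 x) := le_max_left _ _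
  have hc1 : max 0 (min 1 x) ≤ 1 := max_le zero_le_one (min_le_left _ _)
  by_cases hk : rw.length < 3
  · have hl : (argBits c rw).length = 0 := by rw [argBits_length]; omega
    rw [List.length_eq_zero_iff.1 hl]
    simp only [frac_nil, List.length_nil, pow_zero, sub_zero]
    rw [abs_of_nonneg hc0]
    linarith
  obtain ⟨p, hp⟩ := Nat.exists_eq_add_of_le (not_lt.1 hk)
  rw [add_comm] at hp
  have hpow : (0 : ℝ) < 2 ^ p := by positivity
  have hpow1 : (1 : ℝ) ≤ 2 ^ p := one_le_pow₀ (by norm_num)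
  obtain ⟨t1, t2⟩ := pats_spec c p
  obtain ⟨c1, c2⟩ := h
  have e8 : (2 : ℝ) ^ (p + 3) = 8 * 2 ^ p := by rw [pow_add]; ring
  rw [frac, List.length_reverse, hp, e8] at c1 c2
  rw [div_le_div_iff₀ (by positivity) (by norm_num)] at c1
  rw [← add_div, div_lt_div_iff₀ (by norm_num) (by positivity)] at c2
  have hsum : lsum ((rw.zip (pats c rw.length).reverse).map fun q =>
      (q.1.toNat : ℤ) + -1 * q.2.toNat) = binVal rw.reverse - binVal (pats c (p + 3)) := by
    rw [lsum_add, lsum_mul, lsum_bits, lsum_bits _ Prod.snd, List.map_fst_zip, List.map_snd_zip]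
    · rw [List.reverse_reverse, hp]; ring
    · simp [pats_length]
    · simp [pats_length]
  obtain ⟨k, hk⟩ := addBits_spec 0 ((rw.zip (pats c rw.length).reverse).map fun q =>
      (q.1.toNat : ℤ) + -1 * q.2.toNat)
  rw [hsum, zero_add] at hk
  have hlen : ((rw.zip (pats c rw.length).reverse).map fun q =>
      (q.1.toNat : ℤ) + -1 * q.2.toNat).length = p + 3 := by simp [pats_length, hp]
  rw [hlen] at hk
  -- `N` is the integer below or at the scaled number, up to an error of one
  set N : ℤ := binVal rw.reverse - binVal (pats c (p + 3)) with hN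
  have n1 : x * 2 ^ p < N + 1 := by rw [hN]; push_cast; nlinarith
  have n2 : (N : ℝ) - 1 < x * 2 ^ p := by rw [hN]; push_cast; nlinarith
  obtain ⟨x1, x2⟩ := abs_le.1 hx
  have n3 : (N : ℝ) < 4 * 2 ^ p := by nlinarith
  have n4 : -(4 * 2 ^ p) ≤ (N : ℝ) := by nlinarith
  have n3' : N < 4 * 2 ^ p := by exact_mod_cast n3
  have n4' : -(4 * 2 ^ p) ≤ N := by exact_mod_cast n4
  have hDl := diffBits_length c rw
  change N = binVal (diffBits c rw) + k * 2 ^ (p + 3) at hk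
  rw [argBits]
  obtain ⟨i1, i2, i3, F, hD⟩ : ∃ i1 i2 i3 F, diffBits c rw = i1 :: i2 :: i3 :: F := by
    match diffBits c rw, hDl.trans hp with
    | i1 :: i2 :: i3 :: F, _ => exact ⟨i1, i2, i3, F, rfl⟩
  rw [hD] at hk hDl ⊢
  have hF : F.length = p := by simp at hDl; omega
  have hFlt := binVal_lt F
  simp only [binVal_cons, List.length_cons, hF, pow_succ] at hk
  rw [hF] at hFlt
  have hFlt' : (binVal F : ℤ) < 2 ^ p := by exact_mod_cast hFlt
  have hP : (0 : ℤ) < 2 ^ p := by positivity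
  push_cast at hk
  -- the integer part of the difference, as a signed number
  have hk' : N = (4 * i1.toNat + 2 * i2.toNat + i3.toNat + 8 * k) * 2 ^ p + binVal F := by
    rw [hk]; ring
  set I : ℤ := 4 * i1.toNat + 2 * i2.toNat + i3.toNat + 8 * k with hI
  have hI1 : I < 4 := by by_contra hge; nlinarith
  have hI2 : -5 < I := by by_contra hge; nlinarith
  have hkr : (N : ℝ) = I * 2 ^ p + binVal F := by exact_mod_cast hk'
  have hfr : frac F * 2 ^ p = binVal F := by rw [frac, hF]; field_simp
  have hf1 : (binVal F : ℝ) + 1 ≤ 2 ^ p := by exact_mod_cast hFlt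
  have h1p : (1 : ℝ) / 2 ^ p * 2 ^ p = 1 := by field_simp
  have hdiv : ∀ y : ℝ, |y * 2 ^ p| ≤ 1 → |y| ≤ 1 / 2 ^ p := by
    intro y hy
    rw [abs_mul, abs_of_pos hpow] at hy
    rwa [le_div_iff₀ hpow]
  have hneg : I < 0 → x < 0 := by
    intro h
    have : (I : ℝ) ≤ -1 := by exact_mod_cast (by omega : I ≤ -1)
    nlinarith
  have hbig : 0 < I → 2 ^ p - 1 < x * 2 ^ p := by
    intro h
    have : (1 : ℝ) ≤ I := by exact_mod_cast h
    nlinarith [(Nat.cast_nonneg (binVal F) : (0 : ℝ) ≤ _)]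
  have hz : ∀ b : Bool, F.map (fun _ => b) = List.replicate p b := fun b => by
    rw [← hF]; exact List.map_const'
  simp only [clampBits, List.take_succ_cons, List.take_zero, List.drop_succ_cons, List.drop_zero,
    List.headD_cons]
  by_cases h0 : [i1, i2, i3] = [false, false, false]
  · rw [if_pos h0, hF]
    simp only [List.cons.injEq, and_true] at h0
    obtain ⟨rfl, rfl, rfl⟩ := h0
    have hI0 : I = 0 := by simp at hI; omega
    rw [hI0, Int.cast_zero, zero_mul, zero_add] at hkr
    refine hdiv _ ?_
    rw [sub_mul, hfr, ← hkr, max_mul_of_nonneg _ _ hpow.le, min_mul_of_nonneg _ _ hpow.le, abs_le]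
    have hN0 : (0 : ℝ) ≤ N := by rw [hkr]; positivity
    constructor
    · rw [neg_le_sub_iff_le_add, ← sub_le_iff_le_add]
      refine le_max_of_le_right (le_min ?_ n2.le)
      linarith
    · rw [sub_le_iff_le_add]
      refine max_le ?_ (min_le_of_right_le ?_) <;> linarith
  · rw [if_neg h0, hz, List.length_replicate]
    cases i1 with
    | true =>
      have hIn : I < 0 := by
        have h2 := Bool.toNat_le i2
        have h3 := Bool.toNat_le i3
        simp at hI
        omega
      have := hneg hIn
      rw [Bool.not_true, frac_replicate, sub_zero, max_eq_left ((min_le_right _ _).trans this.le)]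
      simp
    | false =>
      have hIp : 0 < I := by
        have h2 := Bool.toNat_le i2
        have h3 := Bool.toNat_le i3
        have h4 : i2.toNat + i3.toNat ≠ 0 := by
          intro h
          refine h0 ?_
          cases i2 <;> cases i3 <;> simp_all
        simp at hI
        omega
      have hb := hbig hIp
      rw [Bool.not_false, frac_true]
      refine hdiv _ ?_
      rw [sub_mul, sub_mul, h1p, max_mul_of_nonneg _ _ hpow.le, min_mul_of_nonneg _ _ hpow.le,
        one_mul, abs_le]
      constructor
      · rw [neg_le_sub_iff_le_add, ← sub_le_iff_le_add]
        refine le_max_of_le_right (le_min ?_ ?_) <;> linarith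
      · rw [sub_le_iff_le_add]
        refine max_le ?_ (min_le_of_left_le ?_) <;> linarith

/-! ### Reading interval codes -/

/-- The columns of a code without the control string. -/
def colList : Str → List (Sym × Sym)
  | _ :: x :: y :: s => (x, y) :: colList s
  | [_, x] => [(x, .zero)]
  | [_] => [(.zero, .zero)]
  | [] => []

theorem colList_length (s : Str) : (colList s).length ≤ s.length := by
  match s with
  | _ :: _ :: _ :: s => have := colList_length s; simp [colList]; omega
  | [_, _] => simp [colList]
  | [_] => simp [colList]
  | [] => simp [colList]

theorem colList_strPair (a b : Str) : colList (strPair a b) =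
    (List.range (max (max a.length b.length) (control a b).length)).map
      fun i => (a.getD i .zero, b.getD i .zero) := by
  rw [strPair]
  induction List.range (max (max a.length b.length) (control a b).length) with
  | nil => rfl
  | cons i l ih =>
    rw [List.flatMap_cons, List.map_cons, ← ih]
    rfl

/-- Symbols as binary digits. -/
def isOne (s : Sym) : Bool := decide (s = .one)

theorem isOne_digit (b : Bool) : isOne (digit b) = b := by cases b <;> rfl

/-- The digits of the midpoint and of the radius that are coded by columns: the sign of the midpoint,
the digit of its integer part, the digits of its fractional part, and the digits of the radius,
padded to the same length. The result is `none` if the integer parts are too large. -/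
def parse (cs : List (Sym × Sym)) : Option (Bool × Bool × List Bool × List Bool) :=
  if (cs.getD 1 (.zero, .zero)).2 = .sep then
    if (cs.getD 1 (.zero, .zero)).1 = .sep then
      some (isOne (cs.getD 0 (.zero, .zero)).1, false, (cs.drop 2).map fun q => isOne q.1,
        (cs.drop 2).map fun q => isOne q.2)
    else if (cs.getD 2 (.zero, .zero)).1 = .sep then
      some (isOne (cs.getD 0 (.zero, .zero)).1, isOne (cs.getD 1 (.zero, .zero)).1,
        ((cs.drop 3).map fun q => isOne q.1) ++ [false], (cs.drop 2).map fun q => isOne q.2)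
    else none
  else none

theorem parse_length {cs : List (Sym × Sym)} {s i : Bool} {ma rb : List Bool}
    (h : parse cs = some (s, i, ma, rb)) : ma.length = rb.length ∧ rb.length ≤ cs.length := by
  rw [parse] at h
  split_ifs at h with h1 h2 h3
  · simp only [Option.some.injEq, Prod.mk.injEq] at h
    obtain ⟨-, -, rfl, rfl⟩ := h
    simp
  · have hl : 3 ≤ cs.length := by
      by_contra hlt
      rw [List.getD_eq_default _ _ (by omega)] at h3
      simp at h3
    simp only [Option.some.injEq, Prod.mk.injEq] at h
    obtain ⟨-, -, rfl, rfl⟩ := h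
    simp
    omega

theorem padTake_of_le {n : ℕ} {v : List Bool} (h : v.length ≤ n) :
    padTake false n v = v ++ List.replicate (n - v.length) false := by
  apply List.ext_getElem
  · simp [padTake, h]
  · intro i h1 h2
    simp only [padTake, List.getElem_map, List.getElem_range, List.getElem_append]
    split_ifs with h3
    · simp [h3]
    · simp [not_lt.1 h3]

theorem frac_padTake_of_le {n : ℕ} {v : List Bool} (h : v.length ≤ n) :
    frac (padTake false n v) = frac v := by
  rw [padTake_of_le h, frac_append, frac_replicate]; simp

theorem range_drop_map {α : Type} (L k : ℕ) (g : ℕ → α) :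
    ((List.range L).map g).drop k = (List.range (L - k)).map fun i => g (k + i) := by
  apply List.ext_getElem
  · simp
  · intro i h1 h2
    simp

/-- Codes that cannot be parsed are codes of intervals that are too long, or too far away from the
unit interval, to be of interest. -/
theorem parse_spec {a : Str} {J : ID} (h : IsIntervalCode a J) :
    (parse (colList a) = none ∧ ∀ K, J = some K → K.rad < 1 → 2 ≤ |K.mid|) ∨
    ∃ s i ma rb K, parse (colList a) = some (s, i, ma, rb) ∧ J = some K ∧
      K.mid = (-1) ^ s.toNat * (i.toNat + frac ma) ∧ K.rad = frac rb := by
  cases J with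
  | none =>
    have ha : a = [] := h
    subst ha
    exact .inl ⟨rfl, by simp⟩
  | some K =>
    obtain ⟨a, b, ⟨s, u, v, hu, rfl, hmid⟩, ⟨s', u', v', hu', rfl, hrad⟩, rfl⟩ := h
    have hu0 := frac_nonneg v
    have hmid' : |K.mid| = binVal u + frac v := by
      rw [hmid, abs_sign, abs_of_nonneg (by positivity)]; rfl
    have hs' : s' = false := by
      have := K.rad_pos
      rw [hrad] at this
      cases s' with
      | false => rfl
      | true =>
        have h0 : (0 : ℝ) ≤ (binVal u' : ℝ) + (binVal v' : ℝ) / 2 ^ v'.length := by positivity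
        simp at this
        linarith
    subst hs'
    have hrad' : K.rad = binVal u' + frac v' := by rw [hrad]; simp [frac]
    set a : Str := digit s :: u.map digit ++ Sym.sep :: v.map digit with ha
    set b : Str := digit false :: u'.map digit ++ Sym.sep :: v'.map digit with hb
    set L := max (max a.length b.length) (control a b).length with hL
    have hcl : (control a b).length = min a.length b.length + 2 := by simp [control]
    have hcols := colList_strPair a b
    rw [← hL] at hcols
    have hget : ∀ j, (colList (strPair a b)).getD j (.zero, .zero) =
        (a.getD j .zero, b.getD j .zero) := by
      intro j
      rw [hcols, List.getD_eq_getElem?_getD, List.getElem?_map]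
      by_cases hj : j < L
      · simp [hj]
      · rw [List.getElem?_eq_none (by simpa using hj)]
        rw [List.getD_eq_default a _ (by omega), List.getD_eq_default b _ (by omega)]; rfl
    have htail : ∀ (v : List Bool) (j : ℕ), isOne ((v.map digit).getD j .zero) = v.getD j false := by
      intro v j
      rw [List.getD_eq_getElem?_getD, List.getD_eq_getElem?_getD, List.getElem?_map]
      cases v[j]? with
      | none => rfl
      | some b => exact isOne_digit b
    rw [parse]
    simp only [hget]
    by_cases hb1 : b.getD 1 .zero = .sep
    swap
    · refine .inl ⟨by rw [if_neg hb1], ?_⟩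
      rintro _ ⟨⟩ hlt
      refine absurd ?_ hb1
      have h0 := frac_nonneg v'
      have : (binVal u' : ℝ) < 1 := by linarith
      have := le_binVal hu' (B := 0) (by exact_mod_cast this)
      rw [List.length_eq_zero_iff.1 (Nat.le_zero.1 this)] at hb
      simp [hb]
    have hu'0 : u' = [] := by
      cases u' with
      | nil => rfl
      | cons x u' => simp [hb, digit_ne_sep] at hb1
    subst hu'0
    have hrb : K.rad = frac (((colList (strPair a b)).drop 2).map fun q => isOne q.2) := by
      rw [hcols, range_drop_map, List.map_map]
      have e : ((fun q : Sym × Sym => isOne q.2) ∘ fun i => (a.getD (2 + i) .zero,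
          b.getD (2 + i) .zero)) = fun i => v'.getD i false := by
        funext i
        rw [← htail, Function.comp_apply, Nat.add_comm 2, hb]
        rfl
      rw [e]
      change _ = frac (padTake false (L - 2) v')
      have hbl : b.length = v'.length + 2 := by simp [hb]
      rw [frac_padTake_of_le (by omega), hrad']
      simp [binVal]
    rw [if_pos hb1]
    by_cases ha1 : a.getD 1 .zero = .sep
    · have hu0 : u = [] := by
        cases u with
        | nil => rfl
        | cons x u => simp [ha, digit_ne_sep] at ha1
      subst hu0
      rw [if_pos ha1]
      refine .inr ⟨_, _, _, _, K, rfl, rfl, ?_, hrb⟩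
      rw [hcols, range_drop_map, List.map_map]
      have e : ((fun q : Sym × Sym => isOne q.1) ∘ fun i => (a.getD (2 + i) .zero,
          b.getD (2 + i) .zero)) = fun i => v.getD i false := by
        funext i
        rw [← htail, Function.comp_apply, Nat.add_comm 2, ha]
        rfl
      rw [e]
      change _ = _ * (_ + frac (padTake false (L - 2) v))
      have hal : a.length = v.length + 2 := by simp [ha]
      rw [frac_padTake_of_le (by omega), hmid]
      simp [binVal, frac, ha, isOne_digit]
    rw [if_neg ha1]
    by_cases ha2 : a.getD 2 .zero = .sep
    · obtain ⟨z, hz⟩ : ∃ z, u = [z] := by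
        match u with
        | [] => simp [ha] at ha1
        | [z] => exact ⟨z, rfl⟩
        | _ :: x :: _ => simp [ha, digit_ne_sep] at ha2
      subst hz
      rw [if_pos ha2]
      refine .inr ⟨_, _, _, _, K, rfl, rfl, ?_, hrb⟩
      rw [hcols, range_drop_map, List.map_map]
      have e : ((fun q : Sym × Sym => isOne q.1) ∘ fun i => (a.getD (3 + i) .zero,
          b.getD (3 + i) .zero)) = fun i => v.getD i false := by
        funext i
        rw [← htail, Function.comp_apply, Nat.add_comm 3, ha]
        rfl
      rw [e]
      change _ = _ * (_ + frac (padTake false (L - 3) v ++ [false]))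
      have hal : a.length = v.length + 3 := by simp [ha]
      rw [frac_append, frac_padTake_of_le (by omega), hmid]
      have : frac [false] = 0 := by simp [frac, binVal]
      rw [this]
      simp [binVal, frac, ha, isOne_digit]
    · rw [if_neg ha2]
      refine .inl ⟨rfl, ?_⟩
      rintro _ ⟨⟩ -
      by_contra hlt
      have h2 : (binVal u : ℝ) < 2 ^ 1 := by linarith
      have h3 := le_binVal hu (B := 1) (by exact_mod_cast h2)
      match u with
      | [] => simp [ha] at ha1
      | [z] => simp [ha] at ha2
      | _ :: _ :: _ => simp at h3

/-! ### The smallest cells around an interval -/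

/-- A sign. -/
def sg (b : Bool) : ℤ := if b then -1 else 1

/-- The digits of the left or right endpoint of an interval after a shift. -/
def endBits (c : Bool) (right s : Bool) (ma rb : List Bool) : List Bool :=
  addBits 0 (((ma.zip (rb.zip (pats c rb.length))).reverse.map fun q =>
    (q.2.2.toNat : ℤ) + (sg s * q.1.toNat + sg (!right) * q.2.1.toNat))) []

/-- The common digits of the endpoints. -/
def cellOf (c : Bool) (p : Bool × Bool × List Bool × List Bool) : List Bool :=
  cpre (endBits c false p.1 (false :: false :: p.2.1 :: p.2.2.1)
    (false :: false :: false :: p.2.2.2)) (endBits c true p.1 (false :: false :: p.2.1 :: p.2.2.1)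
      (false :: false :: false :: p.2.2.2))

theorem endBits_length {c right s : Bool} {ma rb : List Bool} (h : ma.length = rb.length) :
    (endBits c right s ma rb).length = rb.length := by
  simp [endBits, addBits_length, pats_length, h]

theorem endBits_spec (c right s i : Bool) {ma rb : List Bool} (h : ma.length = rb.length) :
    let z : ℝ := (-1) ^ s.toNat * (i.toNat + frac ma) + sg (!right) * frac rb
    HasDigits ((z + shift c) / 8) (endBits c right s (false :: false :: i :: ma)
      (false :: false :: false :: rb)) ∧ (binVal (endBits c right s (false :: false :: i :: ma)
      (false :: false :: false :: rb)) : ℝ) = z * 2 ^ rb.length + binVal (pats c (rb.length + 3)) := by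
  intro z
  set n := rb.length with hn
  set MA := false :: false :: i :: ma with hMA
  set RB := false :: false :: false :: rb with hRB
  have hpow : (0 : ℝ) < 2 ^ n := by positivity
  have hpow1 : (1 : ℝ) ≤ 2 ^ n := one_le_pow₀ (by norm_num)
  have hl : MA.length = RB.length := by simp [hMA, hRB, h, hn]
  have hlR : RB.length = n + 3 := by simp [hRB, hn]
  obtain ⟨t1, t2⟩ := pats_spec c n
  have hma : frac ma * 2 ^ n = binVal ma := by rw [frac, h]; field_simp
  have hrb : frac rb * 2 ^ n = binVal rb := by rw [frac, ← hn]; field_simp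
  have hz1 : (binVal MA : ℝ) = (i.toNat + frac ma) * 2 ^ n := by
    rw [add_mul, hma]
    simp only [hMA, binVal_cons, List.length_cons, h]
    simp
  have hz2 : (binVal RB : ℝ) = frac rb * 2 ^ n := by
    rw [hrb]
    simp only [hRB, binVal_cons, List.length_cons]
    simp
  have hsg : ((sg s : ℤ) : ℝ) = (-1) ^ s.toNat := by cases s <;> simp [sg]
  have hsum : lsum ((MA.zip (RB.zip (pats c RB.length))).reverse.map fun q =>
      (q.2.2.toNat : ℤ) + (sg s * q.1.toNat + sg (!right) * q.2.1.toNat)) =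
      binVal (pats c (n + 3)) + (sg s * binVal MA + sg (!right) * binVal RB) := by
    rw [lsum_add _ (fun q : Bool × Bool × Bool => (q.2.2.toNat : ℤ)),
      lsum_add _ (fun q : Bool × Bool × Bool => sg s * (q.1.toNat : ℤ)), lsum_mul, lsum_mul, lsum_bits _ fun q : Bool × Bool × Bool => q.2.2,
      lsum_bits _ fun q : Bool × Bool × Bool => q.1,
      lsum_bits _ fun q : Bool × Bool × Bool => q.2.1]
    simp only [List.map_reverse, List.reverse_reverse]
    have e2 : (MA.zip (RB.zip (pats c RB.length))).map Prod.snd = RB.zip (pats c RB.length) :=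
      List.map_snd_zip (by simp [hl, pats_length])
    have e1 : (MA.zip (RB.zip (pats c RB.length))).map Prod.fst = MA :=
      List.map_fst_zip (by simp [hl, pats_length])
    have e3 : (MA.zip (RB.zip (pats c RB.length))).map (fun q => q.2.1) = RB := by
      rw [show (fun q : Bool × Bool × Bool => q.2.1) = Prod.fst ∘ Prod.snd from rfl, ← List.map_map,
        e2, List.map_fst_zip (by simp [pats_length])]
    have e4 : (MA.zip (RB.zip (pats c RB.length))).map (fun q => q.2.2) = pats c RB.length := by
      rw [show (fun q : Bool × Bool × Bool => q.2.2) = Prod.snd ∘ Prod.snd from rfl, ← List.map_map,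
        e2, List.map_snd_zip (by simp [pats_length])]
    rw [show (fun q : Bool × Bool × Bool => q.1) = Prod.fst from rfl, e1, e3, e4, hlR]
  set N := (binVal (pats c (n + 3)) : ℤ) + (sg s * binVal MA + sg (!right) * binVal RB) with hN
  have hNr : (N : ℝ) = z * 2 ^ n + binVal (pats c (n + 3)) := by
    rw [hN]
    push_cast
    rw [hz1, hz2, hsg]
    ring
  have hz : |z| < 3 := by
    have h1 := toNat_le_one i
    have h2 := frac_lt_one ma
    have h3 := frac_lt_one rb
    have h4 := frac_nonneg ma
    have h5 := frac_nonneg rb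
    have h6 : |(-1 : ℝ) ^ s.toNat * (i.toNat + frac ma)| = i.toNat + frac ma := by
      rw [abs_sign, abs_of_nonneg (by positivity)]
    have h7 : |((sg (!right) : ℤ) : ℝ) * frac rb| = frac rb := by
      cases right <;> simp [sg, abs_of_nonneg h5]
    calc |z| ≤ _ := abs_add_le _ _
      _ < 3 := by rw [h6, h7]; linarith
  obtain ⟨z1, z2⟩ := abs_lt.1 hz
  have hc : 4 ≤ shift c ∧ shift c ≤ 13 / 3 := by cases c <;> simp [shift] <;> norm_num
  have n1 : (N : ℝ) ≤ (z + shift c) * 2 ^ n := by rw [hNr]; nlinarith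
  have n2 : (z + shift c) * 2 ^ n < N + 1 := by rw [hNr]; nlinarith
  have n3 : (-1 : ℝ) < N := by nlinarith
  have n4 : (N : ℝ) < 2 ^ (n + 3) := by rw [pow_add]; nlinarith
  have n3' : -1 < N := by exact_mod_cast n3
  obtain ⟨m, hm⟩ := Int.eq_ofNat_of_zero_le (show 0 ≤ N by omega)
  rw [hm] at hsum n4
  have hval : binVal (endBits c right s MA RB) = m := by
    refine addBits_eq hsum ?_
    simp only [List.length_map, List.length_reverse, List.length_zip, pats_length, hl, hlR, min_self]
    exact_mod_cast n4
  have hvr : (binVal (endBits c right s MA RB) : ℝ) = N := by rw [hval, hm]; simp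
  have e8 : (2 : ℝ) ^ (n + 3) = 8 * 2 ^ n := by rw [pow_add]; ring
  refine ⟨⟨?_, ?_⟩, by rw [hvr, hNr]⟩
  · rw [frac, hvr, endBits_length hl, hlR, e8, div_le_div_iff₀ (by positivity) (by norm_num)]
    linarith
  · rw [frac, hvr, endBits_length hl, hlR, e8, ← add_div, div_lt_div_iff₀ (by norm_num) (by positivity)]
    linarith

/-- The interval lies in a cell if and only if the digits of both endpoints begin with its address. -/
theorem isCell_cellOf (c : Bool) {K : DyadicInterval} {s i : Bool} {ma rb : List Bool}
    (h : ma.length = rb.length) (hm : K.mid = (-1) ^ s.toNat * (i.toNat + frac ma))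
    (hr : K.rad = frac rb) : IsCell c (some K) (cellOf c (s, i, ma, rb)) := by
  obtain ⟨hl, vl⟩ := endBits_spec c false s i h
  obtain ⟨hh, vh⟩ := endBits_spec c true s i h
  rw [← hm, ← hr] at hl hh vl vh
  simp only [sg, Bool.not_false, Bool.not_true, if_true, Bool.false_eq_true, if_false,
    Int.cast_neg, Int.cast_one, one_mul, neg_mul, ← sub_eq_add_neg] at hl hh vl vh
  have hll : ∀ right, (endBits c right s (false :: false :: i :: ma)
      (false :: false :: false :: rb)).length = rb.length + 3 := fun right => by
    rw [endBits_length] <;> simp [h]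
  obtain ⟨p1, p2⟩ := cpre_prefix (endBits c false s (false :: false :: i :: ma)
    (false :: false :: false :: rb)) (endBits c true s (false :: false :: i :: ma)
    (false :: false :: false :: rb))
  have hp := K.rad_pos
  refine ⟨inCell_of_endpoints (hl.of_prefix p1) (hh.of_prefix p2), fun w hw => ?_⟩
  have wl := hw (K.mid - K.rad) (by simp only [ID.toSet, Set.mem_Icc]; constructor <;> linarith)
  have wh := hw (K.mid + K.rad) (by simp only [ID.toSet, Set.mem_Icc]; constructor <;> linarith)
  rcases le_total w.length (rb.length + 3) with hle | hle
  · exact length_le_cpre (wl.prefix_of_le hl (by rw [hll]; exact hle))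
      (wh.prefix_of_le hh (by rw [hll]; exact hle))
  · have e1 := hl.prefix_of_le wl (by rw [hll]; exact hle)
    have e2 := hh.prefix_of_le wh (by rw [hll]; exact hle)
    have e := (List.prefix_of_prefix_length_le e1 e2 (by rw [hll, hll])).eq_of_length
      (by rw [hll, hll])
    rw [e, vh] at vl
    have : (0 : ℝ) < 2 ^ rb.length := by positivity
    nlinarith

/-! ### Chains of levels -/

/-- The projection to the unit interval. -/
noncomputable def clamp (x : ℝ) : unitInterval := Set.projIcc 0 1 zero_le_one x

theorem coe_clamp (x : ℝ) : (clamp x : ℝ) = max 0 (min 1 x) := Set.coe_projIcc _ _ _ _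

theorem clamp_coe (x : unitInterval) : clamp x = x := Set.projIcc_val _ _

open Classical in
/-- The record of a class after the levels of the nonempty prefixes of an address, which is given in
reverse order, together with the number of levels that have been used. The level `X`, on which the
function is asked for its value near `0.X` with index `m`, has the result `code X m`, and is used if
`good X m`. -/
noncomputable def chain (code : List Bool → ℕ → Str) (good : List Bool → ℕ → Prop) (c : Bool) :
    List Bool → (Str × ℕ) × ℕ
  | [] => (([], 0), 0)
  | b :: rw => if good (argBits c (b :: rw)) (chain code good c rw).2 then
      (stepRec (code (argBits c (b :: rw)) (chain code good c rw).2) (chain code good c rw).1,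
        (chain code good c rw).2 + 1)
    else chain code good c rw

/-- The record of larger grade, with its class. -/
def sel (r₀ r₁ : Str × ℕ) : Bool × (Str × ℕ) := if r₀.2 ≤ r₁.2 then (true, r₁) else (false, r₀)

/-- The levels evaluate the function `f`, for which `‖f‖ + 1 ≤ 2 ^ B`. The result of level `X` with
index `m` is the code of an interval `K X m` that contains some value of `f`. If the level is good,
then this interval contains all values of `f` within distance `1 / 2 ^ X.length` of `0.X`. Levels of
length `N (m + 2)` are good, since a run of so many steps cannot ask for more digits than `X` has, and
the intervals shrink at the rate `Q`. -/
structure Levels (f : C(unitInterval, ℝ)) (B : ℕ) (code : List Bool → ℕ → Str)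
    (good : List Bool → ℕ → Prop) (K : List Bool → ℕ → ID) (N Q : ℕ → ℕ) : Prop where
  norm_le : ‖f‖ + 1 ≤ 2 ^ B
  isCode : ∀ X m, IsIntervalCode (code X m) (K X m)
  mem : ∀ X m, ∃ x, f x ∈ (K X m).toSet
  mem_of_good : ∀ X m, good X m → ∀ x : unitInterval, |(x : ℝ) - frac X| ≤ 1 / 2 ^ X.length →
    f x ∈ (K X m).toSet
  good_of_le : ∀ X m, N (m + 2) ≤ X.length → good X m
  mono : Monotone N
  diam_le : ∀ X m n, Q n ≤ m → (K X m).diam ≤ 2⁻¹ ^ n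

section Chain

variable {f : C(unitInterval, ℝ)} {B : ℕ} {code : List Bool → ℕ → Str}
  {good : List Bool → ℕ → Prop} {K : List Bool → ℕ → ID} {N Q : ℕ → ℕ} {c : Bool}

theorem Levels.abs_le (h : Levels f B code good K N Q) (x : unitInterval) : |f x| + 1 ≤ 2 ^ B := by
  have h1 := f.norm_coe_le_norm x
  rw [Real.norm_eq_abs] at h1
  linarith [h.norm_le]

theorem Levels.recOk (h : Levels f B code good K N Q) (c : Bool) (rw : List Bool) :
    ∃ v, RecOk v B (chain code good c rw).1 := by
  induction rw with
  | nil => exact ⟨0, .inl rfl⟩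
  | cons b rw ih =>
    obtain ⟨v, hv⟩ := ih
    rw [chain]
    split_ifs with hg
    · set X := argBits c (b :: rw)
      set m := (chain code good c rw).2
      obtain ⟨x, hx⟩ := h.mem X m
      rcases eq_or_ne (stepRec (code X m) (chain code good c rw).1).2 (chain code good c rw).1.2
        with he | he
      · exact ⟨v, by rw [stepRec_eq (h.isCode X m) he]; exact hv⟩
      · rcases upd_stepRec (h.isCode X m) (chain code good c rw).1 with ⟨-, h2, -⟩ | ⟨h1, K, y, hK,
          h2, h3, h4, h5, h6⟩
        · exact absurd h2 he
        · have hle := one_div_pow_le (Nat.zero_le ((chain code good c rw).1.2 + 6))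
          rw [pow_zero, div_one] at hle
          rw [hK] at hx
          have h7 := h6 B (abs_mid_lt hx (h.abs_le x) (h2.trans_le hle))
          exact ⟨y, .inr ⟨y, h3, by simp, by dsimp only; omega, by dsimp only; omega⟩⟩
    · exact ⟨v, hv⟩

theorem Levels.step_le (h : Levels f B code good K N Q) (b : Bool) (rw : List Bool) :
    (chain code good c rw).1.2 ≤ (chain code good c (b :: rw)).1.2 ∧
      ((chain code good c (b :: rw)).1.2 = (chain code good c rw).1.2 →
        (chain code good c (b :: rw)).1 = (chain code good c rw).1) := by
  rw [chain]
  split_ifs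
  · exact ⟨(stepRec_le (h.isCode _ _) _).1, stepRec_eq (h.isCode _ _)⟩
  · exact ⟨le_rfl, fun _ => rfl⟩

theorem Levels.chain_le (h : Levels f B code good K N Q) (rw : List Bool) :
    (chain code good c rw).1.2 ≤ (chain code good c rw).2 ∧
      (chain code good c rw).2 ≤ rw.length := by
  induction rw with
  | nil => simp [chain]
  | cons b rw ih =>
    rw [chain, List.length_cons]
    split_ifs
    · exact ⟨(stepRec_le (h.isCode _ _) _).2.trans (by omega), by dsimp only; omega⟩
    · omega

/-- Longer addresses have records of larger grade, or the same record. -/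
theorem Levels.chain_mono (h : Levels f B code good K N Q) {rw rw' : List Bool} (hs : rw <:+ rw') :
    (chain code good c rw).1.2 < (chain code good c rw').1.2 ∨
      (chain code good c rw).1 = (chain code good c rw').1 := by
  obtain ⟨s, rfl⟩ := hs
  induction s with
  | nil => exact .inr rfl
  | cons b s ih =>
    obtain ⟨h1, h2⟩ := h.step_le (c := c) b (s ++ rw)
    rw [List.cons_append]
    rcases eq_or_lt_of_le h1 with h1 | h1
    · rw [h2 h1.symm]; exact ih
    · rcases ih with ih | ih
      · exact .inl (ih.trans h1)
      · rw [ih]; exact .inl h1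

/-- The record approximates the values of the function in the cell. -/
theorem Levels.recOk_of_hasDigits (h : Levels f B code good K N Q) {x : ℝ} (hx : |x| ≤ 3)
    {rw : List Bool} (hd : HasDigits ((x + shift c) / 8) rw.reverse) :
    RecOk (f (clamp x)) B (chain code good c rw).1 := by
  induction rw with
  | nil => exact .inl rfl
  | cons b rw ih =>
    have ih := ih (hd.of_prefix (by simp))
    rw [chain]
    split_ifs with hg
    · refine ih.step (h.isCode _ _) (h.mem_of_good _ _ hg _ ?_) (h.abs_le _)
      rw [coe_clamp]
      exact argBits_spec hd hx
    · exact ih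

theorem Levels.le_grade (h : Levels f B code good K N Q) {x : ℝ} (hx : |x| ≤ 3) {rw : List Bool}
    (hd : HasDigits ((x + shift c) / 8) rw.reverse) (T : ℕ) :
    min T ((chain code good c rw).2 - Q (B + T + 6)) ≤ (chain code good c rw).1.2 := by
  induction rw with
  | nil => simp [chain]
  | cons b rw ih =>
    have ih := ih (hd.of_prefix (by simp))
    rw [chain]
    split_ifs with hg
    swap
    · exact ih
    set X := argBits c (b :: rw)
    set m := (chain code good c rw).2
    by_cases hm : Q (B + T + 6) ≤ m
    swap
    · dsimp only; omega
    by_cases hT : T ≤ (chain code good c rw).1.2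
    · have := (stepRec_le (h.isCode X m) (chain code good c rw).1).1
      dsimp only; omega
    have hd' := h.diam_le X m _ hm
    have hmem : f (clamp x) ∈ (K X m).toSet := by
      refine h.mem_of_good _ _ hg _ ?_
      rw [coe_clamp]
      exact argBits_spec hd hx
    obtain ⟨L, hL⟩ : ∃ L, K X m = some L := by
      cases hL : K X m with
      | none => rw [hL] at hd'; simp [ID.diam] at hd'
      | some L => exact ⟨L, rfl⟩
    rw [hL, diam_le_iff, inv_pow, ← one_div] at hd'
    have hp := L.rad_pos
    have h1 := one_div_pow_le (m := B + (chain code good c rw).1.2 + 6) (n := B + T + 6) (by omega)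
    have h3 : L.rad < 1 / 2 ^ (B + T + 6) := by linarith
    have h2 := stepRec_progress (h.isCode X m) hL hmem (h.abs_le _) (h3.trans_le h1)
    dsimp only
    omega

theorem Levels.le_used (h : Levels f B code good K N Q) (M : ℕ) {rw : List Bool} {j : ℕ}
    (hl : N (M + 2) + 3 + j ≤ rw.length) : min M j ≤ (chain code good c rw).2 := by
  induction rw generalizing j with
  | nil => simp at hl
  | cons b rw ih =>
    cases j with
    | zero => simp
    | succ j =>
      rw [List.length_cons] at hl
      have ih := ih (j := j) (by omega)
      rw [chain]
      split_ifs with hg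
      · dsimp only; omega
      · by_contra hlt
        refine hg (h.good_of_le _ _ ?_)
        rw [argBits_length, List.length_cons]
        have := h.mono (show (chain code good c rw).2 + 2 ≤ M + 2 by omega)
        omega

/-- Long addresses have records of large grade. -/
theorem Levels.grade_of_length (h : Levels f B code good K N Q) {x : ℝ} (hx : |x| ≤ 3)
    {rw : List Bool} (hd : HasDigits ((x + shift c) / 8) rw.reverse) {T : ℕ}
    (hl : N (Q (B + T + 6) + T + 2) + 3 + (Q (B + T + 6) + T) ≤ rw.length) :
    T ≤ (chain code good c rw).1.2 := by
  have h1 := h.le_used (c := c) _ hl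
  have h2 := h.le_grade hx hd T
  omega

theorem sel_mono {r₀ r₁ r₀' r₁' : Str × ℕ} (h₀ : r₀.2 < r₀'.2 ∨ r₀ = r₀')
    (h₁ : r₁.2 < r₁'.2 ∨ r₁ = r₁') : (sel r₀ r₁).2.2 < (sel r₀' r₁').2.2 ∨
      (sel r₀ r₁).2.2 = (sel r₀' r₁').2.2 ∧ (sel r₀ r₁).1 = false ∧ (sel r₀' r₁').1 = true ∨
        (sel r₀ r₁).2 = (sel r₀' r₁').2 ∧ (sel r₀ r₁).1 = (sel r₀' r₁').1 := by
  have e₀ : r₀.2 ≤ r₀'.2 := by rcases h₀ with h | rfl <;> omega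
  have e₁ : r₁.2 ≤ r₁'.2 := by rcases h₁ with h | rfl <;> omega
  unfold sel
  split_ifs with h1 h2 h2
  · rcases h₁ with h | rfl
    · exact .inl h
    · exact .inr (.inr ⟨rfl, rfl⟩)
  · exact .inl (by dsimp only; omega)
  · dsimp only
    rcases eq_or_lt_of_le (e₀.trans h2) with h | h
    · exact .inr (.inl ⟨h, rfl, rfl⟩)
    · exact .inl h
  · rcases h₀ with h | rfl
    · exact .inl h
    · exact .inr (.inr ⟨rfl, rfl⟩)

/-- The class and the record that are selected for the digits of an interval. -/
noncomputable def selRec (code : List Bool → ℕ → Str) (good : List Bool → ℕ → Prop)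
    (p : Bool × Bool × List Bool × List Bool) : Bool × (Str × ℕ) :=
  sel (chain code good false (cellOf false p).reverse).1
    (chain code good true (cellOf true p).reverse).1

/-- The code of the value of the interval function on the interval with the code `a`. -/
noncomputable def funCode (code : List Bool → ℕ → Str) (good : List Bool → ℕ → Prop) (a : Str) :
    Str :=
  (parse (colList a)).elim [] fun p => recCode (selRec code good p).1 (selRec code good p).2

/-- The interval function that is obtained from the levels. -/
noncomputable def funID (code : List Bool → ℕ → Str) (good : List Bool → ℕ → Prop) (J : ID) : ID :=
  (parse (colList (exists_intervalCode J).choose)).elim none fun p =>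
    recID (selRec code good p).1 (selRec code good p).2

theorem Levels.sel_recOk {v : ℝ} {p : Bool × Bool × List Bool × List Bool}
    (h : ∀ c, RecOk v B (chain code good c (cellOf c p).reverse).1) :
    RecOk v B (selRec code good p).2 := by
  unfold selRec sel
  split_ifs
  · exact h true
  · exact h false

theorem parse_bounds {s i : Bool} {ma rb : List Bool} {L : DyadicInterval}
    (hm : L.mid = (-1) ^ s.toNat * (i.toNat + frac ma)) (hr : L.rad = frac rb) :
    |L.mid| < 2 ∧ L.rad < 1 := by
  have h1 := toNat_le_one i
  have h2 := frac_lt_one ma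
  have h3 := frac_nonneg ma
  rw [hm, hr, abs_sign, abs_of_nonneg (by positivity)]
  exact ⟨by linarith, frac_lt_one rb⟩

/-- The value of the interval function depends only on the smallest cells around an interval. -/
theorem funID_cases (code : List Bool → ℕ → Str) (good : List Bool → ℕ → Prop) (J : ID) :
    (funID code good J = none ∧ ∀ L, J = some L → L.rad < 1 → 2 ≤ |L.mid|) ∨
    ∃ L p, J = some L ∧ |L.mid| < 2 ∧ L.rad < 1 ∧ (∀ c, IsCell c J (cellOf c p)) ∧
      funID code good J = recID (selRec code good p).1 (selRec code good p).2 := by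
  have hc := (exists_intervalCode J).choose_spec
  rcases parse_spec hc with ⟨h1, h2⟩ | ⟨s, i, ma, rb, L, h1, h2, h3, h4⟩
  · exact .inl ⟨by rw [funID, h1]; rfl, h2⟩
  · obtain ⟨b1, b2⟩ := parse_bounds h3 h4
    refine .inr ⟨L, _, h2, b1, b2, fun c => ?_, by rw [funID, h1]; rfl⟩
    rw [h2]
    exact isCell_cellOf c (parse_length h1).1 h3 h4

theorem selRec_congr {p p' : Bool × Bool × List Bool × List Bool} (code : List Bool → ℕ → Str)
    (good : List Bool → ℕ → Prop) (h : ∀ c, cellOf c p = cellOf c p') :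
    selRec code good p = selRec code good p' := by
  rw [selRec, h, h, ← selRec]

/-- The emitted code depends only on the interval, and not on its code, since the smallest cells do. -/
theorem Levels.encodesFun (h : Levels f B code good K N Q) :
    EncodesFun (funCode code good) (funID code good) := by
  intro J a ha
  rcases parse_spec ha with ⟨h1, h2⟩ | ⟨s, i, ma, rb, L, h1, rfl, h3, h4⟩
  · rcases funID_cases code good J with ⟨e, -⟩ | ⟨L, p, rfl, b1, b2, -⟩
    · rw [e, funCode, h1]; rfl
    · exact absurd (h2 L rfl b2) (not_le.2 b1)
  · obtain ⟨b1, b2⟩ := parse_bounds h3 h4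
    rcases funID_cases code good (some L) with ⟨-, e⟩ | ⟨L', p, e1, -, -, e2, e3⟩
    · exact absurd (e L rfl b2) (not_le.2 b1)
    · rw [e3, funCode, h1, selRec_congr code good fun c =>
        (e2 c).unique (isCell_cellOf c (parse_length h1).1 h3 h4)]
      obtain ⟨v, hv⟩ : ∃ v, RecOk v B (selRec code good (s, i, ma, rb)).2 := by
        unfold selRec sel
        split_ifs
        · exact h.recOk _ _
        · exact h.recOk _ _
      simp only [Option.elim_some]
      generalize selRec code good (s, i, ma, rb) = q at hv ⊢
      exact hv.isCode q.1

theorem abs_le_three {L : DyadicInterval} (h1 : |L.mid| < 2) (h2 : L.rad < 1) {x : ℝ}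
    (hx : x ∈ ID.toSet (some L)) : |x| ≤ 3 := by
  simp only [ID.toSet, Set.mem_Icc] at hx
  obtain ⟨h3, h4⟩ := abs_lt.1 h1
  exact abs_le.2 ⟨by linarith, by linarith⟩

theorem abs_mid_lt_two {L : DyadicInterval} {x : ℝ} (hx : x ∈ ID.toSet (some L))
    (hx' : x ∈ Set.Icc (0 : ℝ) 1) (h : L.rad < 1) : |L.mid| < 2 := by
  simp only [ID.toSet, Set.mem_Icc] at hx hx'
  exact abs_lt.2 ⟨by linarith, by linarith⟩

theorem Levels.recOk_selRec (h : Levels f B code good K N Q) {L : DyadicInterval}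
    {p : Bool × Bool × List Bool × List Bool} (h1 : |L.mid| < 2) (h2 : L.rad < 1)
    (hp : ∀ c, IsCell c (some L) (cellOf c p)) {x : unitInterval}
    (hx : (x : ℝ) ∈ ID.toSet (some L)) : RecOk (f x) B (selRec code good p).2 := by
  refine Levels.sel_recOk fun c => ?_
  have := h.recOk_of_hasDigits (c := c) (rw := (cellOf c p).reverse) (abs_le_three h1 h2 hx)
    (by rw [List.reverse_reverse]; exact (hp c).1 x hx)
  rwa [clamp_coe] at this

theorem Levels.mem_funID (h : Levels f B code good K N Q) {J : ID} {x : unitInterval}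
    (hx : (x : ℝ) ∈ J.toSet) : f x ∈ (funID code good J).toSet := by
  rcases funID_cases code good J with ⟨e, -⟩ | ⟨L, p, rfl, b1, b2, hp, e⟩
  · rw [e]; trivial
  · rw [e]
    exact (h.recOk_selRec b1 b2 hp hx).mem _

/-- The interval function is monotone: the smallest cell around a smaller interval has a longer
address, so its chain extends that of the larger interval, and records of larger grade describe
smaller intervals. -/
theorem Levels.funID_subset (h : Levels f B code good K N Q) {J J' : ID} (hJ : J'.toSet ⊆ J.toSet)
    {x : unitInterval} (hx : (x : ℝ) ∈ J'.toSet) :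
    (funID code good J').toSet ⊆ (funID code good J).toSet := by
  rcases funID_cases code good J with ⟨e, -⟩ | ⟨L, p, rfl, b1, b2, hp, e⟩
  · rw [e]; exact Set.subset_univ _
  cases J' with
  | none =>
    have := hJ (Set.mem_univ (L.mid + L.rad + 1))
    simp only [ID.toSet, Set.mem_Icc] at this
    linarith [this.2]
  | some L' =>
    have hr : L'.rad < 1 := by
      have hp := L'.rad_pos
      have m1 := hJ (show L'.mid - L'.rad ∈ ID.toSet (some L') from ⟨le_rfl, by linarith⟩)
      have m2 := hJ (show L'.mid + L'.rad ∈ ID.toSet (some L') from ⟨by linarith, le_rfl⟩)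
      simp only [ID.toSet, Set.mem_Icc] at m1 m2
      linarith [m1.1, m2.2]
    have hm := abs_mid_lt_two hx x.2 hr
    rcases funID_cases code good (some L') with ⟨-, e'⟩ | ⟨_, p', ⟨⟩, -, -, hp', e'⟩
    · exact absurd (e' L' rfl hr) (not_le.2 hm)
    · rw [e, e']
      exact (h.recOk_selRec b1 b2 hp (hJ hx)).subset (h.recOk_selRec hm hr hp' hx)
        (sel_mono (h.chain_mono (List.reverse_suffix.2 ((hp _).prefix (hp' _) hJ)))
          (h.chain_mono (List.reverse_suffix.2 ((hp _).prefix (hp' _) hJ))))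

/-- The precision of the argument that yields the precision `n` of the value. -/
def funMod (B : ℕ) (N Q : ℕ → ℕ) (n : ℕ) : ℕ :=
  N (Q (B + (n + 1) + 6) + (n + 1) + 2) + 2 + (Q (B + (n + 1) + 6) + (n + 1))

theorem Levels.diam_funID (h : Levels f B code good K N Q) {J : ID} {x : unitInterval}
    (hx : (x : ℝ) ∈ J.toSet) {n : ℕ} (hd : J.diam ≤ 2⁻¹ ^ funMod B N Q n) :
    (funID code good J).diam ≤ 2⁻¹ ^ n := by
  cases J with
  | none => simp [ID.diam] at hd
  | some L =>
    obtain ⟨p, hp⟩ : ∃ p, funMod B N Q n = p + 2 := ⟨_, by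
      rw [funMod, add_right_comm]⟩
    rw [diam_le_iff, inv_pow, ← one_div, hp] at hd
    have h1 : L.rad < 1 := by
      have := one_div_pow_le (Nat.zero_le (p + 2))
      rw [pow_zero, div_one] at this
      linarith
    have h2 := abs_mid_lt_two hx x.2 h1
    rcases funID_cases code good (some L) with ⟨-, e⟩ | ⟨_, q, ⟨⟩, -, -, hq, e⟩
    · exact absurd (e L rfl h1) (not_le.2 h2)
    obtain ⟨h3, h4⟩ := abs_lt.1 h2
    have hL := L.rad_pos
    have hd4 : 2 * L.rad ≤ 1 / 4 := hd.trans (by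
      simpa [show (2 : ℝ) ^ 2 = 4 by norm_num] using one_div_pow_le (show 2 ≤ p + 2 by omega))
    have h5 : L.mid + L.rad < 11 / 3 := by linarith
    have h6 : -4 ≤ L.mid - L.rad := by linarith
    obtain ⟨c, w, hw, hc⟩ := exists_inCell h6 h5 hd
    have hl := (hq c).2 w hc
    have hg := h.grade_of_length (T := n + 1) (c := c) (rw := (cellOf c q).reverse)
      (abs_le_three h2 h1 hx) (by rw [List.reverse_reverse]; exact (hq c).1 x hx) (by
        rw [List.length_reverse]
        rw [funMod] at hp
        omega)
    have hs : n + 1 ≤ (selRec code good q).2.2 := by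
      unfold selRec sel
      cases c <;> split_ifs <;> dsimp only <;> omega
    rw [e]
    exact (h.recOk_selRec h2 h1 hq hx).diam_le _ (by omega) (by omega)

/-- The interval function maps names of `x` to names of `f x`. -/
theorem Levels.isFunName (h : Levels f B code good K N Q) : IsFunName (funID code good) f := by
  intro φ x hφ
  refine isRealName_of_small (fun n => h.funID_subset (hφ.1 n) (hφ.mem (n + 1)))
    (fun n => h.mem_funID (hφ.mem n)) fun δ hδ => ?_
  obtain ⟨T, hT⟩ := exists_pow_lt_of_lt_one hδ (by norm_num : (2⁻¹ : ℝ) < 1)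
  refine ⟨rate φ (funMod B N Q T), ?_⟩
  have hd := h.diam_funID (hφ.mem _) (diam_le_of_rate_le hφ (n := funMod B N Q T) le_rfl)
  cases hL : funID code good (φ (rate φ (funMod B N Q T))) with
  | none => rw [hL] at hd; simp [ID.diam] at hd
  | some L =>
    rw [hL, diam_le_iff] at hd
    have := L.rad_pos
    exact ⟨L, hL, by linarith⟩

/-- A short interval has a long address in one of the two grids. All long prefixes of the
address are good levels, so the grade of the last record is large. -/
theorem Levels.modulus_le (h : Levels f B code good K N Q) (n : ℕ) :
    modulus (funID code good) n ≤ funMod B N Q n :=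
  Nat.sInf_le fun _ ⟨_, hx, hx'⟩ hd => h.diam_funID (x := ⟨_, hx'⟩) hx hd

end Chain

/-! ### Names of the arguments of levels -/

/-- The code of an approximation to the binary fraction `0.X` with `n + 1` digits. -/
def nuCode (X : List Bool) (n : ℕ) : Str :=
  emitCode false ([.zero, .sep] ++ (padTake false (n + 1) X).map digit) n

/-- A name of the binary fraction `0.X`. -/
def nu (X : List Bool) : Baire := fun b => nuCode X b.length

/-- The intervals of the name of `0.X`. -/
noncomputable def nuID (X : List Bool) (n : ℕ) : ID :=
  some (approx false n (frac (padTake false (n + 1) X)) (frac_dyadic _))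

theorem nuCode_spec (X : List Bool) (n : ℕ) : IsIntervalCode (nuCode X n) (nuID X n) := by
  refine emitCode_spec false n ⟨false, [], padTake false (n + 1) X, by simp, rfl, ?_⟩
  simp [frac, binVal]

theorem mem_nuID {X : List Bool} {n : ℕ} {x : ℝ} : x ∈ (nuID X n).toSet ↔
    frac (padTake false (n + 1) X) - 1 / 2 ^ (n + 1) ≤ x ∧
      x ≤ frac (padTake false (n + 1) X) + 1 / 2 ^ (n + 1) := by
  simp only [nuID, ID.toSet, approx, radius, Set.mem_Icc, Bool.false_eq_true, if_false]

theorem nuID_subset (X : List Bool) (n : ℕ) : (nuID X (n + 1)).toSet ⊆ (nuID X n).toSet := by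
  intro x hx
  rw [mem_nuID, padTake_succ false (n + 1), frac_append, padTake_length, frac_cons, frac_nil] at hx
  rw [mem_nuID]
  set y := frac (padTake false (n + 1) X)
  have e : (1 : ℝ) / 2 ^ (n + 1 + 1) = 1 / 2 ^ (n + 1) / 2 := by
    rw [pow_succ _ (n + 1)]; field_simp
  have h : (0 : ℝ) < 1 / 2 ^ (n + 1) := by positivity
  have e2 : ∀ b : Bool, ((b.toNat : ℝ) + 0) / 2 / 2 ^ (n + 1) = b.toNat * (1 / 2 ^ (n + 1) / 2) :=
    fun b => by ring
  rw [e, e2] at hx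
  have h2 := toNat_le_one (X.getD (n + 1) false)
  have h3 : (0 : ℝ) ≤ (X.getD (n + 1) false).toNat := Nat.cast_nonneg _
  constructor <;> nlinarith

theorem frac_mem_nuID (X : List Bool) (n : ℕ) : frac X ∈ (nuID X n).toSet := by
  have := frac_padTake (n + 1) X
  have h : (0 : ℝ) < 1 / 2 ^ (n + 1) := by positivity
  exact mem_nuID.2 ⟨by linarith [this.1], this.2.le⟩

/-- The early intervals contain all the numbers that are as close to `0.X` as the number of digits
tells. -/
theorem mem_nuID_of_le {X : List Bool} {n : ℕ} (hn : n + 1 ≤ X.length) {x : ℝ}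
    (hx : |x - frac X| ≤ 1 / 2 ^ X.length) : x ∈ (nuID X n).toSet := by
  have e : padTake false (n + 1) X = X.take (n + 1) := by
    have := padTake_append false 0 (X.take (n + 1)) (X.drop (n + 1))
    rw [List.take_append_drop, List.length_take, min_eq_left hn] at this
    simpa [padTake] using this
  obtain ⟨k, hk⟩ := Nat.exists_eq_add_of_le hn
  have h1 : frac X = frac (X.take (n + 1)) + frac (X.drop (n + 1)) / 2 ^ (n + 1) := by
    conv_lhs => rw [← List.take_append_drop (n + 1) X]
    rw [frac_append, List.length_take, min_eq_left hn]
  have h2 := frac_le (X.drop (n + 1))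
  rw [List.length_drop, hk, Nat.add_sub_cancel_left] at h2
  have h3 := frac_nonneg (X.drop (n + 1))
  have hp : (0 : ℝ) < 1 / 2 ^ (n + 1) := by positivity
  have e2 : (1 : ℝ) / 2 ^ X.length = 1 / 2 ^ k * (1 / 2 ^ (n + 1)) := by
    rw [hk, pow_add _ (n + 1)]; field_simp
  have h4 : (1 : ℝ) / 2 ^ k ≤ 1 := by simpa using one_div_pow_le (Nat.zero_le k)
  rw [e2] at hx
  rw [div_eq_mul_one_div] at h1
  obtain ⟨h5, h6⟩ := abs_le.1 hx
  rw [mem_nuID, e]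
  constructor <;> nlinarith

theorem nu_encodes (X : List Bool) : EncodesSeq (nu X) fun n => nuID X (n + 2) := by
  intro n
  have : (natCode n).length = n + 2 := by simp [natCode]
  rw [nu, this]
  exact nuCode_spec X (n + 2)

theorem nu_isRealName (X : List Bool) : IsRealName (fun n => nuID X (n + 2)) (frac X) := by
  refine isRealName_of_small (fun n => nuID_subset X (n + 2)) (fun n => frac_mem_nuID X (n + 2)) ?_
  intro δ hδ
  obtain ⟨n, hn⟩ := exists_pow_lt_of_lt_one hδ (by norm_num : (2⁻¹ : ℝ) < 1)
  refine ⟨n, _, rfl, ?_⟩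
  rw [inv_pow, ← one_div] at hn
  have := one_div_pow_le (show n ≤ n + 2 + 1 by omega)
  simp only [approx, radius, Bool.false_eq_true, if_false]
  linarith

theorem nu_rate (X : List Bool) (n : ℕ) : rate (fun n => nuID X (n + 2)) n ≤ n := by
  refine Nat.sInf_le ?_
  have h := one_div_pow_le (show n ≤ n + 2 by omega)
  change ID.diam (some _) ≤ _
  rw [diam_le_iff, inv_pow, ← one_div]
  simp only [approx, radius, Bool.false_eq_true, if_false]
  rw [pow_succ _ (n + 2), show 2 * ((1 : ℝ) / (2 ^ (n + 2) * 2)) = 1 / 2 ^ (n + 2) by field_simp]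
  exact h

theorem ceil_logb_le_one (x : unitInterval) : ⌈Real.logb 2 (|(x : ℝ)| + 1)⌉₊ ≤ 1 := by
  rw [Nat.ceil_le, Real.logb_le_iff_le_rpow (by norm_num) (by positivity), abs_of_nonneg x.2.1]
  have := x.2.2
  norm_num
  linarith

theorem around_rate (x : ℝ) (n : ℕ) : rate (fun n => some (around x n)) n ≤ n + 2 := by
  refine Nat.sInf_le ?_
  change ID.diam (some _) ≤ _
  rw [diam_le_iff, inv_pow, ← one_div]
  simp only [around]
  rw [pow_add]
  apply le_of_eq
  field_simp

/-- A name of a number that is close to `0.X` and that begins with the intervals of the name of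
`0.X`. -/
theorem exists_splice {X : List Bool} {x : ℝ} (hx : |x - frac X| ≤ 1 / 2 ^ X.length) {k : ℕ}
    (hk : k ≤ X.length - 2) : ∃ J, IsRealName J x ∧ ∀ n < k, J n = nuID X (n + 2) := by
  cases k with
  | zero => exact ⟨_, isRealName_around x, by simp⟩
  | succ j =>
    obtain ⟨J, hJ, hJ0⟩ := exists_realName_of_mem (mem_nuID_of_le (n := j + 2) (by omega) hx)
    have hJ0 : J 0 = nuID X (j + 2) := hJ0
    have hlate : ∀ i, (if j + i ≤ j then nuID X (j + i + 2) else J (j + i - j)) = J i := by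
      intro i
      cases i with
      | zero => simp [hJ0]
      | succ i => rw [if_neg (by omega)]; congr 1; omega
    refine ⟨fun n => if n ≤ j then nuID X (n + 2) else J (n - j), isRealName_of_small ?_ ?_ ?_,
      fun n hn => if_pos (by omega)⟩
    · intro n
      rcases lt_or_ge n j with h | h
      · rw [if_pos (by omega), if_pos (by omega)]
        exact nuID_subset X (n + 2)
      · obtain ⟨i, rfl⟩ := Nat.exists_eq_add_of_le h
        have := hJ.1 i
        rw [← hlate, ← hlate i] at this
        exact this
    · intro n
      rcases lt_or_ge n j with h | h
      · rw [if_pos (by omega)]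
        exact mem_nuID_of_le (by omega) hx
      · obtain ⟨i, rfl⟩ := Nat.exists_eq_add_of_le h
        have := hJ.mem i
        rw [← hlate] at this
        exact this
    · intro δ hδ
      obtain ⟨i, L, hL, hr⟩ := hJ.small hδ
      rw [← hlate] at hL
      exact ⟨j + i, L, hL, hr⟩

/-! ### Levels of an evaluating machine -/

theorem mem_intervalUnit {χ : Baire} {x : unitInterval} :
    x ∈ intervalUnit.rep χ ↔ ∃ J, EncodesSeq χ J ∧ IsRealName J x := by
  rw [← mem_intervalReals]
  constructor
  · rintro ⟨h, rfl⟩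
    exact ⟨h.1, rfl⟩
  · rintro ⟨h, hx⟩
    exact ⟨⟨h, by rw [hx]; exact x.2⟩, Subtype.ext hx⟩

theorem param_intervalUnit {χ : intervalUnit.rep.Dom} {J : ℕ → ID} {x : ℝ}
    (h1 : EncodesSeq χ J) (h2 : IsRealName J x) (n : ℕ) :
    intervalUnit.param χ n = rate J n + ⌈Real.logb 2 (|x| + 1)⌉₊ :=
  param_intervalReals (χ := ⟨χ, χ.2.1⟩) h1 h2 n

/-- The queries whose answers are the same for all the names that begin like the name of `0.X`. -/
def okSet (X : List Bool) : Set Str := {q | ∀ b, q = .one :: b → b.length + 1 ≤ X.length}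

/-- The result of the level `X` with index `m`: the output of the machine on the name of `0.X`. -/
noncomputable def levCode (M : OracleMachine) (φ : Baire) (T : ℕ → ℕ) (X : List Bool) (m : ℕ) : Str :=
  ((M.conf (pair φ (nu X)) (natCode m) (T (m + 2))).tape .output).content

/-- A level is good if all queries about its argument are short enough to be answered by the digits
of `X` in the same way for all points of the cell. -/
def levGood (M : OracleMachine) (φ : Baire) (T : ℕ → ℕ) (X : List Bool) (m : ℕ) : Prop :=
  ∀ q ∈ M.queries (pair φ (nu X)) (natCode m) (T (m + 2)), q ∈ okSet X

section Level

variable {R : ParamRep C(unitInterval, ℝ)} {M : OracleMachine} {P Q : (ℕ → ℕ) → ℕ → ℕ}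

/-- The machine `M`, with the bounds `P` for its time and `Q` for the parameter of its results,
witnesses that evaluation is polytime computable. -/
structure Witness (R : ParamRep C(unitInterval, ℝ)) (M : OracleMachine) (P Q : (ℕ → ℕ) → ℕ → ℕ) :
    Prop where
  real : IsRealiser (R.prod intervalUnit) intervalReals M.operator fun p => p.1 p.2
  sopP : IsSOP P
  sopQ : IsSOP Q
  time : ∀ (φ : (R.prod intervalUnit).rep.Dom) (a : Str),
    M.time φ a ≤ (P ((R.prod intervalUnit).param φ) a.length : ℕ∞)
  blowup : ∀ (φ : (R.prod intervalUnit).rep.Dom) (χ : intervalReals.rep.Dom),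
    (χ : Baire) ∈ M.operator φ → ∀ n, intervalReals.param χ n ≤ Q ((R.prod intervalUnit).param φ) n

/-- The bounds for an evaluation in terms of any monotone bound `l` for the parameters of its arguments. -/
theorem Witness.eval (h : Witness R M P Q) (φ : R.rep.Dom) {f : C(unitInterval, ℝ)}
    (hf : f ∈ R.rep φ) {χ : Baire} {J : ℕ → ID} {x : unitInterval} (hJ : EncodesSeq χ J)
    (hx : IsRealName J x) {l : ℕ → ℕ} (hl : Monotone l) (h1 : ∀ n, R.param φ n ≤ l n)
    (h2 : ∀ n, rate J n + ⌈Real.logb 2 (|(x : ℝ)| + 1)⌉₊ ≤ l n) :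
    (∀ a, M.HaltedBy (pair φ χ) a (P l a.length)) ∧ ∃ θ L, EncodesSeq θ L ∧
      IsRealName L (f x) ∧ (∀ n, rate L n + ⌈Real.logb 2 (|f x| + 1)⌉₊ ≤ Q l n) ∧
      ∀ a n, M.HaltedBy (pair φ χ) a n → θ a = ((M.conf (pair φ χ) a n).tape .output).content := by
  classical
  have hx' : x ∈ intervalUnit.rep χ := mem_intervalUnit.2 ⟨J, hJ, hx⟩
  have hdom : ((R.prod intervalUnit).rep (pair φ χ)).Dom := ⟨rfl, hf.1, hx'.1⟩
  have hval : (f, x) ∈ (R.prod intervalUnit).rep (pair φ χ) :=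
    ⟨hdom, Prod.ext hf.2 hx'.2⟩
  have hpar : ∀ n, (R.prod intervalUnit).param ⟨pair φ χ, hdom⟩ n ≤ l n := by
    intro n
    refine max_le (h1 n) ?_
    exact (param_intervalUnit (χ := ⟨χ, hx'.1⟩) hJ hx n).le.trans (h2 n)
  obtain ⟨θ, hθ, hθf⟩ := h.real _ _ hval
  obtain ⟨L, hL, hLf⟩ := mem_intervalReals.1 hθf
  refine ⟨fun a => (OracleMachine.haltedBy_of_time_le (h.time ⟨_, hdom⟩ a)).mono
    (h.sopP.mono hl hpar le_rfl), θ, L, hL, hLf, fun n => ?_, fun a n hn => ?_⟩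
  · have := h.blowup ⟨_, hdom⟩ ⟨θ, hθf.1⟩ hθ n
    rw [param_intervalReals hL hLf] at this
    exact this.trans (h.sopQ.mono hl hpar le_rfl)
  · obtain ⟨hh, rfl⟩ := hθ
    simp only [OracleMachine.operator]
    rw [OracleMachine.content_find (hh a) hn]

theorem haltedBy_congr {θ θ' : Baire} {a : Str} {n : ℕ} (h : M.HaltedBy θ a n)
    (hc : M.conf θ a n = M.conf θ' a n) : M.HaltedBy θ' a n := by
  have ho := h.oracle_eq_none
  unfold OracleMachine.HaltedBy at h ⊢
  rw [← hc]
  simp only [OracleMachine.step, ho] at h ⊢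
  exact h

/-- The parameter of the names on which the machine is run. -/
def levParam (l : ℕ → ℕ) (n : ℕ) : ℕ := l n + n + 3

theorem levParam_mono {l : ℕ → ℕ} (hl : Monotone l) : Monotone (levParam l) := fun m n h => by
  have := hl h
  unfold levParam
  omega

theorem fracUnit (X : List Bool) : frac X ∈ unitInterval := ⟨frac_nonneg X, (frac_lt_one X).le⟩

/-- Every simulated run terminates in time, good or not, since it is a run on genuine names. -/
theorem Witness.halted (h : Witness R M P Q) (φ : R.rep.Dom) (X : List Bool) (a : Str) :
    M.HaltedBy (pair φ (nu X)) a (P (levParam (R.param φ)) a.length) := by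
  refine (h.eval φ (Part.get_mem φ.2) (x := ⟨frac X, fracUnit X⟩) (nu_encodes X) (nu_isRealName X)
    (levParam_mono (R.mono φ)) (fun n => ?_) fun n => ?_).1 a
  · unfold levParam; omega
  · have h1 := nu_rate X n
    have h2 := ceil_logb_le_one ⟨frac X, fracUnit X⟩
    unfold levParam
    omega

/-- The levels of an evaluating machine evaluate the function. In a good level, the run on the name of
`0.X` is also a run on a name of any other point of the cell, by `exists_splice`. -/
theorem Witness.levels (h : Witness R M P Q) (φ : R.rep.Dom) {f : C(unitInterval, ℝ)}
    (hf : f ∈ R.rep φ) : ∃ K, Levels f (Q (levParam (R.param φ)) 0)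
      (levCode M φ (P (levParam (R.param φ)))) (levGood M φ (P (levParam (R.param φ)))) K
      (P (levParam (R.param φ))) (Q (levParam (R.param φ))) := by
  classical
  set l := levParam (R.param φ) with hl
  have hlm : Monotone l := levParam_mono (R.mono φ)
  have hlφ : ∀ n, R.param φ n ≤ l n := fun n => by rw [hl]; unfold levParam; omega
  have hln : ∀ n, n + 3 ≤ l n := fun n => by rw [hl]; unfold levParam; omega
  have hlen : ∀ m, (natCode m).length = m + 2 := fun m => by simp [natCode]
  have hnu : ∀ X, ∃ L : ℕ → ID, (∀ m, IsIntervalCode (levCode M φ (P l) X m) (L m)) ∧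
      IsRealName L (f ⟨frac X, fracUnit X⟩) ∧ ∀ n, rate L n ≤ Q l n := by
    intro X
    obtain ⟨h1, θ, L, h2, h3, h4, h5⟩ := h.eval φ hf (x := ⟨frac X, fracUnit X⟩) (nu_encodes X)
      (nu_isRealName X) hlm hlφ fun n => by
        have h1 := nu_rate X n
        have h2 := ceil_logb_le_one ⟨frac X, fracUnit X⟩
        have h3 := hln n
        omega
    refine ⟨L, fun m => ?_, h3, fun n => (Nat.le_add_right _ _).trans (h4 n)⟩
    have := h5 _ _ (h1 (natCode m))
    rw [hlen] at this
    rw [levCode, ← this]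
    exact h2 m
  choose L hL1 hL2 hL3 using hnu
  refine ⟨L, ⟨?_, hL1, fun X m => ⟨_, (hL2 X).mem m⟩, ?_, ?_, ?_, ?_⟩⟩
  · have h1 : ‖f‖ ≤ 2 ^ Q l 0 - 1 := by
      refine (ContinuousMap.norm_le f ?_).2 fun x => ?_
      · have : (1 : ℝ) ≤ 2 ^ Q l 0 := one_le_pow₀ (by norm_num)
        linarith
      · obtain ⟨χ, hχ⟩ := exists_encodesSeq fun n => some (around x n)
        obtain ⟨-, θ, L', -, -, h4, -⟩ := h.eval φ hf (x := x) hχ (isRealName_around x) hlm hlφ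
          fun n => by
            have h1 := around_rate x n
            have h2 := ceil_logb_le_one x
            have h3 := hln n
            omega
        have h5 := add_one_le_two_pow (abs_nonneg (f x))
        have h6 : (2 : ℝ) ^ ⌈Real.logb 2 (|f x| + 1)⌉₊ ≤ 2 ^ Q l 0 :=
          pow_le_pow_right₀ (by norm_num) ((Nat.le_add_left _ _).trans (h4 0))
        rw [Real.norm_eq_abs]
        linarith
    linarith
  · -- run the machine on a name of `x` that agrees with the name of `0.X` on all the queries
    intro X m hg x hx
    obtain ⟨J, hJ, hJX⟩ := exists_splice hx le_rfl
    choose c hc using exists_intervalCode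
    let χ : Baire := fun b => if b = natCode (b.length - 2) ∧ X.length - 2 ≤ b.length - 2 then
      c (J (b.length - 2)) else nu X b
    have hχ : EncodesSeq χ J := by
      intro n
      have e : (natCode n).length - 2 = n := by rw [hlen]; omega
      simp only [χ, e, true_and]
      split_ifs with hn
      · exact hc _
      · rw [hJX n (by omega)]
        exact nu_encodes X n
    have hag : ∀ q ∈ M.queries (pair φ (nu X)) (natCode m) (P l (m + 2)),
        pair φ (nu X) q = pair φ χ q := by
      intro q hq
      match q, hg q hq with
      | [], _ => rfl
      | .zero :: b, _ => rfl
      | .sep :: b, _ => rfl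
      | .one :: b, hb =>
        have hb := hb b rfl
        change nu X b = χ b
        refine (if_neg ?_).symm
        rintro ⟨h1, h2⟩
        have h3 := congrArg List.length h1
        rw [hlen] at h3
        omega
    have hconf := OracleMachine.conf_congr hag le_rfl
    have hhalt := h.halted φ X (natCode m)
    rw [← hl, hlen] at hhalt
    have hhalt' := haltedBy_congr hhalt hconf
    obtain ⟨-, θ, L', h2, h3, -, h5⟩ := h.eval φ hf hχ hJ
      (l := fun n => max (R.param φ n) (rate J n + ⌈Real.logb 2 (|(x : ℝ)| + 1)⌉₊))
      (fun m n hmn => max_le_max (R.mono φ hmn) (Nat.add_le_add_right (rate_mono hJ hmn) _))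
      (fun n => le_max_left _ _) (fun n => le_max_right _ _)
    have h6 := h2 m
    rw [h5 _ _ hhalt', ← hconf] at h6
    rw [intervalCode_unique (hL1 X m) h6]
    exact h3.mem m
  · intro X m hX q hq b hb
    have := OracleMachine.query_length_le hq
    rw [hb, List.length_cons] at this
    omega
  · exact fun m n hmn => h.sopP.mono hlm (fun _ => le_rfl) hmn
  · exact fun X m n hm => diam_le_of_rate_le (hL2 X) ((hL3 X n).trans hm)

end Level

/-! ### Simulated oracles of levels -/

/-- Binary digits as cells. -/
def bt (b : Bool) : Cell := some (digit b)

theorem nuCode_eq (X : List Bool) (n : ℕ) : nuCode X n = [.one, .zero, .zero, .one, .sep, .sep] ++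
    ((padTake false n X).flatMap fun b => [.one, digit b, .zero]) ++
      [.one, digit (X.getD n false), .one] ++ List.replicate 6 .zero := by
  have hl : (radCode false n 0).length = n + 3 := by simp [radCode]
  have hz : ([Sym.zero, Sym.sep] ++ (padTake false (n + 1) X).map digit).length -
      (radCode false n 0).length = 0 := by rw [hl]; simp [padTake_length]
  have hcols : ∀ l : List Bool, cols ((l.map digit).zip (List.replicate l.length .zero)) =
      l.flatMap fun b => [.one, digit b, .zero] := by
    intro l
    induction l with
    | nil => rfl
    | cons b l ih => simpa [cols, List.replicate_succ] using ih
  have hz2 : ([Sym.zero, Sym.sep] ++ (padTake false (n + 1) X).map digit).zip (radCode false n 0) =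
      [(.zero, .zero), (.sep, .sep)] ++ ((padTake false n X).map digit).zip
        (List.replicate (padTake false n X).length .zero) ++ [(digit (X.getD n false), .one)] := by
    rw [padTake_length, padTake_succ]
    have : (radCode false n 0) = [.zero, .sep] ++ (List.replicate n .zero ++ [.one]) := by
      simp [radCode]
    rw [this, List.map_append, List.append_assoc, List.zip_append rfl, List.zip_append
      (by simp [padTake_length])]
    rfl
  rw [nuCode, emitCode, hz, strPair_eq (by rw [hl]; simp [padTake_length]), hz2, cols_append,
    cols_append, hcols]
  rfl

section Level

variable {M : OracleMachine} {φ : Baire}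

/-- Write a column with a digit of the stack `X` and the symbol `b`; report in the flag `bad`
whether there is no digit. -/
noncomputable def nuStep (M : OracleMachine) (b : Sym) : Prog (Dat M.State) (Rg M.Work) :=
  doOps (fun v => { v.d with bad := v.d.bad || !(v.top (.reg .X)).isSome }) fun v =>
    [(.reg .harg, .drop), (.reg .X, .drop),
      (.reg .X2, if (v.top (.reg .X)).isSome then .put (v.top (.reg .X)).join else .keep),
      (.reg .tmp, .put3 (some .one) (some ((v.top (.reg .X)).join.getD .zero)) (some b))]

/-- The stacks after `i` digits of `X` have been read and `r` has been written. -/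
noncomputable def nuS {W : Type} (X : List Bool) (i : ℕ) (q r : Str) (S : Stk (Rg W) → List Cell) :
    Stk (Rg W) → List Cell :=
  update (update (update (update S (.reg .harg) (q.map some)) (.reg .X) ((X.drop i).map bt))
    (.reg .X2) (((X.take i).map bt).reverse)) (.reg .tmp) ((r.map some).reverse)

theorem run_nuStep (b : Sym) (X : List Bool) (i : ℕ) (q r : Str) (d : Dat M.State)
    (S : Stk (Rg M.Work) → List Cell) (x : Str) :
    Run φ (nuStep M b) ⟨d, nuS X i q r S, x⟩ 1 fun σ => ∃ d' : Dat M.State,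
      σ = ⟨d', nuS X (i + 1) q.tail (r ++ [.one, digit (X.getD i false), b]) S, x⟩ ∧ d'.q = d.q ∧
        d'.halt = d.halt ∧ (d'.bad = false ↔ d.bad = false ∧ i + 1 ≤ X.length) := by
  refine run_doOps ⟨_, St.ext rfl ?_ rfl, rfl, rfl, ?_⟩
  · have t : nuS X i q r S (.reg .X) = (X.drop i).map bt := by simp [nuS]
    rcases lt_or_ge i X.length with hi | hi
    · have e1 : X.drop i = X[i] :: X.drop (i + 1) := List.drop_eq_getElem_cons hi
      have e2 : ((X.take (i + 1)).map bt).reverse = bt X[i] :: ((X.take i).map bt).reverse := by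
        rw [← List.take_concat_get' X i hi, List.map_append, List.reverse_append]; rfl
      have e3 : X.getD i false = X[i] := by simp [hi]
      rw [e1] at t
      simp only [St.view, sem, Op.ap, pushO, t, e3, List.map_cons, List.head?_cons, Option.isSome_some,
        Option.join_some, ↓reduceIte, List.tail_cons, Bool.false_eq_true]
      funext j
      simp only [nuS, e2, Function.update_apply, Stk.reg.injEq, reduceCtorEq, ↓reduceIte]
      generalize ((X.take i).map bt).reverse = l
      clear * -
      split_ifs <;> simp_all [bt]
    · have e1 : X.drop i = [] := List.drop_eq_nil_of_le hi
      have e2 : X.drop (i + 1) = [] := List.drop_eq_nil_of_le (by omega)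
      have e3 : X.take (i + 1) = X := List.take_of_length_le (by omega)
      have e4 : X.take i = X := List.take_of_length_le hi
      have e5 : X.getD i false = false := List.getD_eq_default _ _ hi
      rw [e1] at t
      simp only [St.view, sem, Op.ap, pushO, t, e5, List.map_nil, List.head?_nil, Option.isSome_none,
        ↓reduceIte, List.tail_nil, Bool.false_eq_true]
      funext j
      simp only [nuS, e2, e3, e4, Function.update_apply, Stk.reg.injEq, reduceCtorEq, ↓reduceIte]
      clear * -
      split_ifs <;> simp_all [digit]
  · rcases lt_or_ge i X.length with hi | hi
    · simp [St.view, nuS, hi, Nat.succ_le_iff]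
    · simp [St.view, nuS, hi, Nat.not_lt.2 hi, Nat.succ_le_iff]

/-- Answer a query to the simulated oracle: queries to its first component are passed to the oracle,
and queries to its second component are answered by the name of `0.X`. -/
noncomputable def levelOracle (M : OracleMachine) : Prog (Dat M.State) (Rg M.Work) :=
  .ite (fun v => decide ((v.top (.reg .harg)).join = some .zero))
    (.seq (doOps (fun v => v.d) fun _ => [(.reg .harg, .drop)]) <|
      .seq (move (.reg .harg) .qry) (.seq .call (empty .qry)))
    (.ite (fun v => decide ((v.top (.reg .harg)).join = some .one))
      (.seq (doOps (fun v => v.d) fun _ =>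
          [(.reg .harg, .drop), (.reg .tmp, .put3 (some .one) (some .zero) (some .zero))]) <|
        .seq (doOps (fun v => v.d) fun _ =>
          [(.reg .tmp, .put3 (some .one) (some .sep) (some .sep))]) <|
        .seq (.loop (fun v => (v.top (.reg .harg)).isSome) (nuStep M .zero)) <|
        .seq (nuStep M .one) <|
        .seq (doOps (fun v => v.d) fun _ =>
          [(.reg .tmp, .put3 (some .zero) (some .zero) (some .zero))]) <|
        .seq (doOps (fun v => v.d) fun _ =>
          [(.reg .tmp, .put3 (some .zero) (some .zero) (some .zero))]) <|
        .seq (move (.reg .X2) (.reg .X)) (move (.reg .tmp) .ans))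
      (empty (.reg .harg)))

/-- The program answers queries to the pair of the oracle and the name of `0.X`, and reports queries
that ask for more digits than `X` has. -/
theorem handles_levelOracle {S₀ : Stk (Rg M.Work) → List Cell} {X : List Bool} (hq : S₀ .qry = [])
    (hX : S₀ (.reg .X) = X.map bt) (hX2 : S₀ (.reg .X2) = []) (n : ℕ) (x : Str) :
    Handles φ (levelOracle M) (pair φ (nu X)) (okSet X) (12 * n + 60) n S₀ x := by
  intro d S q hS hn hh htmp hcd htp hans
  have hq' := (hS .qry id).trans hq
  have hX' := (hS (.reg .X) id).trans hX
  have hX2' := (hS (.reg .X2) id).trans hX2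
  clear hS hq hX hX2 hcd htp
  rcases q with _ | ⟨s, q⟩
  · refine Run.ite_false (by simp [St.view, hh]) ?_
    |>.weaken (T := 1 + 1 + 1) (by omega)
    refine Run.ite_false (by simp [St.view, hh]) ((run_empty _ _ _ _).mono le_rfl ?_)
    rintro _ rfl
    refine ⟨d, ?_, rfl, rfl, by simp [okSet]⟩
    congr 1
    funext j
    simp only [Function.update_apply, pair]
    split_ifs <;> simp_all
  cases s with
  | sep =>
    refine Run.ite_false (by simp [St.view, hh]) ?_
    |>.weaken (T := 1 + 1 + 1) (by omega)
    refine Run.ite_false (by simp [St.view, hh]) ((run_empty _ _ _ _).mono le_rfl ?_)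
    rintro _ rfl
    refine ⟨d, ?_, rfl, rfl, by simp [okSet]⟩
    congr 1
    funext j
    simp only [Function.update_apply, pair]
    split_ifs <;> simp_all
  | zero =>
    have hn' : q.length + 1 ≤ n := hn
    refine Run.ite_true (by simp [St.view, hh]) (Run.weaken (T := 1 + ((2 * q.length + 1) +
      (1 + 1))) ?_ (by omega)) |>.weaken (T := (12 * n + 59) + 1) (by omega)
    refine (run_doOps rfl).seq ?_
    rintro _ rfl
    refine ((run_move (by simp) _ _ _).weaken (by simp [sem, St.view, hh, Op.ap, pushO])).seq ?_
    rintro _ rfl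
    refine (Run.call rfl).seq ?_
    rintro _ rfl
    refine (run_empty _ _ _ _).mono le_rfl ?_
    rintro _ rfl
    refine ⟨d, ?_, rfl, rfl, by simp [okSet]⟩
    simp only [St.ask, St.view, sem, Op.ap, pushO]
    congr 1
    funext j
    have hc := stkT_content q
    simp only [Function.update_apply, Stk.reg.injEq, reduceCtorEq, ↓reduceIte, pair]
    split_ifs <;> simp_all
  | one =>
    have hn' : q.length + 1 ≤ n := hn
    have hf : ∀ i, i + 1 ≤ q.length → (q.drop i).tail = q.drop (i + 1) := by simp
    have hmv : ∀ {k k' : Stk (Rg M.Work)} (_ : k ≠ k') (d : Dat M.State)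
      (S : Stk (Rg M.Work) → List Cell) (L : ℕ), (S k).length ≤ L → Run φ (move k k') ⟨d, S, x⟩
        (2 * L + 1) fun σ => σ = ⟨d, update (update S k' ((S k).reverse ++ S k')) k [], x⟩ :=
      fun hk d S L hL => (run_move hk d S x).weaken (by omega)
    refine Run.ite_false (by simp [St.view, hh]) (Run.ite_true (by simp [St.view, hh])
      (Run.weaken (T := 1 + (1 + ((q.length * (1 + 1) + 1) + (1 + (1 + (1 +
        ((2 * (q.length + 1) + 1) + (2 * (3 * q.length + 15) + 1)))))))) ?_ le_rfl))
      |>.weaken (by omega)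
    refine (run_doOps rfl).seq ?_
    rintro _ rfl
    refine (run_doOps rfl).seq ?_
    rintro _ rfl
    have e0 : (sem [(.reg .tmp, .put3 (some .one) (some .sep) (some .sep))] (sem [(.reg .harg,
        .drop), (.reg .tmp, .put3 (some .one) (some .zero) (some .zero))] S) :
        Stk (Rg M.Work) → List Cell) = nuS X 0 q [.one, .zero, .zero, .one, .sep, .sep] S := by
      simp only [sem, nuS, Op.ap, pushO]
      funext j
      simp only [Function.update_apply, Stk.reg.injEq, reduceCtorEq, ↓reduceIte]
      split_ifs <;> simp_all
    simp only [St.view, e0]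
    refine (Run.loop (n := q.length) (T := 1) (I := fun i σ => ∃ d' : Dat M.State, σ = ⟨d',
      nuS X i (q.drop i) ([.one, .zero, .zero, .one, .sep, .sep] ++
        ((padTake false i X).flatMap fun b => [.one, digit b, .zero])) S, x⟩ ∧ d'.q = d.q ∧
        d'.halt = d.halt ∧ (d'.bad = false ↔ d.bad = false ∧ i ≤ X.length)) ?_ ?_ ?_).seq ?_
    · rintro i hi _ ⟨d', rfl, h1, h2, h3⟩
      refine ⟨by simp [St.view, nuS, hi], (run_nuStep .zero X i _ _ d' S x).mono le_rfl ?_⟩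
      · rintro _ ⟨d'', rfl, g1, g2, g3⟩
        refine ⟨d'', ?_, g1.trans h1, g2.trans h2, ?_⟩
        · rw [List.tail_drop, padTake_succ, List.flatMap_append, List.append_assoc]
          rfl
        · rw [g3, h3]
          constructor
          · rintro ⟨⟨h, -⟩, h'⟩; exact ⟨h, h'⟩
          · rintro ⟨h, h'⟩; exact ⟨⟨h, by omega⟩, h'⟩
    · rintro _ ⟨d', rfl, -⟩
      simp [St.view, nuS]
    · exact ⟨d, by simp [padTake], rfl, rfl, by simp⟩
    rintro _ ⟨d1, rfl, h1, h2, h3⟩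
    refine (run_nuStep .one X q.length _ _ d1 S x).seq ?_
    rintro _ ⟨d2, rfl, g1, g2, g3⟩
    refine (run_doOps rfl).seq ?_
    rintro _ rfl
    refine (run_doOps rfl).seq ?_
    rintro _ rfl
    have e1 : ∀ r : Str, (sem [(.reg .tmp, .put3 (some .zero) (some .zero) (some .zero))]
        (sem [(.reg .tmp, .put3 (some .zero) (some .zero) (some .zero))]
          (nuS X (q.length + 1) (q.drop q.length).tail r S)) : Stk (Rg M.Work) → List Cell) =
        nuS X (q.length + 1) [] (r ++ List.replicate 6 .zero) S := by
      intro r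
      simp only [sem, nuS, Op.ap, pushO]
      funext j
      simp only [Function.update_apply, Stk.reg.injEq, reduceCtorEq, ↓reduceIte]
      split_ifs <;> simp_all [List.replicate_succ]
    simp only [St.view, e1, ← nuCode_eq]
    have hlen : (nuCode X q.length).length = 3 * q.length + 15 := by
      rw [nuCode_eq]; simp [padTake_length]; omega
    refine (hmv (by simp) d2 _ _ (by simp [nuS])).seq ?_
    rintro _ rfl
    refine (hmv (by simp) d2 _ _ (by simp [nuS, hlen])).mono le_rfl ?_
    rintro _ rfl
    refine ⟨d2, ?_, g1.trans h1, g2.trans h2, ?_⟩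
    · congr 1
      have hX3 := List.take_append_drop (q.length + 1) X
      have hp : pair φ (nu X) (.one :: q) = nuCode X q.length := rfl
      rw [hp]
      generalize nuCode X q.length = c
      have hX4 : S (.reg .X) = (X.take (q.length + 1)).map bt ++ (X.drop (q.length + 1)).map bt := by
        rw [← List.map_append, hX3, hX']
      clear * - hX4 hX2' hans htmp
      simp only [nuS]
      funext j
      simp only [Function.update_apply, Stk.reg.injEq, reduceCtorEq, ↓reduceIte]
      split_ifs <;> simp_all
    · rw [g3, h3]
      simp only [okSet, Set.mem_ofPred_eq, List.cons.injEq, true_and, forall_eq']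
      constructor
      · rintro ⟨⟨h, -⟩, h'⟩; exact ⟨h, h'⟩
      · rintro ⟨h, h'⟩; exact ⟨⟨h, by omega⟩, h'⟩

end Level

/-! ### Signed addition -/

/-- Carries from `-2` to `3`. -/
def carry (c : Fin 6) : ℤ := c - 2

/-- The number of a carry. -/
def ofCarry (z : ℤ) : Fin 6 := Fin.ofNat 6 (z + 2).toNat

theorem carry_ofCarry {z : ℤ} (h : -2 ≤ z) (h' : z ≤ 3) : carry (ofCarry z) = z := by
  obtain ⟨m, hm⟩ := Int.eq_ofNat_of_zero_le (show 0 ≤ z + 2 by omega)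
  have : m < 6 := by omega
  simp only [carry, ofCarry, hm, Int.toNat_natCast, Fin.ofNat, Nat.mod_eq_of_lt this]
  omega

theorem carry_bounds (c : Fin 6) : -2 ≤ carry c ∧ carry c ≤ 3 := by
  unfold carry
  have := c.2
  omega

/-- The next carry. -/
def nextCarry (c : Fin 6) (t : ℤ) : Fin 6 := ofCarry ((t + carry c) / 2)

/-- The digit of a sum. -/
def sumBit (c : Fin 6) (t : ℤ) : Bool := decide ((t + carry c) % 2 = 1)

theorem addBits_carry {c : Fin 6} {t : ℤ} (h : -2 ≤ t) (h' : t ≤ 3) (l : List ℤ) (acc : List Bool) :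
    addBits (carry c) (t :: l) acc = addBits (carry (nextCarry c t)) l (sumBit c t :: acc) := by
  have := carry_bounds c
  rw [addBits, nextCarry, carry_ofCarry (by omega) (by omega)]
  rfl

/-- The value of a cell as a binary digit. -/
def cellBit (g : Option Cell) : Bool := isOne (g.join.getD .zero)

theorem cellBit_bt (b : Bool) : cellBit (some (bt b)) = b := isOne_digit b

section Arg

variable {M : OracleMachine} {φ : Baire}

/-! ### Computing the argument of a level -/

/-- The difference of the digits on top of `w` and `tw`. -/
noncomputable def diffDigit {D : Type} (v : View D (Rg M.Work)) : ℤ :=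
  (cellBit (v.top (.reg .w))).toNat + -1 * (cellBit (v.top (.reg .tw))).toNat

/-- Subtract the digits on `tw` from the digits on `w`. -/
noncomputable def diffLoop (M : OracleMachine) : Prog (Dat M.State) (Rg M.Work) :=
  .loop (fun v => (v.top (.reg .w)).isSome) <| doOps
    (fun v => { v.d with lc := fun _ => nextCarry (v.d.lc false) (diffDigit v) })
    fun v => [(.reg .w, .drop), (.reg .tw, .drop), (.reg .w2, .put (v.top (.reg .w)).join),
      (.reg .X2, .put (v.top (.reg .tw)).join),
      (.reg .X, .put (bt (sumBit (v.d.lc false) (diffDigit v))))]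

/-- The stacks during the subtraction. -/
noncomputable def diffS {W : Type} (q : List (Bool × Bool)) (w2 X2 : List Cell) (acc : List Bool)
    (S : Stk (Rg W) → List Cell) : Stk (Rg W) → List Cell :=
  update (update (update (update (update S (.reg .w) (q.map fun p => bt p.1)) (.reg .tw)
    (q.map fun p => bt p.2)) (.reg .w2) w2) (.reg .X2) X2) (.reg .X) (acc.map bt)

theorem run_diffLoop (q : List (Bool × Bool)) (w2 X2 : List Cell) (acc : List Bool) (d : Dat M.State)
    (S : Stk (Rg M.Work) → List Cell) (x : Str) :
    Run φ (diffLoop M) ⟨d, diffS q w2 X2 acc S, x⟩ (2 * q.length + 1) fun σ => ∃ d',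
      σ = ⟨d', diffS [] ((q.map fun p => bt p.1).reverse ++ w2) ((q.map fun p => bt p.2).reverse ++ X2)
        (addBits (carry (d.lc false)) (q.map fun p => (p.1.toNat : ℤ) + -1 * p.2.toNat) acc) S, x⟩ := by
  induction q generalizing w2 X2 acc d with
  | nil => exact Run.loop_false (by simp [St.view, diffS]) ⟨d, rfl⟩
  | cons p q ih =>
    obtain ⟨b, b'⟩ := p
    refine (Run.loop_true (T := 1) (by simp [St.view, diffS]) (run_doOps rfl) ?_).weaken
      (T := 1 + (2 * q.length + 1) + 1) (by simp; omega)
    rintro _ rfl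
    have t1 : diffS ((b, b') :: q) w2 X2 acc S (.reg .w) = bt b :: q.map fun p => bt p.1 := by
      simp [diffS]
    have t2 : diffS ((b, b') :: q) w2 X2 acc S (.reg .tw) = bt b' :: q.map fun p => bt p.2 := by
      simp [diffS]
    simp only [St.view, diffDigit, sem, Op.ap, pushO, t1, t2, List.head?_cons, cellBit_bt, Option.join_some,
      ↓reduceIte, List.tail_cons, Bool.false_eq_true]
    refine Eq.subst (motive := fun S' => Run φ (diffLoop M) ⟨_, S', x⟩ _ _) ?_ ((ih (bt b :: w2)
      (bt b' :: X2) (sumBit (d.lc false) (b.toNat + -1 * b'.toNat) :: acc) _).mono le_rfl ?_)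
    · funext j
      simp only [diffS, Function.update_apply, Stk.reg.injEq, reduceCtorEq, ↓reduceIte]
      clear * -
      split_ifs <;> simp_all
    · rintro _ ⟨d', rfl⟩
      refine ⟨d', St.ext rfl ?_ rfl⟩
      simp only [List.map_cons, List.reverse_cons, List.append_assoc, List.singleton_append]
      rw [addBits_carry (by cases b <;> cases b' <;> simp) (by cases b <;> cases b' <;> simp)]

/-- Replace the digits on `X` by the digits of a number in the unit interval, after its first three
digits have been read. -/
noncomputable def clampLoop (M : OracleMachine) : Prog (Dat M.State) (Rg M.Work) :=
  .ite (fun v => decide (v.d.s1 = .zero ∧ v.d.s2 = .zero ∧ v.d.s3 = .zero)) skip <|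
    .seq (move (.reg .X) (.reg .X2)) <|
      .loop (fun v => (v.top (.reg .X2)).isSome) <| doOps (fun v => v.d) fun v =>
        [(.reg .X2, .drop), (.reg .X, .put (bt (!(isOne v.d.s1))))]

/-- Compute the digits of the argument of a level from the address on `w` and the shift on `tw`. -/
noncomputable def argProg (M : OracleMachine) : Prog (Dat M.State) (Rg M.Work) :=
  .seq (doOps (fun v => { v.d with lc := fun _ => ofCarry 0 }) fun _ => []) <|
  .seq (diffLoop M) <| .seq (move (.reg .w2) (.reg .w)) <| .seq (move (.reg .X2) (.reg .tw)) <|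
  .seq (doOps (fun v => { v.d with s1 := (v.top (.reg .X)).join.getD .zero })
    fun _ => [(.reg .X, .drop)]) <|
  .seq (doOps (fun v => { v.d with s2 := (v.top (.reg .X)).join.getD .zero })
    fun _ => [(.reg .X, .drop)]) <|
  .seq (doOps (fun v => { v.d with s3 := (v.top (.reg .X)).join.getD .zero })
    fun _ => [(.reg .X, .drop)]) (clampLoop M)

theorem run_clampLoop (D : List Bool) (d : Dat M.State) {S : Stk (Rg M.Work) → List Cell} (x : Str)
    (h1 : d.s1 = digit (D.getD 0 false)) (h2 : d.s2 = digit (D.getD 1 false))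
    (h3 : d.s3 = digit (D.getD 2 false)) (hX : S (.reg .X) = (D.drop 3).map bt)
    (hX2 : S (.reg .X2) = []) :
    Run φ (clampLoop M) ⟨d, S, x⟩ (4 * D.length + 3) fun σ =>
      σ = ⟨d, update S (.reg .X) ((clampBits D).map bt), x⟩ := by
  have hz : ∀ b, digit b = .zero ↔ b = false := by decide
  have hgen : ∀ l : List Bool, ∀ S : Stk (Rg M.Work) → List Cell, S (.reg .X2) = l.map bt →
      Run φ (.loop (fun v => (v.top (.reg .X2)).isSome) <| doOps (fun v => v.d) fun v =>
        [(.reg .X2, .drop), (.reg .X, .put (bt (!(isOne v.d.s1))))]) ⟨d, S, x⟩ (2 * l.length + 1)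
        fun σ => σ = ⟨d, update (update S (.reg .X) ((l.map fun _ => bt (!(D.headD false))).reverse ++
          S (.reg .X))) (.reg .X2) [], x⟩ := by
    intro l
    induction l with
    | nil =>
      intro S h
      refine Run.loop_false (by simp [St.view, h]) (St.ext rfl ?_ rfl)
      funext j
      simp only [Function.update_apply]
      split_ifs <;> simp_all
    | cons b l ih =>
      intro S h
      refine (Run.loop_true (T := 1) (by simp [St.view, h]) (run_doOps rfl) ?_).weaken
        (T := 1 + (2 * l.length + 1) + 1) (by simp; omega)
      rintro _ rfl
      simp only [St.view, sem, h, Op.ap, pushO, h1, isOne_digit]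
      refine (ih _ (by simp)).mono le_rfl ?_
      rintro _ rfl
      refine St.ext rfl ?_ rfl
      have : D.headD false = D.getD 0 false := by cases D <;> rfl
      rw [this]
      clear * -
      funext j
      simp only [Function.update_apply, Stk.reg.injEq, reduceCtorEq, ↓reduceIte]
      split_ifs <;> simp_all
  by_cases hD : D.take 3 = [false, false, false]
  · refine Run.ite_true ?_ ((run_doOps ?_).weaken (by omega))
    · have : ∀ i < 3, D.getD i false = false := by
        intro i hi
        have e : (D.take 3).getD i false = D.getD i false := by
          simp [List.getD_eq_getElem?_getD, List.getElem?_take, hi]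
        rw [← e, hD]
        interval_cases i <;> rfl
      simp only [St.view, h1, h2, h3, hz, this 0 (by omega), this 1 (by omega), this 2 (by omega)]
      rfl
    · refine St.ext rfl ?_ rfl
      simp [sem, St.view, clampBits, hD, ← hX]
  · rcases lt_or_ge D.length 3 with hl | hl
    · have hnil : D.drop 3 = [] := List.drop_eq_nil_of_le (by omega)
      have hc : clampBits D = [] := by rw [clampBits, if_neg hD, hnil]; rfl
      rw [hnil] at hX
      have e : S = update S (.reg .X) [] := by
        rw [List.map_nil] at hX; simp [← hX]
      rw [hc]
      refine Run.ite (fun _ => (run_doOps ?_).weaken (T' := 2) (by omega)) (fun _ => ?_) |>.weaken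
        (by omega)
      · refine St.ext rfl ?_ rfl
        simpa [sem, St.view] using e
      · refine Run.weaken (T := 1 + 1) ?_ le_rfl
        refine ((run_move (by simp) _ _ _).weaken (by simp [hX])).seq ?_
        rintro _ rfl
        refine (hgen [] _ (by simp [hX, hX2])).mono (by simp) ?_
        rintro _ rfl
        refine St.ext rfl ?_ rfl
        clear * - hX hX2
        funext j
        simp only [Function.update_apply, Stk.reg.injEq, reduceCtorEq, ↓reduceIte]
        split_ifs <;> simp_all
    · refine Run.ite_false ?_ ?_ |>.weaken (T := ((2 * D.length + 1) + (2 * D.length + 1)) + 1)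
        (by omega)
      · rcases D with _ | ⟨b0, _ | ⟨b1, _ | ⟨b2, D⟩⟩⟩
        · simp at hl
        · simp at hl
        · simp at hl
        · simp only [St.view, h1, h2, h3, hz, decide_eq_false_iff_not]
          rintro ⟨g1, g2, g3⟩
          apply hD
          simp at g1 g2 g3
          simp [g1, g2, g3]
      · refine ((run_move (by simp) _ _ _).weaken (by simp [hX])).seq ?_
        rintro _ rfl
        refine (hgen (D.drop 3).reverse _ (by simp [hX, hX2])).mono (by simp) ?_
        rintro _ rfl
        refine St.ext rfl ?_ rfl
        have hc : (clampBits D).map bt = (List.replicate (D.drop 3).length (bt (!(D.headD false)))) := by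
          rw [clampBits, if_neg hD, List.map_const', List.map_replicate]
        have hr : (((D.drop 3).reverse.map fun _ => bt (!(D.headD false))).reverse : List Cell) =
            (List.replicate (D.drop 3).length (bt (!(D.headD false)))) := by
          rw [List.map_const', List.reverse_replicate, List.length_reverse]
        rw [hc, hr]
        clear * - hX hX2
        funext j
        simp only [Function.update_apply, Stk.reg.injEq, reduceCtorEq, ↓reduceIte]
        split_ifs <;> simp_all

theorem run_argProg (c : Bool) (rw : List Bool) (d : Dat M.State) {S : Stk (Rg M.Work) → List Cell}
    (x : Str) (hw : S (.reg .w) = rw.map bt)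
    (htw : S (.reg .tw) = (pats c rw.length).reverse.map bt) (hw2 : S (.reg .w2) = [])
    (hX : S (.reg .X) = []) (hX2 : S (.reg .X2) = []) :
    Run φ (argProg M) ⟨d, S, x⟩ (10 * rw.length + 10) fun σ => ∃ d',
      σ = ⟨d', update S (.reg .X) ((argBits c rw).map bt), x⟩ := by
  set q := rw.zip (pats c rw.length).reverse with hq
  have hql : q.length = rw.length := by simp [hq, pats_length]
  have q1 : (q.map fun p => bt p.1) = rw.map bt := by
    have : (q.map Prod.fst) = rw := List.map_fst_zip (by simp [pats_length])
    conv_rhs => rw [← this, List.map_map]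
    rfl
  have q2 : (q.map fun p => bt p.2) = (pats c rw.length).reverse.map bt := by
    have : (q.map Prod.snd) = (pats c rw.length).reverse := List.map_snd_zip (by simp [pats_length])
    conv_rhs => rw [← this, List.map_map]
    rfl
  refine Run.weaken (T := 1 + ((2 * rw.length + 1) + ((2 * rw.length + 1) + ((2 * rw.length + 1) +
    (1 + (1 + (1 + (4 * rw.length + 3)))))))) ?_ (by omega)
  refine (run_doOps rfl).seq ?_
  rintro _ rfl
  have e0 : S = diffS q [] [] [] S := by
    clear * - hw htw hw2 hX hX2 q1 q2
    simp only [diffS, q1, q2]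
    funext j
    simp only [Function.update_apply, Stk.reg.injEq, reduceCtorEq, ↓reduceIte]
    split_ifs <;> simp_all
  simp only [St.view, sem]
  refine Eq.subst (motive := fun S' => Run φ _ ⟨_, S', x⟩ _ _) e0.symm ?_
  refine ((run_diffLoop q [] [] [] _ S x).weaken (by rw [hql])).seq ?_
  rintro _ ⟨d1, rfl⟩
  have hD : addBits (carry (ofCarry 0)) (q.map fun p => (p.1.toNat : ℤ) + -1 * p.2.toNat) [] =
      diffBits c rw := by
    rw [carry_ofCarry (by omega) (by omega)]; rfl
  rw [hD]
  have hDl := diffBits_length c rw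
  rw [argBits]
  set D := diffBits c rw
  clear_value D
  clear e0
  refine ((run_move (by simp) _ _ _).weaken (by simp [diffS, hql])).seq ?_
  rintro _ rfl
  refine (Run.mono (T' := 2 * rw.length + 1) (Q' := fun σ => σ = ⟨d1, update S (.reg .X) (D.map bt), x⟩)
    (run_move (by simp) _ _ _) (by simp [diffS, hql]) ?_).seq ?_
  · rintro _ rfl
    refine St.ext rfl ?_ rfl
    clear * - hw htw hw2 hX hX2 q1 q2
    simp only [diffS, q1, q2]
    funext j
    simp only [Function.update_apply, Stk.reg.injEq, reduceCtorEq, ↓reduceIte]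
    split_ifs <;> simp_all
  rintro _ rfl
  refine (run_doOps rfl).seq ?_
  rintro _ rfl
  refine (run_doOps rfl).seq ?_
  rintro _ rfl
  refine (run_doOps rfl).seq ?_
  rintro _ rfl
  refine (run_clampLoop D _ x ?_ ?_ ?_ ?_ ?_).mono (by rw [hDl]) ?_
  iterate 4
    clear * -
    rcases D with _ | ⟨_, _ | ⟨_, _ | ⟨_, D⟩⟩⟩ <;> simp [St.view, sem, Op.ap, pushO, bt] <;> rfl
  · simp [St.view, sem, hX2]
  rintro _ rfl
  refine ⟨_, St.ext rfl ?_ rfl⟩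
  simp [St.view, sem]

end Arg

section Level

variable {M : OracleMachine} {φ : Baire}

/-! ### Levels and chains as programs -/

/-- Write the code of the number that is in unary on `cnt`. -/
noncomputable def natProg (M : OracleMachine) : Prog (Dat M.State) (Rg M.Work) :=
  .seq (doOps (fun v => v.d) fun _ => [(.reg .tmp, ⟨false, some (some .zero), some (some .one), none⟩)]) <|
  .seq (.loop (fun v => (v.top (.reg .cnt)).isSome) (doOps (fun v => v.d)
    fun _ => [(.reg .cnt, .drop), (.reg .cd, .put none), (.reg .tmp, .put (some .zero))]))
    (move (.reg .cd) (.reg .cnt))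

theorem run_natProg {n : ℕ} (d : Dat M.State) {S : Stk (Rg M.Work) → List Cell} (x : Str)
    (ht : S (.reg .tmp) = []) (hcd : S (.reg .cd) = [])
    (hcnt : S (.reg .cnt) = List.replicate n none) :
    Run φ (natProg M) ⟨d, S, x⟩ (4 * n + 3)
      fun σ => σ = ⟨d, update S (.reg .tmp) ((natCode n).map some).reverse, x⟩ := by
  refine Run.weaken (T := 1 + ((n * (1 + 1) + 1) + (2 * n + 1))) ?_ (by omega)
  refine (run_doOps rfl).seq ?_
  rintro _ rfl
  refine (Run.loop (n := n) (I := fun i σ => σ = ⟨d, update (update (update S (.reg .tmp)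
    (List.replicate i (some .zero) ++ [some .one, some .zero])) (.reg .cnt)
    (List.replicate (n - i) none)) (.reg .cd) (List.replicate i none), x⟩) ?_ ?_ ?_).seq ?_
  · rintro i hi _ rfl
    obtain ⟨m, hm⟩ : ∃ m, n - i = m + 1 := ⟨n - i - 1, by omega⟩
    have hm' : n - (i + 1) = m := by omega
    refine ⟨by simp [St.view, hm, List.replicate_succ], run_doOps (St.ext rfl ?_ rfl)⟩
    simp only [St.view, sem, Op.ap, pushO, hm, hm']
    funext j
    clear * -
    simp only [Function.update_apply, Stk.reg.injEq, reduceCtorEq, ↓reduceIte]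
    split_ifs <;> simp_all [List.replicate_succ]
  · rintro _ rfl
    simp [St.view]
  · refine St.ext rfl ?_ rfl
    simp only [St.view, sem, Op.ap, pushO]
    funext j
    simp only [Function.update_apply, Stk.reg.injEq, reduceCtorEq, ↓reduceIte]
    split_ifs <;> simp_all
  rintro _ rfl
  refine (run_move (by simp) _ _ _).mono (by simp) ?_
  rintro _ rfl
  refine St.ext rfl ?_ rfl
  funext j
  clear * - ht hcd hcnt
  simp only [Function.update_apply, Stk.reg.injEq, reduceCtorEq, ↓reduceIte, natCode]
  split_ifs <;> simp_all

/-- One level of the chain of class `c`: run the machine on the name of `0.X`, and use the result if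
no query was too long. -/
noncomputable def levelProg (M : OracleMachine) (c : Bool) : Prog (Dat M.State) (Rg M.Work) :=
  .seq (argProg M) <| .seq (natProg M) <|
  .seq (doOps (fun v => { v.d with bad := false }) fun _ => []) <| .seq (sim M (levelOracle M)) <|
  .seq (.ite (fun v => v.d.bad) (empty .ans) (.seq (updateRec M c)
    (doOps (fun v => v.d) fun _ => [(.reg .cnt, .put none)]))) (empty (.reg .X))

/-- A bound for the time of a level. -/
def levelTime (B L n : ℕ) : ℕ := (n + 1) * (32 * n + 82) + 8 * n + 30 * L + 12 * B + 200

variable {f : C(unitInterval, ℝ)} {B : ℕ} {T N Q : ℕ → ℕ} {K : List Bool → ℕ → ID} {c : Bool}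

theorem run_levelProg (h : Levels f B (levCode M φ T) (levGood M φ T) K N Q)
    (hM : ∀ X a, M.HaltedBy (pair φ (nu X)) a (T a.length)) (hT : Monotone T) {b : Bool}
    {rw : List Bool} {L : ℕ} (hL : rw.length < L) (d : Dat M.State)
    {S : Stk (Rg M.Work) → List Cell} (x : Str) (hS : ∀ k, Scratch k → S k = [])
    (hq : S .qry = []) (hAn : S (.reg .An) = []) (hw : S (.reg .w) = (b :: rw).map bt)
    (htw : S (.reg .tw) = (pats c (b :: rw).length).reverse.map bt) (hw2 : S (.reg .w2) = [])
    (hX : S (.reg .X) = []) (hX2 : S (.reg .X2) = [])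
    (hA : S (.reg (.A c)) = (chain (levCode M φ T) (levGood M φ T) c rw).1.1.map some)
    (hZ : S (.reg (.Z c)) = List.replicate (chain (levCode M φ T) (levGood M φ T) c rw).1.2 none)
    (hcnt : S (.reg .cnt) = List.replicate (chain (levCode M φ T) (levGood M φ T) c rw).2 none) :
    Run φ (levelProg M c) ⟨d, S, x⟩ (levelTime B L (T (L + 2))) fun σ => ∃ d', σ = ⟨d', update
      (update (update S (.reg (.A c))
        ((chain (levCode M φ T) (levGood M φ T) c (b :: rw)).1.1.map some)) (.reg (.Z c))
        (List.replicate (chain (levCode M φ T) (levGood M φ T) c (b :: rw)).1.2 none)) (.reg .cnt)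
        (List.replicate (chain (levCode M φ T) (levGood M φ T) c (b :: rw)).2 none), x⟩ := by
  have hle := h.chain_le (c := c) rw
  have hch := chain.eq_2 (levCode M φ T) (levGood M φ T) c b rw
  generalize chain (levCode M φ T) (levGood M φ T) c (b :: rw) = r' at *
  generalize chain (levCode M φ T) (levGood M φ T) c rw = r at *
  obtain ⟨r, m⟩ := r
  dsimp only at *
  set X := argBits c (b :: rw) with hXdef
  have hg1 : levGood M φ T X m → r' = (stepRec (levCode M φ T X m) r, m + 1) := fun hg => by
    rw [hch, if_pos hg]
  have hg2 : ¬ levGood M φ T X m → r' = (r, m) := fun hg => by rw [hch, if_neg hg]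
  clear hch
  have hlen : (natCode m).length = m + 2 := by simp [natCode]
  have hn : T (m + 2) ≤ T (L + 2) := hT (by omega)
  have hmul : (T (m + 2) + 1) * (20 * T (m + 2) + (12 * T (m + 2) + 60) + 22) ≤
      (T (L + 2) + 1) * (32 * T (L + 2) + 82) := Nat.mul_le_mul (by omega) (by omega)
  refine Run.weaken (T := (10 * (b :: rw).length + 10) + ((4 * m + 3) + (1 + (((T (m + 2) + 1) *
    (20 * T (m + 2) + (12 * T (m + 2) + 60) + 22) + 2 * (natCode m).length + 8 * T (m + 2) + 10) +
    (((12 * (B + r.2) + 80) + 1 + 1) + 1))))) ?_ ?_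
  swap
  · rw [levelTime, hlen]
    simp only [List.length_cons]
    omega
  refine (run_argProg c (b :: rw) d x hw htw hw2 hX hX2).seq ?_
  rintro _ ⟨d1, rfl⟩
  rw [← hXdef]
  refine (run_natProg (n := m) d1 x (by simp [hS (.reg .tmp) trivial])
    (by simp [hS (.reg .cd) trivial]) (by simpa using hcnt)).seq ?_
  rintro _ rfl
  refine (run_doOps rfl).seq ?_
  rintro _ rfl
  have hhalt := hM X (natCode m)
  rw [hlen] at hhalt
  refine (run_sim (a := natCode m) (handles_levelOracle (X := X) (by simp [sem, hq])
    (by simp [sem]) (by simp [sem, hX2]) _ x) hhalt ?_ (by simp [sem])).seq ?_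
  · intro k hk hk'
    have hk2 : k ≠ .reg .X := by rintro rfl; exact hk
    simp [sem, hk', hk2, hS k hk]
  rintro _ ⟨d2, rfl, hbad⟩
  have hbad : d2.bad = false ↔ levGood M φ T X m := by
    rw [hbad]; simp [St.view, levGood]
  rw [show (((M.conf (pair φ (nu X)) (natCode m) (T (m + 2))).tape .output).content) =
    levCode M φ T X m from rfl]
  simp only [St.view, sem]
  refine Run.seq (Q := fun σ => ∃ d', σ = ⟨d', update (update (update (update S (.reg .X) (X.map bt))
      (.reg (.A c)) (r'.1.1.map some)) (.reg (.Z c)) (List.replicate r'.1.2 none)) (.reg .cnt)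
        (List.replicate r'.2 none), x⟩) ?_ ?_
  · have htmp := hS (.reg .tmp) trivial
    have hans := hS .ans trivial
    by_cases hg : levGood M φ T X m
    · refine Run.ite_false (by simpa [St.view] using hbad.2 hg) ?_
      obtain ⟨y, hy⟩ := h.mem X m
      refine Run.weaken (T := (12 * (B + r.2) + 80) + 1) ?_ (by omega)
      refine (run_updateRec (c := c) (r := r) (h.isCode X m) (B := B) ?_ d2 x ?_ ?_ ?_ ?_
        ?_).seq ?_
      · intro L hL hr
        rw [hL] at hy
        exact abs_mid_lt hy (h.abs_le y) hr
      · simp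
      · simp [hAn]
      · simp [hS (.reg .cd) trivial]
      · simp [hA]
      · simp [hZ]
      rintro _ ⟨d3, rfl⟩
      refine run_doOps ⟨d3, St.ext rfl ?_ rfl⟩
      simp only [hg1 hg, St.view, sem, Op.ap, pushO]
      clear * - htmp hans hcnt
      funext j
      simp only [Function.update_apply, Stk.reg.injEq, reduceCtorEq, ↓reduceIte]
      split_ifs <;> simp_all [List.replicate_succ]
    · have hb : d2.bad = true := by
        cases e : d2.bad with
        | true => rfl
        | false => exact absurd (hbad.1 e) hg
      refine Run.ite_true (by simpa [St.view] using hb) ((run_empty _ _ _ _).mono (by omega) ?_)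
      rintro _ rfl
      refine ⟨d2, St.ext rfl ?_ rfl⟩
      simp only [hg2 hg]
      clear * - htmp hans hcnt hA hZ
      funext j
      simp only [Function.update_apply, Stk.reg.injEq, reduceCtorEq, ↓reduceIte]
      split_ifs <;> simp_all
  rintro _ ⟨d3, rfl⟩
  refine (run_empty _ _ _ _).mono le_rfl ?_
  rintro _ rfl
  refine ⟨d3, St.ext rfl ?_ rfl⟩
  clear * - hX
  funext j
  simp only [Function.update_apply, Stk.reg.injEq, reduceCtorEq, ↓reduceIte]
  split_ifs <;> simp_all

/-- The levels of class `c` along the common digits of `lo c` and `hi c`. -/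
noncomputable def chainLoop (M : OracleMachine) (c : Bool) : Prog (Dat M.State) (Rg M.Work) :=
  .loop (fun v => (v.top (.reg (.lo c))).isSome &&
      decide (v.top (.reg (.hi c)) = v.top (.reg (.lo c))))
    (.seq (doOps (fun v => v.d) fun v => [(.reg (.lo c), .drop), (.reg (.hi c), .drop),
        (.reg (.tb c), .drop), (.reg .w, .put (v.top (.reg (.lo c))).join),
        (.reg .tw, .put (v.top (.reg (.tb c))).join)]) (levelProg M c))

/-- The levels of class `c`, with the stacks emptied in the end. -/
noncomputable def chainProg (M : OracleMachine) (c : Bool) : Prog (Dat M.State) (Rg M.Work) :=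
  .seq (chainLoop M c) (.clear fun k => decide (k = .reg .w ∨ k = .reg .tw ∨ k = .reg .cnt ∨
    k = .reg (.lo c) ∨ k = .reg (.hi c) ∨ k = .reg (.tb c)))

/-- The stacks between two levels. -/
noncomputable def chainS {W : Type} (c : Bool) (n : ℕ) (lo hi rw : List Bool)
    (r : (Str × ℕ) × ℕ) (S : Stk (Rg W) → List Cell) : Stk (Rg W) → List Cell :=
  update (update (update (update (update (update (update (update S (.reg (.lo c)) (lo.map bt))
    (.reg (.hi c)) (hi.map bt)) (.reg (.tb c)) (((pats c n).drop rw.length).map bt))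
    (.reg .w) (rw.map bt)) (.reg .tw) ((pats c rw.length).reverse.map bt))
    (.reg (.A c)) (r.1.1.map some)) (.reg (.Z c)) (List.replicate r.1.2 none)) (.reg .cnt)
    (List.replicate r.2 none)

theorem run_chainLoop (h : Levels f B (levCode M φ T) (levGood M φ T) K N Q)
    (hM : ∀ X a, M.HaltedBy (pair φ (nu X)) a (T a.length)) (hT : Monotone T) {n L : ℕ}
    {lo' hi' rw : List Bool} (hn : n ≤ L) (d : Dat M.State) {S : Stk (Rg M.Work) → List Cell}
    (x : Str) (hrw : rw.length + lo'.length = n) (hS : ∀ k, Scratch k → S k = [])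
    (hq : S .qry = []) (hAn : S (.reg .An) = []) (hw2 : S (.reg .w2) = [])
    (hX : S (.reg .X) = []) (hX2 : S (.reg .X2) = []) :
    Run φ (chainLoop M c) ⟨d, chainS c n lo' hi' rw
      (chain (levCode M φ T) (levGood M φ T) c rw) S, x⟩
      (lo'.length * (levelTime B L (T (L + 2)) + 2) + 1) fun σ => ∃ d' lo'' hi'', σ = ⟨d',
        chainS c n lo'' hi'' ((cpre lo' hi').reverse ++ rw) (chain (levCode M φ T) (levGood M φ T) c
          ((cpre lo' hi').reverse ++ rw)) S, x⟩ := by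
  set C := chain (levCode M φ T) (levGood M φ T) c with hC
  set TL := levelTime B L (T (L + 2)) with hTL
  induction lo' generalizing hi' rw d with
  | nil =>
    exact (Run.loop_false (by simp [St.view, chainS]) ⟨d, [], hi', rfl⟩).weaken (by simp)
  | cons a lo' ih =>
    rcases hi' with _ | ⟨b, hi'⟩
    · exact (Run.loop_false (by simp [St.view, chainS]) ⟨d, a :: lo', [], rfl⟩).weaken (by omega)
    by_cases hab : a = b
    swap
    · refine (Run.loop_false ?_ ⟨d, a :: lo', b :: hi', by rw [cpre, if_neg hab]; rfl⟩).weaken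
        (by omega)
      have : ∀ a b, bt b = bt a ↔ b = a := by decide
      simp [St.view, chainS, this, Ne.symm hab]
    subst hab
    rw [cpre, if_pos rfl, List.reverse_cons, List.append_assoc, List.singleton_append]
    simp only [List.length_cons] at hrw
    have hdrop : (pats c n).drop rw.length = pat c rw.length ::
        (pats c n).drop (rw.length + 1) := by
      rw [List.drop_eq_getElem_cons (by rw [pats_length]; omega)]
      simp [pats]
    refine (Run.loop_true (T := 1 + TL) (by simp [St.view, chainS]) (Q := fun σ => ∃ d', σ =
      ⟨d', chainS c n lo' hi' (a :: rw) (C (a :: rw)) S, x⟩) ?_ ?_).weaken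
      (T := (1 + TL) + (lo'.length * (TL + 2) + 1) + 1) ?_
    · refine (run_doOps rfl).seq ?_
      rintro _ rfl
      have e : sem [(.reg (.lo c), .drop), (.reg (.hi c), .drop), (.reg (.tb c), .drop),
          (.reg .w, .put (bt a)), (.reg .tw, .put (bt (pat c rw.length)))]
          (chainS c n (a :: lo') (a :: hi') rw (C rw) S) =
          (chainS c n lo' hi' (a :: rw) (C rw) S : Stk (Rg M.Work) → List Cell) := by
        simp only [sem, chainS, hdrop, Op.ap, pushO, List.length_cons, pats_succ]
        generalize C rw = r
        clear * -
        funext j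
        simp only [Function.update_apply, Stk.reg.injEq, reduceCtorEq, ↓reduceIte]
        split_ifs <;> simp_all
      have e1 : (chainS c n (a :: lo') (a :: hi') rw (C rw) S (.reg (.lo c))).head?.join =
          bt a := by simp [chainS]
      have e2 : (chainS c n (a :: lo') (a :: hi') rw (C rw) S (.reg (.tb c))).head?.join =
          bt (pat c rw.length) := by simp [chainS, hdrop]
      simp only [St.view, e1, e2, e]
      refine (run_levelProg h hM hT (L := L) (c := c) (b := a) (rw := rw) (by omega) d x ?_
        ?_ ?_ ?_ ?_ ?_ ?_ ?_ ?_ ?_ ?_).mono le_rfl ?_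
      · intro k hk
        have hk' : ∀ k', ¬ Scratch k' → k ≠ k' := by rintro _ h rfl; exact h hk
        rw [chainS]
        iterate 8 rw [Function.update_of_ne (hk' _ id)]
        exact hS k hk
      · simp [chainS, hq]
      · simp [chainS, hAn]
      · simp [chainS]
      · simp [chainS]
      · simp [chainS, hw2]
      · simp [chainS, hX]
      · simp [chainS, hX2]
      · simp [chainS, hC]
      · simp [chainS, hC]
      · simp [chainS, hC]
      rintro _ ⟨d', rfl⟩
      refine ⟨d', St.ext rfl ?_ rfl⟩
      rw [← hC]
      generalize C rw = r
      generalize C (a :: rw) = r'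
      simp only [chainS]
      clear * -
      funext j
      simp only [Function.update_apply, Stk.reg.injEq, reduceCtorEq, ↓reduceIte]
      split_ifs <;> simp_all
    · rintro _ ⟨d', rfl⟩
      exact ih (hi' := hi') (rw := a :: rw) d' (by simp only [List.length_cons]; omega)
    · rw [List.length_cons, Nat.add_mul, one_mul]; omega
theorem chainS_init {n : ℕ} {lo hi : List Bool} {S : Stk (Rg M.Work) → List Cell}
    (hw : S (.reg .w) = []) (htw : S (.reg .tw) = []) (hA : S (.reg (.A c)) = [])
    (hZ : S (.reg (.Z c)) = []) (hcnt : S (.reg .cnt) = []) (hlo : S (.reg (.lo c)) = lo.map bt)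
    (hhi : S (.reg (.hi c)) = hi.map bt) (htb : S (.reg (.tb c)) = (pats c n).map bt) :
    chainS c n lo hi [] (([], 0), 0) S = S := by
  simp only [chainS, List.length_nil, List.drop_zero]
  rw [← hlo, ← hhi, ← htb]
  funext j
  simp only [Function.update_apply]
  split_ifs with h1 h2 h3 h4 h5 h6 h7 h8 <;> first | rfl | (subst_vars; simp_all [pats])

theorem chainS_clear {n : ℕ} {lo hi rw : List Bool} {r : (Str × ℕ) × ℕ}
    {S : Stk (Rg M.Work) → List Cell} (hw : S (.reg .w) = []) (htw : S (.reg .tw) = [])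
    (hcnt : S (.reg .cnt) = []) :
    (fun k => if decide (k = .reg .w ∨ k = .reg .tw ∨ k = .reg .cnt ∨ k = .reg (.lo c) ∨
      k = .reg (.hi c) ∨ k = .reg (.tb c)) then [] else chainS c n lo hi rw r S k) =
      update (update (update (update (update S (.reg (.lo c)) []) (.reg (.hi c)) [])
        (.reg (.tb c)) []) (.reg (.A c)) (r.1.1.map some)) (.reg (.Z c))
        (List.replicate r.1.2 none) := by
  funext j
  by_cases hj : j = .reg .w ∨ j = .reg .tw ∨ j = .reg .cnt ∨ j = .reg (.lo c) ∨
      j = .reg (.hi c) ∨ j = .reg (.tb c)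
  · rw [if_pos (by simpa using hj)]
    rcases hj with rfl | rfl | rfl | rfl | rfl | rfl <;> simp [*]
  · rw [if_neg (by simpa using hj)]
    simp only [not_or] at hj
    obtain ⟨h1, h2, h3, h4, h5, h6⟩ := hj
    simp only [chainS, Function.update_apply, if_neg h1, if_neg h2, if_neg h3, if_neg h4, if_neg h5,
      if_neg h6]

theorem run_chainProg (h : Levels f B (levCode M φ T) (levGood M φ T) K N Q)
    (hM : ∀ X a, M.HaltedBy (pair φ (nu X)) a (T a.length)) (hT : Monotone T) {lo hi : List Bool}
    {L : ℕ} (hlo : lo.length ≤ L) (d : Dat M.State) {S : Stk (Rg M.Work) → List Cell} (x : Str)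
    (hS : ∀ k, Scratch k → S k = []) (hq : S .qry = []) (hAn : S (.reg .An) = [])
    (hw : S (.reg .w) = []) (htw : S (.reg .tw) = []) (hw2 : S (.reg .w2) = [])
    (hX : S (.reg .X) = []) (hX2 : S (.reg .X2) = []) (hA : S (.reg (.A c)) = [])
    (hZ : S (.reg (.Z c)) = []) (hcnt : S (.reg .cnt) = []) (hlo : S (.reg (.lo c)) = lo.map bt)
    (hhi : S (.reg (.hi c)) = hi.map bt) (htb : S (.reg (.tb c)) = (pats c lo.length).map bt) :
    Run φ (chainProg M c) ⟨d, S, x⟩ (L * (levelTime B L (T (L + 2)) + 2) + 2) fun σ => ∃ d',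
      σ = ⟨d', update (update (update (update (update S (.reg (.lo c)) []) (.reg (.hi c)) [])
        (.reg (.tb c)) []) (.reg (.A c)) ((chain (levCode M φ T) (levGood M φ T) c
          (cpre lo hi).reverse).1.1.map some)) (.reg (.Z c)) (List.replicate
        (chain (levCode M φ T) (levGood M φ T) c (cpre lo hi).reverse).1.2 none), x⟩ := by
  refine Run.weaken (T := (lo.length * (levelTime B L (T (L + 2)) + 2) + 1) + 1) ?_
    (by have := Nat.mul_le_mul_right (levelTime B L (T (L + 2)) + 2) ‹lo.length ≤ L›; omega)
  rw [← chainS_init hw htw hA hZ hcnt hlo hhi htb]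
  refine (run_chainLoop (rw := []) h hM hT ‹lo.length ≤ L› d x (by simp) hS hq hAn hw2 hX hX2).seq ?_
  rintro _ ⟨d', lo'', hi'', rfl⟩
  refine Run.clear ⟨d', St.ext rfl ?_ rfl⟩
  rw [chainS_init hw htw hA hZ hcnt hlo hhi htb, List.append_nil]
  exact chainS_clear hw htw hcnt

end Level

/-! ### Parsing the argument -/

theorem colList_getD (s : Str) (i : ℕ) : (colList s).getD i (.zero, .zero) =
    (s.getD (3 * i + 1) .zero, s.getD (3 * i + 2) .zero) := by
  match s, i with
  | _ :: _ :: _ :: s, i + 1 =>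
    exact colList_getD s i
  | _ :: _ :: _ :: s, 0 => rfl
  | [_, _], 0 => rfl
  | [_], 0 => rfl
  | [_, _], i + 1 => simp [colList]
  | [_], i + 1 => simp [colList]
  | [], i => simp [colList]

theorem colList_drop (s : Str) (i : ℕ) : colList (s.drop (3 * i)) = (colList s).drop i := by
  match s, i with
  | _ :: _ :: _ :: s, i + 1 =>
    have := colList_drop s i
    simpa [colList, Nat.mul_add] using this
  | s, 0 => simp
  | [_, _], i + 1 => simp [colList, Nat.mul_add]
  | [_], i + 1 => simp [colList, Nat.mul_add]
  | [], i + 1 => simp [colList]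

theorem colList_cons {s : Str} (h : s ≠ []) :
    colList s = (s.getD 1 .zero, s.getD 2 .zero) :: colList (s.drop 3) := by
  match s with
  | _ :: _ :: _ :: s => rfl
  | [_, _] => rfl
  | [_] => rfl
  | [] => exact absurd rfl h

section Parse

variable {M : OracleMachine} {φ : Baire}

theorem run_col_of_ans {s : Str} (d : Dat M.State) {S : Stk (Rg M.Work) → List Cell} (x : Str)
    (h : S .ans = s.map some) : Run φ col ⟨d, S, x⟩ 3 fun σ => σ = ⟨{ d with
        s1 := s.getD 0 .zero
        s2 := s.getD 1 .zero
        s3 := s.getD 2 .zero }, update S .ans ((s.drop 3).map some), x⟩ := by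
  refine (run_doOps rfl).seq (T' := 1 + 1) ?_
  rintro _ rfl
  refine (run_doOps rfl).seq ?_
  rintro _ rfl
  refine (run_doOps rfl).mono le_rfl ?_
  rintro _ rfl
  simp only [sem, St.view, h, Op.ap, pushO, Function.update_self, Function.update_idem]
  rcases s with _ | ⟨s0, _ | ⟨s1, _ | ⟨s2, s⟩⟩⟩ <;> simp

/-- Read all remaining columns. The flag `bad` holds the next digit of the second shift. -/
noncomputable def digitLoop (M : OracleMachine) : Prog (Dat M.State) (Rg M.Work) :=
  .loop (fun v => (v.top .ans).isSome) <| .seq col <|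
    doOps (fun v => { v.d with bad := !v.d.bad }) fun v =>
      [(.reg .ma, .put (bt (isOne v.d.s2))), (.reg .rb, .put (bt (isOne v.d.s3))),
        (.reg (.th false), .put (bt false)), (.reg (.th true), .put (bt v.d.bad))]

/-- The stacks during parsing: the rest of the input, and the digits that have been read. -/
def parseS {W : Type} (s : Str) (ma rb : List Bool) : Stk (Rg W) → List Cell
  | .ans => s.map some
  | .reg .ma => (ma.map bt).reverse
  | .reg .rb => (rb.map bt).reverse
  | .reg (.th c) => ((pats c rb.length).map bt).reverse
  | _ => []

theorem run_digitLoop (s : Str) (ma rb : List Bool) (d : Dat M.State) (x : Str)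
    (hd : d.bad = decide (rb.length % 2 = 0)) (hrb : 3 ≤ rb.length) :
    Run φ (digitLoop M) ⟨d, parseS s ma rb, x⟩ (5 * s.length + 1) fun σ => ∃ d' : Dat M.State,
      σ = ⟨d', parseS [] (ma ++ (colList s).map fun q => isOne q.1)
        (rb ++ (colList s).map fun q => isOne q.2), x⟩ ∧ d'.sgn = d.sgn := by
  induction hn : s.length using Nat.strong_induction_on generalizing s ma rb d with
  | _ n ih =>
    subst hn
    by_cases hs : s = []
    · subst hs
      exact Run.loop_false (by simp [St.view, parseS]) ⟨d, by simp [colList], rfl⟩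
    · have hpos := List.length_pos_iff.2 hs
      have hlen : (s.drop 3).length < s.length := by rw [List.length_drop]; omega
      refine (Run.loop_true (T := 3 + 1) (by simp [St.view, parseS, hs]) (Q := fun σ =>
        ∃ d' : Dat M.State, σ = ⟨d', parseS (s.drop 3) (ma ++ [isOne (s.getD 1 .zero)])
          (rb ++ [isOne (s.getD 2 .zero)]), x⟩ ∧ d'.sgn = d.sgn ∧ d'.bad = !d.bad) ?_ ?_).weaken
        (T := 3 + 1 + (5 * (s.drop 3).length + 1) + 1) (by omega)
      · refine (run_col_of_ans (s := s) d x rfl).seq ?_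
        rintro _ rfl
        refine run_doOps ⟨_, St.ext rfl ?_ rfl, rfl, rfl⟩
        have hne : rb ≠ [] := by rintro rfl; simp at hrb
        have h1 : pat true rb.length = d.bad := by
          rw [hd]
          by_cases h : rb.length % 2 = 0
          · have : 4 ≤ rb.length := by omega
            simp [pat, h, this]
          · simp [pat, h, hne]
        have h0 : pat false rb.length = false := by simp [pat, hne]
        funext j
        cases j with
        | reg j =>
          cases j with
          | th c => cases c <;> simp [sem, St.view, parseS, Op.ap, pushO, pats_succ, h0, h1]
          | _ => simp [sem, St.view, parseS, Op.ap, pushO]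
        | _ => simp [sem, St.view, parseS, Op.ap, pushO]
      · rintro _ ⟨d', rfl, h1, h2⟩
        refine (ih _ hlen (s.drop 3) _ _ d' ?_ (by simp; omega) rfl).mono le_rfl ?_
        · rw [h2, hd, List.length_append, List.length_singleton]
          rcases Nat.mod_two_eq_zero_or_one rb.length with h | h <;> simp [h, Nat.add_mod]
        · rintro _ ⟨d'', rfl, h3⟩
          refine ⟨d'', ?_, h3.trans h1⟩
          rw [colList_cons hs]
          simp

/-- Push the three leading digits of the midpoint, of the radius and of the shifts, where `b` is the
digit of the integer part of the midpoint. -/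
noncomputable def parseInit (M : OracleMachine) (b : Dat M.State → Bool) :
    Prog (Dat M.State) (Rg M.Work) :=
  doOps (fun v => { v.d with bad := false }) fun v =>
    [(.reg .ma, .put3 (bt false) (bt false) (bt (b v.d))),
      (.reg .rb, .put3 (bt false) (bt false) (bt false)),
      (.reg (.th false), .put3 (bt true) (bt false) (bt false)),
      (.reg (.th true), .put3 (bt true) (bt false) (bt false))]

/-- Parse the input, and continue with `K` if it can be parsed. -/
noncomputable def parseProg (M : OracleMachine) (K : Prog (Dat M.State) (Rg M.Work)) :
    Prog (Dat M.State) (Rg M.Work) :=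
  .seq (readIn (.reg .tmp)) <| .seq (move (.reg .tmp) .ans) <| .seq col <|
  .seq (doOps (fun v => { v.d with sgn := isOne v.d.s2 }) fun _ => []) <| .seq col <|
  .ite (fun v => decide (v.d.s3 = .sep))
    (.ite (fun v => decide (v.d.s2 = .sep))
      (.seq (parseInit M fun _ => false) <| .seq (digitLoop M) K)
      (.seq (parseInit M fun d => isOne d.s2) <| .seq col <|
        .ite (fun v => decide (v.d.s2 = .sep))
          (.seq (doOps (fun v => { v.d with bad := true }) fun v => [(.reg .rb, .put (bt (isOne v.d.s3))),
            (.reg (.th false), .put (bt false)), (.reg (.th true), .put (bt false))]) <|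
          .seq (digitLoop M) <| .seq (doOps (fun v => v.d) fun _ => [(.reg .ma, .put (bt false))]) K)
          skip))
    skip

theorem run_parseInit (b : Dat M.State → Bool) (s : Str) (d : Dat M.State) (x : Str) :
    Run φ (parseInit M b) ⟨d, parseS s [] [], x⟩ 1 fun σ => σ = ⟨{ d with bad := false },
      parseS s [false, false, b d] [false, false, false], x⟩ := by
  refine run_doOps (St.ext rfl ?_ rfl)
  have h3 : ∀ c, pats c 3 = [true, false, false] := by decide
  have h0 : ∀ c, pats c 0 = [] := fun _ => rfl
  funext j
  cases j with
  | reg j =>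
    cases j with
    | th c => cases c <;> simp [sem, St.view, parseS, Op.ap, pushO, h3, h0]
    | _ => simp [sem, St.view, parseS, Op.ap, pushO]
  | _ => simp [sem, St.view, parseS, Op.ap, pushO]

theorem run_parseProg {K : Prog (Dat M.State) (Rg M.Work)} {T : ℕ}
    {Q : St (Dat M.State) (Rg M.Work) → Prop} (a : Str) (d : Dat M.State)
    (hK : ∀ p, parse (colList a) = some p → ∀ d : Dat M.State, d.sgn = p.1 →
      Run φ K ⟨d, parseS [] (false :: false :: p.2.1 :: p.2.2.1)
        (false :: false :: false :: p.2.2.2), []⟩ T Q)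
    (hnone : parse (colList a) = none → ∀ σ, σ.stk .out = [] → Q σ) :
    Run φ (parseProg M K) ⟨d, fun _ => [], a⟩ (9 * a.length + 30 + T) Q := by
  have hcol : ∀ (s : Str) ma rb (d : Dat M.State), Run φ col ⟨d, parseS s ma rb, []⟩ 3 fun σ =>
      σ = ⟨{ d with s1 := s.getD 0 .zero, s2 := s.getD 1 .zero, s3 := s.getD 2 .zero },
        parseS (s.drop 3) ma rb, []⟩ := by
    intro s ma rb d
    refine (run_col_of_ans (s := s) d [] rfl).mono le_rfl ?_
    rintro _ rfl
    refine St.ext rfl ?_ rfl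
    funext j
    cases j with
    | reg j => cases j <;> simp [parseS]
    | _ => simp [parseS]
  have c1 := colList_getD a 0
  have c2 := colList_getD a 1
  have c3 := colList_getD a 2
  have d2 := colList_drop a 2
  have d3 := colList_drop a 3
  have l2 : (a.drop (3 * 2)).length ≤ a.length := by simp
  have l3 : (a.drop (3 * 3)).length ≤ a.length := by simp
  simp only [Nat.reduceMul, Nat.reduceAdd] at c1 c2 c3 d2 d3 l2 l3
  refine Run.weaken (T := (2 * a.length + 1) + ((2 * a.length + 1) + (3 + (1 + (3 +
    ((1 + (3 + ((1 + ((5 * a.length + 1) + (1 + T))) + 1))) + 1 + 1)))))) ?_ (by omega)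
  refine (run_readIn _ _ _ _).seq ?_
  rintro _ rfl
  refine (Run.mono (T' := 2 * a.length + 1) (Q' := fun σ => σ = ⟨d, parseS a [] [], []⟩)
    (run_move (by simp) _ _ _) (by simp) ?_).seq ?_
  · rintro _ rfl
    refine St.ext rfl ?_ rfl
    funext j
    cases j with
    | reg j => cases j <;> simp [parseS, Function.update_apply, pats]
    | _ => simp [parseS, Function.update_apply]
  rintro _ rfl
  refine (hcol a [] [] d).seq ?_
  rintro _ rfl
  refine (run_doOps (Q := fun σ => σ = ⟨_, parseS (a.drop 3) [] [], []⟩) rfl).seq ?_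
  rintro _ rfl
  refine (hcol (a.drop 3) [] [] _).seq ?_
  rintro _ rfl
  simp only [List.drop_drop, Nat.reduceAdd]
  have e4 : ∀ i, (a.drop 3).getD i .zero = a.getD (3 + i) .zero := by
    intro i; simp [List.getD_eq_getElem?_getD]
  have e6 : ∀ i, (a.drop 6).getD i .zero = a.getD (6 + i) .zero := by
    intro i; simp [List.getD_eq_getElem?_getD]
  have hskip : ∀ d s ma rb, parse (colList a) = none →
      Run φ skip ⟨d, parseS s ma rb, []⟩ 1 Q := fun d s ma rb hn => run_doOps (hnone hn _ rfl)
  refine Run.ite (fun h => ?_) fun h => ?_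
  swap
  · refine (hskip _ _ _ _ ?_).weaken (by omega)
    simp only [St.view, e4, decide_eq_false_iff_not] at h
    rw [parse, c2, if_neg h]
  simp only [St.view, e4, decide_eq_true_eq, Nat.reduceAdd] at h
  refine Run.ite (fun h' => ?_) fun h' => ?_
  · refine Run.weaken (T := 1 + ((5 * a.length + 1) + T)) ?_ (by omega)
    simp only [St.view, e4, decide_eq_true_eq, Nat.reduceAdd] at h'
    refine (run_parseInit _ _ _ _).seq ?_
    rintro _ rfl
    refine ((run_digitLoop _ _ _ _ _ rfl (by simp)).weaken (by omega)).seq ?_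
    rintro _ ⟨d1, rfl, hs⟩
    rw [d2]
    refine hK (isOne (a.getD 1 .zero), false, ((colList a).drop 2).map fun q => isOne q.1,
      ((colList a).drop 2).map fun q => isOne q.2) ?_ d1 hs
    rw [parse, c2, if_pos h, if_pos h', c1]
  · simp only [St.view, e4, decide_eq_false_iff_not, Nat.reduceAdd] at h'
    refine (run_parseInit _ _ _ _).seq ?_
    rintro _ rfl
    refine (hcol (a.drop 6) _ _ _).seq ?_
    rintro _ rfl
    simp only [List.drop_drop, Nat.reduceAdd]
    refine Run.ite (fun h2 => ?_) fun h2 => ?_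
    swap
    · refine (hskip _ _ _ _ ?_).weaken (by omega)
      simp only [St.view, e6, decide_eq_false_iff_not, Nat.reduceAdd] at h2
      rw [parse, c2, if_pos h, if_neg h', c3, if_neg h2]
    simp only [St.view, e6, decide_eq_true_eq, Nat.reduceAdd] at h2
    refine (run_doOps (Q := fun σ => ∃ d' : Dat M.State, σ = ⟨d', parseS (a.drop 9) [false, false,
      isOne (a.getD 4 .zero)] [false, false, false, isOne (a.getD 8 .zero)], []⟩ ∧ d'.bad = true ∧
        d'.sgn = isOne (a.getD 1 .zero)) ⟨_, St.ext rfl ?_ rfl, rfl, rfl⟩).seq ?_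
    · have : ∀ c, pats c 4 = pats c 3 ++ [false] := by decide
      funext j
      cases j with
      | reg j =>
        cases j with
        | th c => cases c <;> simp [sem, St.view, parseS, Op.ap, pushO, this]
        | _ => simp [sem, St.view, parseS, Op.ap, pushO]
      | _ => simp [sem, St.view, parseS, Op.ap, pushO]
    rintro _ ⟨d1, rfl, hb, hs⟩
    refine ((run_digitLoop _ _ _ _ _ (by rw [hb]; simp) (by simp)).weaken (by omega)).seq ?_
    rintro _ ⟨d4, rfl, hs'⟩
    rw [d3]
    have hdrop : (colList a).drop 2 = (a.getD 7 .zero, a.getD 8 .zero) :: (colList a).drop 3 := by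
      rw [← d2, colList_cons, e6, e6, List.drop_drop, d3]
      intro h0
      have := e6 1
      rw [h0, h2] at this
      simp at this
    refine (run_doOps rfl).seq ?_
    rintro _ rfl
    have e : (sem [(.reg .ma, .put (bt false))] (parseS [] ([false, false, isOne (a.getD 4 .zero)] ++
        ((colList a).drop 3).map fun q => isOne q.1) ([false, false, false, isOne (a.getD 8 .zero)] ++
        ((colList a).drop 3).map fun q => isOne q.2)) : Stk (Rg M.Work) → List Cell) = parseS []
        (false :: false :: isOne (a.getD 4 .zero) :: (((colList a).drop 3).map (fun q => isOne q.1) ++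
          [false])) (false :: false :: false :: ((colList a).drop 2).map fun q => isOne q.2) := by
      rw [hdrop]
      funext j
      cases j with
      | reg j => cases j <;> simp [sem, parseS, Op.ap, pushO]
      | _ => simp [sem, parseS, Op.ap, pushO]
    simp only [St.view, e]
    refine hK (isOne (a.getD 1 .zero), isOne (a.getD 4 .zero), ((colList a).drop 3).map
      (fun q => isOne q.1) ++ [false], ((colList a).drop 2).map fun q => isOne q.2) ?_ d4
      (hs'.trans hs)
    rw [parse, c2, if_pos h, if_neg h', c3, if_pos h2, c1]

end Parse

section Main

variable {M : OracleMachine} {φ : Baire}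

/-! ### The endpoints of the argument -/

/-- The signed sum of the digits on top of the stacks, for the left or right endpoint. -/
noncomputable def endDigit (v : View (Dat M.State) (Rg M.Work)) (c right : Bool) : ℤ :=
  (cellBit (v.top (.reg (.th c)))).toNat + (sg v.d.sgn * (cellBit (v.top (.reg .ma))).toNat +
    sg (!right) * (cellBit (v.top (.reg .rb))).toNat)

/-- Compute the digits of both endpoints after both shifts. -/
noncomputable def endLoop (M : OracleMachine) : Prog (Dat M.State) (Rg M.Work) :=
  .loop (fun v => (v.top (.reg .rb)).isSome) <| doOps
    (fun v => { v.d with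
      lc := fun c => nextCarry (v.d.lc c) (endDigit v c false)
      hc := fun c => nextCarry (v.d.hc c) (endDigit v c true) })
    fun v => [(.reg .ma, .drop), (.reg .rb, .drop), (.reg (.th false), .drop),
      (.reg (.th true), .drop),
      (.reg (.lo false), .put (bt (sumBit (v.d.lc false) (endDigit v false false)))),
      (.reg (.lo true), .put (bt (sumBit (v.d.lc true) (endDigit v true false)))),
      (.reg (.hi false), .put (bt (sumBit (v.d.hc false) (endDigit v false true)))),
      (.reg (.hi true), .put (bt (sumBit (v.d.hc true) (endDigit v true true)))),
      (.reg (.tb false), .put (v.top (.reg (.th false))).join),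
      (.reg (.tb true), .put (v.top (.reg (.th true))).join)]

/-- The stacks during the computation of the endpoints. -/
def endS {W : Type} (q : List (Bool × Bool × (Bool → Bool))) (lo hi tb : Bool → List Bool) :
    Stk (Rg W) → List Cell
  | .reg .ma => q.map fun t => bt t.1
  | .reg .rb => q.map fun t => bt t.2.1
  | .reg (.th c) => q.map fun t => bt (t.2.2 c)
  | .reg (.lo c) => (lo c).map bt
  | .reg (.hi c) => (hi c).map bt
  | .reg (.tb c) => (tb c).map bt
  | _ => []

theorem run_endLoop (q : List (Bool × Bool × (Bool → Bool))) (lo hi tb : Bool → List Bool)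
    (d : Dat M.State) (x : Str) :
    Run φ (endLoop M) ⟨d, endS q lo hi tb, x⟩ (2 * q.length + 1) fun σ => ∃ d', σ = ⟨d', endS []
      (fun c => addBits (carry (d.lc c)) (q.map fun t => ((t.2.2 c).toNat : ℤ) +
        (sg d.sgn * t.1.toNat + sg (!false) * t.2.1.toNat)) (lo c))
      (fun c => addBits (carry (d.hc c)) (q.map fun t => ((t.2.2 c).toNat : ℤ) +
        (sg d.sgn * t.1.toNat + sg (!true) * t.2.1.toNat)) (hi c))
      (fun c => (q.map fun t => t.2.2 c).reverse ++ tb c), x⟩ := by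
  induction q generalizing lo hi tb d with
  | nil => exact Run.loop_false (by simp [St.view, endS]) ⟨d, rfl⟩
  | cons t q ih =>
    obtain ⟨m, r, h⟩ := t
    refine (Run.loop_true (T := 1) (by simp [St.view, endS]) (run_doOps rfl) ?_).weaken
      (T := 1 + (2 * q.length + 1) + 1) (by simp; omega)
    rintro _ rfl
    set t : Bool → Bool → ℤ := fun c right => ((h c).toNat : ℤ) + (sg d.sgn * m.toNat +
      sg (!right) * r.toNat) with ht
    have hb : ∀ c right, -2 ≤ t c right ∧ t c right ≤ 3 := by
      intro c right
      simp only [ht, sg]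
      cases h c <;> cases d.sgn <;> cases m <;> cases right <;> cases r <;> decide
    have e : ∀ c right, endDigit (St.view ⟨d, endS ((m, r, h) :: q) lo hi tb, x⟩) c right =
        t c right := by
      intro c right
      simp only [endDigit, St.view, endS, List.map_cons, List.head?_cons, cellBit_bt, ht]
    simp only [e]
    refine Eq.subst (motive := fun S' => Run φ (endLoop M) ⟨_, S', x⟩ _ _) ?_ ((ih
      (fun c => sumBit (d.lc c) (t c false) :: lo c) (fun c => sumBit (d.hc c) (t c true) :: hi c)
      (fun c => h c :: tb c) { d with
        lc := fun c => nextCarry (d.lc c) (t c false)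
        hc := fun c => nextCarry (d.hc c) (t c true) }).mono le_rfl ?_)
    · clear * -
      funext j
      cases j with
      | reg j =>
        cases j with
        | th c => cases c <;> simp [sem, St.view, endS, Op.ap, pushO]
        | lo c => cases c <;> simp [sem, St.view, endS, Op.ap, pushO]
        | hi c => cases c <;> simp [sem, St.view, endS, Op.ap, pushO]
        | tb c => cases c <;> simp [sem, St.view, endS, Op.ap, pushO]
        | _ => simp [sem, St.view, endS, Op.ap, pushO]
      | _ => simp [sem, St.view, endS, Op.ap, pushO]
    · rintro _ ⟨d', rfl⟩
      refine ⟨d', St.ext rfl ?_ rfl⟩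
      dsimp only
      congr 1
      · funext c
        rw [List.map_cons, addBits_carry (hb c false).1 (hb c false).2]
      · funext c
        rw [List.map_cons, addBits_carry (hb c true).1 (hb c true).2]
      · funext c
        simp

/-- The endpoints of the interval that has been parsed. -/
theorem run_endLoop_parse {ma rb : List Bool} (hl : ma.length = rb.length) (d : Dat M.State)
    (x : Str) : Run φ (.seq (doOps (fun v => { v.d with
        lc := fun _ => ofCarry 0
        hc := fun _ => ofCarry 0 }) fun _ => []) (endLoop M)) ⟨d, parseS [] ma rb, x⟩
      (2 * rb.length + 2) fun σ => ∃ d', σ = ⟨d', endS [] (fun c => endBits c false d.sgn ma rb)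
        (fun c => endBits c true d.sgn ma rb) (fun c => pats c rb.length), x⟩ := by
  set p : List (Bool → Bool) := (List.range rb.length).map fun i c => pat c i with hp
  have hpl : p.length = rb.length := by simp [hp]
  set q := (ma.zip (rb.zip p)).reverse with hq
  have hql : q.length = rb.length := by simp [hq, hl, hpl]
  have hpc : ∀ c, p.map (fun g => g c) = pats c rb.length := fun c => by
    simp [hp, pats, Function.comp_def]
  have q1 : ((ma.zip (rb.zip p)).map Prod.fst) = ma := List.map_fst_zip (by simp [hl, hpl])
  have q2' : ((ma.zip (rb.zip p)).map Prod.snd) = rb.zip p := List.map_snd_zip (by simp [hl, hpl])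
  have q2 : ((ma.zip (rb.zip p)).map fun t => t.2.1) = rb := by
    have : ((rb.zip p).map Prod.fst) = rb := List.map_fst_zip (by simp [hpl])
    rw [← q2', List.map_map] at this
    exact this
  have q3 : ∀ c, ((ma.zip (rb.zip p)).map fun t => t.2.2 c) = pats c rb.length := fun c => by
    have : ((rb.zip p).map Prod.snd) = p := List.map_snd_zip (by simp [hpl])
    have h1 := congrArg (List.map fun g => g c) this
    have h2 := congrArg (List.map fun t : Bool × (Bool → Bool) => t.2 c) q2'
    rw [List.map_map] at h1 h2
    exact h2.trans (h1.trans (hpc c))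
  have h0 : (parseS [] ma rb : Stk (Rg M.Work) → List Cell) =
      endS q (fun _ => []) (fun _ => []) fun _ => [] := by
    have e : ∀ g : Bool × Bool × (Bool → Bool) → Bool, q.map (fun t => bt (g t)) =
        (((ma.zip (rb.zip p)).map g).map bt).reverse := fun g => by
      rw [hq, List.map_reverse, List.map_map]; rfl
    funext j
    cases j with
    | reg j => cases j <;> simp only [parseS, endS, e, q1, q2, q3, List.map_nil]
    | _ => rfl
  have hend : ∀ c right, (q.map fun t => ((t.2.2 c).toNat : ℤ) + (sg d.sgn * t.1.toNat +
      sg (!right) * t.2.1.toNat)) = (ma.zip (rb.zip (pats c rb.length))).reverse.map fun q =>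
        (q.2.2.toNat : ℤ) + (sg d.sgn * q.1.toNat + sg (!right) * q.2.1.toNat) := by
    intro c right
    rw [← hpc, List.zip_map_right, List.zip_map_right, ← List.map_reverse, List.map_map]
    rfl
  refine Run.weaken (T := 1 + (2 * rb.length + 1)) ?_ (by omega)
  refine (run_doOps rfl).seq ?_
  rintro _ rfl
  simp only [St.view, sem, h0]
  refine (run_endLoop q _ _ _ _ x).mono (by rw [hql]) ?_
  rintro _ ⟨d', rfl⟩
  refine ⟨d', St.ext rfl ?_ rfl⟩
  dsimp only
  congr 1
  · funext c
    rw [hend, carry_ofCarry (by omega) (by omega)]; rfl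
  · funext c
    rw [hend, carry_ofCarry (by omega) (by omega)]; rfl
  · funext c
    rw [List.append_nil, hq, List.map_reverse, List.reverse_reverse, q3]

/-! ### The translating program -/

/-- Emit the record of larger grade. -/
noncomputable def selProg (M : OracleMachine) : Prog (Dat M.State) (Rg M.Work) :=
  .seq (.loop (fun v => (v.top (.reg (.Z false))).isSome && (v.top (.reg (.Z true))).isSome)
    (doOps (fun v => v.d) fun _ =>
      [(.reg (.Z false), .drop), (.reg (.Z true), .drop), (.reg .w2, .put none)])) <|
  .seq (doOps (fun v => { v.d with ok := !(v.top (.reg (.Z false))).isSome }) fun _ => []) <|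
  .seq (move2 (.reg .w2) (.reg (.Z false)) (.reg (.Z true)))
    (.ite (fun v => v.d.ok) (emit M true) (emit M false))

theorem run_selProg {r₀ r₁ : Str × ℕ} {v₀ v₁ : ℝ} {B L : ℕ} (h0 : RecOk v₀ B r₀)
    (h1 : RecOk v₁ B r₁) (hL0 : r₀.2 ≤ L) (hL1 : r₁.2 ≤ L) (d : Dat M.State) (x : Str) :
    Run φ (selProg M) ⟨d, evalS [] 0 r₀ r₁, x⟩ (16 * L + 12 * B + 120) fun σ => ∃ d', σ = ⟨d',
      update (evalS [] 0 r₀ r₁) (.reg .tmp)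
        ((recCode (sel r₀ r₁).1 (sel r₀ r₁).2).map some).reverse, x⟩ := by
  set m := min r₀.2 r₁.2 with hm
  refine Run.weaken (T := (m * (1 + 1) + 1) + (1 + ((2 * m + 1) + ((12 * (B + L + 7) + 31) + 1)))) ?_
    (by omega)
  refine (Run.loop (n := m) (I := fun i σ => σ = ⟨d, update (update (update (evalS [] 0 r₀ r₁)
    (.reg (.Z false)) (List.replicate (r₀.2 - i) none)) (.reg (.Z true))
    (List.replicate (r₁.2 - i) none)) (.reg .w2) (List.replicate i none), x⟩) ?_ ?_ ?_).seq ?_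
  · rintro i hi _ rfl
    obtain ⟨k, hk⟩ : ∃ k, r₀.2 - i = k + 1 := ⟨r₀.2 - i - 1, by omega⟩
    obtain ⟨l, hl⟩ : ∃ l, r₁.2 - i = l + 1 := ⟨r₁.2 - i - 1, by omega⟩
    have hk' : r₀.2 - (i + 1) = k := by omega
    have hl' : r₁.2 - (i + 1) = l := by omega
    refine ⟨by simp [St.view, hk, hl, List.replicate_succ], run_doOps (St.ext rfl ?_ rfl)⟩
    simp only [St.view, sem, Op.ap, pushO, hk, hk', hl, hl']
    clear * -
    funext j
    simp only [Function.update_apply, Stk.reg.injEq, reduceCtorEq, ↓reduceIte]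
    split_ifs <;> simp_all [List.replicate_succ]
  · rintro _ rfl
    rcases le_total r₀.2 r₁.2 with h | h <;> simp [St.view, hm, h]
  · refine St.ext rfl ?_ rfl
    funext j
    cases j with
    | reg j =>
      cases j with
      | Z c => cases c <;> simp [Function.update_apply, evalS]
      | _ => simp [Function.update_apply, evalS]
    | _ => simp [Function.update_apply, evalS]
  rintro _ rfl
  refine (run_doOps rfl).seq ?_
  rintro _ rfl
  refine (Run.mono (T' := 2 * m + 1) (Q' := fun σ => σ = ⟨{ d with ok := decide (r₀.2 ≤ r₁.2) },
    evalS [] 0 r₀ r₁, x⟩) (run_move2 (by simp) (by simp) (by simp) _ _ _) (by simp [sem]) ?_).seq ?_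
  · rintro _ rfl
    refine St.ext ?_ ?_ rfl
    · have : ∀ n, (!(List.replicate n (none : Cell)).head?.isSome) = decide (n = 0) := by
        intro n; cases n <;> simp [List.replicate_succ]
      simp [St.view, this, hm, Nat.sub_eq_zero_iff_le]
    · have e0 : List.replicate m (none : Cell) ++ List.replicate (r₀.2 - m) none =
          List.replicate r₀.2 none := by rw [List.replicate_append_replicate]; congr 1; omega
      have e1 : List.replicate m (none : Cell) ++ List.replicate (r₁.2 - m) none =
          List.replicate r₁.2 none := by rw [List.replicate_append_replicate]; congr 1; omega
      clear_value m
      funext j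
      cases j with
      | reg j =>
        cases j with
        | Z c => cases c <;> simp [Function.update_apply, evalS, sem, St.view, e0, e1]
        | _ => simp [Function.update_apply, evalS, sem, St.view]
      | _ => simp [Function.update_apply, evalS, sem, St.view]
  rintro _ rfl
  refine Run.ite (fun h => ?_) fun h => ?_
  · have h : r₀.2 ≤ r₁.2 := by simpa [St.view] using h
    refine (run_emit (c := true) h1 _ x rfl rfl rfl rfl).mono (by omega) ?_
    rintro _ rfl
    refine ⟨_, St.ext rfl ?_ rfl⟩
    simp [sel, h, evalS]
  · have h : ¬ r₀.2 ≤ r₁.2 := by simpa [St.view] using h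
    refine (run_emit (c := false) h0 _ x rfl rfl rfl rfl).mono (by omega) ?_
    rintro _ rfl
    refine ⟨_, St.ext rfl ?_ rfl⟩
    simp only [sel, if_neg h]
    simp [evalS]

theorem endS_scratch {W : Type} (lo hi tb : Bool → List Bool) {k : Stk (Rg W)} (hk : Scratch k) :
    endS [] lo hi tb k = [] := by
  rcases k with _ | _ | _ | k
  · rfl
  · rfl
  · rfl
  · cases k <;> first | rfl | exact absurd hk id

theorem endS_update (lo hi tb : Bool → List Bool) (r₀ r₁ : Str × ℕ) :
    update (update (update (update (update (update (update (update (update (update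
      (endS [] lo hi tb) (.reg (.lo false)) []) (.reg (.hi false)) [])
      (.reg (.tb false)) []) (.reg (.A false)) (r₀.1.map some)) (.reg (.Z false))
      (List.replicate r₀.2 none)) (.reg (.lo true)) []) (.reg (.hi true)) [])
      (.reg (.tb true)) []) (.reg (.A true)) (r₁.1.map some)) (.reg (.Z true))
      (List.replicate r₁.2 none) = (evalS [] 0 r₀ r₁ : Stk (Rg M.Work) → List Cell) := by
  funext j
  cases j with
  | reg j =>
    cases j with
    | A c => cases c <;> simp [endS, evalS]
    | Z c => cases c <;> simp [endS, evalS]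
    | lo c => cases c <;> simp [endS, evalS]
    | hi c => cases c <;> simp [endS, evalS]
    | tb c => cases c <;> simp [endS, evalS]
    | _ => simp [endS, evalS]
  | _ => simp [endS, evalS]

/-- Compute the value of the interval function after its argument has been parsed. -/
noncomputable def valueProg (M : OracleMachine) : Prog (Dat M.State) (Rg M.Work) :=
  .seq (.seq (doOps (fun v => { v.d with
      lc := fun _ => ofCarry 0
      hc := fun _ => ofCarry 0 }) fun _ => []) (endLoop M)) <|
    .seq (chainProg M false) <| .seq (chainProg M true) <| .seq (selProg M) <|
    .seq (move (.reg .tmp) (.reg .harg)) (move (.reg .harg) .out)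

/-- The program that computes a name of a function as an interval function. -/
noncomputable def transProg (M : OracleMachine) : Prog (Dat M.State) (Rg M.Work) :=
  parseProg M (valueProg M)

/-- A bound for the time of the program. -/
def transTime (B L n : ℕ) : ℕ := 2 * (L * (levelTime B L n + 2)) + 100 * L + 100 * B + 1000

variable {f : C(unitInterval, ℝ)} {B : ℕ} {T N Q : ℕ → ℕ} {K : List Bool → ℕ → ID}

theorem run_valueProg (h : Levels f B (levCode M φ T) (levGood M φ T) K N Q)
    (hM : ∀ X a, M.HaltedBy (pair φ (nu X)) a (T a.length)) (hT : Monotone T) {s i : Bool}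
    {ma rb : List Bool} {L : ℕ} (hl : ma.length = rb.length) (hL : rb.length + 3 ≤ L)
    (d1 : Dat M.State) (hs : d1.sgn = s) :
    Run φ (valueProg M) ⟨d1, parseS [] (false :: false :: i :: ma) (false :: false :: false :: rb), []⟩
      (2 * (L * (levelTime B L (T (L + 2)) + 2)) + 40 * L + 30 * B + 300) fun σ =>
        σ.stk .out = ((recCode (selRec (levCode M φ T) (levGood M φ T) (s, i, ma, rb)).1
          (selRec (levCode M φ T) (levGood M φ T) (s, i, ma, rb)).2).map some).reverse := by
  set TL := levelTime B L (T (L + 2))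
  refine Run.weaken (T := (2 * L + 2) + ((L * (TL + 2) + 2) + ((L * (TL + 2) + 2) +
    ((16 * L + 12 * B + 120) + ((2 * (3 * (B + L + 9)) + 1) + (2 * (3 * (B + L + 9)) + 1)))))) ?_
    (by omega)
  set MA := false :: false :: i :: ma with hMA
  set RB := false :: false :: false :: rb with hRB
  have hlen : MA.length = RB.length := by simp [hMA, hRB, hl]
  have hRL : RB.length ≤ L := by simp [hRB]; omega
  have hcell : ∀ c, cellOf c (s, i, ma, rb) = cpre (endBits c false s MA RB)
    (endBits c true s MA RB) := fun c => rfl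
  have hcl : ∀ c, (cellOf c (s, i, ma, rb)).reverse.length ≤ L := fun c => by
    rw [List.length_reverse, hcell]
    exact (cpre_prefix _ _).1.length_le.trans (by rw [endBits_length hlen]; exact hRL)
  refine ((run_endLoop_parse hlen d1 []).weaken (by omega)).seq ?_
  rintro _ ⟨d2, rfl⟩
  rw [hs]
  have hel : ∀ c right, (endBits c right s MA RB).length = RB.length :=
    fun c right => endBits_length hlen
  refine (run_chainProg (c := false) h hM hT (lo := endBits false false s MA RB)
    (hi := endBits false true s MA RB) (by rw [hel]; exact hRL) d2 [] (fun _ => endS_scratch _ _ _) rfl rfl rfl rfl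
    rfl rfl rfl rfl rfl rfl rfl rfl (by rw [hel]; rfl)).seq ?_
  rintro _ ⟨d3, rfl⟩
  rw [← hcell]
  refine (run_chainProg (c := true) h hM hT (lo := endBits true false s MA RB)
    (hi := endBits true true s MA RB) (by rw [hel]; exact hRL) d3 [] ?_ ?_ ?_ ?_ ?_ ?_ ?_ ?_ ?_
    ?_ ?_ ?_ ?_ ?_).seq ?_
  · intro k hk
    have hk' : ∀ k', ¬ Scratch k' → k ≠ k' := by rintro _ h rfl; exact h hk
    iterate 5 rw [Function.update_of_ne (hk' _ id)]
    exact endS_scratch _ _ _ hk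
  iterate 13 simp [endS, hel]
  rintro _ ⟨d4, rfl⟩
  rw [← hcell]
  obtain ⟨v0, ok0⟩ := h.recOk false (cellOf false (s, i, ma, rb)).reverse
  obtain ⟨v1, ok1⟩ := h.recOk true (cellOf true (s, i, ma, rb)).reverse
  have b0 := h.chain_le (c := false) (cellOf false (s, i, ma, rb)).reverse
  have b1 := h.chain_le (c := true) (cellOf true (s, i, ma, rb)).reverse
  have g0 := hcl false
  have g1 := hcl true
  rw [selRec]
  clear hcell hcl
  generalize (chain (levCode M φ T) (levGood M φ T) false
    (cellOf false (s, i, ma, rb)).reverse) = r₀ at *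
  generalize (chain (levCode M φ T) (levGood M φ T) true
    (cellOf true (s, i, ma, rb)).reverse) = r₁ at *
  rw [endS_update]
  refine (run_selProg (L := L) ok0 ok1 (by omega) (by omega) d4 []).seq ?_
  rintro _ ⟨d5, rfl⟩
  have hlen' : (recCode (sel r₀.1 r₁.1).1 (sel r₀.1 r₁.1).2).length ≤ 3 * (B + L + 9) := by
    rw [sel]
    split_ifs
    · exact (ok1.length_le true).trans (by omega)
    · exact (ok0.length_le false).trans (by omega)
  generalize recCode (sel r₀.1 r₁.1).1 (sel r₀.1 r₁.1).2 = out at *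
  refine ((run_move (by simp) _ _ _).weaken (by simpa using hlen')).seq ?_
  rintro _ rfl
  refine (run_move (by simp) _ _ _).mono (by simpa [evalS] using hlen') ?_
  rintro _ rfl
  simp [evalS]

theorem run_transProg (h : Levels f B (levCode M φ T) (levGood M φ T) K N Q)
    (hM : ∀ X a, M.HaltedBy (pair φ (nu X)) a (T a.length)) (hT : Monotone T) (d : Dat M.State)
    (a : Str) : Run φ (transProg M) ⟨d, fun _ => [], a⟩
      (transTime B (a.length + 3) (T (a.length + 3 + 2))) fun σ =>
        σ.stk .out = ((funCode (levCode M φ T) (levGood M φ T) a).map some).reverse := by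
  refine (run_parseProg (T := 2 * ((a.length + 3) * (levelTime B (a.length + 3)
    (T (a.length + 3 + 2)) + 2)) + 40 * (a.length + 3) + 30 * B + 300) a d ?_ ?_).weaken
    (by rw [transTime]; omega)
  · rintro ⟨s, i, ma, rb⟩ hp d1 hs
    obtain ⟨hl, hle⟩ := parse_length hp
    have hle' := hle.trans (colList_length a)
    have hfun : funCode (levCode M φ T) (levGood M φ T) a = recCode
        (selRec (levCode M φ T) (levGood M φ T) (s, i, ma, rb)).1
        (selRec (levCode M φ T) (levGood M φ T) (s, i, ma, rb)).2 := by simp only [funCode, hp, Option.elim_some]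
    rw [hfun]
    exact run_valueProg h hM hT hl (by omega) d1 hs
  · intro hp σ hσ
    simp only [hσ, funCode, hp, Option.elim_none, List.map_nil, List.reverse_nil]

end Main

/-! ### From evaluation to interval functions -/

/-- The program for the translation runs the machine for evaluation on names of binary fractions. -/
theorem translatable_of_evalPolytime {R : ParamRep C(unitInterval, ℝ)} (h : EvalPolytime R) :
    R.TranslatableTo intervalFunctions := by
  classical
  obtain ⟨M, P, Q, hreal, hP, hQ, htime, hblow⟩ := h
  have hw : Witness R M P Q := ⟨hreal, hP, hQ, htime, hblow⟩
  let C := 3 * Nat.card (Stk (Rg M.Work)) + 8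
  let P' : (ℕ → ℕ) → ℕ → ℕ := fun l n => transTime (Q (levParam l) 0) (n + 3)
    (P (levParam l) (n + 3 + 2)) * C + 1
  let Q' : (ℕ → ℕ) → ℕ → ℕ := fun l n => funMod (Q (levParam l) 0) (P (levParam l))
    (Q (levParam l)) n + Q (levParam l) 0
  have c := IsSOP.const
  have i := IsSOP.id'
  have hl : IsSOP levParam := (i.app.sum i).sum (c 3)
  have hPl : IsSOP fun l n => P (levParam l) n := hP.subst hl
  have hQl : IsSOP fun l n => Q (levParam l) n := hQ.subst hl
  have hB : IsSOP fun l _ => Q (levParam l) 0 := hQl.comp (c 0)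
  have hP' : IsSOP P' := by
    have hn : IsSOP fun l n => P (levParam l) (n + 3 + 2) := hPl.comp ((i.sum (c 3)).sum (c 2))
    have hL : IsSOP fun _ n => n + 3 := i.sum (c 3)
    have ht : IsSOP fun l n => levelTime (Q (levParam l) 0) (n + 3) (P (levParam l) (n + 3 + 2)) :=
      (((((hn.sum (c 1)).prod (((c 32).prod hn).sum (c 82))).sum ((c 8).prod hn)).sum
        ((c 30).prod hL)).sum ((c 12).prod hB)).sum (c 200)
    exact ((((((c 2).prod (hL.prod (ht.sum (c 2)))).sum ((c 100).prod hL)).sum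
      ((c 100).prod hB)).sum (c 1000)).prod (c C)).sum (c 1)
  have hQ' : IsSOP Q' := by
    have hq : IsSOP fun l n => Q (levParam l) (Q (levParam l) 0 + (n + 1) + 6) :=
      hQl.comp ((hB.sum (i.sum (c 1))).sum (c 6))
    have hp := hPl.comp ((hq.sum (i.sum (c 1))).sum (c 2))
    exact ((hp.sum (c 2)).sum (hq.sum (i.sum (c 1)))).sum hB
  have key : ∀ (φ : R.rep.Dom) f, f ∈ R.rep φ →
      (∀ a, ((transProg M).mach (Dat.init M)).HaltedBy φ a (P' (R.param φ) a.length)) ∧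
      ∃ χ ∈ ((transProg M).mach (Dat.init M)).operator φ, ∃ ψ, EncodesFun χ ψ ∧ IsFunName ψ f ∧
        ∀ n, modulus ψ n + ⌈Real.logb 2 (‖f‖ + 1)⌉₊ ≤ Q' (R.param φ) n := by
    intro φ f hf
    obtain ⟨K, hL⟩ := hw.levels φ hf
    have hrun : ∀ a, ((transProg M).mach (Dat.init M)).HaltedBy φ a (P' (R.param φ) a.length) ∧
        ∀ h : ∃ t, ((transProg M).mach (Dat.init M)).HaltedBy φ a t,
          ((((transProg M).mach (Dat.init M)).conf φ a (Nat.find h)).tape .output).content =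
            funCode (levCode M φ (P (levParam (R.param φ))))
              (levGood M φ (P (levParam (R.param φ)))) a := by
      intro a
      obtain ⟨t, σ, ht, hσ, hout⟩ := run_transProg hL (hw.halted φ) hL.mono (Dat.init M) a
      obtain ⟨n, hn, hh, hc⟩ := mach_run hσ
      refine ⟨hh.mono (hn.trans (Nat.succ_le_succ (Nat.mul_le_mul_right _ ht))), fun h => ?_⟩
      rw [OracleMachine.content_find h hh, hc, hout, stkT_content]
    refine ⟨fun a => (hrun a).1, _, ⟨fun a => ⟨_, (hrun a).1⟩, ?_⟩, _, hL.encodesFun, hL.isFunName,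
      fun n => ?_⟩
    · funext a
      refine (Eq.trans ?_ ((hrun a).2 ⟨_, (hrun a).1⟩))
      simp only [OracleMachine.operator]
    · refine Nat.add_le_add (hL.modulus_le n) ?_
      rw [Nat.ceil_le, Real.logb_le_iff_le_rpow (by norm_num) (by positivity), Real.rpow_natCast]
      exact hL.norm_le
  refine ⟨(transProg M).mach (Dat.init M), P', Q', ?_, hP', hQ', ?_, ?_⟩
  · intro φ f hf
    obtain ⟨-, χ, h2, ψ, h3, h4, -⟩ := key ⟨φ, hf.1⟩ f hf
    exact ⟨χ, h2, mem_intervalFunctions.2 ⟨ψ, h3, h4⟩⟩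
  · intro φ a
    exact OracleMachine.time_le_of_haltedBy ((key φ _ ⟨φ.2, rfl⟩).1 a)
  · intro φ χ hχ n
    obtain ⟨-, χ', h2, ψ, h3, h4, h5⟩ := key φ _ ⟨φ.2, rfl⟩
    obtain rfl := Part.mem_unique hχ h2
    rw [param_intervalFunctions h3 h4]
    exact h5 n

end ParamSpace

/-- Evaluation is polytime computable with respect to a parametrised representation of `C([0, 1])`
if and only if that representation is polytime translatable to the interval functions; so the latter
carry the least information among the parametrised representations with polytime evaluation. -/
theorem mainTheorem1 :
    (∀ R : ParamSpace.ParamRep C(unitInterval, ℝ),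
      ParamSpace.EvalPolytime R ↔ R.TranslatableTo ParamSpace.intervalFunctions) ∧
    ParamSpace.EvalPolytime ParamSpace.intervalFunctions :=
  ⟨fun R => ⟨ParamSpace.translatable_of_evalPolytime, ParamSpace.evalPolytime_of_translatable⟩,
    ParamSpace.evalPolytime_intervalFunctions⟩
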